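/- Let $p,q\in\mathbb C\setminus\{0\}$ with $|p|,|q|<1$. Write $(t;p)_\infty=\prod_{j\ge0}(1-tp^j)$, $\theta(t;p)=(t;p)_\infty(p/t;p)_\infty$, $(t;q,p)_n=\prod_{j=0}^{n-1}\theta(tq^j;p)$, $(a_1,\dots,a_r;q,p)_n=\prod_{i}(a_i;q,p)_n$, and $$\Gamma(z)=\prod_{j,k\ge0}\frac{1-z^{-1}p^{j+1}q^{k+1}}{1-zp^jq^k},\qquad \Gamma(a_1,\dots,a_r)=\prod_i\Gamma(a_i),$$ $${}_{12}V_{11}(a_0;a_1,\dots,a_7;q,p)=\sum_{j\ge0}\frac{\theta(a_0q^{2j};p)}{\theta(a_0;p)}\prod_{i=0}^{7}\frac{(a_i;q,p)_j}{(qa_0/a_i;q,p)_j}\,q^j .$$ Let $t_0,\dots,t_4\in\mathbb C$ with $|t_m|<1$, and suppose that $A=t_0t_1t_2t_3t_4$ satisfies $|pq|<|A|$. For $n=0,1,2,\dots$ let $$R_n(z;q,p)={}_{12}V_{11}\Big(\frac{t_3}{t_4};\frac q{t_0t_4},\frac q{t_1t_4},\frac q{t_2t_4},t_3z,\frac{t_3}z,q^{-n},\frac{Aq^{n-1}}{t_4};q,p\Big),$$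 $$T_n(z;q,p)={}_{12}V_{11}\Big(\frac{At_3}{q};\frac A{t_0},\frac A{t_1},\frac A{t_2},t_3z,\frac{t_3}z,q^{-n},\frac{Aq^{n-1}}{t_4};q,p\Big)$$ (these series terminate: only the terms $j\le n$ are present), and put $R_{nm}(z)=R_n(z;q,p)R_m(z;p,q)$, $T_{nm}(z)=T_n(z;q,p)T_m(z;p,q)$, $$\Delta(z,t)=\frac{(q;q)_\infty(p;p)_\infty}{4\pi i}\,\frac{\prod_{m=0}^4\Gamma(t_mz,t_mz^{-1})}{\Gamma(z^2,z^{-2},Az,Az^{-1})},\qquad \mathcal N(t)=\frac{\prod_{0\le m<k\le4}\Gamma(t_mt_k)}{\prod_{m=0}^4\Gamma(A/t_m)},$$ $$h_n(q,p)=\frac{\theta(A/qt_4;p)\,(q,\,qt_3/t_4,\,t_0t_1,\,t_0t_2,\,t_1t_2,\,At_3;q,p)_n\,q^{-n}}{\theta(Aq^{2n}/t_4q;p)\,(1/t_3t_4,\,t_0t_3,\,t_1t_3,\,t_2t_3,\,A/qt_3,\,A/qt_4;q,p)_n},\qquad h_{nl}=h_n(q,p)\,h_l(p,q).$$ Let $n,l,m,k$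 be non-negative integers, and suppose that the parameters are generic in the sense that none of the denominators not depending on $z$ vanishes in the terms of $R_m(z;q,p)$, $R_k(z;p,q)$, $T_n(z;q,p)$, $T_l(z;p,q)$, nor in $h_n(q,p)$, $h_l(p,q)$. Let $C_{mn,kl}$ be a closed piecewise $C^1$ contour in $\mathbb C\setminus\{0\}$ separating the points $$t_jp^aq^b\ (j=0,1,2,3),\qquad t_4p^{a-k}q^{b-m},\qquad p^{a+1-l}q^{b+1-n}/A\qquad(a,b=0,1,2,\dots)$$ from their reciprocals: it passes through none of these points and reciprocals, and it has winding number $1$ about each of these points and $0$ about each of the reciprocals. Then the integral below exists and $$\int_{C_{mn,kl}}T_{nl}(z)\,R_{mk}(z)\,\Delta(z,t)\,\frac{dz}{z}=h_{nl}\,\mathcal N(t)\,\delta_{mn}\,\delta_{kl}.$$ -/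

import Mathlib

namespace EllHyp

noncomputable section

open Finset

/-- The infinite product `(t;p)_∞ = ∏_{n ≥ 0} (1 - t p^n)`. -/
def qPochInf (t p : ℂ) : ℂ := ∏' n : ℕ, (1 - t * p ^ n)

/-- The theta function `θ(t;p) = (t;p)_∞ (p/t;p)_∞`. -/
def theta (t p : ℂ) : ℂ := qPochInf t p * qPochInf (p / t) p

/-- The elliptic Pochhammer symbol `(t)_n = ∏_{j < n} θ(t q^j;p)`. -/
def ellPoch (q p t : ℂ) (n : ℕ) : ℂ := ∏ j ∈ range n, theta (t * q ^ j) p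

/-- The elliptic gamma function
`Γ(z;p,q) = ∏_{j,k ≥ 0} (1 - z⁻¹ p^(j+1) q^(k+1)) / (1 - z p^j q^k)`. -/
def ellGamma (p q z : ℂ) : ℂ :=
  (∏' jk : ℕ × ℕ, (1 - z⁻¹ * p ^ (jk.1 + 1) * q ^ (jk.2 + 1))) /
    ∏' jk : ℕ × ℕ, (1 - z * p ^ jk.1 * q ^ jk.2)

/-- The very well poised elliptic hypergeometric series `V(t₀; t₁, …, t_s; q, p)` with argument
`y = 1`; it is `₁₂V₁₁` for `s = 7`. The factor with index `0` of the product is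
`(t₀)_n / (q t₀ / t₀)_n = (t₀)_n / (q)_n`. If some `t_i` is `q^(-N)`, then all the terms with
`n > N` vanish. -/
def ellV {s : ℕ} (q p t₀ : ℂ) (t : Fin s → ℂ) : ℂ :=
  ∑' n : ℕ, theta (t₀ * q ^ (2 * n)) p / theta t₀ p *
    (ellPoch q p t₀ n / ellPoch q p q n) *
    (∏ i, ellPoch q p (t i) n / ellPoch q p (q * t₀ / t i) n) * q ^ n

/-- `A = t₀ t₁ t₂ t₃ t₄`. -/
def prodA (t : Fin 5 → ℂ) : ℂ := ∏ m, t m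

/-- `R_n(z;q,p)`. -/
def R (t : Fin 5 → ℂ) (q p : ℂ) (n : ℕ) (z : ℂ) : ℂ :=
  ellV q p (t 3 / t 4)
    ![q / (t 0 * t 4), q / (t 1 * t 4), q / (t 2 * t 4), t 3 * z, t 3 / z,
      q ^ (-(n : ℤ)), prodA t * q ^ ((n : ℤ) - 1) / t 4]

/-- `T_n(z;q,p)`. -/
def T (t : Fin 5 → ℂ) (q p : ℂ) (n : ℕ) (z : ℂ) : ℂ :=
  ellV q p (prodA t * t 3 / q)
    ![prodA t / t 0, prodA t / t 1, prodA t / t 2, t 3 * z, t 3 / z,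
      q ^ (-(n : ℤ)), prodA t * q ^ ((n : ℤ) - 1) / t 4]

/-- `R_{nm}(z) = R_n(z;q,p) R_m(z;p,q)`. -/
def R₂ (t : Fin 5 → ℂ) (q p : ℂ) (n m : ℕ) (z : ℂ) : ℂ := R t q p n z * R t p q m z

/-- `T_{nm}(z) = T_n(z;q,p) T_m(z;p,q)`. -/
def T₂ (t : Fin 5 → ℂ) (q p : ℂ) (n m : ℕ) (z : ℂ) : ℂ := T t q p n z * T t p q m z

/-- The weight function `Δ(z,t)`. -/
def weight (t : Fin 5 → ℂ) (q p z : ℂ) : ℂ :=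
  qPochInf q q * qPochInf p p / (4 * Real.pi * Complex.I) *
    ((∏ m, ellGamma p q (t m * z) * ellGamma p q (t m * z⁻¹)) /
      (ellGamma p q (z ^ 2) * ellGamma p q (z⁻¹ ^ 2) *
        ellGamma p q (prodA t * z) * ellGamma p q (prodA t * z⁻¹)))

/-- The constant `N(t)`. -/
def normN (t : Fin 5 → ℂ) (q p : ℂ) : ℂ :=
  (∏ m, ∏ k ∈ Ioi m, ellGamma p q (t m * t k)) / ∏ m, ellGamma p q (prodA t / t m)

/-- The denominator of `h_n(q,p)`. -/
def hDen (t : Fin 5 → ℂ) (q p : ℂ) (n : ℕ) : ℂ :=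
  theta (prodA t * q ^ (2 * n) / (t 4 * q)) p *
    (ellPoch q p (1 / (t 3 * t 4)) n * ellPoch q p (t 0 * t 3) n * ellPoch q p (t 1 * t 3) n *
      ellPoch q p (t 2 * t 3) n * ellPoch q p (prodA t / (q * t 3)) n *
      ellPoch q p (prodA t / (q * t 4)) n)

/-- The normalization constant `h_n(q,p)`. -/
def h (t : Fin 5 → ℂ) (q p : ℂ) (n : ℕ) : ℂ :=
  theta (prodA t / (q * t 4)) p *
    (ellPoch q p q n * ellPoch q p (q * t 3 / t 4) n * ellPoch q p (t 0 * t 1) n *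
      ellPoch q p (t 0 * t 2) n * ellPoch q p (t 1 * t 2) n * ellPoch q p (prodA t * t 3) n) *
    q ^ (-(n : ℤ)) / hDen t q p n

/-- `h_{nl} = h_n(q,p) h_l(p,q)`. -/
def h₂ (t : Fin 5 → ℂ) (q p : ℂ) (n l : ℕ) : ℂ := h t q p n * h t p q l

/-- The product of the denominators not depending on `z` in the terms `0, …, n` of the series
`R_n(z;q,p)`. -/
def RDen (t : Fin 5 → ℂ) (q p : ℂ) (n : ℕ) : ℂ :=
  theta (t 3 / t 4) p * ellPoch q p q n *
    (ellPoch q p (t 0 * t 3) n * ellPoch q p (t 1 * t 3) n * ellPoch q p (t 2 * t 3) n *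
      ellPoch q p (q ^ (n + 1) * t 3 / t 4) n *
      ellPoch q p (q ^ (2 - (n : ℤ)) * t 3 / prodA t) n)

/-- The product of the denominators not depending on `z` in the terms `0, …, n` of the series
`T_n(z;q,p)`. -/
def TDen (t : Fin 5 → ℂ) (q p : ℂ) (n : ℕ) : ℂ :=
  theta (prodA t * t 3 / q) p * ellPoch q p q n *
    (ellPoch q p (t 0 * t 3) n * ellPoch q p (t 1 * t 3) n * ellPoch q p (t 2 * t 3) n *
      ellPoch q p (prodA t * t 3 * q ^ n) n *
      ellPoch q p (t 3 * t 4 * q ^ (1 - (n : ℤ))) n)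

/-- `γ`, restricted to `[0,1]`, is a closed piecewise continuously differentiable curve; `s` is
the set of break points. -/
structure IsClosedContour (γ : ℝ → ℂ) : Prop where
  continuousOn : ContinuousOn γ (Set.Icc 0 1)
  closed : γ 0 = γ 1
  piecewise_contDiffOn : ∃ s : Finset ℝ, ∀ a b : ℝ, 0 ≤ a → a < b → b ≤ 1 →
    Disjoint (Set.Ioo a b) (s : Set ℝ) → ContDiffOn ℝ 1 γ (Set.Icc a b)

/-- The function `f` is integrable along `γ`. -/
def ContourIntegrable (γ : ℝ → ℂ) (f : ℂ → ℂ) : Prop :=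
  IntervalIntegrable (fun s : ℝ => f (γ s) * deriv γ s) MeasureTheory.volume 0 1

/-- The contour integral `∫_γ f(z) dz`. -/
def contourIntegral (γ : ℝ → ℂ) (f : ℂ → ℂ) : ℂ :=
  ∫ s in (0 : ℝ)..1, f (γ s) * deriv γ s

/-- The winding number of the closed contour `γ` about a point `w` off `γ`. -/
def windingNumber (γ : ℝ → ℂ) (w : ℂ) : ℂ :=
  contourIntegral γ (fun z => (z - w)⁻¹) / (2 * Real.pi * Complex.I)

/-- The points `t_j p^a q^b` (`j = 0,1,2,3`), `t₄ p^(a-k) q^(b-m)` and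
`p^(a+1-l) q^(b+1-n) / A`, for `a, b = 0, 1, 2, …`. -/
def innerPoints (t : Fin 5 → ℂ) (q p : ℂ) (m n k l : ℕ) : Set ℂ :=
  {w | ∃ a b : ℕ, (∃ j : Fin 4, w = t j.castSucc * p ^ a * q ^ b) ∨
    w = t 4 * p ^ ((a : ℤ) - k) * q ^ ((b : ℤ) - m) ∨
    w = p ^ ((a : ℤ) + 1 - l) * q ^ ((b : ℤ) + 1 - n) / prodA t}

/-- `γ` is a contour in `ℂ \ {0}` separating the set `S` from the set of the reciprocals of
its points: it encircles each point of `S` once in the positive direction, and it does not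
encircle their reciprocals. -/
structure Separates (γ : ℝ → ℂ) (S : Set ℂ) : Prop where
  isClosedContour : IsClosedContour γ
  ne_zero : ∀ s ∈ Set.Icc (0 : ℝ) 1, γ s ≠ 0
  avoids : ∀ w ∈ S, ∀ s ∈ Set.Icc (0 : ℝ) 1, γ s ≠ w ∧ γ s ≠ w⁻¹
  inside : ∀ w ∈ S, windingNumber γ w = 1
  outside : ∀ w ∈ S, windingNumber γ w⁻¹ = 0

end

end EllHyp

namespace EllHyp

noncomputable section

open Finset Filter Topology MeasureTheory

/-! ### Canonical products -/

/-! With a sixth parameter `t₅ = pq/A` there are six parameters of modulus less than `1` with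
product `pq`; this is where `|pq| < |A|` enters. Because `Γ(x)Γ(pq/x) = 1` and `1/(Γ(x)Γ(1/x)) =
θ(x;p)θ(1/x;q)`, the weight is a constant multiple of the symmetric kernel `betaKernel`, the
constant `N(t)` is `betaValue`, and `R_n`, `T_n` are one and the same series `wpSeries` in `t₀, …,
t₄, q/A`, with the last two entries exchanged for `T_n`.

The analytic input is the elliptic beta integral: the integral of `betaKernel`, times `(p;p)_∞
(q;q)_∞`, is `4πi` times `betaValue`. The quotient of integral and value does not change when a
factor `q` moves from one parameter to another. Indeed a combination of the two kernels is a
difference of one auxiliary function at `z/q` and at `z` (`shiftAux_sub`, from the theta identity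
`theta_four_term`), and such a difference integrates to zero by Cauchy's theorem in its homology
form. As a function of a parameter `x` with partner `c/x`, the quotient is therefore invariant under
`x ↦ xq` and holomorphic, hence constant (`circInt_div_const`). Two parameters are moved to `e` and
`-e`; when `e` tends to `i`, poles pinch the unit circle, and comparison of the singular parts gives
the constant (`circInt_const_of_eventually`). Analytic continuation and a change of contour complete
the evaluation.

The shift relation uses only winding numbers. Hence the beta integral persists along the given
contour for kernels whose parameters are multiplied by integral powers of `p` and `q` with exponent
sums zero (`Separates.beta_integral_shifted`), as long as one gets there through shifts whose poles
the contour separates (`Reachable`). The quotient of the value by the gamma factors splits into a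
part from the `q`-shift and a part from the `p`-shift (`FreeAt.betaQuot_mul`). So the integral of a
product of a `q`-part, a `p`-part and the kernel is a product of two moments, and it suffices to
work in one base at a time.

In the base `q`, expand `T_n` in the functions `(r₃z^±)_i / (qz^±/r₅)_i` in which it is given, but
re-expand `R_m` in `(r₀z^±)_j / (qz^±/r₄)_j` (`exists_wpSeries_eq_sum`). For fixed `j`, the sum over
`i` of coefficients times moments is a Frenkel–Turaev sum (`GenericParams.sum_wpCoeff_mul_moment`),
and its value contains the factor `(q^(-j))_n`, which vanishes for `j < n`. As `j ≤ m`, everything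
vanishes if `m < n`; if `m = n` only `j = n` survives, and the leading coefficient yields the norm;
the case `m > n` follows by exchanging `R` and `T`.

This argument needs generic parameters. In general the parameters are deformed along a curve that is
generic off a countable set. The apparent poles of the series are absorbed into the kernel
(`RegularAt.biorthIntegrand_eq`), the contour still separates the perturbed points
(`Separates.eventually_of_tendsto`), and both sides are continuous. Identities between integrands
that fail on countably many `z`, because of divisions by zero, are harmless by
`ae_contour_eq_of_countable`. -/

theorem multipliable_one_sub_mul {ι : Type*} {c : ι → ℂ} (hc : Summable fun i => ‖c i‖) (x : ℂ) :
    Multipliable fun i => 1 - x * c i := by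
  simp only [sub_eq_add_neg]
  refine multipliable_one_add_of_summable ?_
  simpa [norm_mul] using hc.mul_left ‖x‖

theorem differentiable_tprod_one_sub_mul {ι : Type*} {c : ι → ℂ} (hc : Summable fun i => ‖c i‖) :
    Differentiable ℂ fun x : ℂ => ∏' i, (1 - x * c i) := by
  intro x₀
  have hO : IsOpen (Metric.ball (0 : ℂ) (‖x₀‖ + 1)) := Metric.isOpen_ball
  have h := Summable.hasProdLocallyUniformlyOn_one_add (f := fun i (x : ℂ) => -(x * c i)) hO
    (hc.mul_left (‖x₀‖ + 1)) (Eventually.of_forall fun i x hx => by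
      have hx' : ‖x‖ < ‖x₀‖ + 1 := by simpa using hx
      rw [norm_neg, norm_mul]
      gcongr) (fun i => by fun_prop)
  have h' := (hasProdLocallyUniformlyOn_iff_tendstoLocallyUniformlyOn.mp h).differentiableOn
    (Eventually.of_forall fun s => by
      have : Differentiable ℂ fun x : ℂ => ∏ i ∈ s, (1 + -(x * c i)) := by fun_prop
      exact this.differentiableOn) hO
  have h2 := h'.differentiableAt (hO.mem_nhds (x := x₀) (by simp))
  simpa only [← sub_eq_add_neg] using h2

theorem tprod_one_sub_mul_eq_zero_iff {ι : Type*} {c : ι → ℂ} (hc : Summable fun i => ‖c i‖)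
    (x : ℂ) : ∏' i, (1 - x * c i) = 0 ↔ ∃ i, x * c i = 1 := by
  constructor
  · intro h
    by_contra! hne
    refine tprod_one_add_ne_zero_of_summable (f := fun i => -(x * c i)) (fun i hi => hne i ?_) ?_ ?_
    · linear_combination -hi
    · simpa [norm_mul] using hc.mul_left ‖x‖
    · simpa only [← sub_eq_add_neg] using h
  · rintro ⟨i, hi⟩
    exact tprod_of_exists_eq_zero ⟨i, by simp [hi]⟩

/-- The double product `∏_{j,k ≥ 0} (1 - x p^j q^k)`. -/
def dblPoch (p q x : ℂ) : ℂ := ∏' jk : ℕ × ℕ, (1 - x * p ^ jk.1 * q ^ jk.2)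

theorem summable_norm_pow {p : ℂ} (hp : ‖p‖ < 1) : Summable fun n : ℕ => ‖p ^ n‖ := by
  simpa [norm_pow] using summable_geometric_of_lt_one (norm_nonneg p) hp

theorem summable_norm_pow_mul_pow {p q : ℂ} (hp : ‖p‖ < 1) (hq : ‖q‖ < 1) :
    Summable fun jk : ℕ × ℕ => ‖p ^ jk.1 * q ^ jk.2‖ :=
  Summable.mul_norm (summable_norm_pow hp) (summable_norm_pow hq)

theorem differentiable_qPochInf {p : ℂ} (hp : ‖p‖ < 1) : Differentiable ℂ fun x => qPochInf x p :=
  differentiable_tprod_one_sub_mul (summable_norm_pow hp)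

theorem qPochInf_eq_zero_iff {p : ℂ} (hp : ‖p‖ < 1) (x : ℂ) :
    qPochInf x p = 0 ↔ ∃ n : ℕ, x * p ^ n = 1 :=
  tprod_one_sub_mul_eq_zero_iff (summable_norm_pow hp) x

theorem differentiable_dblPoch {p q : ℂ} (hp : ‖p‖ < 1) (hq : ‖q‖ < 1) :
    Differentiable ℂ (dblPoch p q) := by
  have := differentiable_tprod_one_sub_mul (summable_norm_pow_mul_pow hp hq)
  simp only [← mul_assoc] at this
  exact this

theorem dblPoch_eq_zero_iff {p q : ℂ} (hp : ‖p‖ < 1) (hq : ‖q‖ < 1) (x : ℂ) :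
    dblPoch p q x = 0 ↔ ∃ a b : ℕ, x * p ^ a * q ^ b = 1 := by
  have := tprod_one_sub_mul_eq_zero_iff (summable_norm_pow_mul_pow hp hq) x
  simp only [← mul_assoc, Prod.exists] at this
  exact this

theorem dblPoch_ne_zero_of_norm_lt_one {p q x : ℂ} (hp : ‖p‖ < 1) (hq : ‖q‖ < 1) (hx : ‖x‖ < 1) :
    dblPoch p q x ≠ 0 := by
  rw [Ne, dblPoch_eq_zero_iff hp hq]
  rintro ⟨a, b, h⟩
  have h1 := congrArg norm h
  rw [norm_mul, norm_mul, norm_pow, norm_pow, norm_one] at h1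
  have ha := pow_le_one₀ (n := a) (norm_nonneg p) hp.le
  have hb := pow_le_one₀ (n := b) (norm_nonneg q) hq.le
  have : ‖x‖ * ‖p‖ ^ a * ‖q‖ ^ b ≤ ‖x‖ * 1 * 1 := by gcongr
  linarith

theorem dblPoch_swap (p q x : ℂ) : dblPoch p q x = dblPoch q p x := by
  unfold dblPoch
  rw [← (Equiv.prodComm ℕ ℕ).tprod_eq]
  refine tprod_congr fun jk => ?_
  simp only [Equiv.prodComm_apply, Prod.fst_swap, Prod.snd_swap]
  ring

theorem qPochInf_eq_mul {p : ℂ} (hp : ‖p‖ < 1) (x : ℂ) :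
    qPochInf x p = (1 - x) * qPochInf (x * p) p := by
  unfold qPochInf
  rw [tprod_eq_zero_mul']
  · simp [pow_succ', mul_assoc]
  · have := multipliable_one_sub_mul (summable_norm_pow hp) (x * p)
    simpa only [pow_succ', mul_assoc] using this

theorem dblPoch_eq_mul {p q : ℂ} (hp : ‖p‖ < 1) (hq : ‖q‖ < 1) (x : ℂ) :
    dblPoch p q x = qPochInf x p * dblPoch p q (x * q) := by
  -- The pairs with second index `0` are separated from the others: their factors form the single
  -- product.
  let e : ℕ ⊕ ℕ × ℕ ≃ ℕ × ℕ :=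
    { toFun := Sum.elim (fun j => (j, 0)) (fun jk => (jk.1, jk.2 + 1))
      invFun := fun jk => match jk with
        | (j, 0) => Sum.inl j
        | (j, k + 1) => Sum.inr (j, k)
      left_inv := by rintro (j | ⟨j, k⟩) <;> rfl
      right_inv := by rintro ⟨j, (_ | k)⟩ <;> rfl }
  unfold dblPoch
  rw [← e.tprod_eq, Multipliable.tprod_sum]
  · congr 1
    · simp [e, qPochInf]
    · refine tprod_congr fun jk => ?_
      simp only [e, Equiv.coe_fn_mk, Sum.elim_inr]
      ring
  · simpa [e, Function.comp_def] using multipliable_one_sub_mul (summable_norm_pow hp) x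
  · have := multipliable_one_sub_mul (summable_norm_pow_mul_pow hp hq) (x * q)
    refine this.congr fun jk => ?_
    simp only [e, Equiv.coe_fn_mk, Function.comp_def, Sum.elim_inr]
    ring

/-! ### The theta function -/

theorem theta_mul_self {p x : ℂ} (hp₀ : p ≠ 0) (hp : ‖p‖ < 1) (hx : x ≠ 0) :
    theta (x * p) p = -x⁻¹ * theta x p := by
  unfold theta
  have h1 := qPochInf_eq_mul hp x
  have h2 := qPochInf_eq_mul hp (p / (x * p))
  have h3 : p / (x * p) = x⁻¹ := by field_simp
  have h4 : x⁻¹ * p = p / x := by field_simp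
  rw [h3, h4] at h2
  rw [h1, h3, h2]
  field_simp
  ring

theorem theta_inv {p x : ℂ} (hp : ‖p‖ < 1) (hx : x ≠ 0) :
    theta x⁻¹ p = -x⁻¹ * theta x p := by
  unfold theta
  have h1 := qPochInf_eq_mul hp x
  have h2 := qPochInf_eq_mul hp x⁻¹
  have h3 : p / x⁻¹ = x * p := by field_simp
  have h4 : x⁻¹ * p = p / x := by field_simp
  rw [h4] at h2
  rw [h1, h2, h3]
  field_simp
  ring

theorem theta_p_div {p x : ℂ} (hp₀ : p ≠ 0) (hx : x ≠ 0) : theta (p / x) p = theta x p := by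
  unfold theta
  rw [mul_comm]
  congr 2
  field_simp

theorem theta_one {p : ℂ} (hp : ‖p‖ < 1) : theta 1 p = 0 := by
  unfold theta
  rw [(qPochInf_eq_zero_iff hp 1).mpr ⟨0, by simp⟩, zero_mul]

theorem theta_eq_zero_iff {p x : ℂ} (hp₀ : p ≠ 0) (hp : ‖p‖ < 1) (hx : x ≠ 0) :
    theta x p = 0 ↔ ∃ k : ℤ, x = p ^ k := by
  unfold theta
  rw [mul_eq_zero, qPochInf_eq_zero_iff hp, qPochInf_eq_zero_iff hp]
  constructor
  · rintro (⟨n, hn⟩ | ⟨n, hn⟩)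
    · refine ⟨-(n : ℤ), ?_⟩
      rw [zpow_neg, zpow_natCast]
      exact eq_inv_of_mul_eq_one_left hn
    · refine ⟨(n + 1 : ℕ), ?_⟩
      rw [zpow_natCast, pow_succ']
      field_simp at hn
      exact hn.symm
  · rintro ⟨k, rfl⟩
    obtain ⟨n, rfl | rfl⟩ := k.eq_nat_or_neg
    · rcases n with _ | n
      · exact Or.inl ⟨0, by simp⟩
      · refine Or.inr ⟨n, ?_⟩
        rw [zpow_natCast, pow_succ']
        field_simp
    · refine Or.inl ⟨n, ?_⟩
      rw [zpow_neg, zpow_natCast]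
      field_simp

theorem differentiableAt_theta {p x : ℂ} (hp : ‖p‖ < 1) (hx : x ≠ 0) :
    DifferentiableAt ℂ (fun x => theta x p) x := by
  unfold theta
  have h1 := differentiable_qPochInf hp
  exact (h1 x).mul ((h1 (p / x)).comp x ((differentiableAt_const p).div differentiableAt_id hx))

/-- At `1` the derivative is `-(p;p)_∞²`, and the functional equation under `x ↦ xp` carries its
nonvanishing to every zero `p^k`. Simplicity of the zeros is what makes the quotients in the proof
of the addition formula regular. -/
theorem deriv_theta_ne_zero {p x : ℂ} (hp₀ : p ≠ 0) (hp : ‖p‖ < 1) (hx : x ≠ 0)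
    (h0 : theta x p = 0) : deriv (fun x => theta x p) x ≠ 0 := by
  have hpp : qPochInf p p ≠ 0 := by
    rw [Ne, qPochInf_eq_zero_iff hp]
    rintro ⟨n, hn⟩
    have := congrArg norm hn
    rw [← pow_succ', norm_pow, norm_one] at this
    exact absurd this (pow_lt_one₀ (norm_nonneg p) hp (by simp)).ne
  -- the derivative at `1`
  have h1 : deriv (fun x => theta x p) 1 ≠ 0 := by
    have e : (fun x => theta x p) = fun x => (1 - x) * (qPochInf (x * p) p * qPochInf (p / x) p) := by
      funext x
      unfold theta
      rw [qPochInf_eq_mul hp x, mul_assoc]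
    have hd : DifferentiableAt ℂ (fun x => qPochInf (x * p) p * qPochInf (p / x) p) 1 := by
      have h1 := differentiable_qPochInf hp
      refine DifferentiableAt.mul ?_ ?_
      · exact DifferentiableAt.comp (1 : ℂ) (f := fun x => x * p) (h1 _) (by fun_prop)
      · exact DifferentiableAt.comp (1 : ℂ) (f := fun x => p / x) (h1 _)
          (by fun_prop (disch := simp))
    have h2 : HasDerivAt (fun x : ℂ => 1 - x) (-1) 1 := by
      simpa using (hasDerivAt_id (1 : ℂ)).const_sub 1
    rw [e, (h2.fun_mul hd.hasDerivAt).deriv]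
    simpa using hpp
  -- the derivative at `y * p` in terms of the derivative at `y`
  have hstep (y : ℂ) (hy : y ≠ 0) (hy0 : theta y p = 0) :
      deriv (fun x => theta x p) (y * p) * p = -y⁻¹ * deriv (fun x => theta x p) y := by
    have ha : HasDerivAt (fun x => theta (x * p) p) (deriv (fun x => theta x p) (y * p) * p) y := by
      have h3 := (differentiableAt_theta hp (mul_ne_zero hy hp₀)).hasDerivAt
      have h4 : HasDerivAt (fun x : ℂ => x * p) p y := by
        simpa using (hasDerivAt_id y).mul_const p
      exact h3.comp y h4
    have hb : HasDerivAt (fun x => -x⁻¹ * theta x p) (-y⁻¹ * deriv (fun x => theta x p) y) y := by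
      have h3 := (hasDerivAt_inv hy).neg.mul (differentiableAt_theta hp hy).hasDerivAt
      simp only [hy0, mul_zero, zero_add] at h3
      exact h3
    have hc : (fun x => theta (x * p) p) =ᶠ[𝓝 y] fun x => -x⁻¹ * theta x p := by
      filter_upwards [isOpen_ne.mem_nhds hy] with x hx using theta_mul_self hp₀ hp hx
    exact ha.unique (hb.congr_of_eventuallyEq hc)
  obtain ⟨k, rfl⟩ := (theta_eq_zero_iff hp₀ hp hx).mp h0
  have hz (k : ℤ) : theta (p ^ k) p = 0 :=
    (theta_eq_zero_iff hp₀ hp (zpow_ne_zero k hp₀)).mpr ⟨k, rfl⟩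
  clear h0 hx
  induction k using Int.induction_on with
  | zero => simpa using h1
  | succ k ih =>
    intro h
    have := hstep _ (zpow_ne_zero k hp₀) (hz k)
    rw [← zpow_add_one₀ hp₀, h, zero_mul] at this
    have h5 : -(p ^ (k : ℤ))⁻¹ ≠ 0 := neg_ne_zero.mpr (inv_ne_zero (zpow_ne_zero _ hp₀))
    exact (mul_ne_zero h5 ih) this.symm
  | pred k ih =>
    intro h
    have := hstep _ (zpow_ne_zero (-k - 1) hp₀) (hz _)
    rw [← zpow_add_one₀ hp₀, h, mul_zero, sub_add_cancel] at this
    exact (mul_ne_zero ih hp₀) this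

/-- A quotient of holomorphic functions, completed by the quotient of the derivatives at the zeros
of the denominator. -/
def regQuot (F D : ℂ → ℂ) (x : ℂ) : ℂ := if D x = 0 then deriv F x / deriv D x else F x / D x

/-- At a simple zero `x` of `D` where `F` vanishes too, both functions are `y - x` times their
`dslope`, and the quotient of the `dslope`s is holomorphic with the prescribed value at `x`. -/
theorem differentiableAt_regQuot {F D : ℂ → ℂ} {x : ℂ} (hF : ∀ᶠ y in 𝓝 x, DifferentiableAt ℂ F y)
    (hD : ∀ᶠ y in 𝓝 x, DifferentiableAt ℂ D y) (h0 : D x = 0 → F x = 0)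
    (h1 : D x = 0 → deriv D x ≠ 0) : DifferentiableAt ℂ (regQuot F D) x := by
  by_cases hx : D x = 0
  · obtain ⟨s, hs, hsF⟩ := eventually_iff_exists_mem.mp (hF.and hD)
    have dF := (Complex.differentiableOn_dslope hs).mpr
      (fun y hy => (hsF y hy).1.differentiableWithinAt)
    have dD := (Complex.differentiableOn_dslope hs).mpr
      (fun y hy => (hsF y hy).2.differentiableWithinAt)
    have dF' := dF.differentiableAt hs
    have dD' := dD.differentiableAt hs
    have hne : dslope D x x ≠ 0 := by rw [dslope_same]; exact h1 hx
    refine (dF'.div dD' hne).congr_of_eventuallyEq ?_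
    filter_upwards [dD'.continuousAt.eventually_ne hne] with y hy
    by_cases hxy : y = x
    · subst hxy
      simp [regQuot, hx, dslope_same]
    · have e1 : F y = (y - x) * dslope F x y := by
        rw [dslope_of_ne _ hxy, slope_def_field, h0 hx]
        field_simp [sub_ne_zero.mpr hxy]
        ring
      have e2 : D y = (y - x) * dslope D x y := by
        rw [dslope_of_ne _ hxy, slope_def_field, hx]
        field_simp [sub_ne_zero.mpr hxy]
        ring
      have hyx := sub_ne_zero.mpr hxy
      have hDy : D y ≠ 0 := by rw [e2]; exact mul_ne_zero hyx hy
      simp only [regQuot, hDy, if_false, Pi.div_apply]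
      rw [e1, e2, mul_div_mul_left _ _ hyx]
  · have hc := hD.self_of_nhds.continuousAt.eventually_ne hx
    refine (hF.self_of_nhds.div hD.self_of_nhds hx).congr_of_eventuallyEq ?_
    filter_upwards [hc] with y hy
    simp [regQuot, hy]

/-- A holomorphic function on `ℂ \ {0}` which is invariant under `x ↦ x p` is constant. -/
theorem eq_of_mul_periodic {p : ℂ} (hp₀ : p ≠ 0) (hp : ‖p‖ < 1) {Q : ℂ → ℂ}
    (hQ : ∀ x, x ≠ 0 → DifferentiableAt ℂ Q x) (hper : ∀ x, x ≠ 0 → Q (x * p) = Q x)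
    {x y : ℂ} (hx : x ≠ 0) (hy : y ≠ 0) : Q x = Q y := by
  -- Pulled back along `exp`, the function is entire. By periodicity it takes only the values of `Q`
  -- on the compact annulus `‖p‖ ≤ ‖z‖ ≤ 1`, so Liouville's theorem applies.
  have hdiff : Differentiable ℂ fun w => Q (Complex.exp w) := fun w =>
    (hQ _ (Complex.exp_ne_zero w)).comp w Complex.differentiableAt_exp
  have hperZ (k : ℤ) (x : ℂ) (hx : x ≠ 0) : Q (x * p ^ k) = Q x := by
    induction k using Int.induction_on with
    | zero => simp
    | succ k ih =>
      rw [zpow_add_one₀ hp₀, ← mul_assoc, hper _ (mul_ne_zero hx (zpow_ne_zero _ hp₀)), ih]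
    | pred k ih =>
      rw [← ih, ← hper _ (mul_ne_zero hx (zpow_ne_zero (-k - 1) hp₀)), mul_assoc,
        ← zpow_add_one₀ hp₀, sub_add_cancel]
  have hK : IsCompact (Metric.closedBall (0 : ℂ) 1 \ Metric.ball 0 ‖p‖) :=
    (isCompact_closedBall 0 1).diff Metric.isOpen_ball
  have hpn : 0 < ‖p‖ := norm_pos_iff.mpr hp₀
  have hQK : ContinuousOn Q (Metric.closedBall (0 : ℂ) 1 \ Metric.ball 0 ‖p‖) := fun z hz =>
    (hQ z (by
      rintro rfl
      exact hz.2 (by simpa using hp₀))).continuousAt.continuousWithinAt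
  obtain ⟨C, hC⟩ := hK.exists_bound_of_continuousOn hQK
  have hbound (x : ℂ) (hx : x ≠ 0) : ‖Q x‖ ≤ C := by
    obtain ⟨k, hk1, hk2⟩ := exists_mem_Ico_zpow (norm_pos_iff.mpr hx)
      ((one_lt_inv₀ hpn).mpr hp)
    have hnp : 0 < ‖p‖ ^ (k + 1) := zpow_pos hpn _
    rw [← hperZ (k + 1) x hx]
    apply hC
    have e1 : ‖p‖ ^ (k + 1) = ‖p‖ ^ k * ‖p‖ := zpow_add_one₀ hpn.ne' k
    have hnk : 0 < ‖p‖ ^ k := zpow_pos hpn k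
    rw [inv_zpow] at hk1 hk2
    have hk1' : 1 ≤ ‖x‖ * ‖p‖ ^ k := by rwa [inv_le_iff_one_le_mul₀ hnk] at hk1
    have hk2' : ‖x‖ * ‖p‖ ^ (k + 1) < 1 := by
      rwa [lt_inv_comm₀ (norm_pos_iff.mpr hx) hnp, ← one_div, lt_div_iff₀ (norm_pos_iff.mpr hx),
        mul_comm] at hk2
    constructor
    · simp only [Metric.mem_closedBall, dist_zero_right, norm_mul, norm_zpow]
      exact hk2'.le
    · simp only [Metric.mem_ball, dist_zero_right, norm_mul, norm_zpow, not_lt]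
      rw [e1]
      nlinarith
  have hb : Bornology.IsBounded (Set.range fun w => Q (Complex.exp w)) := by
    rw [isBounded_iff_forall_norm_le]
    exact ⟨C, by rintro _ ⟨w, rfl⟩; exact hbound _ (Complex.exp_ne_zero w)⟩
  have := hdiff.apply_eq_apply_of_bounded hb (Complex.log x) (Complex.log y)
  simpa [Complex.exp_log hx, Complex.exp_log hy] using this

theorem theta_div_comm {p x y : ℂ} (hp : ‖p‖ < 1) (hx : x ≠ 0) (hy : y ≠ 0) :
    theta (x / y) p = -(x / y) * theta (y / x) p := by
  have := theta_inv hp (div_ne_zero hy hx)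
  rwa [inv_div] at this

theorem theta_inv_mul_comm {p x y : ℂ} (hp : ‖p‖ < 1) (hx : x ≠ 0) (hy : y ≠ 0) :
    theta (x⁻¹ * y) p = -(y / x) * theta (x / y) p := by
  rw [← theta_div_comm hp hy hx, div_eq_inv_mul]

theorem countable_setOf_theta_eq_zero {p : ℂ} (hp₀ : p ≠ 0) (hp : ‖p‖ < 1) :
    {x : ℂ | x ≠ 0 ∧ theta x p = 0}.Countable := by
  refine (Set.countable_range fun k : ℤ => p ^ k).mono ?_
  rintro x ⟨hx, h0⟩
  obtain ⟨k, rfl⟩ := (theta_eq_zero_iff hp₀ hp hx).mp h0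
  exact ⟨k, rfl⟩

/-- The addition formula under the assumption that the zeros in `x` of `θ(xu)θ(x/u)` are simple
and that `y` is not one of them. -/
theorem theta_addition_of_ne {p : ℂ} (hp₀ : p ≠ 0) (hp : ‖p‖ < 1) {x y u v : ℂ} (hx : x ≠ 0)
    (hy : y ≠ 0) (hu : u ≠ 0) (hv : v ≠ 0) (hu2 : theta (u ^ 2) p ≠ 0)
    (hyu : theta (y * u) p * theta (y / u) p ≠ 0) :
    theta (x * y) p * theta (x / y) p * theta (u * v) p * theta (u / v) p -
      theta (x * v) p * theta (x / v) p * theta (u * y) p * theta (u / y) p =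
      u / y * (theta (y * v) p * theta (y / v) p * theta (x * u) p * theta (x / u) p) := by
  have hd (c : ℂ) (hc : c ≠ 0) (z : ℂ) (hz : z ≠ 0) :
      DifferentiableAt ℂ (fun x => theta (x * c) p) z :=
    DifferentiableAt.comp z (f := fun x => x * c) (differentiableAt_theta hp (mul_ne_zero hz hc))
      (by fun_prop)
  have hd' (c : ℂ) (hc : c ≠ 0) (z : ℂ) (hz : z ≠ 0) :
      DifferentiableAt ℂ (fun x => theta (x / c) p) z := by
    simpa only [div_eq_mul_inv] using hd c⁻¹ (inv_ne_zero hc) z hz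
  -- `F` and `D` acquire the same multiplier `z⁻²` under `z ↦ zp`, and `F` vanishes at the zeros
  -- `u^(±1) p^k` of `D`. Hence `F / D` extends to a periodic holomorphic function, a constant,
  -- which is then read off at `x = y`.
  set F : ℂ → ℂ := fun x => theta (x * y) p * theta (x / y) p * theta (u * v) p * theta (u / v) p -
      theta (x * v) p * theta (x / v) p * theta (u * y) p * theta (u / y) p with hF
  set D : ℂ → ℂ := fun x => theta (x * u) p * theta (x / u) p with hD
  have hper (c : ℂ) (hc : c ≠ 0) (z : ℂ) (hz : z ≠ 0) :
      theta (z * p * c) p * theta (z * p / c) p = (z ^ 2)⁻¹ * (theta (z * c) p * theta (z / c) p) := by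
    have e1 : z * p * c = z * c * p := by ring
    have e2 : z * p / c = z / c * p := by ring
    rw [e1, e2, theta_mul_self hp₀ hp (mul_ne_zero hz hc), theta_mul_self hp₀ hp (div_ne_zero hz hc)]
    field_simp
  have hFper (z : ℂ) (hz : z ≠ 0) : F (z * p) = (z ^ 2)⁻¹ * F z := by
    simp only [hF]
    rw [hper y hy z hz, hper v hv z hz]
    ring
  have hDper (z : ℂ) (hz : z ≠ 0) : D (z * p) = (z ^ 2)⁻¹ * D z := hper u hu z hz
  have hFd (z : ℂ) (hz : z ≠ 0) : DifferentiableAt ℂ F z := by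
    have := hd y hy z hz
    have := hd' y hy z hz
    have := hd v hv z hz
    have := hd' v hv z hz
    simp only [hF]
    fun_prop
  have hDd (z : ℂ) (hz : z ≠ 0) : DifferentiableAt ℂ D z := (hd u hu z hz).mul (hd' u hu z hz)
  have hFu : F u = 0 := by
    simp only [hF]
    ring
  have hFu' : F u⁻¹ = 0 := by
    simp only [hF]
    rw [theta_inv_mul_comm hp hu hy, theta_inv_mul_comm hp hu hv]
    have e (c : ℂ) (hc : c ≠ 0) : theta (u⁻¹ / c) p = -(u * c)⁻¹ * theta (u * c) p := by
      rw [← theta_inv hp (mul_ne_zero hu hc)]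
      congr 1
      field_simp
    rw [e y hy, e v hv]
    field_simp
    ring
  have hFZ (k : ℤ) (z : ℂ) (hz : z ≠ 0) (h0 : F z = 0) : F (z * p ^ k) = 0 := by
    induction k using Int.induction_on with
    | zero => simpa using h0
    | succ k ih =>
      rw [zpow_add_one₀ hp₀, ← mul_assoc, hFper _ (mul_ne_zero hz (zpow_ne_zero _ hp₀)), ih,
        mul_zero]
    | pred k ih =>
      have h1 := hFper _ (mul_ne_zero hz (zpow_ne_zero (-k - 1) hp₀))
      rw [mul_assoc, ← zpow_add_one₀ hp₀, sub_add_cancel, ih] at h1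
      exact (mul_eq_zero.mp h1.symm).resolve_left
        (inv_ne_zero (pow_ne_zero _ (mul_ne_zero hz (zpow_ne_zero _ hp₀))))
  have hzero (z : ℂ) (hz : z ≠ 0) (h0 : D z = 0) : F z = 0 ∧ deriv D z ≠ 0 := by
    have hDz : deriv D z = deriv (fun x => theta x p) (z * u) * u * theta (z / u) p +
        theta (z * u) p * (deriv (fun x => theta x p) (z / u) * u⁻¹) := by
      have h1 : HasDerivAt (fun x => theta (x * u) p)
          (deriv (fun x => theta x p) (z * u) * u) z := by
        have h4 : HasDerivAt (fun x : ℂ => x * u) u z := by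
          simpa using (hasDerivAt_id z).mul_const u
        exact (differentiableAt_theta hp (mul_ne_zero hz hu)).hasDerivAt.comp z h4
      have h2 : HasDerivAt (fun x => theta (x / u) p)
          (deriv (fun x => theta x p) (z / u) * u⁻¹) z := by
        have h4 : HasDerivAt (fun x : ℂ => x / u) u⁻¹ z := by
          simpa [div_eq_mul_inv] using (hasDerivAt_id z).mul_const u⁻¹
        exact (differentiableAt_theta hp (div_ne_zero hz hu)).hasDerivAt.comp z h4
      exact (h1.fun_mul h2).deriv
    have hor := mul_eq_zero.mp h0
    have hnot : ¬ (theta (z * u) p = 0 ∧ theta (z / u) p = 0) := by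
      rintro ⟨h1, h2⟩
      obtain ⟨k, hk⟩ := (theta_eq_zero_iff hp₀ hp (mul_ne_zero hz hu)).mp h1
      obtain ⟨l, hl⟩ := (theta_eq_zero_iff hp₀ hp (div_ne_zero hz hu)).mp h2
      apply hu2
      rw [theta_eq_zero_iff hp₀ hp (pow_ne_zero 2 hu)]
      refine ⟨k - l, ?_⟩
      rw [zpow_sub₀ hp₀, ← hk, ← hl]
      field_simp
    rcases hor with h1 | h1
    · have h2 : theta (z / u) p ≠ 0 := fun h2 => hnot ⟨h1, h2⟩
      constructor
      · obtain ⟨k, hk⟩ := (theta_eq_zero_iff hp₀ hp (mul_ne_zero hz hu)).mp h1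
        have : z = u⁻¹ * p ^ k := by rw [← hk]; field_simp
        rw [this]
        exact hFZ k _ (inv_ne_zero hu) hFu'
      · rw [hDz, h1, zero_mul, add_zero]
        exact mul_ne_zero (mul_ne_zero (deriv_theta_ne_zero hp₀ hp (mul_ne_zero hz hu) h1) hu) h2
    · have h2 : theta (z * u) p ≠ 0 := fun h2 => hnot ⟨h2, h1⟩
      constructor
      · obtain ⟨k, hk⟩ := (theta_eq_zero_iff hp₀ hp (div_ne_zero hz hu)).mp h1
        have : z = u * p ^ k := by rw [← hk]; field_simp
        rw [this]
        exact hFZ k _ hu hFu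
      · rw [hDz, h1, mul_zero, zero_add]
        exact mul_ne_zero h2 (mul_ne_zero (deriv_theta_ne_zero hp₀ hp (div_ne_zero hz hu) h1)
          (inv_ne_zero hu))
  have hev (z : ℂ) (hz : z ≠ 0) : ∀ᶠ w in 𝓝 z, w ≠ 0 := isOpen_ne.mem_nhds hz
  have hQd (z : ℂ) (hz : z ≠ 0) : DifferentiableAt ℂ (regQuot F D) z :=
    differentiableAt_regQuot ((hev z hz).mono fun w hw => hFd w hw)
      ((hev z hz).mono fun w hw => hDd w hw) (fun h => (hzero z hz h).1) (fun h => (hzero z hz h).2)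
  have hderiv (G : ℂ → ℂ) (hG : ∀ z, z ≠ 0 → DifferentiableAt ℂ G z)
      (hGper : ∀ z, z ≠ 0 → G (z * p) = (z ^ 2)⁻¹ * G z) (z : ℂ) (hz : z ≠ 0) (h0 : G z = 0) :
      deriv G (z * p) * p = (z ^ 2)⁻¹ * deriv G z := by
    have ha : HasDerivAt (fun x => G (x * p)) (deriv G (z * p) * p) z := by
      have h4 : HasDerivAt (fun x : ℂ => x * p) p z := by
        simpa using (hasDerivAt_id z).mul_const p
      exact (hG _ (mul_ne_zero hz hp₀)).hasDerivAt.comp z h4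
    have hsq : DifferentiableAt ℂ (fun x : ℂ => (x ^ 2)⁻¹) z := by
      have := pow_ne_zero 2 hz
      fun_prop (disch := assumption)
    have hb := hsq.hasDerivAt.fun_mul (hG z hz).hasDerivAt
    rw [h0, mul_zero, zero_add] at hb
    exact ha.unique (hb.congr_of_eventuallyEq ((hev z hz).mono fun w hw => hGper w hw))
  -- At zeros of `D` the value is a quotient of derivatives; by `hderiv` these have equal
  -- multipliers too.
  have hQper (z : ℂ) (hz : z ≠ 0) : regQuot F D (z * p) = regQuot F D z := by
    have hz2 : (z ^ 2)⁻¹ ≠ 0 := inv_ne_zero (pow_ne_zero 2 hz)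
    by_cases h0 : D z = 0
    · have h0' : D (z * p) = 0 := by rw [hDper z hz, h0, mul_zero]
      have e1 := hderiv F hFd hFper z hz (hzero z hz h0).1
      have e2 := hderiv D hDd hDper z hz h0
      simp only [regQuot, h0, h0', if_true]
      rw [← mul_div_mul_right _ _ hp₀, e1, e2, mul_div_mul_left _ _ hz2]
    · have h0' : D (z * p) ≠ 0 := by rw [hDper z hz]; exact mul_ne_zero hz2 h0
      simp only [regQuot, h0, h0', if_false]
      rw [hFper z hz, hDper z hz, mul_div_mul_left _ _ hz2]
  have hconst := eq_of_mul_periodic hp₀ hp hQd hQper hx hy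
  -- At `x = y` the first term of `F` contains `θ(1) = 0`, so only the second one remains.
  have hQy : regQuot F D y = u / y * (theta (y * v) p * theta (y / v) p) := by
    have h0 : D y ≠ 0 := hyu
    simp only [regQuot, h0, if_false]
    rw [div_eq_iff h0]
    simp only [hF, hD, div_self hy, theta_one hp]
    rw [theta_div_comm hp hu hy, mul_comm u y]
    ring
  rw [hQy] at hconst
  by_cases h0 : D x = 0
  · have h1 := (hzero x hx h0).1
    simp only [hF] at h1
    simp only [hD] at h0
    linear_combination h1 - u / y * (theta (y * v) p * theta (y / v) p) * h0
  · simp only [regQuot, h0, if_false] at hconst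
    rw [div_eq_iff h0] at hconst
    simp only [hF, hD] at hconst
    linear_combination hconst

/-- The addition formula for the theta function. -/
theorem theta_addition {p : ℂ} (hp₀ : p ≠ 0) (hp : ‖p‖ < 1) {x y u v : ℂ} (hx : x ≠ 0)
    (hy : y ≠ 0) (hu : u ≠ 0) (hv : v ≠ 0) :
    theta (x * y) p * theta (x / y) p * theta (u * v) p * theta (u / v) p -
      theta (x * v) p * theta (x / v) p * theta (u * y) p * theta (u / y) p =
      u / y * (theta (y * v) p * theta (y / v) p * theta (x * u) p * theta (x / u) p) := by
  have hc := countable_setOf_theta_eq_zero hp₀ hp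
  set Z := {x : ℂ | x ≠ 0 ∧ theta x p = 0} with hZ
  -- These are the excluded values of `u`. They are countable in number, so `u` is a limit of
  -- admissible values and the formula extends by continuity.
  set B : Set ℂ := {0} ∪ (fun w : ℂ => w ^ 2) ⁻¹' Z ∪ (fun w => y * w) ⁻¹' Z ∪
      (fun w => y / w) ⁻¹' Z with hB
  have hbad : B.Countable := by
    refine ((((Set.countable_singleton 0).union ?_).union ?_).union ?_)
    · have : (fun w : ℂ => w ^ 2) ⁻¹' Z ⊆ ⋃ z ∈ Z, {w : ℂ | w ^ 2 = z} := by
        intro w hw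
        simp only [Set.mem_iUnion]
        exact ⟨w ^ 2, hw, rfl⟩
      refine Set.Countable.mono this (hc.biUnion fun z _ => ?_)
      obtain ⟨c, rfl⟩ := IsAlgClosed.exists_eq_mul_self z
      refine (Set.toFinite {c, -c}).countable.mono fun w hw => ?_
      have hw' : (w - c) * (w + c) = 0 := by
        have : w ^ 2 = c * c := hw
        linear_combination this
      rcases mul_eq_zero.mp hw' with h | h
      · exact Or.inl (sub_eq_zero.mp h)
      · exact Or.inr (eq_neg_of_add_eq_zero_left h)
    · exact hc.preimage (mul_right_injective₀ hy)
    · simp only [div_eq_mul_inv]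
      exact hc.preimage ((mul_right_injective₀ hy).comp inv_injective)
  have hdense := hbad.dense_compl ℝ
  have hne : (𝓝[Bᶜ] u).NeBot := mem_closure_iff_nhdsWithin_neBot.mp (hdense u)
  have hcm (c : ℂ) (hc : c ≠ 0) : ContinuousAt (fun u => theta (u * c) p) u :=
    ContinuousAt.comp' (f := fun u => u * c) (differentiableAt_theta hp (mul_ne_zero hu hc)).continuousAt
      (by fun_prop)
  have hcd (c : ℂ) (hc : c ≠ 0) : ContinuousAt (fun u => theta (u / c) p) u := by
    simpa only [div_eq_mul_inv] using hcm c⁻¹ (inv_ne_zero hc)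
  have hcd' (c : ℂ) (hc : c ≠ 0) : ContinuousAt (fun u => theta (c / u) p) u :=
    ContinuousAt.comp' (f := fun u => c / u) (differentiableAt_theta hp (div_ne_zero hc hu)).continuousAt
      (continuousAt_const.div continuousAt_id hu)
  have hL : ContinuousAt (fun u => theta (x * y) p * theta (x / y) p * theta (u * v) p *
      theta (u / v) p - theta (x * v) p * theta (x / v) p * theta (u * y) p * theta (u / y) p) u := by
    have := hcm v hv
    have := hcd v hv
    have := hcm y hy
    have := hcd y hy
    fun_prop
  have hR : ContinuousAt (fun u => u / y * (theta (y * v) p * theta (y / v) p * theta (x * u) p *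
      theta (x / u) p)) u := by
    have h1 := hcm x hx
    simp only [mul_comm _ x] at h1
    exact (continuousAt_id.div_const y).mul ((continuousAt_const.mul h1).mul (hcd' x hx))
  refine tendsto_nhds_unique (hL.tendsto.mono_left (nhdsWithin_le_nhds (s := Bᶜ)))
    ((hR.tendsto.mono_left nhdsWithin_le_nhds).congr' ?_)
  filter_upwards [self_mem_nhdsWithin] with w hw
  simp only [hB, Set.mem_compl_iff, Set.mem_union, Set.mem_singleton_iff, Set.mem_preimage, not_or,
    hZ, Set.mem_ofPred_eq, not_and] at hw
  obtain ⟨⟨⟨hw0, hw1⟩, hw2⟩, hw3⟩ := hw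
  exact (theta_addition_of_ne hp₀ hp hx hy hw0 hv (hw1 (pow_ne_zero 2 hw0))
    (mul_ne_zero (hw2 (mul_ne_zero hy hw0)) (hw3 (div_ne_zero hy hw0)))).symm

/-! ### The elliptic gamma function -/

theorem ellGamma_eq (p q z : ℂ) : ellGamma p q z = dblPoch p q (p * q / z) / dblPoch p q z := by
  unfold ellGamma dblPoch
  congr 1
  refine tprod_congr fun jk => ?_
  rw [pow_succ, pow_succ]
  ring

theorem ellGamma_swap (p q z : ℂ) : ellGamma p q z = ellGamma q p z := by
  rw [ellGamma_eq, ellGamma_eq, dblPoch_swap p q, dblPoch_swap p q, mul_comm p q]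

theorem ellGamma_inv_eq {p q z : ℂ} (hp₀ : p ≠ 0) (hq₀ : q ≠ 0) :
    (ellGamma p q z)⁻¹ = ellGamma p q (p * q / z) := by
  rw [ellGamma_eq, ellGamma_eq, inv_div, div_div_cancel₀ (mul_ne_zero hp₀ hq₀)]

theorem dblPoch_ne_zero_mul {p q x : ℂ} (hp : ‖p‖ < 1) (hq : ‖q‖ < 1) (h : dblPoch p q x ≠ 0) :
    dblPoch p q (x * q) ≠ 0 := by
  rw [dblPoch_eq_mul hp hq] at h
  exact right_ne_zero_of_mul h

/-- At a pole `x` the quotient defining `ellGamma` has the value `0` by convention and the equation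
can fail, hence the last hypothesis. -/
theorem ellGamma_mul_q {p q x : ℂ} (hq₀ : q ≠ 0) (hp : ‖p‖ < 1) (hq : ‖q‖ < 1) (hx : x ≠ 0)
    (h : dblPoch p q x ≠ 0) : ellGamma p q (x * q) = theta x p * ellGamma p q x := by
  rw [ellGamma_eq, ellGamma_eq, theta]
  have e1 := dblPoch_eq_mul hp hq x
  have e2 := dblPoch_eq_mul hp hq (p / x)
  have e3 : p * q / (x * q) = p / x := by field_simp
  have e4 : p / x * q = p * q / x := by ring
  rw [e3, e2, e4]
  have h1 : dblPoch p q (x * q) ≠ 0 := dblPoch_ne_zero_mul hp hq h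
  have h2 : qPochInf x p ≠ 0 := by
    rw [e1] at h
    exact left_ne_zero_of_mul h
  rw [e1]
  field_simp

/-- Each of the four double products loses single products until the remaining double products
cancel. This turns the factor `1/Γ(z²,z⁻²)` of the weight into theta functions without poles off
`0`. -/
theorem ellGamma_mul_inv {p q x : ℂ} (hp₀ : p ≠ 0) (hq₀ : q ≠ 0) (hp : ‖p‖ < 1) (hq : ‖q‖ < 1)
    (hx : x ≠ 0) (h : dblPoch p q x ≠ 0) (h' : dblPoch p q x⁻¹ ≠ 0) :
    (ellGamma p q x * ellGamma p q x⁻¹)⁻¹ = theta x p * theta x⁻¹ q := by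
  have e1 := dblPoch_eq_mul hp hq x
  have e2 := dblPoch_eq_mul hp hq (p / x)
  have e3 := dblPoch_eq_mul hq hp x⁻¹
  have e4 := dblPoch_eq_mul hq hp (q / x⁻¹)
  have f1 : p * q / x⁻¹ = x * q * p := by field_simp
  have f2 : p / x * q = p * q / x := by ring
  have f4 : q / x⁻¹ * p = x * q * p := by field_simp
  have f5 : q / x⁻¹ = x * q := by field_simp
  have f3 : x⁻¹ * p = p / x := by field_simp
  rw [f4, f5, dblPoch_swap q p, dblPoch_swap q p] at e4
  rw [f3, dblPoch_swap q p, dblPoch_swap q p] at e3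
  rw [f2] at e2
  rw [ellGamma_eq, ellGamma_eq, f1, theta, theta, f5]
  rw [e1, e4] at h ⊢
  rw [e3, e2] at h' ⊢
  have h1 := left_ne_zero_of_mul h
  have h2 := left_ne_zero_of_mul (right_ne_zero_of_mul h)
  have h3 := right_ne_zero_of_mul (right_ne_zero_of_mul h)
  have h4 := left_ne_zero_of_mul h'
  have h5 := left_ne_zero_of_mul (right_ne_zero_of_mul h')
  have h6 := right_ne_zero_of_mul (right_ne_zero_of_mul h')
  generalize qPochInf x p = a1 at *
  generalize qPochInf (x * q) q = a2 at *
  generalize dblPoch p q (x * q * p) = a3 at *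
  generalize qPochInf x⁻¹ q = a4 at *
  generalize qPochInf (p / x) p = a5 at *
  generalize dblPoch p q (p * q / x) = a6 at *
  field_simp

/-! ### Theta function identities -/

/-- The addition formula for the products `θ(wt)θ(ws)`, `θ(bt)θ(bs)`, `θ(ct)θ(cs)`. -/
theorem theta_pair {p : ℂ} (hp₀ : p ≠ 0) (hp : ‖p‖ < 1) {t s w b c : ℂ} (ht : t ≠ 0) (hs : s ≠ 0)
    (hw : w ≠ 0) (hb : b ≠ 0) (hc : c ≠ 0) :
    theta (w * t) p * theta (w * s) p * (theta (b * c * (t * s)) p * theta (b / c) p) =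
      theta (w * c * (t * s)) p * theta (w / c) p * (theta (b * t) p * theta (b * s) p) -
        b / c * (theta (w * b * (t * s)) p * theta (w / b) p) *
          (theta (c * t) p * theta (c * s) p) := by
  -- With `r² = ts`, the arguments `wt` and `ws` are the product and the quotient of `wr` and `t/r`,
  -- as the addition formula requires.
  obtain ⟨r, hr⟩ := IsAlgClosed.exists_eq_mul_self (t * s)
  have hr0 : r ≠ 0 := by
    rintro rfl
    exact mul_ne_zero ht hs (by simpa using hr)
  have h := theta_addition hp₀ hp (x := w * r) (y := t / r) (u := b * r) (v := c * r)
    (mul_ne_zero hw hr0) (div_ne_zero ht hr0) (mul_ne_zero hb hr0) (mul_ne_zero hc hr0)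
  have hsr : s = r * r / t := by rw [← hr]; field_simp
  have e1 (w : ℂ) : w * r * (t / r) = w * t := by field_simp
  have e2 (w : ℂ) : w * r / (t / r) = w * s := by rw [hsr]; field_simp
  have e3 (w c : ℂ) : w * r * (c * r) = w * c * (t * s) := by rw [hr]; ring
  have e4 (w c : ℂ) : w * r / (c * r) = w / c := mul_div_mul_right _ _ hr0
  have e5 : t / r * (c * r) = c * t := by field_simp
  have e6 : theta (t / r / (c * r)) p = -(t / r / (c * r)) * theta (c * s) p := by
    rw [theta_div_comm hp (div_ne_zero ht hr0) (mul_ne_zero hc hr0), e2]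
  rw [e1, e2, e3, e4, e3, e4, e1, e2, e3, e4, e5, e6] at h
  have e7 : b * s * (t / r / (c * r)) = b / c := by rw [hsr]; field_simp
  linear_combination h + theta (c * t) p * theta (c * s) p * theta (w * b * (t * s)) p *
    theta (w / b) p * (-1) * e7

/-- This identity is behind both the shift of the beta integral (`shiftAux_sub`) and the telescoping
of the Frenkel–Turaev sum (`theta_four_term_discrete`). The factors with `t₀` and with `A` on the
left are written by `theta_pair` in terms of the products over `t₁, t₂` at `z` and at `1/z`; their
coefficients combine by `theta_pair` for `t₃, t₄`. The first expansion costs a factor `θ(t₁t₂)`,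
which has to be cancelled. -/
theorem theta_four_term {p : ℂ} (hp₀ : p ≠ 0) (hp : ‖p‖ < 1) {z t₀ t₁ t₂ t₃ t₄ A : ℂ} (hz : z ≠ 0)
    (h₀ : t₀ ≠ 0) (h₁ : t₁ ≠ 0) (h₂ : t₂ ≠ 0) (h₃ : t₃ ≠ 0) (h₄ : t₄ ≠ 0)
    (hA : A = t₀ * t₁ * t₂ * t₃ * t₄) (h : theta (t₁ * t₂) p ≠ 0) :
    z * theta (z ^ 2) p * (theta (t₀ * z) p * theta (t₀ / z) p *
        (theta (A / t₁) p * theta (A / t₂) p * theta (A / t₃) p * theta (A / t₄) p) -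
      theta (A * z) p * theta (A / z) p *
        (theta (t₀ * t₁) p * theta (t₀ * t₂) p * theta (t₀ * t₃) p * theta (t₀ * t₄) p)) =
      -t₀ * theta (t₀ * A) p * (theta (A / z) p * (theta (t₀ * z) p * theta (t₁ * z) p *
          theta (t₂ * z) p * theta (t₃ * z) p * theta (t₄ * z) p) -
        z ^ 4 * theta (A * z) p * (theta (t₀ / z) p * theta (t₁ / z) p * theta (t₂ / z) p *
          theta (t₃ / z) p * theta (t₄ / z) p)) := by
  have hzi := inv_ne_zero hz
  have hP := mul_ne_zero h₁ h₂
  have hQ := mul_ne_zero h₃ h₄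
  -- expansion of the products over `t₁, t₂`
  have a1 := theta_pair hp₀ hp h₁ h₂ h₀ hz hzi
  have a2 := theta_pair hp₀ hp h₁ h₂ (mul_ne_zero h₀ hQ) hz hzi
  -- the coefficients
  have a3 := theta_pair hp₀ hp h₃ h₄ (mul_ne_zero h₀ hP) h₀ hz
  have a4 := theta_pair hp₀ hp h₃ h₄ (mul_ne_zero h₀ hP) h₀ hzi
  have f1 : A / t₁ = t₀ * (t₃ * t₄) * t₂ := by rw [hA]; field_simp
  have f2 : A / t₂ = t₀ * (t₃ * t₄) * t₁ := by rw [hA]; field_simp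
  have f3 : A / t₃ = t₀ * (t₁ * t₂) * t₄ := by rw [hA]; field_simp
  have f4 : A / t₄ = t₀ * (t₁ * t₂) * t₃ := by rw [hA]; field_simp
  have g1 : z * z⁻¹ * (t₁ * t₂) = t₁ * t₂ := by field_simp
  have g2 : z / z⁻¹ = z ^ 2 := by field_simp
  have g3 (w s : ℂ) : w * z⁻¹ * s = w * s / z := by field_simp
  have g4 (w : ℂ) : w / z⁻¹ = w * z := by field_simp
  have g5 (w : ℂ) : z⁻¹ * w = w / z := by field_simp
  have g6 : t₀ * (t₃ * t₄) * (t₁ * t₂) = A := by rw [hA]; ring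
  have g7 : t₀ * (t₃ * t₄) * z * (t₁ * t₂) = A * z := by rw [hA]; ring
  have g8 : t₀ * (t₁ * t₂) * (t₃ * t₄) = A := by rw [hA]; ring
  have g9 : t₀ * (t₁ * t₂) * z * (t₃ * t₄) = A * z := by rw [hA]; ring
  have g10 : t₀ * (t₁ * t₂) * t₀ * (t₃ * t₄) = t₀ * A := by rw [hA]; ring
  have g11 : t₀ * (t₁ * t₂) / t₀ = t₁ * t₂ := by field_simp
  have g12 : t₀ * z * (t₁ * t₂) = t₀ * (t₁ * t₂) * z := by ring
  have g13 : t₀ * z * (t₃ * t₄) = t₀ * (t₃ * t₄) * z := by ring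
  rw [g1, g2, g3, g4, g5, g5, g12, mul_comm z t₁, mul_comm z t₂] at a1
  rw [g1, g2, g3, g4, g5, g5, g6, g7, mul_comm z t₁, mul_comm z t₂] at a2
  rw [g13, g9, g10, g11, mul_comm z t₃, mul_comm z t₄] at a3
  rw [g3, g4, g3, g8, g4, g10, g11, g5, g5] at a4
  rw [f1, f2, f3, f4]
  refine mul_right_cancel₀ h ?_
  generalize theta (t₁ * t₂) p = P at *
  generalize theta (z ^ 2) p = Z at *
  generalize theta (t₀ * z) p = x1 at *
  generalize theta (t₀ / z) p = x2 at *
  generalize theta (t₀ * (t₃ * t₄) * t₂) p = x3 at *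
  generalize theta (t₀ * (t₃ * t₄) * t₁) p = x4 at *
  generalize theta (t₀ * (t₁ * t₂) * t₄) p = x5 at *
  generalize theta (t₀ * (t₁ * t₂) * t₃) p = x6 at *
  generalize theta (A * z) p = x7 at *
  generalize theta (A / z) p = x8 at *
  generalize theta (t₀ * t₁) p = x9 at *
  generalize theta (t₀ * t₂) p = x10 at *
  generalize theta (t₀ * t₃) p = x11 at *
  generalize theta (t₀ * t₄) p = x12 at *
  generalize theta (t₀ * A) p = x13 at *
  generalize theta (t₁ * z) p = y1 at *
  generalize theta (t₂ * z) p = y2 at *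
  generalize theta (t₃ * z) p = y3 at *
  generalize theta (t₄ * z) p = y4 at *
  generalize theta (t₁ / z) p = w1 at *
  generalize theta (t₂ / z) p = w2 at *
  generalize theta (t₃ / z) p = w3 at *
  generalize theta (t₄ / z) p = w4 at *
  generalize theta (t₀ * (t₁ * t₂) / z) p = v1 at *
  generalize theta (t₀ * (t₁ * t₂) * z) p = v2 at *
  generalize theta (t₀ * (t₃ * t₄) / z) p = v3 at *
  generalize theta (t₀ * (t₃ * t₄) * z) p = v4 at *
  have e : z * (t₀ / z) = t₀ := by field_simp
  linear_combination z * x1 * x2 * x5 * x6 * a2 - z * x7 * x8 * x11 * x12 * a1 +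
    z * x8 * x1 * y1 * y2 * a3 - z ^ 3 * x7 * x2 * w1 * w2 * a4 -
    x8 * x1 * y1 * y2 * y3 * y4 * x13 * P * e

/-! ### Elliptic Pochhammer symbols -/

@[simp] theorem ellPoch_zero (q p t : ℂ) : ellPoch q p t 0 = 1 := by simp [ellPoch]

theorem ellPoch_succ (q p t : ℂ) (n : ℕ) :
    ellPoch q p t (n + 1) = ellPoch q p t n * theta (t * q ^ n) p := by
  simp [ellPoch, prod_range_succ]

theorem ellPoch_succ' (q p t : ℂ) (n : ℕ) :
    ellPoch q p t (n + 1) = theta t p * ellPoch q p (t * q) n := by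
  simp only [ellPoch, prod_range_succ', pow_zero, mul_one]
  rw [mul_comm]
  congr 1
  refine prod_congr rfl fun j _ => ?_
  rw [pow_succ']
  ring_nf

theorem ellPoch_add (q p t : ℂ) (m n : ℕ) :
    ellPoch q p t (m + n) = ellPoch q p t m * ellPoch q p (t * q ^ m) n := by
  simp only [ellPoch, prod_range_add]
  congr 1
  refine prod_congr rfl fun j _ => ?_
  rw [pow_add, mul_assoc]

theorem ellPoch_one (q p t : ℂ) : ellPoch q p t 1 = theta t p := by simp [ellPoch]

theorem ellPoch_ne_zero_of_le {q p t : ℂ} {m n : ℕ} (hmn : m ≤ n) (h : ellPoch q p t n ≠ 0) :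
    ellPoch q p t m ≠ 0 := by
  obtain ⟨k, rfl⟩ := Nat.exists_eq_add_of_le hmn
  rw [ellPoch_add] at h
  exact left_ne_zero_of_mul h

theorem theta_ne_zero_of_ellPoch_ne_zero {q p t : ℂ} {m n : ℕ} (hmn : m < n)
    (h : ellPoch q p t n ≠ 0) : theta (t * q ^ m) p ≠ 0 := by
  rw [ellPoch, prod_ne_zero_iff] at h
  exact h m (mem_range.mpr hmn)

/-- No theta function `θ(x q^i;p)` with an integer `i` vanishes. -/
def Generic (q p x : ℂ) : Prop := ∀ i : ℤ, theta (x * q ^ i) p ≠ 0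

theorem Generic.ellPoch_ne_zero {q p x : ℂ} (hq₀ : q ≠ 0) (h : Generic q p x) (i : ℤ) (n : ℕ) :
    ellPoch q p (x * q ^ i) n ≠ 0 := by
  rw [ellPoch, prod_ne_zero_iff]
  intro j _
  rw [mul_assoc, ← zpow_natCast, ← zpow_add₀ hq₀]
  exact h _

theorem Generic.of_eq {q p x y : ℂ} (h : Generic q p x) (hq₀ : q ≠ 0) (i : ℤ)
    (hy : y = x * q ^ i) : Generic q p y := by
  intro j
  rw [hy, mul_assoc, ← zpow_add₀ hq₀]
  exact h _

theorem Generic.inv {q p x : ℂ} (hq₀ : q ≠ 0) (hp : ‖p‖ < 1) (hx : x ≠ 0) (h : Generic q p x) :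
    Generic q p x⁻¹ := by
  intro j
  have e : x⁻¹ * q ^ j = (x * q ^ (-j))⁻¹ := by rw [mul_inv, zpow_neg, inv_inv]
  have h0 : x * q ^ (-j) ≠ 0 := mul_ne_zero hx (zpow_ne_zero _ hq₀)
  rw [e, theta_inv hp h0]
  exact mul_ne_zero (neg_ne_zero.mpr (inv_ne_zero h0)) (h _)

theorem Generic.theta_ne_zero {q p x y : ℂ} (h : Generic q p x) (i : ℤ) (hy : y = x * q ^ i) :
    theta y p ≠ 0 := hy ▸ h i

theorem Generic.poch_ne_zero {q p x y : ℂ} (hq₀ : q ≠ 0) (h : Generic q p x) (i : ℤ) (n : ℕ)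
    (hy : y = x * q ^ i) : ellPoch q p y n ≠ 0 := hy ▸ h.ellPoch_ne_zero hq₀ i n

/-! ### The terminating very well poised summation formula -/

/-- The terms of the series `₁₀V₉(a;b,c,d,e,q^(-n))`. -/
def ftTerm (q p a b c d e : ℂ) (n k : ℕ) : ℂ :=
  theta (a * q ^ (2 * k)) p / theta a p *
    ((ellPoch q p a k * ellPoch q p b k * ellPoch q p c k * ellPoch q p d k * ellPoch q p e k *
        ellPoch q p (q ^ (-(n : ℤ))) k) /
      (ellPoch q p q k * ellPoch q p (a * q / b) k * ellPoch q p (a * q / c) k *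
        ellPoch q p (a * q / d) k * ellPoch q p (a * q / e) k *
        ellPoch q p (a * q ^ (n + 1)) k)) * q ^ k

/-- The sum of the series `₁₀V₉(a;b,c,d,e,q^(-n))`. -/
def ftSum (q p a b c d : ℂ) (n : ℕ) : ℂ :=
  (ellPoch q p (a * q) n * ellPoch q p (a * q / (b * c)) n * ellPoch q p (a * q / (b * d)) n *
      ellPoch q p (a * q / (c * d)) n) /
    (ellPoch q p (a * q / b) n * ellPoch q p (a * q / c) n * ellPoch q p (a * q / d) n *
      ellPoch q p (a * q / (b * c * d)) n)

/-- The telescoping term for `ftTerm`, for `k + 1` and without its constant factor. -/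
def ftCert (q p a b c d e : ℂ) (n k : ℕ) : ℂ :=
  (ellPoch q p a (k + 1) * ellPoch q p b (k + 1) * ellPoch q p c (k + 1) * ellPoch q p d (k + 1) *
      ellPoch q p e (k + 1) * ellPoch q p (q ^ (-(n : ℤ))) k) /
    (ellPoch q p q k * ellPoch q p (a * q / b) k * ellPoch q p (a * q / c) k *
      ellPoch q p (a * q / d) k * ellPoch q p (a * q / e) k * ellPoch q p (a * q ^ (n + 1)) (k + 1))

/-- This is `theta_four_term` at `z = r q^k` with parameters `e/r, b/r, c/r, d/r, r`, where `r² =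
a`; the balancing condition makes their product `r q^(n+1)`. Some arguments are inverted to match
the factors of the series. -/
theorem theta_four_term_discrete {q p : ℂ} (hq₀ : q ≠ 0) (hp₀ : p ≠ 0) (hp : ‖p‖ < 1)
    {a b c d e : ℂ} (ha : a ≠ 0) (hb : b ≠ 0) (hc : c ≠ 0) (hd : d ≠ 0) {n : ℕ}
    (he : e * (b * c * d) = a ^ 2 * q ^ (n + 1)) (h : theta (b * c / a) p ≠ 0) (k : ℕ) :
    theta (a * q ^ (2 * k)) p *
      (-e * theta (e * q ^ k) p * theta (a * q ^ k / e) p *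
          (theta (a * q ^ (n + 1) / b) p * theta (a * q ^ (n + 1) / c) p *
            theta (a * q ^ (n + 1) / d) p) * theta (q ^ (n + 1)) p +
        a * q ^ (n + 1) * theta (a * q ^ (n + 1) * q ^ k) p * theta (q ^ k / q ^ (n + 1)) p *
          (theta (a * q ^ (n + 1) / (c * d)) p * theta (a * q ^ (n + 1) / (b * d)) p *
            theta (a * q ^ (n + 1) / (b * c)) p) * theta e p) =
    -e * (q ^ (n + 1) / q ^ k) * theta (e * q ^ (n + 1)) p *
      (-theta (q ^ k / q ^ (n + 1)) p * theta (e * q ^ k) p *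
          (theta (b * q ^ k) p * theta (c * q ^ k) p * theta (d * q ^ k) p * theta (a * q ^ k) p) +
        theta (a * q ^ (n + 1) * q ^ k) p * theta (a * q ^ k / e) p *
          (theta (a * q ^ k / b) p * theta (a * q ^ k / c) p * theta (a * q ^ k / d) p *
            theta (q ^ k) p)) := by
  obtain ⟨r, hr⟩ := IsAlgClosed.exists_eq_mul_self a
  have hr0 : r ≠ 0 := by
    rintro rfl
    exact ha (by simpa using hr)
  have hqk : q ^ k ≠ 0 := pow_ne_zero k hq₀
  have hqn : q ^ (n + 1) ≠ 0 := pow_ne_zero _ hq₀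
  have he0 : e ≠ 0 := by
    rintro rfl
    rw [zero_mul] at he
    exact mul_ne_zero (pow_ne_zero 2 ha) hqn he.symm
  have he' : e = a ^ 2 * q ^ (n + 1) / (b * c * d) := by
    rw [← he]
    field_simp
  have hq2 : q ^ (2 * k) = (q ^ k) ^ 2 := by rw [← pow_mul, mul_comm]
  have H := theta_four_term hp₀ hp (z := r * q ^ k) (t₀ := e / r) (t₁ := b / r) (t₂ := c / r)
    (t₃ := d / r) (t₄ := r) (A := r * q ^ (n + 1)) (mul_ne_zero hr0 hqk) (div_ne_zero he0 hr0)
    (div_ne_zero hb hr0) (div_ne_zero hc hr0) (div_ne_zero hd hr0) hr0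
    (by rw [he', hr]; field_simp)
    (by rwa [show b / r * (c / r) = b * c / a by rw [hr]; field_simp])
  generalize hQk : q ^ k = Qk at *
  generalize hQ : q ^ (n + 1) = Q at *
  have e1 : (r * Qk) ^ 2 = a * q ^ (2 * k) := by rw [hq2, hr]; ring
  have e2 (x : ℂ) : x / r * (r * Qk) = x * Qk := by field_simp
  have e3 (x : ℂ) : x / r / (r * Qk) = x / (a * Qk) := by rw [hr]; field_simp
  have e4 (x : ℂ) : r * Q / (x / r) = a * Q / x := by rw [hr]; field_simp
  have e5 : r * Q / r = Q := by field_simp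
  have e6 : r * Q * (r * Qk) = a * Q * Qk := by rw [hr]; ring
  have e7 : r * Q / (r * Qk) = Q / Qk := by field_simp
  have e8 : e / r * (b / r) = a * Q / (c * d) := by
    rw [he', hr]; field_simp
  have e9 : e / r * (c / r) = a * Q / (b * d) := by
    rw [he', hr]; field_simp
  have e10 : e / r * (d / r) = a * Q / (b * c) := by
    rw [he', hr]; field_simp
  have e11 : e / r * r = e := by field_simp
  have e12 : e / r * (r * Q) = e * Q := by field_simp
  have e13 : r * (r * Qk) = a * Qk := by rw [hr]; ring
  have e14 : r / (r * Qk) = 1 / Qk := by field_simp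
  rw [e1, e2, e3, e4, e4, e4, e5, e6, e7, e8, e9, e10, e11, e12, e2, e2, e2, e3, e3, e3, e13,
    e14] at H
  have haQ : a * Qk ≠ 0 := mul_ne_zero ha hqk
  rw [theta_div_comm hp he0 haQ, theta_div_comm hp hb haQ, theta_div_comm hp hc haQ,
    theta_div_comm hp hd haQ, theta_div_comm hp one_ne_zero hqk, theta_div_comm hp hqn hqk,
    div_one] at H
  have m1 : r * Qk * (e / (a * Qk)) * r = e := by rw [hr]; field_simp
  have m2 : r * Qk * (Q / Qk) * r = a * Q := by rw [hr]; field_simp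
  have m3 : e / r * (Q / Qk) * r = e * (Q / Qk) := by field_simp
  have m4 : e / r * ((r * Qk) ^ 4 * (e / (a * Qk) * (b / (a * Qk)) * (c / (a * Qk)) *
      (d / (a * Qk)) * (1 / Qk))) * r = e * (Q / Qk) := by
    rw [he', hr]
    field_simp
  have H2 := congrArg (· * r) H
  clear H he he' hQk hQ hq2 e1 e2 e3 e4 e5 e6 e7 e8 e9 e10 e11 e12 e13 e14
  generalize theta (a * q ^ (2 * k)) p = x1 at *
  generalize theta (e * Qk) p = x2 at *
  generalize theta (a * Qk / e) p = x3 at *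
  generalize theta (a * Q / b) p = x4 at *
  generalize theta (a * Q / c) p = x5 at *
  generalize theta (a * Q / d) p = x6 at *
  generalize theta Q p = x7 at *
  generalize theta (a * Q * Qk) p = x8 at *
  generalize theta (Qk / Q) p = x9 at *
  generalize theta (a * Q / (c * d)) p = x10 at *
  generalize theta (a * Q / (b * d)) p = x11 at *
  generalize theta (a * Q / (b * c)) p = x12 at *
  generalize theta e p = x13 at *
  generalize theta (e * Q) p = x14 at *
  generalize theta (b * Qk) p = y1 at *
  generalize theta (c * Qk) p = y2 at *
  generalize theta (d * Qk) p = y3 at *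
  generalize theta (a * Qk) p = y4 at *
  generalize theta (a * Qk / b) p = y5 at *
  generalize theta (a * Qk / c) p = y6 at *
  generalize theta (a * Qk / d) p = y7 at *
  generalize theta Qk p = y8 at *
  linear_combination H2 + x1 * x2 * x3 * x4 * x5 * x6 * x7 * m1 - x1 * x8 * x9 * x10 * x11 * x12 *
    x13 * m2 + x14 * x9 * x2 * y1 * y2 * y3 * y4 * m3 - x14 * x8 * x3 * y5 * y6 * y7 * y8 * m4

/-- Here and in the next two lemmas, the term of order `n`, the next telescoping term and the term
of order `n + 1` are written as multiples of one `ftCert q p a b c d e n k`, so that telescoping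
reduces to an identity between single theta functions. -/
theorem ftTerm_succ_mul {q p a b c d e : ℂ} (n k : ℕ)
    (hq₀ : q ≠ 0) :
    ftTerm q p a b c d e n (k + 1) = ftCert q p a b c d e n k *
      (theta (a * q ^ (2 * (k + 1))) p / theta a p * q ^ (k + 1) *
        (theta (q ^ (k + 1) / q ^ (n + 1)) p /
        (theta (q ^ (k + 1)) p * theta (a * q ^ (k + 1) / b) p * theta (a * q ^ (k + 1) / c) p *
          theta (a * q ^ (k + 1) / d) p * theta (a * q ^ (k + 1) / e) p))) := by
  have e1 (x : ℂ) : a * q / x * q ^ k = a * q ^ (k + 1) / x := by ring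
  have e2 : q ^ (-(n : ℤ)) * q ^ k = q ^ (k + 1) / q ^ (n + 1) := by
    rw [zpow_neg, zpow_natCast, pow_succ, pow_succ]
    field_simp
  have e3 : q * q ^ k = q ^ (k + 1) := by ring
  unfold ftTerm ftCert
  rw [ellPoch_succ q p (q ^ (-(n : ℤ))), ellPoch_succ q p q, ellPoch_succ q p (a * q / b),
    ellPoch_succ q p (a * q / c), ellPoch_succ q p (a * q / d), ellPoch_succ q p (a * q / e),
    e1, e1, e1, e1, e2, e3]
  simp only [div_eq_mul_inv, mul_inv]
  ring

theorem ftCert_succ {q p a b c d e : ℂ} (n k : ℕ) (hq₀ : q ≠ 0) :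
    ftCert q p a b c d e n (k + 1) = ftCert q p a b c d e n k *
      (theta (a * q ^ (k + 1)) p * theta (b * q ^ (k + 1)) p * theta (c * q ^ (k + 1)) p *
        theta (d * q ^ (k + 1)) p * theta (e * q ^ (k + 1)) p *
        theta (q ^ (k + 1) / q ^ (n + 1)) p /
        (theta (q ^ (k + 1)) p * theta (a * q ^ (k + 1) / b) p * theta (a * q ^ (k + 1) / c) p *
          theta (a * q ^ (k + 1) / d) p * theta (a * q ^ (k + 1) / e) p *
          theta (a * q ^ (n + 1) * q ^ (k + 1)) p)) := by
  have e1 (x : ℂ) : a * q / x * q ^ k = a * q ^ (k + 1) / x := by ring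
  have e2 : q ^ (-(n : ℤ)) * q ^ k = q ^ (k + 1) / q ^ (n + 1) := by
    rw [zpow_neg, zpow_natCast, pow_succ, pow_succ]
    field_simp
  have e3 : q * q ^ k = q ^ (k + 1) := by ring
  unfold ftCert
  rw [ellPoch_succ q p (q ^ (-(n : ℤ))), ellPoch_succ q p q, ellPoch_succ q p (a * q / b),
    ellPoch_succ q p (a * q / c), ellPoch_succ q p (a * q / d), ellPoch_succ q p (a * q / e),
    e1, e1, e1, e1, e2, e3, ellPoch_succ q p a (k + 1), ellPoch_succ q p b (k + 1),
    ellPoch_succ q p c (k + 1), ellPoch_succ q p d (k + 1), ellPoch_succ q p e (k + 1),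
    ellPoch_succ q p (a * q ^ (n + 1)) (k + 1)]
  simp only [div_eq_mul_inv, mul_inv]
  ring

theorem ftTerm_succ_nat {q p a b c d e : ℂ} (n k : ℕ) (hq₀ : q ≠ 0)
    (h1 : theta (a * q ^ (n + 1)) p ≠ 0) (h2 : theta e p ≠ 0) :
    ftTerm q p a b c d (e * q) (n + 1) (k + 1) = ftCert q p a b c d e n k *
      (theta (a * q ^ (2 * (k + 1))) p / theta a p * q ^ (k + 1) *
        (theta (e * q ^ (k + 1)) p / theta e p * theta (1 / q ^ (n + 1)) p *
          theta (a * q ^ (n + 1)) p /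
        (theta (q ^ (k + 1)) p * theta (a * q ^ (k + 1) / b) p * theta (a * q ^ (k + 1) / c) p *
          theta (a * q ^ (k + 1) / d) p * theta (a / e) p *
          theta (a * q ^ (n + 1) * q ^ (k + 1)) p))) := by
  have e1 (x : ℂ) : a * q / x * q ^ k = a * q ^ (k + 1) / x := by ring
  have e2 : q ^ (-((n + 1 : ℕ) : ℤ)) = 1 / q ^ (n + 1) := by
    rw [zpow_neg, zpow_natCast, one_div]
  have e2' : 1 / q ^ (n + 1) * q = q ^ (-(n : ℤ)) := by
    rw [zpow_neg, zpow_natCast, pow_succ]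
    field_simp
  have e3 : q * q ^ k = q ^ (k + 1) := by ring
  have e4 : a * q / (e * q) = a / e := mul_div_mul_right _ _ hq₀
  have e5 : a / e * q = a * q / e := by ring
  have h3 : ellPoch q p (e * q) (k + 1) = ellPoch q p e (k + 1) * theta (e * q ^ (k + 1)) p /
      theta e p := by
    rw [eq_div_iff h2, mul_comm, ← ellPoch_succ', ellPoch_succ]
  have h4 : ellPoch q p (a * q ^ (n + 1 + 1)) (k + 1) = ellPoch q p (a * q ^ (n + 1)) (k + 1) *
      theta (a * q ^ (n + 1) * q ^ (k + 1)) p / theta (a * q ^ (n + 1)) p := by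
    rw [eq_div_iff h1, mul_comm, ← ellPoch_succ, ellPoch_succ' q p (a * q ^ (n + 1)),
      pow_succ q (n + 1), mul_assoc]
  unfold ftTerm ftCert
  rw [h3, h4, e2, e4, ellPoch_succ' q p (1 / q ^ (n + 1)), e2', ellPoch_succ' q p (a / e), e5,
    ellPoch_succ q p q, ellPoch_succ q p (a * q / b),
    ellPoch_succ q p (a * q / c), ellPoch_succ q p (a * q / d), e1, e1, e1, e3]
  simp only [div_eq_mul_inv, mul_inv, inv_inv]
  ring

theorem ftSum_succ (q p a b c d : ℂ) (n : ℕ) :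
    ftSum q p a b c d (n + 1) = ftSum q p a b c d n *
      (theta (a * q ^ (n + 1)) p * (theta (a * q ^ (n + 1) / (c * d)) p *
        theta (a * q ^ (n + 1) / (b * d)) p * theta (a * q ^ (n + 1) / (b * c)) p) /
      ((theta (a * q ^ (n + 1) / b) p * theta (a * q ^ (n + 1) / c) p *
        theta (a * q ^ (n + 1) / d) p) * theta (a * q ^ (n + 1) / (b * c * d)) p)) := by
  have e1 (x : ℂ) : a * q / x * q ^ n = a * q ^ (n + 1) / x := by ring
  have e2 : a * q * q ^ n = a * q ^ (n + 1) := by ring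
  unfold ftSum
  simp only [ellPoch_succ, e1, e2]
  simp only [div_eq_mul_inv, mul_inv]
  ring

/-- The algebra behind the telescoping of the very well poised series. -/
theorem telescoping_algebra {a e T Qk Q x7 x8 x9 ek M M' P Qθ S eθ eA aQ ea : ℂ}
    (ha : a ≠ 0) (he : e ≠ 0) (hQk : Qk ≠ 0) (hQ : Q ≠ 0) (hx7 : x7 ≠ 0) (hx9 : x9 ≠ 0)
    (hS : S ≠ 0) (heθ : eθ ≠ 0) (haQ : aQ ≠ 0) (hea : ea ≠ 0)
    (D : T * (-e * ek * x7 * P * Qθ + a * Q * x9 * x8 * S * eθ) =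
      -e * (Q / Qk) * eA * (-x8 * ek * M + x9 * x7 * M')) :
    T * Qk * (P * ea / (aQ * S)) * (ek / eθ * (-(1 / Q) * Qθ) * aQ / (-(a / e) * ea * x9)) -
      T * Qk * (x8 / x7) = -(e / a) * eA / (S * eθ) * (M * ek * x8 / (x7 * x9) - M') := by
  have D' : T * (-e * ek * x7 * P * Qθ + a * Q * x9 * x8 * S * eθ) * Qk =
      -e * Q * eA * (-x8 * ek * M + x9 * x7 * M') := by
    rw [D]
    field_simp
  field_simp
  linear_combination (-1) * D'

theorem ellPoch_neg_eq_zero {q p : ℂ} (hq₀ : q ≠ 0) (hp : ‖p‖ < 1) {n k : ℕ} (h : n < k) :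
    ellPoch q p (q ^ (-(n : ℤ))) k = 0 := by
  rw [ellPoch, prod_eq_zero_iff]
  refine ⟨n, mem_range.mpr h, ?_⟩
  rw [zpow_neg, zpow_natCast, inv_mul_cancel₀ (pow_ne_zero n hq₀), theta_one hp]

/-- The summation formula of Frenkel and Turaev, for generic parameters. -/
theorem frenkel_turaev {q p : ℂ} (hq₀ : q ≠ 0) (hp₀ : p ≠ 0) (hp : ‖p‖ < 1)
    {a b c d : ℂ} (ha : a ≠ 0) (hb : b ≠ 0) (hc : c ≠ 0) (hd : d ≠ 0)
    (ga : Generic q p a) (gb : Generic q p (a / b)) (gc : Generic q p (a / c))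
    (gd : Generic q p (a / d)) (gbc : Generic q p (a / (b * c))) (gbd : Generic q p (a / (b * d)))
    (gcd : Generic q p (a / (c * d))) (gbcd : Generic q p (a / (b * c * d)))
    (ge : Generic q p (a ^ 2 / (b * c * d))) (n : ℕ) (hn : ellPoch q p q n ≠ 0) :
    ∑ k ∈ range (n + 1), ftTerm q p a b c d (a ^ 2 * q ^ (n + 1) / (b * c * d)) n k =
      ftSum q p a b c d n := by
  have hga : theta a p ≠ 0 := ga.theta_ne_zero 0 (by simp)
  induction n with
  | zero => simp [ftTerm, ftSum, hga]
  | succ n ih =>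
    have ih' := ih (ellPoch_ne_zero_of_le (Nat.le_succ n) hn)
    have hqn : q ^ (n + 1) ≠ 0 := pow_ne_zero _ hq₀
    set e := a ^ 2 * q ^ (n + 1) / (b * c * d) with hedef
    have he0 : e ≠ 0 := by rw [hedef]; positivity
    have heq : a ^ 2 * q ^ (n + 1 + 1) / (b * c * d) = e * q := by rw [hedef]; ring
    have he : e * (b * c * d) = a ^ 2 * q ^ (n + 1) := by rw [hedef]; field_simp
    rw [heq]
    have hz (m : ℕ) : q ^ m = q ^ (m : ℤ) := (zpow_natCast q m).symm
    have hxa (m : ℕ) : theta (a * q ^ m) p ≠ 0 := ga.theta_ne_zero m (by rw [hz])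
    have hPi : ∀ x, Generic q p (a / x) → theta (a * q ^ (n + 1) / x) p ≠ 0 := fun x hx =>
      hx.theta_ne_zero ((n + 1 : ℕ) : ℤ) (by rw [← hz]; ring)
    have hea' : e / a = a * q ^ (n + 1) / (b * c * d) := by rw [hedef]; field_simp
    have hee : e = a ^ 2 / (b * c * d) * q ^ (n + 1) := by rw [hedef]; ring
    have heθ : theta e p ≠ 0 := ge.theta_ne_zero ((n + 1 : ℕ) : ℤ) (by rw [← hz, hee])
    have hbc0 : theta (b * c / a) p ≠ 0 :=
      (gbc.inv hq₀ hp (by positivity)).theta_ne_zero 0 (by simp)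
    have hx7 (k : ℕ) : theta (a * q ^ k / e) p ≠ 0 := by
      refine (gbcd.inv hq₀ hp (by positivity)).theta_ne_zero ((k : ℤ) - (n + 1 : ℕ)) ?_
      rw [zpow_sub₀ hq₀, ← hz, ← hz, hee]
      field_simp
    have hqθ : theta (q ^ (n + 1)) p ≠ 0 := by
      have := theta_ne_zero_of_ellPoch_ne_zero (Nat.lt_succ_self n) hn
      rwa [← pow_succ'] at this
    have hea : theta (e / a) p ≠ 0 := by rw [hea']; exact hPi _ gbcd
    have hae : theta (a / e) p = -(a / e) * theta (e / a) p := theta_div_comm hp ha he0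
    have hQi : theta (1 / q ^ (n + 1)) p = -(1 / q ^ (n + 1)) * theta (q ^ (n + 1)) p := by
      rw [theta_div_comm hp one_ne_zero hqn, div_one]
    set P := theta (a * q ^ (n + 1) / b) p * theta (a * q ^ (n + 1) / c) p *
      theta (a * q ^ (n + 1) / d) p with hP
    set S := theta (a * q ^ (n + 1) / (c * d)) p * theta (a * q ^ (n + 1) / (b * d)) p *
      theta (a * q ^ (n + 1) / (b * c)) p with hS
    have hS0 : S ≠ 0 := mul_ne_zero (mul_ne_zero (hPi _ gcd) (hPi _ gbd)) (hPi _ gbc)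
    have hP0 : P ≠ 0 := mul_ne_zero (mul_ne_zero (hPi _ gb) (hPi _ gc)) (hPi _ gd)
    -- `ρ` is the expected ratio of the sum of order `n` to the sum of order `n + 1`.
    set ρ := P * theta (e / a) p / (theta (a * q ^ (n + 1)) p * S) with hρ
    set K := -(e / a) * theta (e * q ^ (n + 1)) p / (S * theta e p) / theta a p with hK
    have hρ0 : ρ ≠ 0 := div_ne_zero (mul_ne_zero hP0 hea) (mul_ne_zero (hxa _) hS0)
    have alg (k : ℕ) := telescoping_algebra (Qk := q ^ k) (P := P) (S := S) ha he0 (pow_ne_zero k hq₀) hqn (hx7 k)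
      (x9 := theta (a * q ^ (n + 1) * q ^ k) p) (by rw [mul_assoc, ← pow_add]; exact hxa _)
      hS0 heθ (hxa (n + 1)) hea
      (theta_four_term_discrete hq₀ hp₀ hp ha hb hc hd he hbc0 k)
    -- The difference of the two series, the longer one normalized by `ρ`, telescopes; in passing
    -- from `n` to `n + 1` the balanced parameter changes from `e` to `eq`.
    have step (k : ℕ) (hk : k ≤ n + 1) : ∑ j ∈ range (k + 1), (ftTerm q p a b c d (e * q) (n + 1) j * ρ -
        ftTerm q p a b c d e n j) = K * ftCert q p a b c d e n k := by
      induction k with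
      | zero =>
        have h0 := alg 0
        simp only [pow_zero, mul_one, mul_zero, theta_one hp, sub_zero] at h0
        simp only [ftTerm, ftCert, zero_add, range_one, sum_singleton, ellPoch_zero, ellPoch_one,
          mul_zero, pow_zero, mul_one, div_one, div_self hga, one_mul]
        rw [← hQi, ← hae] at h0
        have h1 : theta (1 / q ^ (n + 1)) p ≠ 0 := by
          rw [hQi]
          exact mul_ne_zero (neg_ne_zero.mpr (one_div_ne_zero hqn)) hqθ
        have h2 : theta (a / e) p ≠ 0 := by simpa using hx7 0
        rw [hK]
        rw [← hρ] at h0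
        have h3 := hxa (n + 1)
        clear_value ρ S
        generalize theta (1 / q ^ (n + 1)) p = y1 at *
        generalize theta (a / e) p = y2 at *
        generalize theta (a * q ^ (n + 1)) p = y3 at *
        generalize theta (e / a) p = y4 at *
        generalize theta (e * q ^ (n + 1)) p = y5 at *
        generalize theta e p = y6 at *
        generalize theta a p = y7 at *
        generalize theta b p = y8 at *
        generalize theta c p = y9 at *
        generalize theta d p = y10 at *
        field_simp at h0 ⊢
        linear_combination h0
      | succ k ihk =>
        rw [sum_range_succ, ihk (by lia), ftCert_succ n k hq₀, ftTerm_succ_mul n k hq₀,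
          ftTerm_succ_nat n k hq₀ (hxa _) heθ]
        have h0 := alg (k + 1)
        rw [← hQi, ← hae] at h0
        rw [← hρ] at h0
        have h1 : theta (q ^ (k + 1)) p ≠ 0 := by
          have := theta_ne_zero_of_ellPoch_ne_zero (m := k) (by lia) hn
          rwa [← pow_succ'] at this
        have h2 (x : ℂ) (hx : Generic q p (a / x)) : theta (a * q ^ (k + 1) / x) p ≠ 0 :=
          hx.theta_ne_zero ((k + 1 : ℕ) : ℤ) (by rw [← hz]; ring)
        have hb' := h2 b gb
        have hc' := h2 c gc
        have hd' := h2 d gd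
        have h7 := hx7 (k + 1)
        have h9 : theta (a * q ^ (n + 1) * q ^ (k + 1)) p ≠ 0 := by
          rw [mul_assoc, ← pow_add]; exact hxa _
        have h2' : theta (a / e) p ≠ 0 := by simpa using hx7 0
        have h3 := hxa (n + 1)
        rw [← eq_sub_iff_add_eq', ← mul_sub]
        trans ftCert q p a b c d e n k / (theta a p * (theta (q ^ (k + 1)) p *
          theta (a * q ^ (k + 1) / b) p * theta (a * q ^ (k + 1) / c) p *
          theta (a * q ^ (k + 1) / d) p)) *
          (-(e / a) * theta (e * q ^ (n + 1)) p / (S * theta e p) *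
          (theta (b * q ^ (k + 1)) p * theta (c * q ^ (k + 1)) p * theta (d * q ^ (k + 1)) p *
          theta (a * q ^ (k + 1)) p * theta (e * q ^ (k + 1)) p *
          theta (q ^ (k + 1) / q ^ (n + 1)) p / (theta (a * q ^ (k + 1) / e) p *
          theta (a * q ^ (n + 1) * q ^ (k + 1)) p) - theta (a * q ^ (k + 1) / b) p *
          theta (a * q ^ (k + 1) / c) p * theta (a * q ^ (k + 1) / d) p * theta (q ^ (k + 1)) p))
        · rw [← h0]
          simp only [div_eq_mul_inv, mul_inv]
          ring
        · rw [hK]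
          clear h0 alg
          clear_value ρ S
          generalize theta (a * q ^ (n + 1) * q ^ (k + 1)) p = y1 at *
          generalize theta (a * q ^ (k + 1) / e) p = y2 at *
          generalize theta (a * q ^ (k + 1) / b) p = y3 at *
          generalize theta (a * q ^ (k + 1) / c) p = y4 at *
          generalize theta (a * q ^ (k + 1) / d) p = y5 at *
          generalize theta (q ^ (k + 1)) p = y6 at *
          generalize theta a p = y7 at *
          field_simp
    have hfin := step (n + 1) le_rfl
    -- The telescoping term ends with `(q^(-n))_(n+1) = 0`, so the two normalized sums agree.
    have hc0 : ftCert q p a b c d e n (n + 1) = 0 := by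
      rw [ftCert, ellPoch_neg_eq_zero hq₀ hp (Nat.lt_succ_self n), mul_zero, zero_div]
    have ht0 : ftTerm q p a b c d e n (n + 1) = 0 := by
      rw [ftTerm, ellPoch_neg_eq_zero hq₀ hp (Nat.lt_succ_self n), mul_zero, zero_div, mul_zero,
        zero_mul]
    rw [hc0, mul_zero, sum_sub_distrib, ← sum_mul, sum_range_succ (ftTerm q p a b c d e n), ht0,
      add_zero, ih', sub_eq_zero] at hfin
    rw [eq_div_of_mul_eq hρ0 hfin, ftSum_succ, hρ, hea', ← hP, ← hS]
    have h4 := hPi _ gbcd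
    have h5 := hxa (n + 1)
    clear_value P S
    generalize theta (a * q ^ (n + 1)) p = y1 at *
    generalize theta (a * q ^ (n + 1) / (b * c * d)) p = y2 at *
    field_simp

/-! ### Closed contours -/

/-- Without break points `deriv γ` agrees in the interior with `derivWithin`, which is continuous up
to the end points. Break points are treated one at a time by cutting the interval there. -/
theorem intervalIntegrable_deriv_of_piecewise {γ : ℝ → ℂ} (s : Finset ℝ) : ∀ {a b : ℝ}, a ≤ b →
    (∀ c d : ℝ, a ≤ c → c < d → d ≤ b → Disjoint (Set.Ioo c d) (s : Set ℝ) →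
      ContDiffOn ℝ 1 γ (Set.Icc c d)) → IntervalIntegrable (deriv γ) volume a b := by
  induction s using Finset.induction_on with
  | empty =>
    intro a b hab h
    rcases hab.eq_or_lt with rfl | hlt
    · exact IntervalIntegrable.refl
    have hc := (h a b le_rfl hlt le_rfl (by simp)).continuousOn_derivWithin
      (uniqueDiffOn_Icc hlt) le_rfl
    refine IntervalIntegrable.congr_uIoo (hc.intervalIntegrable_of_Icc hab) ?_
    intro x hx
    rw [Set.uIoo_of_le hab] at hx
    exact derivWithin_of_mem_nhds (Icc_mem_nhds hx.1 hx.2)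
  | insert x s _ ih =>
    intro a b hab h
    by_cases hx : x ∈ Set.Ioo a b
    · refine (ih hx.1.le fun c d hc hcd hd hdis => ?_).trans
        (ih hx.2.le fun c d hc hcd hd hdis => ?_)
      · refine h c d hc hcd (hd.trans hx.2.le) ?_
        rw [coe_insert, Set.disjoint_insert_right]
        exact ⟨fun hxx => absurd hxx.2 (not_lt.mpr hd), hdis⟩
      · refine h c d (hx.1.le.trans hc) hcd hd ?_
        rw [coe_insert, Set.disjoint_insert_right]
        exact ⟨fun hxx => absurd hxx.1 (not_lt.mpr hc), hdis⟩
    · refine ih hab fun c d hc hcd hd hdis => h c d hc hcd hd ?_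
      rw [coe_insert, Set.disjoint_insert_right]
      exact ⟨fun hxx => hx ⟨hc.trans_lt hxx.1, hxx.2.trans_le hd⟩, hdis⟩

/-- For a single point `e`, the parameters `s` with `γ s = e` and `γ' s ≠ 0` are isolated among
themselves, hence countable in number; where `γ' s = 0` both sides vanish. So the contour may run
through exceptional points, even stay there, without influence on the integral. All later identities
between integrands hold only off a countable set of `z`. -/
theorem ae_contour_eq_of_countable {γ : ℝ → ℂ} {f g : ℂ → ℂ} {E : Set ℂ} (hE : E.Countable)
    (hfg : ∀ s ∈ Set.Icc (0 : ℝ) 1, γ s ∉ E → f (γ s) = g (γ s)) :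
    ∀ᵐ s : ℝ, s ∈ Set.uIoc (0 : ℝ) 1 → f (γ s) * deriv γ s = g (γ s) * deriv γ s := by
  have hcount (e : ℂ) : {s : ℝ | γ s = e ∧ deriv γ s ≠ 0}.Countable := by
    refine Set.Countable.mono ?_ (countable_setOfPred_isolated_right_within
      (s := {s : ℝ | γ s = e ∧ deriv γ s ≠ 0}))
    rintro s ⟨hs, hs'⟩
    refine ⟨⟨hs, hs'⟩, ?_⟩
    have hd : DifferentiableAt ℝ γ s := by
      by_contra hcon
      exact hs' (deriv_zero_of_not_differentiableAt hcon)
    have hne := hd.hasDerivAt.eventually_ne (c := e) hs'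
    rw [← Filter.empty_mem_iff_bot, mem_nhdsWithin_iff_eventually]
    rw [eventually_nhdsWithin_iff] at hne
    filter_upwards [hne] with x hx hx'
    exact absurd hx'.1.1 (hx (ne_of_gt hx'.2))
  have hnull : (⋃ e ∈ E, {s : ℝ | γ s = e ∧ deriv γ s ≠ 0}).Countable :=
    hE.biUnion fun e _ => hcount e
  filter_upwards [hnull.ae_notMem volume] with s hs hs01
  by_cases hsE : γ s ∈ E
  · have : deriv γ s = 0 := by
      by_contra hne
      exact hs (Set.mem_biUnion hsE ⟨rfl, hne⟩)
    rw [this, mul_zero, mul_zero]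
  · rw [hfg s _ hsE]
    rw [Set.uIoc_of_le zero_le_one] at hs01
    exact Set.Ioc_subset_Icc_self hs01

theorem contourIntegral_congr_of_countable {γ : ℝ → ℂ} {f g : ℂ → ℂ} {E : Set ℂ}
    (hE : E.Countable) (hfg : ∀ s ∈ Set.Icc (0 : ℝ) 1, γ s ∉ E → f (γ s) = g (γ s)) :
    contourIntegral γ f = contourIntegral γ g :=
  intervalIntegral.integral_congr_ae (ae_contour_eq_of_countable hE hfg)

theorem contourIntegrable_congr_of_countable {γ : ℝ → ℂ} {f g : ℂ → ℂ} {E : Set ℂ}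
    (hE : E.Countable) (hfg : ∀ s ∈ Set.Icc (0 : ℝ) 1, γ s ∉ E → f (γ s) = g (γ s))
    (hg : ContourIntegrable γ g) : ContourIntegrable γ f := by
  refine IntervalIntegrable.congr_ae hg ?_
  rw [Filter.EventuallyEq, ae_restrict_iff' measurableSet_uIoc]
  filter_upwards [ae_contour_eq_of_countable hE hfg] with s hs hs' using (hs hs').symm

namespace IsClosedContour

variable {γ : ℝ → ℂ}

theorem intervalIntegrable_deriv (h : IsClosedContour γ) :
    IntervalIntegrable (deriv γ) volume 0 1 := by
  obtain ⟨s, hs⟩ := h.piecewise_contDiffOn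
  exact intervalIntegrable_deriv_of_piecewise s zero_le_one hs

theorem exists_countable_differentiableAt (h : IsClosedContour γ) :
    ∃ s : Set ℝ, s.Countable ∧ ∀ x ∈ Set.Ioo (0 : ℝ) 1 \ s, DifferentiableAt ℝ γ x := by
  obtain ⟨s, hs⟩ := h.piecewise_contDiffOn
  refine ⟨s, s.countable_toSet, fun x hx => ?_⟩
  have hU : IsOpen (Set.Ioo (0 : ℝ) 1 \ (s : Set ℝ)) :=
    isOpen_Ioo.sdiff s.finite_toSet.isClosed
  obtain ⟨ε, hε, hball⟩ := Metric.isOpen_iff.mp hU x hx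
  have hsub : Set.Icc (x - ε / 2) (x + ε / 2) ⊆ Set.Ioo (0 : ℝ) 1 \ (s : Set ℝ) := by
    refine Set.Subset.trans (fun y hy => ?_) hball
    rw [Metric.mem_ball, Real.dist_eq, abs_lt]
    constructor <;> linarith [hy.1, hy.2]
  have h1 := hsub (Set.left_mem_Icc.mpr (by linarith))
  have h2 := hsub (Set.right_mem_Icc.mpr (by linarith))
  have hd := hs (x - ε / 2) (x + ε / 2) h1.1.1.le (by linarith) h2.1.2.le (by
    rw [Set.disjoint_left]
    exact fun y hy => (hsub (Set.Ioo_subset_Icc_self hy)).2)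
  exact (hd.differentiableOn one_ne_zero).differentiableAt
    (Icc_mem_nhds (by linarith) (by linarith))

theorem contourIntegrable (h : IsClosedContour γ) {f : ℂ → ℂ}
    (hf : ContinuousOn (fun s => f (γ s)) (Set.Icc 0 1)) : ContourIntegrable γ f :=
  h.intervalIntegrable_deriv.continuousOn_mul (by rwa [Set.uIcc_of_le zero_le_one])

theorem contourIntegral_eq_zero_of_hasDerivAt (h : IsClosedContour γ) {F F' : ℂ → ℂ}
    (hF : ∀ s ∈ Set.Icc (0 : ℝ) 1, HasDerivAt F (F' (γ s)) (γ s))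
    (hF' : ContinuousOn (fun s => F' (γ s)) (Set.Icc 0 1)) : contourIntegral γ F' = 0 := by
  obtain ⟨s, hs, hd⟩ := h.exists_countable_differentiableAt
  have := MeasureTheory.integral_eq_of_hasDerivAt_off_countable_of_le (fun s => F (γ s))
    (fun s => F' (γ s) * deriv γ s) zero_le_one hs
    (fun x hx => (hF x hx).continuousAt.comp_continuousWithinAt (h.continuousOn x hx))
    (fun x hx => by
      have := (hF x (Set.Ioo_subset_Icc_self hx.1)).scomp x (hd x hx).hasDerivAt
      rwa [smul_eq_mul, mul_comm] at this)
    (h.contourIntegrable hF')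
  rw [contourIntegral, this, h.closed, sub_self]

/-- Contour integrals depend holomorphically on a parameter. -/
theorem differentiableAt_contourIntegral (h : IsClosedContour γ) {Φ : ℂ → ℂ → ℂ} {U : Set ℂ}
    (hU : IsOpen U) (hΦ : ContinuousOn (fun x : ℂ × ℂ => Φ x.1 x.2) (U ×ˢ (γ '' Set.Icc 0 1)))
    (hd : ∀ w ∈ γ '' Set.Icc 0 1, DifferentiableOn ℂ (fun z => Φ z w) U) {z₀ : ℂ} (hz₀ : z₀ ∈ U) :
    DifferentiableAt ℂ (fun z => contourIntegral γ (Φ z)) z₀ := by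
  obtain ⟨r, hr, hball⟩ := Metric.isOpen_iff.mp hU z₀ hz₀
  have hK : IsCompact (γ '' Set.Icc 0 1) := isCompact_Icc.image_of_continuousOn h.continuousOn
  have hsub : Metric.closedBall z₀ (r / 2) ⊆ U := (Metric.closedBall_subset_ball (by linarith)).trans
    hball
  obtain ⟨M, hM⟩ := ((isCompact_closedBall z₀ (r / 2)).prod hK).exists_bound_of_continuousOn
    (hΦ.mono (Set.prod_mono hsub subset_rfl))
  have hcont (z : ℂ) (hz : z ∈ U) : ContinuousOn (fun s => Φ z (γ s)) (Set.Icc 0 1) := by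
    have h1 : ContinuousOn (fun s => ((z, γ s) : ℂ × ℂ)) (Set.Icc 0 1) :=
      continuousOn_const.prodMk h.continuousOn
    exact hΦ.comp h1 (fun s hs => ⟨hz, Set.mem_image_of_mem γ hs⟩)
  have hInt (z : ℂ) (hz : z ∈ U) := h.contourIntegrable (hcont z hz)
  have hmeas (z : ℂ) (hz : z ∈ U) : AEStronglyMeasurable (fun s => Φ z (γ s) * deriv γ s)
      (volume.restrict (Set.uIoc (0 : ℝ) 1)) :=
    (intervalIntegrable_iff.mp (hInt z hz)).aestronglyMeasurable
  have hmem (s : ℝ) (hs : s ∈ Set.uIoc (0 : ℝ) 1) : γ s ∈ γ '' Set.Icc 0 1 := by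
    rw [Set.uIoc_of_le zero_le_one] at hs
    exact Set.mem_image_of_mem γ (Set.Ioc_subset_Icc_self hs)
  have hr4 : 0 < r / 4 := by linarith
  have hin (z : ℂ) (hz : z ∈ Metric.ball z₀ (r / 4)) :
      Metric.closedBall z (r / 4) ⊆ Metric.closedBall z₀ (r / 2) := by
    refine Metric.closedBall_subset_closedBall' ?_
    have := (Metric.mem_ball.mp hz).le
    linarith
  have hzU (z : ℂ) (hz : z ∈ Metric.ball z₀ (r / 4)) : z ∈ U :=
    hsub (hin z hz (Metric.mem_closedBall_self hr4.le))
  have hderiv (z : ℂ) (hz : z ∈ Metric.ball z₀ (r / 4)) (s : ℝ) (hs : s ∈ Set.uIoc (0 : ℝ) 1) :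
      HasDerivAt (fun z => Φ z (γ s) * deriv γ s)
        (deriv (fun z => Φ z (γ s)) z * deriv γ s) z :=
    ((hd _ (hmem s hs)).differentiableAt (hU.mem_nhds (hzU z hz))).hasDerivAt.mul_const _
  refine (intervalIntegral.hasDerivAt_integral_of_dominated_loc_of_deriv_le
    (bound := fun s => M / (r / 4) * ‖deriv γ s‖)
    (F := fun z s => Φ z (γ s) * deriv γ s)
    (F' := fun z s => deriv (fun z => Φ z (γ s)) z * deriv γ s)
    (Metric.ball_mem_nhds z₀ hr4) ?_ (hInt z₀ hz₀) ?_ ?_ ?_ ?_).2.differentiableAt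
  · filter_upwards [hU.mem_nhds hz₀] with z hz using hmeas z hz
  -- The derivative is measurable in `s` as a limit of difference quotients along a sequence tending
  -- to `0`; the sequence is shifted by `N` so that all its points stay in `U`.
  · have hseq : Tendsto (fun n : ℕ => ((r / 8 : ℝ) : ℂ) * (1 / ((n : ℂ) + 1))) atTop (𝓝[≠] 0) := by
      rw [tendsto_nhdsWithin_iff]
      constructor
      · simpa using (tendsto_one_div_add_atTop_nhds_zero_nat (𝕜 := ℂ)).const_mul ((r / 8 : ℝ) : ℂ)
      · refine Eventually.of_forall fun n => ?_
        have h1 : ((r / 8 : ℝ) : ℂ) ≠ 0 := by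
          rw [Complex.ofReal_ne_zero]; positivity
        have h2 : (n : ℂ) + 1 ≠ 0 := Nat.cast_add_one_ne_zero n
        exact mul_ne_zero h1 (one_div_ne_zero h2)
    have hev : ∀ᶠ n : ℕ in atTop, z₀ + ((r / 8 : ℝ) : ℂ) * (1 / ((n : ℂ) + 1)) ∈ U := by
      have : Tendsto (fun n : ℕ => z₀ + ((r / 8 : ℝ) : ℂ) * (1 / ((n : ℂ) + 1))) atTop (𝓝 z₀) := by
        simpa using (hseq.mono_right nhdsWithin_le_nhds).const_add z₀
      exact this.eventually (hU.mem_nhds hz₀)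
    obtain ⟨N, hN⟩ := eventually_atTop.mp hev
    set x : ℕ → ℂ := fun n => ((r / 8 : ℝ) : ℂ) * (1 / (((n + N : ℕ) : ℂ) + 1)) with hx
    have hxt : Tendsto x atTop (𝓝[≠] 0) := hseq.comp (tendsto_add_atTop_nat N)
    refine aestronglyMeasurable_of_tendsto_ae (u := atTop)
      (f := fun n s => (x n)⁻¹ * (Φ (z₀ + x n) (γ s) * deriv γ s - Φ z₀ (γ s) * deriv γ s))
      (fun n => ((hmeas _ (hN (n + N) (by lia))).sub (hmeas z₀ hz₀)).const_mul _) ?_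
    rw [ae_restrict_iff' measurableSet_uIoc]
    refine Eventually.of_forall fun s hs => ?_
    have := (hderiv z₀ (Metric.mem_ball_self hr4) s hs).tendsto_slope_zero
    simpa only [smul_eq_mul, Function.comp_def] using this.comp hxt
  · refine Eventually.of_forall fun s hs z hz => ?_
    rw [norm_mul]
    refine mul_le_mul_of_nonneg_right ?_ (norm_nonneg _)
    -- Cauchy's estimate on discs of radius `r / 4`, which remain in the closed disc of radius `r /
    -- 2` where `M` bounds `Φ`.
    refine Complex.norm_deriv_le_of_forall_mem_sphere_norm_le hr4 ?_ fun w hw => ?_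
    · refine DifferentiableOn.diffContOnCl ?_
      rw [closure_ball z hr4.ne']
      exact (hd _ (hmem s hs)).mono ((hin z hz).trans hsub)
    · exact hM (w, γ s) ⟨hin z hz (Metric.sphere_subset_closedBall hw), hmem s hs⟩
  · exact h.intervalIntegrable_deriv.norm.const_mul _
  · exact Eventually.of_forall fun s hs z hz => hderiv z hz s hs

end IsClosedContour

/-! ### The homology form of Cauchy's theorem -/

/-- Off the diagonal this is a quotient of continuous functions. On the diagonal, strict
differentiability controls the difference quotients at two nearby distinct points, and continuity of
the derivative the diagonal values. -/
theorem continuousOn_dslope_uncurry {f : ℂ → ℂ} {U : Set ℂ} (hU : IsOpen U)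
    (hf : DifferentiableOn ℂ f U) :
    ContinuousOn (fun x : ℂ × ℂ => dslope f x.1 x.2) (U ×ˢ U) := by
  rintro ⟨z, w⟩ ⟨hz, hw⟩
  refine ContinuousAt.continuousWithinAt ?_
  have hfz (z : ℂ) (hz : z ∈ U) : ContinuousAt f z := (hf.differentiableAt (hU.mem_nhds hz)).continuousAt
  by_cases hzw : w = z
  · subst hzw
    have hA : AnalyticAt ℂ f w := hf.analyticAt (hU.mem_nhds hw)
    have hs := hA.hasStrictDerivAt
    have hd : ContinuousAt (deriv f) w := hA.deriv.continuousAt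
    rw [Metric.continuousAt_iff']
    intro ε hε
    have h1 := hasStrictDerivAt_iff_hasStrictFDerivAt.mp hs |>.isLittleO.def (half_pos hε)
    have h2 : ∀ᶠ x : ℂ × ℂ in 𝓝 (w, w), dist (deriv f x.1) (deriv f w) < ε :=
      (hd.fst' (y := w)).eventually (Metric.ball_mem_nhds _ hε)
    filter_upwards [h1, h2] with x hx1 hx2
    rw [dslope_same]
    by_cases hx : x.2 = x.1
    · rw [hx, dslope_same]
      exact hx2
    · rw [dslope_of_ne _ hx, slope_def_field, dist_eq_norm]
      have hne : x.2 - x.1 ≠ 0 := sub_ne_zero.mpr hx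
      have e : (f x.2 - f x.1) / (x.2 - x.1) - deriv f w =
          -(f x.1 - f x.2 - (x.1 - x.2) * deriv f w) / (x.2 - x.1) := by
        field_simp
        ring
      rw [e, norm_div, norm_neg, div_lt_iff₀ (norm_pos_iff.mpr hne)]
      have hx1' : ‖f x.1 - f x.2 - (x.1 - x.2) * deriv f w‖ ≤ ε / 2 * ‖x.1 - x.2‖ := by
        simpa using hx1
      rw [norm_sub_rev x.1 x.2] at hx1'
      have : 0 < ‖x.2 - x.1‖ := norm_pos_iff.mpr hne
      nlinarith
  · have hne : ∀ᶠ x : ℂ × ℂ in 𝓝 (z, w), x.2 ≠ x.1 :=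
      (isOpen_ne_fun continuous_snd continuous_fst).mem_nhds hzw
    have hc : ContinuousAt (fun x : ℂ × ℂ => (f x.2 - f x.1) / (x.2 - x.1)) (z, w) := by
      have h1 := (hfz z hz).fst' (y := w)
      have h2 := (hfz w hw).snd' (x := z)
      exact (h2.sub h1).div (by fun_prop) (sub_ne_zero.mpr hzw)
    refine hc.congr ?_
    filter_upwards [hne] with x hx
    rw [dslope_of_ne _ hx, slope_def_field]

theorem dslope_comm (f : ℂ → ℂ) (z w : ℂ) : dslope f z w = dslope f w z := by
  by_cases h : w = z
  · rw [h]
  · rw [dslope_of_ne _ h, dslope_of_ne _ (Ne.symm h), slope_comm]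

section Dixon

variable {ι : Type*} [Fintype ι] {a : ι → ℂ} {Γ : ι → ℝ → ℂ}

/-- For such `z` the function `log (1 - w / z)` is a primitive along the contour, since `‖w / z‖ <
1` there. -/
theorem IsClosedContour.contourIntegral_sub_inv_eq_zero {γ : ℝ → ℂ} (h : IsClosedContour γ)
    {R : ℝ} (hR : ∀ s ∈ Set.Icc (0 : ℝ) 1, ‖γ s‖ ≤ R) {z : ℂ} (hz : R < ‖z‖) :
    contourIntegral γ (fun w => (w - z)⁻¹) = 0 := by
  have hz0 : 0 < ‖z‖ := ((norm_nonneg _).trans (hR 0 (by simp))).trans_lt hz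
  have hne (s : ℝ) (hs : s ∈ Set.Icc (0 : ℝ) 1) : γ s - z ≠ 0 := by
    intro h0
    have := hR s hs
    rw [sub_eq_zero.mp h0] at this
    linarith
  refine h.contourIntegral_eq_zero_of_hasDerivAt (F := fun w => Complex.log (1 - w / z)) ?_ ?_
  · intro s hs
    have hslit : 1 - γ s / z ∈ Complex.slitPlane := by
      refine Complex.mem_slitPlane_of_norm_lt_one (z := -(γ s / z)) ?_
      rw [norm_neg, norm_div, div_lt_one hz0]
      exact (hR s hs).trans_lt hz
    have h1 : HasDerivAt (fun w : ℂ => 1 - w / z) (-(1 / z)) (γ s) :=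
      ((hasDerivAt_id (γ s)).div_const z).const_sub 1
    refine (h1.clog hslit).congr_deriv ?_
    have hz0' : z ≠ 0 := norm_pos_iff.mp hz0
    have h2 := hne s hs
    have h3 : 1 - γ s / z ≠ 0 := Complex.slitPlane_ne_zero hslit
    have h4 : z - γ s ≠ 0 := by rw [← neg_sub]; exact neg_ne_zero.mpr h2
    have h5 : 1 - γ s / z = (z - γ s) / z := by field_simp
    rw [h5, ← neg_sub z (γ s)]
    field_simp
  · exact (h.continuousOn.sub continuousOn_const).inv₀ hne

/-- The difference of the integrands has the primitive `log (1 - (w' - w) / (z - w))`, because `w'`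
is closer to `w` than the contour is. It gives both the local constancy of winding numbers and their
stability when the points are perturbed. -/
theorem IsClosedContour.contourIntegral_sub_inv_eq {γ : ℝ → ℂ} (h : IsClosedContour γ) {w w' : ℂ}
    (hw : ∀ s ∈ Set.Icc (0 : ℝ) 1, ‖w' - w‖ < ‖γ s - w‖) :
    contourIntegral γ (fun z => (z - w')⁻¹) = contourIntegral γ (fun z => (z - w)⁻¹) := by
  have hne (s : ℝ) (hs : s ∈ Set.Icc (0 : ℝ) 1) : γ s - w ≠ 0 :=
    norm_pos_iff.mp ((norm_nonneg _).trans_lt (hw s hs))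
  have hne' (s : ℝ) (hs : s ∈ Set.Icc (0 : ℝ) 1) : γ s - w' ≠ 0 := by
    intro h0
    have := hw s hs
    rw [← sub_eq_zero.mp h0] at this
    exact lt_irrefl _ this
  have hi : ContinuousOn (fun s => (γ s - w)⁻¹) (Set.Icc 0 1) :=
    (h.continuousOn.sub continuousOn_const).inv₀ hne
  have hi' : ContinuousOn (fun s => (γ s - w')⁻¹) (Set.Icc 0 1) :=
    (h.continuousOn.sub continuousOn_const).inv₀ hne'
  have key : contourIntegral γ (fun z => (z - w')⁻¹ - (z - w)⁻¹) = 0 := by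
    refine h.contourIntegral_eq_zero_of_hasDerivAt
      (F := fun z => Complex.log (1 - (w' - w) / (z - w))) ?_ (hi'.sub hi)
    intro s hs
    have h1 := hne s hs
    have h2 := hne' s hs
    have hslit : 1 - (w' - w) / (γ s - w) ∈ Complex.slitPlane := by
      refine Complex.mem_slitPlane_of_norm_lt_one (z := -((w' - w) / (γ s - w))) ?_
      rw [norm_neg, norm_div, div_lt_one (norm_pos_iff.mpr h1)]
      exact hw s hs
    have h3 : HasDerivAt (fun z : ℂ => 1 - (w' - w) / (z - w))
        (-((0 * (γ s - w) - (w' - w) * 1) / (γ s - w) ^ 2)) (γ s) :=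
      ((hasDerivAt_const (γ s) (w' - w)).div ((hasDerivAt_id (γ s)).sub_const w) h1).const_sub 1
    refine (h3.clog hslit).congr_deriv ?_
    have h4 : 1 - (w' - w) / (γ s - w) = (γ s - w') / (γ s - w) := by
      field_simp
      ring
    rw [h4]
    field_simp
    ring
  rw [contourIntegral] at key
  simp only [sub_mul] at key
  rw [intervalIntegral.integral_sub (h.contourIntegrable (f := fun z => (z - w')⁻¹) hi')
    (h.contourIntegrable (f := fun z => (z - w)⁻¹) hi), sub_eq_zero] at key
  exact key

/-- **Cauchy's theorem** in its homology form, for finite linear combinations of closed contours. -/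
theorem sum_contourIntegral_eq_zero (hΓ : ∀ i, IsClosedContour (Γ i)) {U : Set ℂ} (hU : IsOpen U)
    {f : ℂ → ℂ} (hf : DifferentiableOn ℂ f U) (himg : ∀ i, ∀ s ∈ Set.Icc (0 : ℝ) 1, Γ i s ∈ U)
    (hw : ∀ w ∉ U, ∑ i, a i * contourIntegral (Γ i) (fun z => (z - w)⁻¹) = 0) :
    ∑ i, a i * contourIntegral (Γ i) f = 0 := by
  set K : Set ℂ := ⋃ i, Γ i '' Set.Icc 0 1 with hKdef
  have hK : IsCompact K := isCompact_iUnion fun i =>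
    isCompact_Icc.image_of_continuousOn (hΓ i).continuousOn
  have hKU : K ⊆ U := by
    rintro _ ⟨_, ⟨i, rfl⟩, s, hs, rfl⟩
    exact himg i s hs
  have hmemK (i : ι) (s : ℝ) (hs : s ∈ Set.Icc (0 : ℝ) 1) : Γ i s ∈ K :=
    Set.mem_iUnion.mpr ⟨i, s, hs, rfl⟩
  have hsubK (i : ι) : Γ i '' Set.Icc 0 1 ⊆ K := Set.subset_iUnion (fun i => Γ i '' Set.Icc 0 1) i
  have hKo : IsOpen Kᶜ := hK.isClosed.isOpen_compl
  -- `W` is `2πi` times the winding number of the cycle. The argument is Dixon's.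
  set W : ℂ → ℂ := fun w => ∑ i, a i * contourIntegral (Γ i) (fun z => (z - w)⁻¹) with hW
  -- Cauchy transforms are holomorphic off `K`
  have hCauchy (g : ℂ → ℂ) (hg : ContinuousOn g K) (z : ℂ) (hz : z ∈ Kᶜ) :
      DifferentiableAt ℂ (fun z => ∑ i, a i * contourIntegral (Γ i) fun w => g w / (w - z)) z := by
    refine DifferentiableAt.fun_sum fun i _ => DifferentiableAt.const_mul ?_ _
    refine (hΓ i).differentiableAt_contourIntegral (Φ := fun z w => g w / (w - z)) hKo ?_ ?_ hz
    · refine ContinuousOn.div ?_ (by fun_prop) ?_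
      · exact hg.comp continuousOn_snd fun x hx => hsubK i hx.2
      · rintro ⟨z, w⟩ ⟨h1, h2⟩
        refine sub_ne_zero.mpr fun h0 => h1 (hsubK i ?_)
        rwa [h0] at h2
    · intro w hw z hz
      have : w - z ≠ 0 := by
        rw [sub_ne_zero]
        rintro rfl
        exact hz (hsubK i hw)
      exact DifferentiableAt.differentiableWithinAt (by fun_prop (disch := assumption))
  have hVopen : IsOpen {w | w ∈ Kᶜ ∧ W w = 0} := by
    rw [Metric.isOpen_iff]
    rintro w ⟨hwK, hw0⟩
    obtain ⟨r, hr, hball⟩ := Metric.isOpen_iff.mp hKo w hwK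
    refine ⟨r, hr, fun x hx => ⟨hball hx, ?_⟩⟩
    rw [← hw0]
    refine sum_congr rfl fun i _ => ?_
    rw [(hΓ i).contourIntegral_sub_inv_eq fun s hs => ?_]
    rw [Metric.mem_ball, dist_eq_norm] at hx
    refine hx.trans_le (not_lt.mp fun hlt => hball (a := Γ i s) ?_ (hmemK i s hs))
    rwa [Metric.mem_ball, dist_eq_norm]
  obtain ⟨R, hR⟩ := hK.isBounded.exists_norm_le
  have hfar (z : ℂ) (hz : R < ‖z‖) : z ∈ Kᶜ ∧ W z = 0 := by
    refine ⟨fun h => absurd (hR z h) (not_le.mpr hz), sum_eq_zero fun i _ => ?_⟩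
    rw [(hΓ i).contourIntegral_sub_inv_eq_zero (fun s hs => hR _ (hmemK i s hs)) hz, mul_zero]
  -- it suffices to consider the values of Cauchy transforms
  suffices key : ∀ g : ℂ → ℂ, DifferentiableOn ℂ g U → ∀ z, R < ‖z‖ →
      ∑ i, a i * contourIntegral (Γ i) (fun w => g w / (w - z)) = 0 by
    have hR1 : R < ‖((|R| + 1 : ℝ) : ℂ)‖ := by
      rw [Complex.norm_real, Real.norm_of_nonneg (by positivity)]
      linarith [le_abs_self R]
    set z : ℂ := ((|R| + 1 : ℝ) : ℂ)
    -- The Cauchy transform of `(w - z) f(w)` at `z` is the integral of `f`.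
    rw [← key (fun w => (w - z) * f w) ((by fun_prop : DifferentiableOn ℂ (fun w => w - z) U).mul hf)
      z hR1]
    refine sum_congr rfl fun i _ => ?_
    congr 1
    refine intervalIntegral.integral_congr fun s hs => ?_
    rw [Set.uIcc_of_le zero_le_one] at hs
    have : Γ i s - z ≠ 0 := by
      rw [sub_ne_zero]
      intro h
      exact (hfar z hR1).1 (h ▸ hmemK i s hs)
    simp only
    rw [mul_div_cancel_left₀ _ this]
  intro g hg z hz
  have hgK : ContinuousOn g K := hg.continuousOn.mono hKU
  have hzint (z : ℂ) (hz : z ∈ Kᶜ) (i : ι) (c : ℂ → ℂ) (hc : ContinuousOn c K) :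
      ContourIntegrable (Γ i) (fun w => c w / (w - z)) := by
    refine (hΓ i).contourIntegrable ?_
    refine ContinuousOn.div ?_ ?_ ?_
    · exact hc.comp (hΓ i).continuousOn fun s hs => hmemK i s hs
    · exact (hΓ i).continuousOn.sub continuousOn_const
    · intro s hs
      rw [sub_ne_zero]
      rintro rfl
      exact hz (hmemK i s hs)
  classical
  -- On `U` the difference quotients of `g` are integrated, elsewhere `g w / (w - z)`. The two
  -- formulas agree off `K` wherever `W = 0`, and by hypothesis this covers the complement of `U`;
  -- hence `h` is entire.
  set h : ℂ → ℂ := fun z => if z ∈ U then ∑ i, a i * contourIntegral (Γ i) (dslope g z) else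
    ∑ i, a i * contourIntegral (Γ i) (fun w => g w / (w - z)) with hh
  have hhV (z : ℂ) (hz : z ∈ Kᶜ) (hz0 : W z = 0) :
      h z = ∑ i, a i * contourIntegral (Γ i) (fun w => g w / (w - z)) := by
    simp only [hh]
    split_ifs with hzU
    · have e (i : ι) : contourIntegral (Γ i) (dslope g z) =
          contourIntegral (Γ i) (fun w => g w / (w - z)) -
            g z * contourIntegral (Γ i) (fun w => (w - z)⁻¹) := by
        have h1 := hzint z hz i g hgK
        have h2 := (hzint z hz i (fun _ => 1) continuousOn_const).const_mul (g z)
        unfold contourIntegral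
        rw [← intervalIntegral.integral_const_mul, ← intervalIntegral.integral_sub h1
          (by simpa only [one_div, mul_assoc] using h2)]
        refine intervalIntegral.integral_congr fun s hs => ?_
        rw [Set.uIcc_of_le zero_le_one] at hs
        have : Γ i s ≠ z := by
          rintro rfl
          exact hz (hmemK i s hs)
        simp only
        rw [dslope_of_ne _ this, slope_def_field]
        ring
      simp only [e, mul_sub, sum_sub_distrib]
      have : ∑ i, a i * (g z * contourIntegral (Γ i) fun w => (w - z)⁻¹) = g z * W z := by
        rw [hW, mul_sum]
        exact sum_congr rfl fun i _ => by ring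
      rw [this, hz0, mul_zero, sub_zero]
    · rfl
  have hhd : Differentiable ℂ h := by
    intro z
    by_cases hzU : z ∈ U
    · have h1 : DifferentiableAt ℂ (fun z => ∑ i, a i * contourIntegral (Γ i) (dslope g z)) z := by
        refine DifferentiableAt.fun_sum fun i _ => DifferentiableAt.const_mul ?_ _
        refine (hΓ i).differentiableAt_contourIntegral (Φ := fun z w => dslope g z w) hU ?_ ?_ hzU
        · exact (continuousOn_dslope_uncurry hU hg).mono
            (Set.prod_mono subset_rfl ((hsubK i).trans hKU))
        · intro w hw
          simp only [dslope_comm g _ w]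
          exact (Complex.differentiableOn_dslope (hU.mem_nhds (hKU (hsubK i hw)))).mpr hg
      refine h1.congr_of_eventuallyEq ?_
      filter_upwards [hU.mem_nhds hzU] with y hy
      simp [hh, hy]
    · have hzK : z ∈ Kᶜ := fun h => hzU (hKU h)
      refine (hCauchy g hgK z hzK).congr_of_eventuallyEq ?_
      filter_upwards [hVopen.mem_nhds ⟨hzK, hw z hzU⟩] with y hy using hhV y hy.1 hy.2
  -- Far out `h` is a Cauchy transform and decays, so by Liouville's theorem it is zero.
  have hlim : Tendsto h (cocompact ℂ) (𝓝 0) := by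
    set C : ℝ := ∑ i, ‖a i‖ * ∫ s in (0 : ℝ)..1, ‖g (Γ i s) * deriv (Γ i) s‖ with hC
    have hnorm : Tendsto (fun z : ℂ => C * (‖z‖ - R)⁻¹) (cocompact ℂ) (𝓝 0) := by
      have h1 : Tendsto (fun z : ℂ => ‖z‖ - R) (cocompact ℂ) atTop :=
        tendsto_atTop_add_const_right _ (-R) tendsto_norm_cocompact_atTop
      simpa using h1.inv_tendsto_atTop.const_mul C
    refine squeeze_zero_norm' ?_ hnorm
    filter_upwards [(tendsto_norm_cocompact_atTop (E := ℂ)).eventually_gt_atTop R] with z hz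
    rw [hhV z (hfar z hz).1 (hfar z hz).2, hC, sum_mul]
    refine (norm_sum_le _ _).trans (sum_le_sum fun i _ => ?_)
    rw [norm_mul, mul_assoc]
    refine mul_le_mul_of_nonneg_left ?_ (norm_nonneg _)
    rw [← intervalIntegral.integral_mul_const]
    have hgi : ContourIntegrable (Γ i) g := (hΓ i).contourIntegrable
      (hgK.comp (hΓ i).continuousOn fun s hs => hmemK i s hs)
    refine intervalIntegral.norm_integral_le_of_norm_le zero_le_one
      (Eventually.of_forall fun s hs => ?_) (hgi.norm.mul_const _)
    have h1 := hR _ (hmemK i s (Set.Ioc_subset_Icc_self hs))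
    have h2 : ‖z‖ - R ≤ ‖Γ i s - z‖ := by
      have := norm_sub_norm_le z (Γ i s)
      rw [norm_sub_rev] at this
      linarith
    have h3 : 0 < ‖z‖ - R := by linarith
    rw [div_mul_eq_mul_div, norm_div, div_eq_mul_inv]
    gcongr
  rw [← hhV z (hfar z hz).1 (hfar z hz).2]
  exact hhd.apply_eq_of_tendsto_cocompact z hlim

end Dixon

/-! ### Circles -/

/-- The circle with centre `c` and radius `R`, parametrized by `[0,1]`. -/
def circleContour (c : ℂ) (R : ℝ) (s : ℝ) : ℂ := circleMap c R (2 * Real.pi * s)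

theorem isClosedContour_circleContour (c : ℂ) (R : ℝ) : IsClosedContour (circleContour c R) := by
  have h : ContDiff ℝ 1 (circleContour c R) :=
    (contDiff_circleMap c R).comp (contDiff_const.mul contDiff_id)
  refine ⟨h.continuous.continuousOn, ?_, ∅, fun a b _ _ _ _ => h.contDiffOn⟩
  have := periodic_circleMap c R 0
  simp only [circleContour, mul_zero, mul_one]
  rw [← this, zero_add]

theorem contourIntegral_circleContour (c : ℂ) (R : ℝ) (f : ℂ → ℂ) :
    contourIntegral (circleContour c R) f = ∮ z in C(c, R), f z := by
  have hd (s : ℝ) : deriv (circleContour c R) s =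
      2 * Real.pi * deriv (circleMap c R) (2 * Real.pi * s) := by
    have h1 : HasDerivAt (fun s : ℝ => 2 * Real.pi * s) (2 * Real.pi) s := by
      simpa using (hasDerivAt_id s).const_mul (2 * Real.pi)
    have h2 := ((differentiable_circleMap c R _).hasDerivAt.scomp s h1).deriv
    rw [Function.comp_def] at h2
    unfold circleContour
    rw [h2, Complex.real_smul]
    push_cast
    rfl
  unfold contourIntegral circleIntegral
  have := intervalIntegral.smul_integral_comp_mul_left (a := 0) (b := 1)
    (fun θ => deriv (circleMap c R) θ • f (circleMap c R θ)) (2 * Real.pi)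
  rw [mul_zero, mul_one] at this
  rw [← this, ← intervalIntegral.integral_smul]
  refine intervalIntegral.integral_congr fun s _ => ?_
  simp only [hd, smul_eq_mul, Complex.real_smul, circleContour]
  push_cast
  ring

theorem norm_circleContour_sub (c : ℂ) {R : ℝ} (hR : 0 ≤ R) (s : ℝ) :
    ‖circleContour c R s - c‖ = R := by
  rw [circleContour, circleMap_sub_center, norm_circleMap_zero, abs_of_nonneg hR]

theorem contourIntegral_circleContour_of_lt {c w : ℂ} {R : ℝ} (h : ‖w - c‖ < R) :
    contourIntegral (circleContour c R) (fun z => (z - w)⁻¹) = 2 * Real.pi * Complex.I := by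
  rw [contourIntegral_circleContour]
  exact circleIntegral.integral_sub_inv_of_mem_ball (by rwa [Metric.mem_ball, dist_eq_norm])

theorem contourIntegral_circleContour_of_gt {c w : ℂ} {R : ℝ} (hR : 0 ≤ R) (h : R < ‖w - c‖) :
    contourIntegral (circleContour c R) (fun z => (z - w)⁻¹) = 0 := by
  rw [contourIntegral_circleContour]
  refine Complex.circleIntegral_eq_zero_of_differentiable_on_off_countable hR Set.countable_empty
    ?_ ?_
  · refine ContinuousOn.inv₀ (by fun_prop) fun z hz => ?_
    rw [Metric.mem_closedBall, dist_eq_norm] at hz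
    rw [sub_ne_zero]
    rintro rfl
    linarith
  · rintro z ⟨hz, -⟩
    rw [Metric.mem_ball, dist_eq_norm] at hz
    have : z - w ≠ 0 := by
      rw [sub_ne_zero]
      rintro rfl
      linarith
    fun_prop (disch := assumption)

/-! ### The kernel of the elliptic beta integral -/

/-- The integrand of the elliptic beta integral in its symmetric form, with six parameters. -/
def betaKernel (p q : ℂ) (s : Fin 6 → ℂ) (z : ℂ) : ℂ :=
  (∏ j, ellGamma p q (s j * z) * ellGamma p q (s j / z)) *
    (theta (z ^ 2) p * theta ((z ^ 2)⁻¹) q) / z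

/-- The value of the elliptic beta integral in its symmetric form. -/
def betaValue (p q : ℂ) (s : Fin 6 → ℂ) : ℂ := ∏ j, ∏ k ∈ Ioi j, ellGamma p q (s j * s k)

section

variable {p q : ℂ} (hp₀ : p ≠ 0) (hq₀ : q ≠ 0) (hp : ‖p‖ < 1) (hq : ‖q‖ < 1)

include hp hq in
theorem differentiableAt_ellGamma {x : ℂ} (hx : x ≠ 0) (h : dblPoch p q x ≠ 0) :
    DifferentiableAt ℂ (ellGamma p q) x := by
  have e : ellGamma p q = fun z => dblPoch p q (p * q / z) / dblPoch p q z := by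
    funext z
    exact ellGamma_eq p q z
  rw [e]
  refine DifferentiableAt.div ?_ (differentiable_dblPoch hp hq x) h
  exact DifferentiableAt.comp x (f := fun z => p * q / z) (differentiable_dblPoch hp hq _)
    ((differentiableAt_const _).div differentiableAt_id hx)

include hp hq in
theorem differentiableAt_betaKernel {E : Type*} [NormedAddCommGroup E] [NormedSpace ℂ E] {x : E}
    {S : E → Fin 6 → ℂ} {Z : E → ℂ} (hS : ∀ j, DifferentiableAt ℂ (fun y => S y j) x)
    (hZ : DifferentiableAt ℂ Z x) (hS0 : ∀ j, S x j ≠ 0) (hZ0 : Z x ≠ 0)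
    (h1 : ∀ j, dblPoch p q (S x j * Z x) ≠ 0) (h2 : ∀ j, dblPoch p q (S x j / Z x) ≠ 0) :
    DifferentiableAt ℂ (fun y => betaKernel p q (S y) (Z y)) x := by
  have hZi : DifferentiableAt ℂ (fun y => (Z y)⁻¹) x := hZ.inv hZ0
  have hZ2 : DifferentiableAt ℂ (fun y => Z y ^ 2) x := hZ.pow 2
  unfold betaKernel
  simp only [div_eq_mul_inv] at h2 ⊢
  refine DifferentiableAt.fun_mul (DifferentiableAt.fun_mul ?_ (DifferentiableAt.fun_mul ?_ ?_)) hZi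
  · suffices hj : ∀ j : Fin 6, DifferentiableAt ℂ
        (fun y => ellGamma p q (S y j * Z y) * ellGamma p q (S y j * (Z y)⁻¹)) x by
      simp only [Fin.prod_univ_six]
      exact (((((hj 0).fun_mul (hj 1)).fun_mul (hj 2)).fun_mul (hj 3)).fun_mul (hj 4)).fun_mul (hj 5)
    intro j
    refine DifferentiableAt.fun_mul ?_ ?_
    · exact DifferentiableAt.comp x (f := fun y => S y j * Z y)
        (differentiableAt_ellGamma hp hq (mul_ne_zero (hS0 j) hZ0) (h1 j)) ((hS j).mul hZ)
    · exact DifferentiableAt.comp x (f := fun y => S y j * (Z y)⁻¹)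
        (differentiableAt_ellGamma hp hq (mul_ne_zero (hS0 j) (inv_ne_zero hZ0)) (h2 j))
        ((hS j).mul hZi)
  · exact DifferentiableAt.comp x (f := fun y => Z y ^ 2)
      (differentiableAt_theta hp (pow_ne_zero 2 hZ0)) hZ2
  · exact DifferentiableAt.comp x (f := fun y => (Z y ^ 2)⁻¹)
      (differentiableAt_theta hq (inv_ne_zero (pow_ne_zero 2 hZ0))) (hZ2.inv (pow_ne_zero 2 hZ0))

include hp hq in
theorem differentiableAt_betaValue {S : ℂ → Fin 6 → ℂ} {x : ℂ}
    (hS : ∀ j, DifferentiableAt ℂ (fun y => S y j) x) (hS0 : ∀ j, S x j ≠ 0)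
    (h1 : ∀ j k, j < k → dblPoch p q (S x j * S x k) ≠ 0) :
    DifferentiableAt ℂ (fun y => betaValue p q (S y)) x := by
  unfold betaValue
  refine DifferentiableAt.fun_finsetProd fun j _ => DifferentiableAt.fun_finsetProd fun k hk => ?_
  exact DifferentiableAt.comp x (f := fun y => S y j * S y k)
    (differentiableAt_ellGamma hp hq (mul_ne_zero (hS0 j) (hS0 k)) (h1 j k (mem_Ioi.mp hk)))
    ((hS j).mul (hS k))

theorem betaValue_eq (s : Fin 6 → ℂ) : betaValue p q s =
    (ellGamma p q (s 0 * s 1) * ellGamma p q (s 0 * s 2) * ellGamma p q (s 0 * s 3) *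
      ellGamma p q (s 0 * s 4) * ellGamma p q (s 0 * s 5)) *
    (ellGamma p q (s 1 * s 2) * ellGamma p q (s 1 * s 3) * ellGamma p q (s 1 * s 4) *
      ellGamma p q (s 1 * s 5)) *
    (ellGamma p q (s 2 * s 3) * ellGamma p q (s 2 * s 4) * ellGamma p q (s 2 * s 5)) *
    (ellGamma p q (s 3 * s 4) * ellGamma p q (s 3 * s 5)) * ellGamma p q (s 4 * s 5) := by
  unfold betaValue
  have e0 : (Ioi (0 : Fin 6)) = {1, 2, 3, 4, 5} := by decide
  have e1 : (Ioi (1 : Fin 6)) = {2, 3, 4, 5} := by decide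
  have e2 : (Ioi (2 : Fin 6)) = {3, 4, 5} := by decide
  have e3 : (Ioi (3 : Fin 6)) = {4, 5} := by decide
  have e4 : (Ioi (4 : Fin 6)) = {5} := by decide
  have e5 : (Ioi (5 : Fin 6)) = ∅ := by decide
  rw [Fin.prod_univ_six, e0, e1, e2, e3, e4, e5]
  rw [prod_insert (by decide), prod_insert (by decide), prod_insert (by decide),
    prod_insert (by decide), prod_singleton, prod_insert (by decide), prod_insert (by decide),
    prod_insert (by decide), prod_singleton, prod_insert (by decide), prod_insert (by decide),
    prod_singleton, prod_insert (by decide), prod_singleton, prod_singleton, prod_empty]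
  ring

end

/-! ### Contours separating the poles of the kernel -/

/-- The points `s_j p^a q^b` with `a, b ≥ 0`. -/
def paramPoints (p q : ℂ) (s : Fin 6 → ℂ) : Set ℂ :=
  {w | ∃ (j : Fin 6) (a b : ℕ), w = s j * p ^ a * q ^ b}

theorem Separates.mono {γ : ℝ → ℂ} {S S' : Set ℂ} (h : Separates γ S) (hS : S' ⊆ S) :
    Separates γ S' :=
  ⟨h.isClosedContour, h.ne_zero, fun w hw => h.avoids w (hS hw), fun w hw => h.inside w (hS hw),
    fun w hw => h.outside w (hS hw)⟩

theorem two_pi_I_ne_zero : (2 * Real.pi * Complex.I : ℂ) ≠ 0 := Complex.two_pi_I_ne_zero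

theorem Separates.integral_inside {γ : ℝ → ℂ} {S : Set ℂ} (h : Separates γ S) {w : ℂ}
    (hw : w ∈ S) : contourIntegral γ (fun z => (z - w)⁻¹) = 2 * Real.pi * Complex.I := by
  have := h.inside w hw
  rwa [windingNumber, div_eq_one_iff_eq two_pi_I_ne_zero] at this

theorem Separates.integral_outside {γ : ℝ → ℂ} {S : Set ℂ} (h : Separates γ S) {w : ℂ}
    (hw : w⁻¹ ∈ S) : contourIntegral γ (fun z => (z - w)⁻¹) = 0 := by
  have := h.outside _ hw
  rw [inv_inv, windingNumber, div_eq_zero_iff] at this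
  exact this.resolve_right two_pi_I_ne_zero

theorem Separates.inv_notMem {γ : ℝ → ℂ} {S : Set ℂ} (h : Separates γ S) {w w' : ℂ}
    (hw : w ∈ S) (hw' : w' ∈ S) : w * w' ≠ 1 := by
  intro h1
  have h2 : w⁻¹ = w' := inv_eq_of_mul_eq_one_right h1
  have h3 := h.integral_outside (w := w) (h2 ▸ hw')
  rw [h.integral_inside hw] at h3
  exact two_pi_I_ne_zero h3

/-- A contour that encircles points arbitrarily close to `0` encircles `0`. -/
theorem Separates.integral_zero {γ : ℝ → ℂ} {S : Set ℂ} (h : Separates γ S)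
    (hS : ∀ ε > 0, ∃ w ∈ S, ‖w‖ < ε) :
    contourIntegral γ (fun z => (z - 0)⁻¹) = 2 * Real.pi * Complex.I := by
  obtain ⟨s₀, hs₀, hmin⟩ := isCompact_Icc.exists_isMinOn (Set.nonempty_Icc.mpr zero_le_one)
    h.isClosedContour.continuousOn.norm
  obtain ⟨w, hw, hwn⟩ := hS ‖γ s₀‖ (norm_pos_iff.mpr (h.ne_zero s₀ hs₀))
  rw [← h.integral_inside hw]
  refine (h.isClosedContour.contourIntegral_sub_inv_eq fun s hs => ?_).symm
  rw [sub_zero, sub_zero]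
  exact hwn.trans_le (hmin hs)

section

variable {p q : ℂ} (hp₀ : p ≠ 0) (hq₀ : q ≠ 0) (hp : ‖p‖ < 1) (hq : ‖q‖ < 1)

theorem paramPoints_mul_q {s : Fin 6 → ℂ} {w : ℂ} (hw : w ∈ paramPoints p q s) :
    w * q ∈ paramPoints p q s := by
  obtain ⟨j, a, b, rfl⟩ := hw
  exact ⟨j, a, b + 1, by ring⟩

include hp in
theorem exists_paramPoints_norm_lt (s : Fin 6 → ℂ) {ε : ℝ} (hε : 0 < ε) :
    ∃ w ∈ paramPoints p q s, ‖w‖ < ε := by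
  have h : Tendsto (fun a : ℕ => ‖s 0 * p ^ a * q ^ 0‖) atTop (𝓝 0) := by
    have := ((tendsto_pow_atTop_nhds_zero_of_norm_lt_one hp).const_mul (s 0)).norm
    simpa using this
  obtain ⟨a, ha⟩ := (h.eventually (gt_mem_nhds hε)).exists
  exact ⟨_, ⟨0, a, 0, rfl⟩, ha⟩

include hp hq in
theorem dblPoch_mul_eq_zero_iff {s : Fin 6 → ℂ} {j : Fin 6} {z : ℂ}
    (h : dblPoch p q (s j * z) = 0) : z⁻¹ ∈ paramPoints p q s := by
  obtain ⟨a, b, hab⟩ := (dblPoch_eq_zero_iff hp hq _).mp h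
  exact ⟨j, a, b, inv_eq_of_mul_eq_one_right (by linear_combination hab)⟩

include hp hq in
theorem dblPoch_div_eq_zero_iff {s : Fin 6 → ℂ} {j : Fin 6} {z : ℂ} (hz : z ≠ 0)
    (h : dblPoch p q (s j / z) = 0) : z ∈ paramPoints p q s := by
  obtain ⟨a, b, hab⟩ := (dblPoch_eq_zero_iff hp hq _).mp h
  refine ⟨j, a, b, ?_⟩
  field_simp at hab
  exact hab.symm

include hp hq in
theorem Separates.dblPoch_mul_ne_zero {γ : ℝ → ℂ} {s : Fin 6 → ℂ}
    (h : Separates γ (paramPoints p q s)) (j : Fin 6) {x : ℝ} (hx : x ∈ Set.Icc (0 : ℝ) 1) :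
    dblPoch p q (s j * γ x) ≠ 0 := fun h0 =>
  (h.avoids _ (dblPoch_mul_eq_zero_iff hp hq h0) x hx).2 (inv_inv _).symm

include hp hq in
theorem Separates.dblPoch_div_ne_zero {γ : ℝ → ℂ} {s : Fin 6 → ℂ}
    (h : Separates γ (paramPoints p q s)) (j : Fin 6) {x : ℝ} (hx : x ∈ Set.Icc (0 : ℝ) 1) :
    dblPoch p q (s j / γ x) ≠ 0 := fun h0 =>
  (h.avoids _ (dblPoch_div_eq_zero_iff hp hq (h.ne_zero x hx) h0) x hx).1 rfl

include hp hq in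
theorem Separates.dblPoch_param_ne_zero {γ : ℝ → ℂ} {s : Fin 6 → ℂ}
    (h : Separates γ (paramPoints p q s)) (j k : Fin 6) :
    dblPoch p q (s j * s k) ≠ 0 := by
  intro h0
  obtain ⟨a, b, hab⟩ := (dblPoch_eq_zero_iff hp hq _).mp h0
  exact h.inv_notMem (w := s j) (w' := s k * p ^ a * q ^ b) ⟨j, 0, 0, by simp⟩ ⟨k, a, b, rfl⟩
    (by linear_combination hab)

/-- The set where the kernel with parameters `s` is regular. -/
def regularSet (p q : ℂ) (s : Fin 6 → ℂ) : Set ℂ :=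
  {z | z ≠ 0 ∧ ∀ j, dblPoch p q (s j * z) ≠ 0 ∧ dblPoch p q (s j / z) ≠ 0}

include hp hq in
theorem isOpen_regularSet (s : Fin 6 → ℂ) : IsOpen (regularSet p q s) := by
  rw [isOpen_iff_mem_nhds]
  rintro z ⟨hz, h⟩
  have hc := (differentiable_dblPoch hp hq).continuous
  have h1 : ∀ j, ∀ᶠ y in 𝓝 z, dblPoch p q (s j * y) ≠ 0 ∧ dblPoch p q (s j / y) ≠ 0 := fun j =>
    ((hc.comp (continuous_const.mul continuous_id)).continuousAt.eventually_ne (h j).1).and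
      ((ContinuousAt.comp (x := z) (f := fun y => s j / y) hc.continuousAt
        (continuousAt_const.div continuousAt_id hz)).eventually_ne (h j).2)
  filter_upwards [eventually_ne_nhds hz, eventually_all.mpr h1] with y hy hy' using ⟨hy, hy'⟩

include hp hq in
theorem differentiableOn_betaKernel {s : Fin 6 → ℂ} (hs : ∀ j, s j ≠ 0) :
    DifferentiableOn ℂ (betaKernel p q s) (regularSet p q s) := fun _ hz =>
  (differentiableAt_betaKernel hp hq (S := fun _ => s) (Z := fun y => y)
    (fun _ => differentiableAt_const _) differentiableAt_id hs hz.1 (fun j => (hz.2 j).1)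
    (fun j => (hz.2 j).2)).differentiableWithinAt

include hp hq in
theorem Separates.mem_regularSet {γ : ℝ → ℂ} {s : Fin 6 → ℂ}
    (h : Separates γ (paramPoints p q s)) {x : ℝ} (hx : x ∈ Set.Icc (0 : ℝ) 1) :
    γ x ∈ regularSet p q s :=
  ⟨h.ne_zero x hx, fun j => ⟨h.dblPoch_mul_ne_zero hp hq j hx, h.dblPoch_div_ne_zero hp hq j hx⟩⟩

include hp hq in
theorem Separates.contourIntegrable_betaKernel {γ : ℝ → ℂ} {s : Fin 6 → ℂ}
    (h : Separates γ (paramPoints p q s)) (hs : ∀ j, s j ≠ 0) :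
    ContourIntegrable γ (betaKernel p q s) :=
  h.isClosedContour.contourIntegrable
    (((differentiableOn_betaKernel hp hq hs).continuousOn).comp h.isClosedContour.continuousOn
      fun _ hx => h.mem_regularSet hp hq hx)

include hp hq in
/-- The integral of the kernel is the same for all separating contours. -/
theorem Separates.contourIntegral_betaKernel_eq {γ γ' : ℝ → ℂ} {s : Fin 6 → ℂ}
    (h : Separates γ (paramPoints p q s)) (h' : Separates γ' (paramPoints p q s))
    (hs : ∀ j, s j ≠ 0) :
    contourIntegral γ (betaKernel p q s) = contourIntegral γ' (betaKernel p q s) := by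
  have key := sum_contourIntegral_eq_zero (a := ![1, -1]) (Γ := ![γ, γ'])
    (U := regularSet p q s) (f := betaKernel p q s)
    (by simpa [Fin.forall_fin_two] using ⟨h.isClosedContour, h'.isClosedContour⟩)
    (isOpen_regularSet hp hq s) (differentiableOn_betaKernel hp hq hs)
    (by
      simp only [Fin.forall_fin_two, Matrix.cons_val_zero, Matrix.cons_val_one]
      exact ⟨fun x hx => h.mem_regularSet hp hq hx, fun x hx => h'.mem_regularSet hp hq hx⟩)
    (by
      intro w hw
      simp only [Fin.sum_univ_two, Matrix.cons_val_zero, Matrix.cons_val_one, one_mul, neg_mul]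
      rw [← sub_eq_add_neg, sub_eq_zero]
      -- The origin is also a singularity of the kernel; both contours encircle it once, because the
      -- separated points accumulate there.
      by_cases hw0 : w = 0
      · rw [hw0, h.integral_zero fun ε hε => exists_paramPoints_norm_lt hp s hε,
          h'.integral_zero fun ε hε => exists_paramPoints_norm_lt hp s hε]
      have : ∃ j, dblPoch p q (s j * w) = 0 ∨ dblPoch p q (s j / w) = 0 := by
        by_contra! hcon
        exact hw ⟨hw0, hcon⟩
      obtain ⟨j, hj | hj⟩ := this
      · have := dblPoch_mul_eq_zero_iff hp hq hj
        rw [h.integral_outside this, h'.integral_outside this]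
      · have := dblPoch_div_eq_zero_iff hp hq hw0 hj
        rw [h.integral_inside this, h'.integral_inside this])
  simp only [Fin.sum_univ_two, Matrix.cons_val_zero, Matrix.cons_val_one, one_mul, neg_mul] at key
  linear_combination key

include hp hq in
theorem separates_unitCircle {s : Fin 6 → ℂ} (hs : ∀ j, s j ≠ 0) (hp₀ : p ≠ 0) (hq₀ : q ≠ 0)
    (hs1 : ∀ j, ‖s j‖ < 1) :
    Separates (circleContour 0 1) (paramPoints p q s) := by
  have hS : ∀ w ∈ paramPoints p q s, w ≠ 0 ∧ ‖w‖ < 1 := by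
    rintro w ⟨j, a, b, rfl⟩
    refine ⟨mul_ne_zero (mul_ne_zero (hs j) (pow_ne_zero _ hp₀)) (pow_ne_zero _ hq₀), ?_⟩
    rw [norm_mul, norm_mul, norm_pow, norm_pow]
    have h1 := pow_le_one₀ (norm_nonneg p) hp.le (n := a)
    have h2 := pow_le_one₀ (norm_nonneg q) hq.le (n := b)
    calc ‖s j‖ * ‖p‖ ^ a * ‖q‖ ^ b ≤ ‖s j‖ * 1 * 1 := by gcongr
      _ < 1 := by simpa using hs1 j
  have hn (x : ℝ) : ‖circleContour 0 1 x‖ = 1 := by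
    have := norm_circleContour_sub 0 zero_le_one x
    rwa [sub_zero] at this
  have hi : ∀ w ∈ paramPoints p q s, 1 < ‖w⁻¹‖ := fun w hw => by
    rw [norm_inv]
    exact (one_lt_inv₀ (norm_pos_iff.mpr (hS w hw).1)).mpr (hS w hw).2
  refine ⟨isClosedContour_circleContour 0 1, fun x _ h0 => ?_, fun w hw x _ => ⟨?_, ?_⟩,
    fun w hw => ?_, fun w hw => ?_⟩
  · have := hn x
    rw [h0, norm_zero] at this
    exact zero_ne_one this
  · rintro h0
    have := hn x
    rw [h0] at this
    exact (hS w hw).2.ne this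
  · rintro h0
    have := hn x
    rw [h0] at this
    exact (hi w hw).ne' this
  · rw [windingNumber, contourIntegral_circleContour_of_lt (by simpa using (hS w hw).2),
      div_self two_pi_I_ne_zero]
  · rw [windingNumber, contourIntegral_circleContour_of_gt zero_le_one (by simpa using hi w hw),
      zero_div]

/-! ### The shift of the parameters -/

/-- The auxiliary function whose differences give the shift relation for the kernel. -/
def shiftAux (p q : ℂ) (v : Fin 6 → ℂ) (z : ℂ) : ℂ :=
  (∏ j, ellGamma p q (v j * q * z) * ellGamma p q (v j / z)) * (theta ((z ^ 2)⁻¹) q / z)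

/-- After the gamma factors at shifted arguments have been written as theta factors `b`, `c` times
`g`, `k`, the shift relation is the four-term identity `h` times a common product of gamma factors.
-/
theorem shift_algebra {g0 g1 g2 g3 g4 g5 k0 k1 k2 k3 k4 k5 b0 b1 b2 b3 b4 c0 c1 c2 c3 c4 g5' k5' Az Azi
    z T τ P Q s0 σ : ℂ} (hz : z ≠ 0)
    (h5 : g5' * Azi = g5) (h5' : k5' * Az = k5)
    (h : z * T * (b0 * c0 * P - Az * Azi * Q) = -s0 * σ * (Azi * (b0 * b1 * b2 * b3 * b4) -
      z ^ 4 * Az * (c0 * c1 * c2 * c3 * c4))) :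
    s0 * σ * ((g0 * g1 * g2 * g3 * g4 * g5') * (c0 * k0 * (c1 * k1) * (c2 * k2) * (c3 * k3) *
        (c4 * k4) * k5) * (z ^ 3 * τ) -
      (b0 * g0 * (b1 * g1) * (b2 * g2) * (b3 * g3) * (b4 * g4) * g5) * (k0 * k1 * k2 * k3 * k4 * k5')
        * (τ / z)) =
      P * ((b0 * g0 * (c0 * k0) * (g1 * k1) * (g2 * k2) * (g3 * k3) * (g4 * k4) * (g5' * k5')) *
        (T * τ)) -
      Q * ((g0 * k0 * (g1 * k1) * (g2 * k2) * (g3 * k3) * (g4 * k4) * (g5 * k5)) * (T * τ)) := by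
  subst h5 h5'
  have hzi : z * z⁻¹ = 1 := mul_inv_cancel₀ hz
  rw [div_eq_mul_inv]
  generalize z⁻¹ = y at *
  linear_combination (-(g0 * g1 * g2 * g3 * g4 * g5' * k0 * k1 * k2 * k3 * k4 * k5' * τ * y)) * h +
    (g0 * g1 * g2 * g3 * g4 * g5' * k0 * k1 * k2 * k3 * k4 * k5' * τ) *
      (T * (b0 * c0 * P - Az * Azi * Q) - s0 * σ * Az * (c0 * c1 * c2 * c3 * c4) * z ^ 3) * hzi

/-- The set where `shiftAux p q v` is regular. -/
def shiftSet (p q : ℂ) (v : Fin 6 → ℂ) : Set ℂ :=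
  {z | z ≠ 0 ∧ ∀ j, dblPoch p q (v j * q * z) ≠ 0 ∧ dblPoch p q (v j / z) ≠ 0}

include hp₀ hq₀ hp hq in
-- All four terms share a product of gamma factors; the theta quotients that remain are related by
-- `theta_four_term` for `v₀, …, v₄`, whose product is `p / v₅`. The symmetry `θ(p/x) = θ(x)` turns
-- the factors with `p / v₅` into factors with `v₅`.
theorem shiftAux_sub {v : Fin 6 → ℂ} (hv : ∀ j, v j ≠ 0)
    (hprod : v 0 * v 1 * v 2 * v 3 * v 4 * v 5 = p) (h12 : theta (v 1 * v 2) p ≠ 0)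
    {z : ℂ} (hz : z ∈ regularSet p q v) :
    v 0 * theta (v 0 * (p / v 5)) p * (shiftAux p q v (z / q) - shiftAux p q v z) =
      (theta (v 5 * v 1) p * theta (v 5 * v 2) p * theta (v 5 * v 3) p * theta (v 5 * v 4) p) *
          (z * betaKernel p q (Function.update v 0 (v 0 * q)) z) -
        (theta (v 0 * v 1) p * theta (v 0 * v 2) p * theta (v 0 * v 3) p * theta (v 0 * v 4) p) *
          (z * betaKernel p q (Function.update v 5 (v 5 * q)) z) := by
  obtain ⟨hz0, hzr⟩ := hz
  have hA : p / v 5 = v 0 * v 1 * v 2 * v 3 * v 4 := by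
    rw [← hprod]
    field_simp [hv 5]
  have star := theta_four_term hp₀ hp hz0 (hv 0) (hv 1) (hv 2) (hv 3) (hv 4) hA h12
  have f (m : Fin 6) : theta (p / v 5 / v m) p = theta (v 5 * v m) p := by
    rw [div_div, theta_p_div hp₀ (mul_ne_zero (hv 5) (hv m))]
  rw [f 1, f 2, f 3, f 4] at star
  have g (j : Fin 6) : ellGamma p q (v j * q * z) = theta (v j * z) p * ellGamma p q (v j * z) := by
    rw [← ellGamma_mul_q hq₀ hp hq (mul_ne_zero (hv j) hz0) (hzr j).1]
    congr 1
    ring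
  have k (j : Fin 6) : ellGamma p q (v j * q / z) =
      theta (v j / z) p * ellGamma p q (v j / z) := by
    rw [← ellGamma_mul_q hq₀ hp hq (div_ne_zero (hv j) hz0) (hzr j).2]
    congr 1
    ring
  have e5 : ellGamma p q (v 5 * z) * theta (p / v 5 / z) p = ellGamma p q (v 5 * q * z) := by
    rw [g 5, div_div, theta_p_div hp₀ (mul_ne_zero (hv 5) hz0), mul_comm]
  have e5' : ellGamma p q (v 5 / z) * theta (p / v 5 * z) p = ellGamma p q (v 5 * q / z) := by
    rw [k 5, show p / v 5 * z = p / (v 5 / z) by field_simp,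
      theta_p_div hp₀ (div_ne_zero (hv 5) hz0), mul_comm]
  have eτ : theta (((z / q) ^ 2)⁻¹) q / (z / q) = z ^ 3 * theta ((z ^ 2)⁻¹) q := by
    have a1 : ((z / q) ^ 2)⁻¹ = (z ^ 2)⁻¹ * q * q := by field_simp
    have hz2 := pow_ne_zero 2 hz0
    rw [a1, theta_mul_self hq₀ hq (mul_ne_zero (inv_ne_zero hz2) hq₀),
      theta_mul_self hq₀ hq (inv_ne_zero hz2)]
    field_simp
  have key := shift_algebra (g0 := ellGamma p q (v 0 * z)) (g1 := ellGamma p q (v 1 * z))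
    (g2 := ellGamma p q (v 2 * z)) (g3 := ellGamma p q (v 3 * z)) (g4 := ellGamma p q (v 4 * z))
    (k0 := ellGamma p q (v 0 / z)) (k1 := ellGamma p q (v 1 / z)) (k2 := ellGamma p q (v 2 / z))
    (k3 := ellGamma p q (v 3 / z)) (k4 := ellGamma p q (v 4 / z))
    (τ := theta ((z ^ 2)⁻¹) q) hz0 e5 e5' star
  have b1 (x : ℂ) : x * q * (z / q) = x * z := by field_simp
  have b2 (x : ℂ) : x / (z / q) = x * q / z := by field_simp
  rw [shiftAux, shiftAux, eτ, betaKernel, betaKernel, mul_div_cancel₀ _ hz0, mul_div_cancel₀ _ hz0]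
  simp only [b1, b2, Fin.prod_univ_six]
  simp +decide only [Function.update_self, Function.update_of_ne, ne_eq]
  rw [k 0, k 1, k 2, k 3, k 4, g 0, g 1, g 2, g 3, g 4]
  linear_combination key

include hp hq in
theorem isOpen_shiftSet (v : Fin 6 → ℂ) : IsOpen (shiftSet p q v) := by
  rw [isOpen_iff_mem_nhds]
  rintro z ⟨hz, h⟩
  have hc := (differentiable_dblPoch hp hq).continuous
  have h1 : ∀ j, ∀ᶠ y in 𝓝 z, dblPoch p q (v j * q * y) ≠ 0 ∧ dblPoch p q (v j / y) ≠ 0 := fun j =>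
    ((hc.comp (continuous_const.mul continuous_id)).continuousAt.eventually_ne (h j).1).and
      ((ContinuousAt.comp (x := z) (f := fun y => v j / y) hc.continuousAt
        (continuousAt_const.div continuousAt_id hz)).eventually_ne (h j).2)
  filter_upwards [eventually_ne_nhds hz, eventually_all.mpr h1] with y hy hy' using ⟨hy, hy'⟩

include hp hq hq₀ in
theorem differentiableOn_shiftAux {v : Fin 6 → ℂ} (hv : ∀ j, v j ≠ 0) :
    DifferentiableOn ℂ (shiftAux p q v) (shiftSet p q v) := by
  rintro z ⟨hz0, hz⟩
  apply DifferentiableAt.differentiableWithinAt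
  unfold shiftAux
  refine DifferentiableAt.fun_mul ?_ (DifferentiableAt.fun_div ?_ differentiableAt_id hz0)
  · refine DifferentiableAt.fun_finsetProd fun j _ => ?_
    refine DifferentiableAt.fun_mul ?_ ?_
    · exact DifferentiableAt.comp z (f := fun y => v j * q * y)
        (differentiableAt_ellGamma hp hq (mul_ne_zero (mul_ne_zero (hv j) hq₀) hz0) (hz j).1)
        (differentiableAt_id.const_mul _)
    · exact DifferentiableAt.comp z (f := fun y => v j / y)
        (differentiableAt_ellGamma hp hq (div_ne_zero (hv j) hz0) (hz j).2)
        ((differentiableAt_const _).fun_div differentiableAt_id hz0)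
  · have h2 := pow_ne_zero 2 hz0
    exact DifferentiableAt.comp z (f := fun y => (y ^ 2)⁻¹)
      (differentiableAt_theta hq (inv_ne_zero h2)) ((differentiableAt_id.fun_pow 2).fun_inv h2)

theorem IsClosedContour.div_const {γ : ℝ → ℂ} (h : IsClosedContour γ) (c : ℂ) :
    IsClosedContour fun s => γ s / c := by
  obtain ⟨s, hs⟩ := h.piecewise_contDiffOn
  refine ⟨h.continuousOn.div_const c, by rw [h.closed], s, fun a b ha hab hb hd => ?_⟩
  exact (hs a b ha hab hb hd).div_const c

theorem contourIntegral_div_const (γ : ℝ → ℂ) (f : ℂ → ℂ) (c : ℂ) :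
    contourIntegral (fun s => γ s / c) f = contourIntegral γ fun z => f (z / c) / c := by
  unfold contourIntegral
  congr 1
  funext s
  rw [deriv_div_const]
  ring

include hp₀ hq₀ hp hq in
/-- The shift relation for the integrals of the kernel. -/
theorem Separates.shift_zero_five {γ : ℝ → ℂ} {v : Fin 6 → ℂ}
    (h : Separates γ (paramPoints p q v)) (hv : ∀ j, v j ≠ 0)
    (hprod : v 0 * v 1 * v 2 * v 3 * v 4 * v 5 = p) (h12 : theta (v 1 * v 2) p ≠ 0) :
    (theta (v 5 * v 1) p * theta (v 5 * v 2) p * theta (v 5 * v 3) p * theta (v 5 * v 4) p) *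
        contourIntegral γ (betaKernel p q (Function.update v 0 (v 0 * q))) =
      (theta (v 0 * v 1) p * theta (v 0 * v 2) p * theta (v 0 * v 3) p * theta (v 0 * v 4) p) *
        contourIntegral γ (betaKernel p q (Function.update v 5 (v 5 * q))) := by
  have hup (i : Fin 6) : paramPoints p q (Function.update v i (v i * q)) ⊆ paramPoints p q v := by
    rintro w ⟨j, a, b, rfl⟩
    by_cases hj : j = i
    · subst hj
      exact ⟨j, a, b + 1, by rw [Function.update_self]; ring⟩
    · exact ⟨j, a, b, by rw [Function.update_of_ne hj]⟩
  have hne (i : Fin 6) (j : Fin 6) : Function.update v i (v i * q) j ≠ 0 := by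
    by_cases hj : j = i
    · subst hj
      rw [Function.update_self]
      exact mul_ne_zero (hv j) hq₀
    · rw [Function.update_of_ne hj]
      exact hv j
  have hqz (z : ℂ) (hz : z ≠ 0) (j : Fin 6) (h0 : dblPoch p q (v j * q * z) = 0) :
      (q * z)⁻¹ ∈ paramPoints p q v := by
    rw [mul_assoc] at h0
    exact dblPoch_mul_eq_zero_iff hp hq h0
  have hqi (z : ℂ) : (q * z)⁻¹ * q = z⁻¹ := by rw [mul_inv]; field_simp
  have hmem (x : ℝ) (hx : x ∈ Set.Icc (0 : ℝ) 1) : γ x ∈ shiftSet p q v := by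
    refine ⟨h.ne_zero x hx, fun j => ⟨fun h0 => ?_, h.dblPoch_div_ne_zero hp hq j hx⟩⟩
    have h1 := paramPoints_mul_q (hqz _ (h.ne_zero x hx) j h0)
    rw [hqi] at h1
    exact (h.avoids _ h1 x hx).2 (inv_inv _).symm
  have hmem' (x : ℝ) (hx : x ∈ Set.Icc (0 : ℝ) 1) : γ x / q ∈ shiftSet p q v := by
    refine ⟨div_ne_zero (h.ne_zero x hx) hq₀, fun j => ⟨?_, fun h0 => ?_⟩⟩
    · rw [show v j * q * (γ x / q) = v j * γ x by field_simp]
      exact h.dblPoch_mul_ne_zero hp hq j hx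
    · have h1 := paramPoints_mul_q
        (dblPoch_div_eq_zero_iff hp hq (div_ne_zero (h.ne_zero x hx) hq₀) h0)
      rw [div_mul_cancel₀ _ hq₀] at h1
      exact (h.avoids _ h1 x hx).1 rfl
  -- The contour `γ / q` winds around `w` as `γ` winds around `wq`.
  have hw (w : ℂ) : contourIntegral (fun s => γ s / q) (fun z => (z - w)⁻¹) =
      contourIntegral γ (fun z => (z - w * q)⁻¹) := by
    rw [contourIntegral_div_const]
    congr 1
    funext z
    rw [show z - w * q = q * (z / q - w) by field_simp, mul_inv_rev, div_eq_mul_inv]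
  have hd : DifferentiableOn ℂ (fun z => shiftAux p q v z / z) (shiftSet p q v) :=
    (differentiableOn_shiftAux hq₀ hp hq hv).fun_div differentiableOn_id fun z hz => hz.1
  have key := sum_contourIntegral_eq_zero (a := ![1, -1]) (Γ := ![fun s => γ s / q, γ])
    (U := shiftSet p q v) (f := fun z => shiftAux p q v z / z)
    (by simpa [Fin.forall_fin_two] using ⟨h.isClosedContour.div_const q, h.isClosedContour⟩)
    (isOpen_shiftSet hp hq v) hd
    (by
      simp only [Fin.forall_fin_two, Matrix.cons_val_zero, Matrix.cons_val_one]
      exact ⟨hmem', hmem⟩)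
    (by
      intro w hw'
      simp only [Fin.sum_univ_two, Matrix.cons_val_zero, Matrix.cons_val_one, one_mul, neg_mul]
      rw [← sub_eq_add_neg, sub_eq_zero, hw]
      by_cases hw0 : w = 0
      · rw [hw0, zero_mul]
      -- At a singularity `w` of `shiftAux`, either `w` or `1/(qw)` is one of the separated points.
      -- That set is stable under multiplication by `q`, so `γ` winds equally often around `w` and
      -- `wq`, and the cycle `γ / q - γ` does not wind around `w`.
      have : ∃ j, dblPoch p q (v j * q * w) = 0 ∨ dblPoch p q (v j / w) = 0 := by
        by_contra! hcon
        exact hw' ⟨hw0, hcon⟩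
      obtain ⟨j, hj | hj⟩ := this
      · have h1 := hqz w hw0 j hj
        have h2 := paramPoints_mul_q h1
        rw [hqi] at h2
        rw [mul_comm q w] at h1
        rw [h.integral_outside h1, h.integral_outside h2]
      · have h1 := dblPoch_div_eq_zero_iff hp hq hw0 hj
        rw [h.integral_inside h1, h.integral_inside (paramPoints_mul_q h1)])
  simp only [Fin.sum_univ_two, Matrix.cons_val_zero, Matrix.cons_val_one, one_mul, neg_mul] at key
  rw [contourIntegral_div_const] at key
  have i1 : ContourIntegrable γ (betaKernel p q (Function.update v 0 (v 0 * q))) :=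
    (h.mono (hup 0)).contourIntegrable_betaKernel hp hq (hne 0)
  have i2 : ContourIntegrable γ (betaKernel p q (Function.update v 5 (v 5 * q))) :=
    (h.mono (hup 5)).contourIntegrable_betaKernel hp hq (hne 5)
  have j1 : ContourIntegrable γ (fun z => shiftAux p q v (z / q) / (z / q) / q) := by
    refine h.isClosedContour.contourIntegrable ?_
    have := hd.continuousOn.comp (h.isClosedContour.continuousOn.div_const q) hmem'
    exact this.div_const q
  have j2 : ContourIntegrable γ (fun z => shiftAux p q v z / z) :=
    h.isClosedContour.contourIntegrable (hd.continuousOn.comp h.isClosedContour.continuousOn hmem)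
  unfold contourIntegral ContourIntegrable at *
  rw [← sub_eq_zero, ← intervalIntegral.integral_const_mul, ← intervalIntegral.integral_const_mul,
    ← intervalIntegral.integral_sub (i1.const_mul _) (i2.const_mul _)]
  rw [← sub_eq_add_neg, ← intervalIntegral.integral_sub j1 j2] at key
  rw [← mul_zero (v 0 * theta (v 0 * (p / v 5)) p), ← key, ← intervalIntegral.integral_const_mul]
  refine intervalIntegral.integral_congr fun x hx => ?_
  rw [Set.uIcc_of_le zero_le_one] at hx
  have hz := h.mem_regularSet hp hq hx
  have hz0 := hz.1
  have e := shiftAux_sub hp₀ hq₀ hp hq hv hprod h12 hz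
  simp only
  generalize γ x = z at *
  have e' : shiftAux p q v (z / q) / (z / q) / q = shiftAux p q v (z / q) / z := by field_simp
  rw [e']
  have e2 : ∀ a b c d : ℂ, a * (b / z * d - c / z * d) = (a * (b - c)) * (d / z) := by
    intros; ring
  rw [e2, e]
  field_simp

end

/-! ### Symmetry in the six parameters and the shift between any two of them. -/

theorem prod_Ioi_comp_perm {n : ℕ} {f : Fin n → Fin n → ℂ} (hf : ∀ j k, f j k = f k j)
    (σ : Equiv.Perm (Fin n)) :
    ∏ j, ∏ k ∈ Ioi j, f (σ j) (σ k) = ∏ j, ∏ k ∈ Ioi j, f j k := by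
  rw [prod_sigma', prod_sigma']
  -- A pair is mapped to its image under `σ`, put in increasing order; symmetry of `f` makes the
  -- order irrelevant.
  refine prod_nbij'
    (fun x => if σ x.1 < σ x.2 then ⟨σ x.1, σ x.2⟩ else ⟨σ x.2, σ x.1⟩)
    (fun x => if σ.symm x.1 < σ.symm x.2 then ⟨σ.symm x.1, σ.symm x.2⟩
      else ⟨σ.symm x.2, σ.symm x.1⟩) ?_ ?_ ?_ ?_ ?_
  · rintro ⟨a, b⟩ hab
    simp only [mem_sigma, mem_univ, mem_Ioi, true_and] at hab ⊢
    split_ifs with h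
    · exact h
    · exact lt_of_le_of_ne (not_lt.mp h) fun h' => hab.ne' (σ.injective h')
  · rintro ⟨a, b⟩ hab
    simp only [mem_sigma, mem_univ, mem_Ioi, true_and] at hab ⊢
    split_ifs with h
    · exact h
    · exact lt_of_le_of_ne (not_lt.mp h) fun h' => hab.ne' (σ.symm.injective h')
  · rintro ⟨a, b⟩ hab
    simp only [mem_sigma, mem_univ, mem_Ioi, true_and] at hab
    by_cases h : σ a < σ b
    · simp [h, hab]
    · simp [h, hab.le]
  · rintro ⟨a, b⟩ hab
    simp only [mem_sigma, mem_univ, mem_Ioi, true_and] at hab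
    by_cases h : σ.symm a < σ.symm b
    · simp [h, hab]
    · simp [h, hab.le]
  · rintro ⟨a, b⟩ hab
    by_cases h : σ a < σ b
    · simp [h]
    · simp [h, hf (σ a)]

section

variable {p q : ℂ}

theorem betaValue_comp (s : Fin 6 → ℂ) (σ : Equiv.Perm (Fin 6)) :
    betaValue p q (s ∘ σ) = betaValue p q s :=
  prod_Ioi_comp_perm (f := fun j k => ellGamma p q (s j * s k))
    (fun j k => by rw [mul_comm]) σ

theorem betaKernel_comp (s : Fin 6 → ℂ) (σ : Equiv.Perm (Fin 6)) :
    betaKernel p q (s ∘ σ) = betaKernel p q s := by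
  funext z
  unfold betaKernel
  rw [← Equiv.prod_comp σ (fun j => ellGamma p q (s j * z) * ellGamma p q (s j / z))]
  rfl

theorem paramPoints_comp (s : Fin 6 → ℂ) (σ : Equiv.Perm (Fin 6)) :
    paramPoints p q (s ∘ σ) = paramPoints p q s := by
  ext w
  constructor
  · rintro ⟨j, a, b, rfl⟩
    exact ⟨σ j, a, b, rfl⟩
  · rintro ⟨j, a, b, rfl⟩
    exact ⟨σ.symm j, a, b, by simp⟩

theorem update_comp_perm (v : Fin 6 → ℂ) (σ : Equiv.Perm (Fin 6)) (i : Fin 6) (x : ℂ) :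
    Function.update (v ∘ σ) i x = Function.update v (σ i) x ∘ σ := by
  rw [Function.update_comp_equiv, Equiv.symm_apply_apply]

variable (hp₀ : p ≠ 0) (hq₀ : q ≠ 0) (hp : ‖p‖ < 1) (hq : ‖q‖ < 1)

include hp hq hq₀ in
theorem betaValue_update_zero {v : Fin 6 → ℂ} (hv : ∀ j, v j ≠ 0)
    (h : ∀ m, dblPoch p q (v 0 * v m) ≠ 0) :
    betaValue p q (Function.update v 0 (v 0 * q)) =
      betaValue p q v * ∏ m ∈ univ.erase 0, theta (v 0 * v m) p := by
  have e0 : (univ.erase 0 : Finset (Fin 6)) = {1, 2, 3, 4, 5} := by decide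
  have g (m : Fin 6) : ellGamma p q (v 0 * q * v m) =
      theta (v 0 * v m) p * ellGamma p q (v 0 * v m) := by
    rw [← ellGamma_mul_q hq₀ hp hq (mul_ne_zero (hv 0) (hv m)) (h m)]
    congr 1
    ring
  rw [e0, prod_insert (by decide), prod_insert (by decide), prod_insert (by decide),
    prod_insert (by decide), prod_singleton, betaValue_eq, betaValue_eq]
  simp +decide only [Function.update_self, Function.update_of_ne, ne_eq]
  simp only [g]
  ring

include hp hq hq₀ in
theorem betaValue_update {v : Fin 6 → ℂ} (hv : ∀ j, v j ≠ 0) (i : Fin 6)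
    (h : ∀ m, dblPoch p q (v i * v m) ≠ 0) :
    betaValue p q (Function.update v i (v i * q)) =
      betaValue p q v * ∏ m ∈ univ.erase i, theta (v i * v m) p := by
  set σ := Equiv.swap 0 i with hσ
  have h0 : σ 0 = i := Equiv.swap_apply_left 0 i
  have e := betaValue_update_zero hq₀ hp hq (v := v ∘ σ) (fun j => hv _)
    (fun m => by simpa [h0] using h (σ m))
  rw [update_comp_perm, betaValue_comp, betaValue_comp] at e
  simp only [Function.comp_apply, h0] at e
  rw [e]
  congr 1
  refine prod_equiv σ (fun m => ?_) fun m _ => rfl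
  rw [mem_erase, mem_erase, ← h0]
  simp

include hp₀ hq₀ hp hq in
/-- The integral of the kernel divided by `betaValue` is the same for all sets of parameters
obtained by multiplying one element of `v` by `q`. -/
theorem Separates.integral_shift {γ : ℝ → ℂ} {v : Fin 6 → ℂ}
    (h : Separates γ (paramPoints p q v)) (hv : ∀ j, v j ≠ 0) (hprod : ∏ j, v j = p)
    (hθ : ∀ j k, j ≠ k → theta (v j * v k) p ≠ 0) {i k : Fin 6} (hik : i ≠ k) :
    contourIntegral γ (betaKernel p q (Function.update v i (v i * q))) *
        betaValue p q (Function.update v k (v k * q)) =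
      contourIntegral γ (betaKernel p q (Function.update v k (v k * q))) *
        betaValue p q (Function.update v i (v i * q)) := by
  -- A permutation that maps `0` to `i` and `5` to `k`, which reduces the claim to the shift between
  -- the first and the last parameter.
  set σ : Equiv.Perm (Fin 6) := Equiv.swap 0 i * Equiv.swap 5 (Equiv.swap 0 i k) with hσ
  have h5 : σ 5 = k := by simp [hσ]
  have h0 : σ 0 = i := by
    have hne : Equiv.swap 0 i k ≠ 0 := fun h0 => by
      have := congrArg (Equiv.swap 0 i) h0
      rw [Equiv.swap_apply_self, Equiv.swap_apply_left] at this
      exact hik this.symm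
    rw [hσ, Equiv.Perm.mul_apply, Equiv.swap_apply_of_ne_of_ne (by decide) hne.symm,
      Equiv.swap_apply_left]
  set w := v ∘ σ with hw
  have hwp : w 0 * w 1 * w 2 * w 3 * w 4 * w 5 = p := by
    rw [← hprod, ← Equiv.prod_comp σ, Fin.prod_univ_six]
    rfl
  have hS : Separates γ (paramPoints p q w) := by rwa [hw, paramPoints_comp]
  have key := hS.shift_zero_five hp₀ hq₀ hp hq (fun j => hv _) hwp
    (hθ _ _ (fun h => by simpa using σ.injective h))
  have hb (i : Fin 6) := betaValue_update hq₀ hp hq (v := w) (fun j => hv _) i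
    (fun m => hS.dblPoch_param_ne_zero hp hq i m)
  have b0 := hb 0
  have b5 := hb 5
  have e0 : (univ.erase 0 : Finset (Fin 6)) = {1, 2, 3, 4, 5} := by decide
  have e5 : (univ.erase 5 : Finset (Fin 6)) = {0, 1, 2, 3, 4} := by decide
  rw [e0, prod_insert (by decide), prod_insert (by decide), prod_insert (by decide),
    prod_insert (by decide), prod_singleton] at b0
  rw [e5, prod_insert (by decide), prod_insert (by decide), prod_insert (by decide),
    prod_insert (by decide), prod_singleton, mul_comm (w 5) (w 0)] at b5
  have u0 : Function.update w 0 (w 0 * q) = Function.update v i (v i * q) ∘ σ := by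
    rw [hw, update_comp_perm, h0, Function.comp_apply, h0]
  have u5 : Function.update w 5 (w 5 * q) = Function.update v k (v k * q) ∘ σ := by
    rw [hw, update_comp_perm, h5, Function.comp_apply, h5]
  rw [u0, u5, betaKernel_comp, betaKernel_comp] at key
  rw [u0, betaValue_comp] at b0
  rw [u5, betaValue_comp] at b5
  rw [b0, b5]
  linear_combination (betaValue p q w * theta (w 0 * w 5) p) * key

end

/-! ### The beta integral over the unit circle -/

/-- A product of two parameters thus lies in modulus strictly between the total product and `1`, a
range in which neither the gamma function (total product `pq`) nor the theta function (total product
`p`) has a zero or pole. -/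
theorem norm_prod_lt_norm_mul {s : Fin 6 → ℂ} (hs : ∀ j, s j ≠ 0) (hs1 : ∀ j, ‖s j‖ < 1) {j k : Fin 6}
    (hjk : j ≠ k) : ‖∏ i, s i‖ < ‖s j * s k‖ := by
  have hk : k ∈ univ.erase j := mem_erase.mpr ⟨hjk.symm, mem_univ k⟩
  rw [← mul_prod_erase univ s (mem_univ j), ← mul_prod_erase (univ.erase j) s hk, ← mul_assoc,
    norm_mul]
  refine mul_lt_of_lt_one_right (norm_pos_iff.mpr (mul_ne_zero (hs j) (hs k))) ?_
  rw [norm_prod]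
  have hne : ((univ.erase j).erase k).Nonempty := by
    rw [← card_pos, card_erase_of_mem hk, card_erase_of_mem (mem_univ j)]
    simp
  obtain ⟨i, hi⟩ := hne
  rw [← mul_prod_erase _ _ hi]
  calc ‖s i‖ * ∏ x ∈ ((univ.erase j).erase k).erase i, ‖s x‖ ≤ ‖s i‖ * 1 := by
        gcongr
        exact prod_le_one (fun _ _ => norm_nonneg _) fun x _ => (hs1 x).le
    _ < 1 := by simpa using hs1 i

/-- The integral of the kernel over the unit circle. -/
def circInt (p q : ℂ) (s : Fin 6 → ℂ) : ℂ := contourIntegral (circleContour 0 1) (betaKernel p q s)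

theorem circInt_comp {p q : ℂ} (s : Fin 6 → ℂ) (σ : Equiv.Perm (Fin 6)) :
    circInt p q (s ∘ σ) = circInt p q s := by
  unfold circInt
  rw [betaKernel_comp]

section

variable {p q : ℂ} (hp₀ : p ≠ 0) (hq₀ : q ≠ 0) (hp : ‖p‖ < 1) (hq : ‖q‖ < 1)

include hp hq in
theorem ellGamma_ne_zero {x : ℂ} (hx : x ≠ 0) (hx1 : ‖x‖ < 1) (hx2 : ‖p * q‖ < ‖x‖) :
    ellGamma p q x ≠ 0 := by
  rw [ellGamma_eq]
  refine div_ne_zero (dblPoch_ne_zero_of_norm_lt_one hp hq ?_)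
    (dblPoch_ne_zero_of_norm_lt_one hp hq hx1)
  rw [norm_div]
  exact (div_lt_one (norm_pos_iff.mpr hx)).mpr hx2

include hp hq in
theorem betaValue_ne_zero {s : Fin 6 → ℂ} (hs : ∀ j, s j ≠ 0) (hs1 : ∀ j, ‖s j‖ < 1)
    (hprod : ∏ j, s j = p * q) : betaValue p q s ≠ 0 := by
  refine prod_ne_zero_iff.mpr fun j _ => prod_ne_zero_iff.mpr fun k hk => ?_
  refine ellGamma_ne_zero hp hq (mul_ne_zero (hs j) (hs k)) ?_ ?_
  · rw [norm_mul]
    exact mul_lt_one_of_nonneg_of_lt_one_left (norm_nonneg _) (hs1 j) (hs1 k).le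
  · rw [← hprod]
    exact norm_prod_lt_norm_mul hs hs1 (mem_Ioi.mp hk).ne

include hp₀ hq₀ hp hq in
theorem circInt_shift {v : Fin 6 → ℂ} (hv : ∀ j, v j ≠ 0) (hv1 : ∀ j, ‖v j‖ < 1)
    (hprod : ∏ j, v j = p) {i k : Fin 6} (hik : i ≠ k) :
    circInt p q (Function.update v i (v i * q)) * betaValue p q (Function.update v k (v k * q)) =
      circInt p q (Function.update v k (v k * q)) *
        betaValue p q (Function.update v i (v i * q)) := by
  refine (separates_unitCircle hp hq hv hp₀ hq₀ hv1).integral_shift hp₀ hq₀ hp hq hv hprod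
    (fun a b hab h0 => ?_) hik
  -- A zero would give `v a * v b = p ^ n`, but its modulus lies strictly between `‖p‖` and `1`.
  obtain ⟨n, hn⟩ := (theta_eq_zero_iff hp₀ hp (mul_ne_zero (hv a) (hv b))).mp h0
  have h1 := norm_prod_lt_norm_mul hv hv1 hab
  have h2 : ‖v a * v b‖ < 1 := by
    rw [norm_mul]
    exact mul_lt_one_of_nonneg_of_lt_one_left (norm_nonneg _) (hv1 a) (hv1 b).le
  rw [hprod, hn, norm_zpow] at h1
  rw [hn, norm_zpow] at h2
  have hpp := norm_pos_iff.mpr hp₀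
  have h3 : 0 < n := by
    by_contra! hc
    exact absurd h2 (not_lt.mpr (one_le_zpow_of_nonpos₀ hpp hp.le hc))
  have h4 : n < 1 := by
    by_contra! hc
    have := zpow_le_zpow_right_of_le_one₀ hpp hp.le hc
    rw [zpow_one] at this
    exact absurd h1 (not_lt.mpr this)
  omega

include hp hq in
theorem differentiableAt_circInt {S : ℂ → Fin 6 → ℂ} {U : Set ℂ} (hU : IsOpen U)
    (hS : ∀ j, DifferentiableOn ℂ (fun x => S x j) U) (hS0 : ∀ x ∈ U, ∀ j, S x j ≠ 0)
    (hS1 : ∀ x ∈ U, ∀ j, ‖S x j‖ < 1) {x : ℂ} (hx : x ∈ U) :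
    DifferentiableAt ℂ (fun x => circInt p q (S x)) x := by
  have hn (w : ℂ) (hw : w ∈ circleContour 0 1 '' Set.Icc 0 1) : ‖w‖ = 1 := by
    obtain ⟨s, -, rfl⟩ := hw
    simpa using norm_circleContour_sub 0 zero_le_one s
  have h1 (x : ℂ) (hx : x ∈ U) (w : ℂ) (hw : ‖w‖ = 1) (j : Fin 6) :
      dblPoch p q (S x j * w) ≠ 0 ∧ dblPoch p q (S x j / w) ≠ 0 :=
    ⟨dblPoch_ne_zero_of_norm_lt_one hp hq (by rw [norm_mul, hw, mul_one]; exact hS1 x hx j),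
      dblPoch_ne_zero_of_norm_lt_one hp hq (by rw [norm_div, hw, div_one]; exact hS1 x hx j)⟩
  have h0 (w : ℂ) (hw : ‖w‖ = 1) : w ≠ 0 := by
    rintro rfl
    simp at hw
  refine (isClosedContour_circleContour 0 1).differentiableAt_contourIntegral
    (Φ := fun x z => betaKernel p q (S x) z) hU ?_ ?_ hx
  · rintro ⟨y, w⟩ ⟨hy, hw⟩
    have hw' := hn w hw
    have hd : DifferentiableAt ℂ (fun x : ℂ × ℂ => betaKernel p q (S x.1) x.2) (y, w) := by
      apply differentiableAt_betaKernel hp hq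
      · intro j
        exact DifferentiableAt.comp (y, w) (f := fun y : ℂ × ℂ => y.1) (g := fun x => S x j)
          ((hS j).differentiableAt (hU.mem_nhds hy)) differentiableAt_fst
      · exact differentiableAt_snd
      · exact hS0 y hy
      · exact h0 w hw'
      · exact fun j => (h1 y hy w hw' j).1
      · exact fun j => (h1 y hy w hw' j).2
    exact hd.continuousAt.continuousWithinAt
  · intro w hw y hy
    have hw' := hn w hw
    exact (differentiableAt_betaKernel hp hq (S := S) (Z := fun _ => w)
      (fun j => (hS j).differentiableAt (hU.mem_nhds hy)) (differentiableAt_const _) (hS0 y hy)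
      (h0 w hw') (fun j => (h1 y hy w hw' j).1)
      (fun j => (h1 y hy w hw' j).2)).differentiableWithinAt

include hp hq in
theorem differentiableAt_betaValue_of_norm_lt {S : ℂ → Fin 6 → ℂ} {x : ℂ}
    (hS : ∀ j, DifferentiableAt ℂ (fun y => S y j) x) (hS0 : ∀ j, S x j ≠ 0)
    (hS1 : ∀ j, ‖S x j‖ < 1) : DifferentiableAt ℂ (fun y => betaValue p q (S y)) x := by
  refine differentiableAt_betaValue hp hq hS hS0 fun j k _ =>
    dblPoch_ne_zero_of_norm_lt_one hp hq ?_
  rw [norm_mul]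
  exact mul_lt_one_of_nonneg_of_lt_one_left (norm_nonneg _) (hS1 j) (hS1 k).le

end

/-! ### Exchange of two parameters with fixed product in the integral over the unit circle. -/

theorem exists_zpow_mem_Ico {q x : ℂ} (hq₀ : q ≠ 0) (hq : ‖q‖ < 1) (hx : x ≠ 0) :
    ∃ n : ℤ, ‖q‖ ≤ ‖x * q ^ n‖ ∧ ‖x * q ^ n‖ < 1 := by
  have hq' : 0 < ‖q‖ := norm_pos_iff.mpr hq₀
  obtain ⟨n, h1, h2⟩ := exists_mem_Ico_zpow (x := ‖x‖) (y := ‖q‖⁻¹) (norm_pos_iff.mpr hx)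
    ((one_lt_inv₀ hq').mpr hq)
  refine ⟨n + 1, ?_⟩
  rw [norm_mul, norm_zpow]
  rw [inv_zpow', zpow_neg] at h1 h2
  have e : ‖q‖ ^ (n + 1) = ‖q‖ ^ n * ‖q‖ := zpow_add_one₀ hq'.ne' n
  have hpos : 0 < ‖q‖ ^ n := zpow_pos hq' n
  constructor
  · rw [e, ← mul_assoc]
    refine le_mul_of_one_le_left hq'.le ?_
    rwa [inv_le_iff_one_le_mul₀ hpos] at h1
  · rw [lt_inv_comm₀ (norm_pos_iff.mpr hx) (zpow_pos hq' _)] at h2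
    rw [← lt_inv_mul_iff₀ (norm_pos_iff.mpr hx), mul_one]
    exact h2

/-- A holomorphic function on an annulus that is periodic with respect to `x ↦ x q` is constant, if
the annulus contains a fundamental domain. -/
theorem eq_of_periodic_annulus {q : ℂ} (hq₀ : q ≠ 0) (hq : ‖q‖ < 1) {a : ℝ} (ha : a < ‖q‖)
    {F : ℂ → ℂ} (hF : ∀ x, x ≠ 0 → a < ‖x‖ → ‖x‖ < 1 → DifferentiableAt ℂ F x)
    (hper : ∀ x, x ≠ 0 → a < ‖x * q‖ → ‖x‖ < 1 → F (x * q) = F x) {x y : ℂ} (hx0 : x ≠ 0) (hy0 : y ≠ 0)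
    (hx : a < ‖x‖) (hx' : ‖x‖ < 1) (hy : a < ‖y‖) (hy' : ‖y‖ < 1) : F x = F y := by
  have hq' : 0 < ‖q‖ := norm_pos_iff.mpr hq₀
  have hnat (k : ℕ) : ∀ x, x ≠ 0 → a < ‖x * q ^ k‖ → ‖x‖ < 1 → F (x * q ^ k) = F x := by
    induction k with
    | zero => intro x _ _ _; simp
    | succ k ih =>
      intro x hx0 h1 h2
      have e : x * q ^ (k + 1) = x * q ^ k * q := by ring
      rw [e] at h1 ⊢
      have h3 : a < ‖x * q ^ k‖ := by
        refine h1.trans_le ?_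
        rw [norm_mul]
        exact mul_le_of_le_one_right (norm_nonneg _) hq.le
      have h4 : ‖x * q ^ k‖ < 1 := by
        rw [norm_mul, norm_pow]
        exact mul_lt_one_of_nonneg_of_lt_one_left (norm_nonneg _) h2
          (pow_le_one₀ hq'.le hq.le)
      rw [hper _ (mul_ne_zero hx0 (pow_ne_zero _ hq₀)) h1 h4, ih x hx0 h3 h2]
  have hle (m n : ℤ) (hmn : m ≤ n) (x : ℂ) (hx0 : x ≠ 0) (hm : ‖x * q ^ m‖ < 1)
      (hn : a < ‖x * q ^ n‖) : F (x * q ^ m) = F (x * q ^ n) := by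
    obtain ⟨k, rfl⟩ := Int.le.dest hmn
    have e : x * q ^ (m + k) = x * q ^ m * q ^ k := by
      rw [zpow_add₀ hq₀, zpow_natCast, mul_assoc]
    rw [e] at hn ⊢
    exact (hnat k _ (mul_ne_zero hx0 (zpow_ne_zero _ hq₀)) hn hm).symm
  have hany (m n : ℤ) (x : ℂ) (hx0 : x ≠ 0) (hm : a < ‖x * q ^ m‖ ∧ ‖x * q ^ m‖ < 1)
      (hn : a < ‖x * q ^ n‖ ∧ ‖x * q ^ n‖ < 1) : F (x * q ^ m) = F (x * q ^ n) := by
    rcases le_total m n with h | h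
    · exact hle m n h x hx0 hm.2 hn.1
    · exact (hle n m h x hx0 hn.2 hm.1).symm
  have hex (x : ℂ) : ∃ n : ℤ, x ≠ 0 → a < ‖x * q ^ n‖ ∧ ‖x * q ^ n‖ < 1 := by
    by_cases hx : x = 0
    · exact ⟨0, fun h => absurd hx h⟩
    · obtain ⟨n, h1, h2⟩ := exists_zpow_mem_Ico hq₀ hq hx
      exact ⟨n, fun _ => ⟨ha.trans_le h1, h2⟩⟩
  -- `F` is continued to all `x ≠ 0` by its value at a representative `x q^N` in the annulus. Any
  -- two representatives are linked by steps inside the annulus, so the value does not depend on the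
  -- choice, and near a given point one exponent serves all points.
  choose N hN using hex
  have hQ (x : ℂ) (hx0 : x ≠ 0) (n : ℤ) (hn : a < ‖x * q ^ n‖ ∧ ‖x * q ^ n‖ < 1) :
      F (x * q ^ N x) = F (x * q ^ n) := hany _ _ x hx0 (hN x hx0) hn
  have key := eq_of_mul_periodic hq₀ hq (Q := fun x => F (x * q ^ N x)) (fun x hx0 => ?_)
    (fun x hx0 => ?_) hx0 hy0
  · rwa [hQ x hx0 0 (by simpa using ⟨hx, hx'⟩), hQ y hy0 0 (by simpa using ⟨hy, hy'⟩), zpow_zero,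
      mul_one, mul_one] at key
  · have h1 := hN x hx0
    have hc : ContinuousAt (fun y : ℂ => ‖y * q ^ N x‖) x := by fun_prop
    have hev : ∀ᶠ y in 𝓝 x, F (y * q ^ N y) = F (y * q ^ N x) := by
      filter_upwards [eventually_ne_nhds hx0, hc.eventually (lt_mem_nhds h1.1),
        hc.eventually (gt_mem_nhds h1.2)] with y h0 h2 h3
      exact hQ y h0 _ ⟨h2, h3⟩
    refine DifferentiableAt.congr_of_eventuallyEq ?_ hev
    exact DifferentiableAt.comp x (f := fun y => y * q ^ N x) (g := F)
      (hF _ (mul_ne_zero hx0 (zpow_ne_zero _ hq₀)) h1.1 h1.2) (differentiableAt_id.mul_const _)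
  · have h1 := hN x hx0
    have e : x * q * q ^ (N x - 1) = x * q ^ N x := by
      rw [zpow_sub₀ hq₀, zpow_one]
      field_simp
    rw [hQ (x * q) (mul_ne_zero hx0 hq₀) (N x - 1) (by rwa [e]), e]

theorem forall_fin_six {P : Fin 6 → Prop} (h0 : P 0) (h1 : P 1) (h2 : P 2) (h3 : P 3) (h4 : P 4)
    (h5 : P 5) : ∀ j, P j := by
  intro j
  fin_cases j <;> assumption

section

variable {p q : ℂ} (hp₀ : p ≠ 0) (hq₀ : q ≠ 0) (hp : ‖p‖ < 1) (hq : ‖q‖ < 1)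

include hp₀ hq₀ hp hq in
-- Moving a factor `q` between `x` and `c / x` leaves the quotient unchanged, so it is periodic
-- under `x ↦ xq` in the annulus `‖c‖ < ‖x‖ < 1`, where both parameters have modulus less than `1`.
-- As `‖c‖ < ‖q‖`, the annulus contains a fundamental domain, and the quotient is constant.
theorem circInt_div_const {s₁ s₂ s₃ s₄ c : ℂ} (h1 : s₁ ≠ 0) (h2 : s₂ ≠ 0) (h3 : s₃ ≠ 0)
    (h4 : s₄ ≠ 0) (h1' : ‖s₁‖ < 1) (h2' : ‖s₂‖ < 1) (h3' : ‖s₃‖ < 1) (h4' : ‖s₄‖ < 1)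
    (hc : s₁ * s₂ * s₃ * s₄ * c = p * q) (hcq : ‖c‖ < ‖q‖) {x y : ℂ} (hx : ‖c‖ < ‖x‖)
    (hx' : ‖x‖ < 1) (hy : ‖c‖ < ‖y‖) (hy' : ‖y‖ < 1) :
    circInt p q ![x, s₁, s₂, s₃, s₄, c / x] / betaValue p q ![x, s₁, s₂, s₃, s₄, c / x] =
      circInt p q ![y, s₁, s₂, s₃, s₄, c / y] / betaValue p q ![y, s₁, s₂, s₃, s₄, c / y] := by
  have hc0 : c ≠ 0 := by
    rintro rfl
    rw [mul_zero] at hc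
    exact mul_ne_zero hp₀ hq₀ hc.symm
  have hne {x : ℂ} (hx : ‖c‖ < ‖x‖) : x ≠ 0 := norm_pos_iff.mp ((norm_nonneg c).trans_lt hx)
  have hS0 {x : ℂ} (hx : ‖c‖ < ‖x‖) : ∀ j, ![x, s₁, s₂, s₃, s₄, c / x] j ≠ 0 :=
    forall_fin_six (hne hx) h1 h2 h3 h4 (div_ne_zero hc0 (hne hx))
  have hS1 {x : ℂ} (hx : ‖c‖ < ‖x‖) (hx' : ‖x‖ < 1) : ∀ j, ‖![x, s₁, s₂, s₃, s₄, c / x] j‖ < 1 :=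
    forall_fin_six hx' h1' h2' h3' h4' (by
      change ‖c / x‖ < 1
      rwa [norm_div, div_lt_one (norm_pos_iff.mpr (hne hx))])
  have hSp {x : ℂ} (hx : ‖c‖ < ‖x‖) : ∏ j, ![x, s₁, s₂, s₃, s₄, c / x] j = p * q := by
    rw [Fin.prod_univ_six, ← hc]
    simp only [Matrix.cons_val]
    have := hne hx
    field_simp
  have hSd {x : ℂ} (hx : x ≠ 0) :
      ∀ j, DifferentiableAt ℂ (fun x => ![x, s₁, s₂, s₃, s₄, c / x] j) x :=
    forall_fin_six differentiableAt_id (differentiableAt_const _) (differentiableAt_const _)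
      (differentiableAt_const _) (differentiableAt_const _)
      ((differentiableAt_const c).fun_div differentiableAt_id hx)
  have hU : IsOpen {x : ℂ | ‖c‖ < ‖x‖ ∧ ‖x‖ < 1} :=
    (isOpen_lt continuous_const continuous_norm).inter (isOpen_lt continuous_norm continuous_const)
  refine eq_of_periodic_annulus hq₀ hq hcq (F := fun x => circInt p q ![x, s₁, s₂, s₃, s₄, c / x] /
    betaValue p q ![x, s₁, s₂, s₃, s₄, c / x]) (fun x hx0 hx hx' => ?_) (fun x hx0 hx hx' => ?_)
    (hne hx) (hne hy) hx hx' hy hy'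
  · refine DifferentiableAt.fun_div ?_ ?_ (betaValue_ne_zero hp hq (hS0 hx) (hS1 hx hx') (hSp hx))
    · exact differentiableAt_circInt hp hq (S := fun x => ![x, s₁, s₂, s₃, s₄, c / x]) hU
        (fun j y hy => (hSd (hne hy.1) j).differentiableWithinAt) (fun y hy => hS0 hy.1)
        (fun y hy => hS1 hy.1 hy.2) ⟨hx, hx'⟩
    · exact differentiableAt_betaValue_of_norm_lt hp hq (S := fun x => ![x, s₁, s₂, s₃, s₄, c / x])
        (hSd hx0) (hS0 hx) (hS1 hx hx')
  · have hxx : ‖c‖ < ‖x‖ := hx.trans_le (by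
      rw [norm_mul]
      exact mul_le_of_le_one_right (norm_nonneg _) hq.le)
    have hxq : ‖x * q‖ < 1 := by
      rw [norm_mul]
      exact mul_lt_one_of_nonneg_of_lt_one_left (norm_nonneg _) hx' hq.le
    have key := circInt_shift hp₀ hq₀ hp hq (v := ![x, s₁, s₂, s₃, s₄, c / (x * q)])
      (forall_fin_six hx0 h1 h2 h3 h4 (div_ne_zero hc0 (hne hx)))
      (forall_fin_six hx' h1' h2' h3' h4' (by
        change ‖c / (x * q)‖ < 1
        rwa [norm_div, div_lt_one (norm_pos_iff.mpr (hne hx))]))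
      (by
        rw [Fin.prod_univ_six]
        simp only [Matrix.cons_val]
        field_simp
        linear_combination hc) (i := 0) (k := 5) (by decide)
    have e0 : Function.update ![x, s₁, s₂, s₃, s₄, c / (x * q)] 0
        (![x, s₁, s₂, s₃, s₄, c / (x * q)] 0 * q) = ![x * q, s₁, s₂, s₃, s₄, c / (x * q)] := by
      funext j
      fin_cases j <;> simp
    have e5 : Function.update ![x, s₁, s₂, s₃, s₄, c / (x * q)] 5
        (![x, s₁, s₂, s₃, s₄, c / (x * q)] 5 * q) = ![x, s₁, s₂, s₃, s₄, c / x] := by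
      funext j
      fin_cases j <;> simp +decide
      field_simp
    rw [e0, e5] at key
    have n1 := betaValue_ne_zero hp hq (hS0 hx) (hS1 hx hxq) (hSp hx)
    have n2 := betaValue_ne_zero hp hq (hS0 hxx) (hS1 hxx hx') (hSp hxx)
    exact (div_eq_div_iff n1 n2).mpr key

/-! ### The residue calculation -/

theorem contourIntegrable_circle_inv {w : ℂ} {r : ℝ} (hr : 0 ≤ r) (hw : ‖w‖ ≠ r) :
    ContourIntegrable (circleContour 0 r) fun z => (z - w)⁻¹ := by
  have h := isClosedContour_circleContour 0 r
  refine h.contourIntegrable ((h.continuousOn.sub continuousOn_const).inv₀ fun s _ h0 => hw ?_)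
  have h1 : circleContour 0 r s = w := sub_eq_zero.mp h0
  rw [← h1]
  simpa using norm_circleContour_sub 0 hr s

/-- The difference of the integrals of a function with two simple poles over two circles. -/
theorem circle_sub_circle {Φ : ℂ → ℂ} {U : Set ℂ} (hU : IsOpen U) (hΦ : DifferentiableOn ℂ Φ U)
    {ρ : ℝ} (hρ : 0 < ρ) (hρ1 : ρ < 1) (hsub : ∀ z, ρ ≤ ‖z‖ → ‖z‖ ≤ 1 → z ∈ U) {a b : ℂ} (hab : a ≠ b)
    (ha : ρ < ‖a‖) (ha' : ‖a‖ < 1) (hb : ρ < ‖b‖) (hb' : ‖b‖ < 1) :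
    contourIntegral (circleContour 0 1) (fun z => Φ z / ((z - a) * (z - b))) -
      contourIntegral (circleContour 0 ρ) (fun z => Φ z / ((z - a) * (z - b))) =
      2 * Real.pi * Complex.I * ((Φ a - Φ b) / (a - b)) := by
  -- Partial fractions: `χ` is the holomorphic part, with equal integrals over both circles, and `ψ
  -- b = (Φ a - Φ b) / (a - b)` is the sum of the two residues.
  set ψ := dslope Φ a with hψ
  set χ := dslope ψ b with hχ
  have hψd : DifferentiableOn ℂ ψ U :=
    (Complex.differentiableOn_dslope (hU.mem_nhds (hsub a ha.le ha'.le))).mpr hΦ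
  have hχd : DifferentiableOn ℂ χ U :=
    (Complex.differentiableOn_dslope (hU.mem_nhds (hsub b hb.le hb'.le))).mpr hψd
  have hn (r : ℝ) (hr : 0 ≤ r) (s : ℝ) : ‖circleContour 0 r s‖ = r := by
    simpa using norm_circleContour_sub 0 hr s
  have key := sum_contourIntegral_eq_zero (a := ![1, -1])
    (Γ := ![circleContour 0 1, circleContour 0 ρ]) (U := U) (f := χ)
    (by simpa [Fin.forall_fin_two] using
      ⟨isClosedContour_circleContour 0 1, isClosedContour_circleContour 0 ρ⟩) hU hχd
    (by
      simp only [Fin.forall_fin_two, Matrix.cons_val_zero, Matrix.cons_val_one]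
      refine ⟨fun s _ => hsub _ ?_ ?_, fun s _ => hsub _ ?_ ?_⟩
      · rw [hn 1 zero_le_one]
        exact hρ1.le
      · rw [hn 1 zero_le_one]
      · rw [hn ρ hρ.le]
      · rw [hn ρ hρ.le]
        exact hρ1.le)
    (by
      intro w hw
      simp only [Fin.sum_univ_two, Matrix.cons_val_zero, Matrix.cons_val_one, one_mul, neg_mul]
      rcases lt_or_ge ‖w‖ ρ with h | h
      · rw [contourIntegral_circleContour_of_lt (by simpa using h.trans hρ1),
          contourIntegral_circleContour_of_lt (by simpa using h)]
        ring
      · have h1 : 1 < ‖w‖ := by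
          by_contra! h1
          exact hw (hsub w h h1)
        rw [contourIntegral_circleContour_of_gt zero_le_one (by simpa using h1),
          contourIntegral_circleContour_of_gt hρ.le (by simpa using hρ1.trans h1)]
        ring)
  simp only [Fin.sum_univ_two, Matrix.cons_val_zero, Matrix.cons_val_one, one_mul, neg_mul] at key
  have hInt (r : ℝ) (hr : 0 ≤ r) (hra : ‖a‖ ≠ r) (hrb : ‖b‖ ≠ r) (hr1 : ρ ≤ r) (hr2 : r ≤ 1) :
      contourIntegral (circleContour 0 r) (fun z => Φ z / ((z - a) * (z - b))) =
        contourIntegral (circleContour 0 r) χ +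
          (Φ a / (a - b)) * contourIntegral (circleContour 0 r) (fun z => (z - a)⁻¹) +
          (ψ b - Φ a / (a - b)) * contourIntegral (circleContour 0 r) (fun z => (z - b)⁻¹) := by
    have i1 := contourIntegrable_circle_inv hr hra
    have i2 := contourIntegrable_circle_inv hr hrb
    have i3 : ContourIntegrable (circleContour 0 r) χ := by
      have h := isClosedContour_circleContour 0 r
      refine h.contourIntegrable (hχd.continuousOn.comp h.continuousOn fun s _ => hsub _ ?_ ?_)
      · rwa [hn r hr]
      · rwa [hn r hr]
    unfold contourIntegral ContourIntegrable at *
    rw [← intervalIntegral.integral_const_mul, ← intervalIntegral.integral_const_mul,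
      ← intervalIntegral.integral_add i3 (i1.const_mul _),
      ← intervalIntegral.integral_add (i3.add (i1.const_mul _)) (i2.const_mul _)]
    refine intervalIntegral.integral_congr fun s _ => ?_
    have hz := hn r hr s
    simp only
    generalize circleContour 0 r s = z at *
    have hza : z ≠ a := fun h => hra (by rw [← h, hz])
    have hzb : z ≠ b := fun h => hrb (by rw [← h, hz])
    rw [hχ, dslope_of_ne _ hzb, slope_def_field, hψ, dslope_of_ne _ hza, slope_def_field]
    have h1 := sub_ne_zero.mpr hza
    have h2 := sub_ne_zero.mpr hzb
    have h3 := sub_ne_zero.mpr hab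
    generalize dslope Φ a b = β
    field_simp
    ring
  rw [hInt 1 zero_le_one ha'.ne hb'.ne hρ1.le le_rfl, hInt ρ hρ.le ha.ne' hb.ne' le_rfl hρ1.le,
    contourIntegral_circleContour_of_lt (by simpa using ha'),
    contourIntegral_circleContour_of_lt (by simpa using hb'),
    contourIntegral_circleContour_of_gt hρ.le (by simpa using ha),
    contourIntegral_circleContour_of_gt hρ.le (by simpa using hb)]
  have hψb : ψ b = (Φ a - Φ b) / (a - b) := by
    rw [hψ, dslope_of_ne _ hab.symm, slope_def_field, ← neg_sub, ← neg_sub a b, neg_div_neg_eq]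
  rw [← hψb]
  linear_combination key

end

/-- The double product without its factor `1 - x`. -/
def resFactor (p q x : ℂ) : ℂ := qPochInf (x * p) p * dblPoch p q (x * q)

/-- The pair of gamma factors with parameter `a`. -/
def gammaPair (p q a z : ℂ) : ℂ := ellGamma p q (a * z) * ellGamma p q (a / z)

/-- The numerator of the kernel with parameters `e, -e, a, b, c, d` over `(z - e) (z + e)`. -/
def resKernel (p q e a b c d z : ℂ) : ℂ :=
  z * (dblPoch p q (p * q * z / e) * dblPoch p q (-(p * q * z / e)) /
      (resFactor p q (e / z) * resFactor p q (-(e / z)))) *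
    (ellGamma p q (e * z) * ellGamma p q (-(e * z))) *
    (gammaPair p q a z * gammaPair p q b z * gammaPair p q c z * gammaPair p q d z) *
    (theta (z ^ 2) p * theta ((z ^ 2)⁻¹) q)

section

variable {p q : ℂ} (hp₀ : p ≠ 0) (hq₀ : q ≠ 0) (hp : ‖p‖ < 1) (hq : ‖q‖ < 1)

include hp hq in
theorem dblPoch_eq_resFactor (x : ℂ) : dblPoch p q x = (1 - x) * resFactor p q x := by
  rw [dblPoch_eq_mul hp hq, qPochInf_eq_mul hp, resFactor, mul_assoc]

include hp hq in
theorem resFactor_ne_zero {x : ℂ} (h1 : ‖x * p‖ < 1) (h2 : ‖x * q‖ < 1) : resFactor p q x ≠ 0 := by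
  refine mul_ne_zero (fun h0 => ?_) (dblPoch_ne_zero_of_norm_lt_one hp hq h2)
  obtain ⟨n, hn⟩ := (qPochInf_eq_zero_iff hp _).mp h0
  have h3 := congrArg norm hn
  rw [norm_mul, norm_one, norm_pow] at h3
  have : ‖x * p‖ * ‖p‖ ^ n < 1 :=
    mul_lt_one_of_nonneg_of_lt_one_left (norm_nonneg _) h1 (pow_le_one₀ (norm_nonneg _) hp.le)
  exact this.ne h3

include hp hq in
theorem differentiable_resFactor : Differentiable ℂ (resFactor p q) := by
  unfold resFactor
  exact ((differentiable_qPochInf hp).comp (differentiable_id.mul_const p)).fun_mul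
    ((differentiable_dblPoch hp hq).comp (differentiable_id.mul_const q))

include hp hq in
theorem betaKernel_eq_resKernel {e a b c d z : ℂ} (hz : z ≠ 0) :
    betaKernel p q ![e, -e, a, b, c, d] z =
      resKernel p q e a b c d z / ((z - e) * (z - -e)) := by
  rw [betaKernel, Fin.prod_univ_six, resKernel]
  simp only [Matrix.cons_val]
  have e1 : ellGamma p q (e / z) =
      dblPoch p q (p * q * z / e) * z / ((z - e) * resFactor p q (e / z)) := by
    rw [ellGamma_eq, dblPoch_eq_resFactor hp hq (e / z), one_sub_div hz, div_mul_eq_mul_div,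
      div_div_eq_mul_div]
    congr 3
    rw [div_div_eq_mul_div]
  have e2 : ellGamma p q (-e / z) =
      dblPoch p q (-(p * q * z / e)) * z / ((z - -e) * resFactor p q (-(e / z))) := by
    rw [ellGamma_eq, dblPoch_eq_resFactor hp hq (-e / z), one_sub_div hz, div_mul_eq_mul_div,
      div_div_eq_mul_div, neg_div]
    congr 3
    rw [div_neg, div_div_eq_mul_div]
  rw [e1, e2]
  simp only [gammaPair, neg_mul, div_eq_mul_inv, mul_inv]
  have h1 := mul_inv_cancel₀ hz
  generalize z⁻¹ = y at *
  linear_combination (z * (dblPoch p q (p * q * z * e⁻¹) * dblPoch p q (-(p * q * z * e⁻¹)) *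
    (resFactor p q (e * y))⁻¹ * (resFactor p q (-(e * y)))⁻¹ * (z - e)⁻¹ * (z - -e)⁻¹) *
    (ellGamma p q (e * z) * ellGamma p q (-(e * z)) * ellGamma p q (a * z) * ellGamma p q (a * y) *
      ellGamma p q (b * z) * ellGamma p q (b * y) * ellGamma p q (c * z) * ellGamma p q (c * y) *
      ellGamma p q (d * z) * ellGamma p q (d * y)) * (theta (z ^ 2) p * theta (z ^ 2)⁻¹ q)) * h1

include hp hq in
theorem differentiableAt_gammaPair {a z : ℂ} (ha : a ≠ 0) (hz : z ≠ 0)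
    (h1 : ‖a * z‖ < 1) (h2 : ‖a / z‖ < 1) : DifferentiableAt ℂ (gammaPair p q a) z := by
  unfold gammaPair
  refine DifferentiableAt.fun_mul ?_ ?_
  · exact DifferentiableAt.comp z (f := fun y => a * y)
      (differentiableAt_ellGamma hp hq (mul_ne_zero ha hz) (dblPoch_ne_zero_of_norm_lt_one hp hq h1))
      (differentiableAt_id.const_mul _)
  · exact DifferentiableAt.comp z (f := fun y => a / y)
      (differentiableAt_ellGamma hp hq (div_ne_zero ha hz) (dblPoch_ne_zero_of_norm_lt_one hp hq h2))
      ((differentiableAt_const _).fun_div differentiableAt_id hz)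

include hp hq in
theorem differentiableAt_resKernel {e a b c d z : ℂ} (he : e ≠ 0) (ha : a ≠ 0) (hb : b ≠ 0)
    (hc : c ≠ 0) (hd : d ≠ 0) (hz : z ≠ 0) (h1 : ‖e * z‖ < 1)
    (h2 : ‖e / z * p‖ < 1) (h3 : ‖e / z * q‖ < 1) (ha1 : ‖a * z‖ < 1) (ha2 : ‖a / z‖ < 1)
    (hb1 : ‖b * z‖ < 1) (hb2 : ‖b / z‖ < 1) (hc1 : ‖c * z‖ < 1) (hc2 : ‖c / z‖ < 1)
    (hd1 : ‖d * z‖ < 1) (hd2 : ‖d / z‖ < 1) :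
    DifferentiableAt ℂ (resKernel p q e a b c d) z := by
  unfold resKernel
  have hP := differentiable_dblPoch hp hq
  have hR := differentiable_resFactor hp hq
  have l1 : DifferentiableAt ℂ (fun y => p * q * y / e) z :=
    (differentiableAt_id.const_mul _).div_const _
  have l2 : DifferentiableAt ℂ (fun y => e / y) z :=
    (differentiableAt_const _).fun_div differentiableAt_id hz
  have l3 : DifferentiableAt ℂ (fun y => e * y) z := differentiableAt_id.const_mul _
  have hz2 := pow_ne_zero 2 hz
  refine DifferentiableAt.fun_mul (DifferentiableAt.fun_mul (DifferentiableAt.fun_mul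
    (DifferentiableAt.fun_mul differentiableAt_id (DifferentiableAt.fun_div
      (DifferentiableAt.fun_mul ?_ ?_) (DifferentiableAt.fun_mul ?_ ?_) ?_))
        (DifferentiableAt.fun_mul ?_ ?_)) (DifferentiableAt.fun_mul (DifferentiableAt.fun_mul
        (DifferentiableAt.fun_mul ?_ ?_) ?_) ?_)) (DifferentiableAt.fun_mul ?_ ?_)
  · exact (hP _).comp z l1
  · exact (hP _).comp z l1.fun_neg
  · exact (hR _).comp z l2
  · exact (hR _).comp z l2.fun_neg
  · exact mul_ne_zero (resFactor_ne_zero hp hq h2 h3)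
      (resFactor_ne_zero hp hq (by rwa [neg_mul, norm_neg]) (by rwa [neg_mul, norm_neg]))
  · exact DifferentiableAt.comp z (differentiableAt_ellGamma hp hq (mul_ne_zero he hz)
      (dblPoch_ne_zero_of_norm_lt_one hp hq h1)) l3
  · exact DifferentiableAt.comp z (f := fun y => -(e * y)) (differentiableAt_ellGamma hp hq
      (neg_ne_zero.mpr (mul_ne_zero he hz)) (dblPoch_ne_zero_of_norm_lt_one hp hq
        (by rwa [norm_neg]))) l3.fun_neg
  · exact differentiableAt_gammaPair hp hq ha hz ha1 ha2
  · exact differentiableAt_gammaPair hp hq hb hz hb1 hb2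
  · exact differentiableAt_gammaPair hp hq hc hz hc1 hc2
  · exact differentiableAt_gammaPair hp hq hd hz hd1 hd2
  · exact DifferentiableAt.comp z (f := fun y => y ^ 2) (differentiableAt_theta hp hz2)
      (differentiableAt_id.fun_pow 2)
  · exact DifferentiableAt.comp z (f := fun y => (y ^ 2)⁻¹)
      (differentiableAt_theta hq (inv_ne_zero hz2)) ((differentiableAt_id.fun_pow 2).fun_inv hz2)

/-- The residue factor of the kernel at `z = e`, up to the factor `Γ(-e²)`. -/
def resValue (p q a b c d e : ℂ) : ℂ :=
  e * (dblPoch p q (p * q) * dblPoch p q (-(p * q)) / (resFactor p q 1 * resFactor p q (-1))) *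
    ellGamma p q (e ^ 2) *
    (gammaPair p q a e * gammaPair p q b e * gammaPair p q c e * gammaPair p q d e) *
    (theta (e ^ 2) p * theta ((e ^ 2)⁻¹) q)

theorem resKernel_self {e a b c d : ℂ} (he : e ≠ 0) :
    resKernel p q e a b c d e = ellGamma p q (-e ^ 2) * resValue p q a b c d e := by
  rw [resKernel, resValue, div_self he, mul_div_cancel_right₀ _ he, ← sq]
  ring

theorem resKernel_neg {e a b c d : ℂ} (he : e ≠ 0) :
    resKernel p q e a b c d (-e) = ellGamma p q (-e ^ 2) * resValue p q a b c d (-e) := by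
  rw [resKernel, resValue, div_neg, div_self he, mul_neg, neg_div, mul_div_cancel_right₀ _ he,
    neg_neg, neg_neg, mul_neg, neg_neg, neg_sq, ← sq]
  ring

include hp hq in
-- Between the two circles lie only the poles `e` and `-e`: the other points `s_j p^a q^b` have
-- modulus less than `ρ²`, and all reciprocals have modulus greater than `1`.
theorem circInt_eq_add_residue {e a b c d : ℂ} {ρ : ℝ} (hρ : 0 < ρ) (he : ρ < ‖e‖) (he' : ‖e‖ < 1)
    (ha : a ≠ 0) (hb : b ≠ 0) (hc : c ≠ 0) (hd : d ≠ 0) (hpρ : ‖p‖ < ρ ^ 2) (hqρ : ‖q‖ < ρ ^ 2)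
    (haρ : ‖a‖ < ρ ^ 2) (hbρ : ‖b‖ < ρ ^ 2) (hcρ : ‖c‖ < ρ ^ 2) (hdρ : ‖d‖ < ρ ^ 2) :
    circInt p q ![e, -e, a, b, c, d] =
      contourIntegral (circleContour 0 ρ) (betaKernel p q ![e, -e, a, b, c, d]) +
      Real.pi * Complex.I / e * (ellGamma p q (-e ^ 2) *
        (resValue p q a b c d e - resValue p q a b c d (-e))) := by
  have he0 : e ≠ 0 := norm_pos_iff.mp (hρ.trans he)
  have hρ1 : ρ < 1 := he.trans he'
  have hρρ : ρ ^ 2 < ρ := by nlinarith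
  have hU : IsOpen {z : ℂ | ρ ^ 2 < ‖z‖ ∧ ‖e * z‖ < 1} :=
    (isOpen_lt continuous_const continuous_norm).inter
      (isOpen_lt (continuous_const.mul continuous_id).norm continuous_const)
  have hd' : DifferentiableOn ℂ (resKernel p q e a b c d) {z : ℂ | ρ ^ 2 < ‖z‖ ∧ ‖e * z‖ < 1} := by
    rintro z ⟨h1, h2⟩
    have hz0 : 0 < ‖z‖ := (by positivity : 0 < ρ ^ 2).trans h1
    have m1 {x : ℂ} (hx : ‖x‖ < ρ ^ 2) : ‖x * z‖ < 1 := by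
      rw [norm_mul] at h2 ⊢
      exact (mul_le_mul_of_nonneg_right (hx.le.trans (hρρ.le.trans he.le)) hz0.le).trans_lt h2
    have m2 {x : ℂ} (hx : ‖x‖ < ρ ^ 2) : ‖x / z‖ < 1 := by
      rw [norm_div, div_lt_one hz0]
      exact hx.trans h1
    have m3 {x : ℂ} (hx : ‖x‖ < ρ ^ 2) : ‖e / z * x‖ < 1 := by
      rw [show e / z * x = e * (x / z) by ring, norm_mul]
      exact mul_lt_one_of_nonneg_of_lt_one_left (norm_nonneg _) he' (m2 hx).le
    exact (differentiableAt_resKernel hp hq he0 ha hb hc hd (norm_pos_iff.mp hz0) h2 (m3 hpρ)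
      (m3 hqρ) (m1 haρ) (m2 haρ) (m1 hbρ) (m2 hbρ) (m1 hcρ) (m2 hcρ) (m1 hdρ)
      (m2 hdρ)).differentiableWithinAt
  have hne : e ≠ -e := fun h => he0 (self_eq_neg.mp h)
  have key := circle_sub_circle hU hd' hρ hρ1 (fun z h1 h2 => ⟨hρρ.trans_le h1, by
    rw [norm_mul]
    exact mul_lt_one_of_nonneg_of_lt_one_left (norm_nonneg _) he' h2⟩) hne he he'
    (by rwa [norm_neg]) (by rwa [norm_neg])
  have hE (r : ℝ) (hr : 0 < r) : contourIntegral (circleContour 0 r)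
      (fun z => resKernel p q e a b c d z / ((z - e) * (z - -e))) =
      contourIntegral (circleContour 0 r) (betaKernel p q ![e, -e, a, b, c, d]) := by
    unfold contourIntegral
    congr 1
    funext s
    rw [betaKernel_eq_resKernel hp hq]
    have : ‖circleContour 0 r s‖ = r := by simpa using norm_circleContour_sub 0 hr.le s
    exact norm_pos_iff.mp (by rwa [this])
  rw [hE 1 one_pos, hE ρ hρ, resKernel_self he0, resKernel_neg he0] at key
  rw [circInt, ← sub_eq_iff_eq_add', key]
  field_simp
  ring

end

/-! ### The limit in which the poles pinch the unit circle. -/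

section

variable {p q : ℂ} (hp₀ : p ≠ 0) (hq₀ : q ≠ 0) (hp : ‖p‖ < 1) (hq : ‖q‖ < 1)

include hp hq in
theorem dblPoch_neg_one_ne_zero : dblPoch p q (-1) ≠ 0 := by
  rw [dblPoch_eq_resFactor hp hq]
  refine mul_ne_zero (by norm_num) (resFactor_ne_zero hp hq ?_ ?_) <;> simpa

include hp hq in
theorem continuousAt_ellGamma_comp {f : ℂ → ℂ} {x : ℂ} (hf : ContinuousAt f x) (h0 : f x ≠ 0)
    (h : dblPoch p q (f x) ≠ 0) : ContinuousAt (fun y => ellGamma p q (f y)) x :=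
  ContinuousAt.comp (f := f) (differentiableAt_ellGamma hp hq h0 h).continuousAt hf

include hp hq in
theorem continuousAt_gammaPair {f g : ℂ → ℂ} {x : ℂ} (hf : ContinuousAt f x)
    (hg : ContinuousAt g x) (hf0 : f x ≠ 0) (hf1 : ‖f x‖ < 1) (hg1 : ‖g x‖ = 1) :
    ContinuousAt (fun y => gammaPair p q (f y) (g y)) x := by
  have hg0 : g x ≠ 0 := norm_pos_iff.mp (by rw [hg1]; exact one_pos)
  unfold gammaPair
  refine (continuousAt_ellGamma_comp hp hq (hf.mul hg) (mul_ne_zero hf0 hg0)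
    (dblPoch_ne_zero_of_norm_lt_one hp hq ?_)).mul (continuousAt_ellGamma_comp hp hq (hf.div hg hg0)
    (div_ne_zero hf0 hg0) (dblPoch_ne_zero_of_norm_lt_one hp hq ?_))
  · rwa [Pi.mul_apply, norm_mul, hg1, mul_one]
  · rwa [norm_div, hg1, div_one]

include hp hq in
theorem continuousAt_resValue {a b c : ℂ} {d f : ℂ → ℂ} {x : ℂ} (hd : ContinuousAt d x)
    (hf : ContinuousAt f x) (hf1 : f x ^ 2 = -1) (ha : a ≠ 0) (hb : b ≠ 0) (hc : c ≠ 0)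
    (hd0 : d x ≠ 0) (ha1 : ‖a‖ < 1) (hb1 : ‖b‖ < 1) (hc1 : ‖c‖ < 1) (hd1 : ‖d x‖ < 1) :
    ContinuousAt (fun y => resValue p q a b c (d y) (f y)) x := by
  have hn : ‖f x‖ = 1 := by
    have := congrArg norm hf1
    rw [norm_pow, norm_neg, norm_one] at this
    exact (pow_eq_one_iff_of_nonneg (norm_nonneg _) two_ne_zero).mp this
  have h2 : ContinuousAt (fun y => f y ^ 2) x := hf.pow 2
  have hne : f x ^ 2 ≠ 0 := by rw [hf1]; norm_num
  unfold resValue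
  refine ((((hf.mul continuousAt_const).mul ?_).mul (((?_ : ContinuousAt _ x).mul ?_).mul ?_ |>.mul ?_))).mul
    (ContinuousAt.mul ?_ ?_)
  · exact continuousAt_ellGamma_comp hp hq h2 hne (by
      rw [hf1]
      exact dblPoch_neg_one_ne_zero hp hq)
  · exact continuousAt_gammaPair hp hq continuousAt_const hf ha ha1 hn
  · exact continuousAt_gammaPair hp hq continuousAt_const hf hb hb1 hn
  · exact continuousAt_gammaPair hp hq continuousAt_const hf hc hc1 hn
  · exact continuousAt_gammaPair hp hq hd hf hd0 hd1 hn
  · exact ContinuousAt.comp (f := fun y => f y ^ 2) (g := fun z => theta z p)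
      (differentiableAt_theta hp hne).continuousAt h2
  · exact ContinuousAt.comp (f := fun y => (f y ^ 2)⁻¹) (g := fun z => theta z q)
      (differentiableAt_theta hq (inv_ne_zero hne)).continuousAt (h2.inv₀ hne)

/-- `betaValue` for the parameters `e, -e, a, b, c, d`, up to the factor `Γ(-e²)`. -/
def betaRest (p q a b c d e : ℂ) : ℂ :=
  (ellGamma p q (a * e) * ellGamma p q (-(a * e))) * (ellGamma p q (b * e) * ellGamma p q (-(b * e))) *
  (ellGamma p q (c * e) * ellGamma p q (-(c * e))) * (ellGamma p q (d * e) * ellGamma p q (-(d * e))) *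
  (ellGamma p q (a * b) * ellGamma p q (a * c) * ellGamma p q (a * d) * ellGamma p q (b * c) *
    ellGamma p q (b * d) * ellGamma p q (c * d))

theorem betaValue_eq_betaRest (a b c d e : ℂ) :
    betaValue p q ![e, -e, a, b, c, d] = ellGamma p q (-e ^ 2) * betaRest p q a b c d e := by
  rw [betaValue_eq, betaRest]
  simp only [Matrix.cons_val]
  rw [show e * -e = -e ^ 2 by ring]
  simp only [neg_mul, mul_comm e]
  ring

include hp₀ hq₀ hp hq in
-- Here `1/e = -e`, and the two theta functions at `e² = -1` are the reciprocal of `Γ(-1)²` by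
-- `ellGamma_mul_inv`, since `-1` is its own inverse. The infinite products that remain cancel down
-- to `2 / ((p;p)_∞ (q;q)_∞)`.
theorem resValue_of_sq {a b c d e : ℂ} (he : e ^ 2 = -1) :
    resValue p q a b c d e * (qPochInf p p * qPochInf q q) = 2 * e * 
      ((ellGamma p q (a * e) * ellGamma p q (-(a * e))) *
      (ellGamma p q (b * e) * ellGamma p q (-(b * e))) *
      (ellGamma p q (c * e) * ellGamma p q (-(c * e))) *
      (ellGamma p q (d * e) * ellGamma p q (-(d * e)))) := by
  have hinv : e⁻¹ = -e := by
    refine inv_eq_of_mul_eq_one_right ?_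
    linear_combination -he
  have hg (x : ℂ) : gammaPair p q x e = ellGamma p q (x * e) * ellGamma p q (-(x * e)) := by
    rw [gammaPair, div_eq_mul_inv, hinv, mul_neg]
  have n1 := dblPoch_neg_one_ne_zero hp hq
  have h1 := ellGamma_mul_inv hp₀ hq₀ hp hq (neg_ne_zero.mpr one_ne_zero) n1
    (by rwa [inv_neg, inv_one])
  have h2 : ellGamma p q (-1) = dblPoch p q (-(p * q)) / dblPoch p q (-1) := by
    rw [ellGamma_eq, div_neg, div_one]
  have h3 : dblPoch p q (-1) = 2 * resFactor p q (-1) := by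
    rw [dblPoch_eq_resFactor hp hq]
    norm_num
  have hpq : ‖p * q‖ < 1 := by
    rw [norm_mul]
    exact mul_lt_one_of_nonneg_of_lt_one_left (norm_nonneg _) hp hq.le
  have n2 : dblPoch p q (-(p * q)) ≠ 0 :=
    dblPoch_ne_zero_of_norm_lt_one hp hq (by rwa [norm_neg])
  have n3 : dblPoch p q (p * q) ≠ 0 := dblPoch_ne_zero_of_norm_lt_one hp hq hpq
  have h4 : resFactor p q 1 = qPochInf p p * qPochInf q q * dblPoch p q (p * q) := by
    rw [resFactor, one_mul, one_mul, dblPoch_swap, dblPoch_eq_mul hq hp, dblPoch_swap,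
      mul_comm q p, mul_assoc]
  have n4 : resFactor p q 1 ≠ 0 := resFactor_ne_zero hp hq (by simpa) (by simpa)
  have n5 : qPochInf p p * qPochInf q q ≠ 0 := by
    rw [h4] at n4
    exact left_ne_zero_of_mul n4
  have n6 : resFactor p q (-1) ≠ 0 := by
    rw [h3] at n1
    exact right_ne_zero_of_mul n1
  rw [resValue, he]
  simp only [hg]
  rw [show (-1 : ℂ)⁻¹ = -1 by norm_num] at h1 ⊢
  rw [← h1, h2, h3, h4]
  generalize dblPoch p q (-(p * q)) = u at *
  generalize dblPoch p q (p * q) = v at *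
  generalize qPochInf p p * qPochInf q q = w at *
  generalize resFactor p q (-1) = x at *
  generalize ellGamma p q (a * e) * ellGamma p q (-(a * e)) = g1
  generalize ellGamma p q (b * e) * ellGamma p q (-(b * e)) = g2
  generalize ellGamma p q (c * e) * ellGamma p q (-(c * e)) = g3
  generalize ellGamma p q (d * e) * ellGamma p q (-(d * e)) = g4
  field_simp

include hp₀ hq₀ hp hq in
-- As `e = ri` tends to `i`, the poles `e` and `-1/e` pinch the unit circle, and both the integral
-- and its expected value blow up like `Γ(-e²)`. Multiplication by `dblPoch p q (-e ^ 2)` makes all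
-- terms continuous at `e = i`; the integral over the smaller circle is multiplied by `0` there, and
-- the residues at `±e` determine `J`.
theorem circInt_const_of_eventually {a b c J : ℂ} (ha : a ≠ 0) (hb : b ≠ 0) (hc : c ≠ 0)
    (ha1 : ‖a‖ < 1) (hb1 : ‖b‖ < 1) (hc1 : ‖c‖ < 1) (habc : ‖p * q‖ < ‖a * b * c‖)
    (hJ : ∀ᶠ r : ℝ in 𝓝[<] 1,
      circInt p q ![r * Complex.I, -(r * Complex.I), a, b, c,
        -(p * q / (a * b * c)) / (r * Complex.I) ^ 2] =
      J * betaValue p q ![r * Complex.I, -(r * Complex.I), a, b, c,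
        -(p * q / (a * b * c)) / (r * Complex.I) ^ 2]) :
    J * (qPochInf p p * qPochInf q q) = 4 * Real.pi * Complex.I := by
  set D := p * q / (a * b * c) with hD
  have hpq0 := mul_ne_zero hp₀ hq₀
  have habc0 := mul_ne_zero (mul_ne_zero ha hb) hc
  have hD0 : D ≠ 0 := div_ne_zero hpq0 habc0
  have hD1 : ‖D‖ < 1 := by
    rw [hD, norm_div, div_lt_one (norm_pos_iff.mpr habc0)]
    exact habc
  -- Some `M < 1` dominates all the moduli; with `ρ = √M` they are less than `ρ²`, as the residue
  -- lemma demands.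
  obtain ⟨M, hM1, hMp, hMq, hMa, hMb, hMc, hMD⟩ : ∃ M : ℝ, M < 1 ∧ ‖p‖ < M ∧ ‖q‖ < M ∧ ‖a‖ < M ∧
      ‖b‖ < M ∧ ‖c‖ < M ∧ ‖D‖ < M := by
    have h : ∀ᶠ M : ℝ in 𝓝[<] 1, M < 1 ∧ ‖p‖ < M ∧ ‖q‖ < M ∧ ‖a‖ < M ∧ ‖b‖ < M ∧ ‖c‖ < M ∧
        ‖D‖ < M := by
      have hl {x : ℝ} (hx : x < 1) : ∀ᶠ M : ℝ in 𝓝[<] 1, x < M :=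
        nhdsWithin_le_nhds (lt_mem_nhds hx)
      filter_upwards [self_mem_nhdsWithin, hl hp, hl hq, hl ha1, hl hb1, hl hc1, hl hD1] with
        M h1 h2 h3 h4 h5 h6 h7 using ⟨h1, h2, h3, h4, h5, h6, h7⟩
    exact h.exists
  have hM0 : 0 < M := (norm_nonneg p).trans_lt hMp
  set ρ := √M with hρ
  have hρ0 : 0 < ρ := Real.sqrt_pos.mpr hM0
  have hρ2 : ρ ^ 2 = M := Real.sq_sqrt hM0.le
  have hρ1 : ρ < 1 := by nlinarith
  rw [← hρ2] at hMp hMq hMa hMb hMc hMD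
  set d : ℂ → ℂ := fun e => -D / e ^ 2 with hd
  set V : Set ℂ := {e | ρ < ‖e‖ ∧ ‖e‖ < ρ⁻¹ ∧ ‖D‖ < ρ ^ 2 * ‖e‖ ^ 2} with hV
  have hVo : IsOpen V := (isOpen_lt continuous_const continuous_norm).inter
    ((isOpen_lt continuous_norm continuous_const).inter
      (isOpen_lt continuous_const (continuous_const.mul (continuous_norm.pow 2))))
  have hIV : Complex.I ∈ V := by
    refine ⟨by simpa using hρ1, by simpa using (one_lt_inv₀ hρ0).mpr hρ1, by simpa using hMD⟩
  have hV0 {e : ℂ} (he : e ∈ V) : e ≠ 0 := norm_pos_iff.mp (hρ0.trans he.1)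
  have hdV {e : ℂ} (he : e ∈ V) : d e ≠ 0 ∧ ‖d e‖ < ρ ^ 2 := by
    refine ⟨div_ne_zero (neg_ne_zero.mpr hD0) (pow_ne_zero 2 (hV0 he)), ?_⟩
    rw [hd]
    simp only
    rw [norm_div, norm_neg, norm_pow, div_lt_iff₀ (pow_pos (norm_pos_iff.mpr (hV0 he)) 2)]
    exact he.2.2
  have hdd {e : ℂ} (he : e ∈ V) : DifferentiableAt ℂ d e :=
    (differentiableAt_const _).fun_div (differentiableAt_id.fun_pow 2) (pow_ne_zero 2 (hV0 he))
  set S : ℂ → Fin 6 → ℂ := fun e => ![e, -e, a, b, c, d e] with hS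
  have hreg {e z : ℂ} (he : e ∈ V) (hz : ‖z‖ = ρ) :
      ∀ j, dblPoch p q (S e j * z) ≠ 0 ∧ dblPoch p q (S e j / z) ≠ 0 := by
    have hz0 : z ≠ 0 := norm_pos_iff.mp (hz ▸ hρ0)
    have g1 {x : ℂ} (hx : ‖x‖ < ρ ^ 2) : dblPoch p q (x * z) ≠ 0 ∧ dblPoch p q (x / z) ≠ 0 := by
      refine ⟨dblPoch_ne_zero_of_norm_lt_one hp hq ?_, dblPoch_ne_zero_of_norm_lt_one hp hq ?_⟩
      · rw [norm_mul, hz]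
        nlinarith [norm_nonneg x]
      · rw [norm_div, hz, div_lt_one hρ0]
        nlinarith
    have g2 {x : ℂ} (h1 : ρ < ‖x‖) (h2 : ‖x‖ < ρ⁻¹) :
        dblPoch p q (x * z) ≠ 0 ∧ dblPoch p q (x / z) ≠ 0 := by
      have h3 : ‖x‖ * ρ < 1 := by rwa [lt_inv_comm₀ ((hρ0).trans h1) hρ0, ← one_div, lt_div_iff₀ ((hρ0).trans h1), mul_comm] at h2
      have h4 {y : ℂ} (hy : ‖y‖ < ρ ^ 2) : ‖x / z * y‖ < 1 := by
        rw [norm_mul, norm_div, hz, div_mul_eq_mul_div, div_lt_one hρ0]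
        nlinarith [norm_nonneg x, norm_nonneg y]
      refine ⟨dblPoch_ne_zero_of_norm_lt_one hp hq ?_, ?_⟩
      · rwa [norm_mul, hz]
      · rw [dblPoch_eq_resFactor hp hq]
        refine mul_ne_zero (fun h0 => ?_) (resFactor_ne_zero hp hq (h4 hMp) (h4 hMq))
        have : x = z := by
          rw [sub_eq_zero] at h0
          rw [eq_div_iff hz0, one_mul] at h0
          exact h0.symm
        rw [this, hz] at h1
        exact lt_irrefl _ h1
    exact forall_fin_six (g2 he.1 he.2.1)
      (g2 (x := -e) (by rw [norm_neg]; exact he.1) (by rw [norm_neg]; exact he.2.1))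
      (g1 hMa) (g1 hMb) (g1 hMc) (g1 (hdV he).2)
  have hSd {e : ℂ} (he : e ∈ V) : ∀ j, DifferentiableAt ℂ (fun e => S e j) e :=
    forall_fin_six differentiableAt_id differentiableAt_id.fun_neg (differentiableAt_const _)
      (differentiableAt_const _) (differentiableAt_const _) (hdd he)
  have hS0 {e : ℂ} (he : e ∈ V) : ∀ j, S e j ≠ 0 :=
    forall_fin_six (hV0 he) (neg_ne_zero.mpr (hV0 he)) ha hb hc (hdV he).1
  have hn (w : ℂ) (hw : w ∈ circleContour 0 ρ '' Set.Icc 0 1) : ‖w‖ = ρ := by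
    obtain ⟨s, -, rfl⟩ := hw
    simpa using norm_circleContour_sub 0 hρ0.le s
  have hC0 : ContinuousAt (fun e => contourIntegral (circleContour 0 ρ) (betaKernel p q (S e)))
      Complex.I := by
    refine DifferentiableAt.continuousAt (𝕜 := ℂ)
      ((isClosedContour_circleContour 0 ρ).differentiableAt_contourIntegral
      (Φ := fun x z => betaKernel p q (S x) z) hVo ?_ ?_ hIV)
    · rintro ⟨y, w⟩ ⟨hy, hw⟩
      have hw' := hn w hw
      have hw0 : w ≠ 0 := norm_pos_iff.mp (hw' ▸ hρ0)
      have hd : DifferentiableAt ℂ (fun x : ℂ × ℂ => betaKernel p q (S x.1) x.2) (y, w) := by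
        apply differentiableAt_betaKernel hp hq
        · intro j
          exact DifferentiableAt.comp (y, w) (f := fun y : ℂ × ℂ => y.1) (g := fun x => S x j)
            (hSd hy j) differentiableAt_fst
        · exact differentiableAt_snd
        · exact hS0 hy
        · exact hw0
        · exact fun j => (hreg hy hw' j).1
        · exact fun j => (hreg hy hw' j).2
      exact hd.continuousAt.continuousWithinAt
    · intro w hw y hy
      have hw' := hn w hw
      exact (differentiableAt_betaKernel hp hq (S := S) (Z := fun _ => w)
        (hSd hy) (differentiableAt_const _) (hS0 hy)
        (norm_pos_iff.mp (hw' ▸ hρ0)) (fun j => (hreg hy hw' j).1)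
        (fun j => (hreg hy hw' j).2)).differentiableWithinAt
  have hI2 := Complex.I_sq
  have hdI0 := (hdV hIV).1
  have hlt {x : ℂ} (hx : ‖x‖ < ρ ^ 2) : ‖x‖ < 1 := hx.trans (by nlinarith)
  have hdI : d Complex.I = D := by simp [hd]
  have hdc : ContinuousAt d Complex.I := (hdd hIV).continuousAt
  have hP := (differentiable_dblPoch hp hq).continuous
  have c1 : ContinuousAt (fun e => resValue p q a b c (d e) e) Complex.I :=
    continuousAt_resValue hp hq hdc continuousAt_id hI2 ha hb hc hdI0 ha1 hb1 hc1
      (hlt (hdV hIV).2)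
  have c2 : ContinuousAt (fun e => resValue p q a b c (d e) (-e)) Complex.I :=
    continuousAt_resValue hp hq hdc continuousAt_neg (by simp) ha hb hc hdI0 ha1 hb1 hc1
      (hlt (hdV hIV).2)
  have cg {f : ℂ → ℂ} (hf : ContinuousAt f Complex.I) (h0 : f Complex.I ≠ 0)
      (h1 : ‖f Complex.I‖ < 1) : ContinuousAt (fun e => ellGamma p q (f e)) Complex.I :=
    continuousAt_ellGamma_comp hp hq hf h0 (dblPoch_ne_zero_of_norm_lt_one hp hq h1)
  have cgp {f : ℂ → ℂ} (hf : ContinuousAt f Complex.I) (h0 : f Complex.I ≠ 0)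
      (h1 : ‖f Complex.I‖ < 1) : ContinuousAt
        (fun e => ellGamma p q (f e * e) * ellGamma p q (-(f e * e))) Complex.I :=
    (cg (hf.mul continuousAt_id) (mul_ne_zero h0 Complex.I_ne_zero) (by simpa using h1)).mul
      (cg (hf.mul continuousAt_id).neg (neg_ne_zero.mpr (mul_ne_zero h0 Complex.I_ne_zero))
        (by simpa using h1))
  have hm {x y : ℂ} (hx : ‖x‖ < 1) (hy : ‖y‖ < 1) : ‖x * y‖ < 1 := by
    rw [norm_mul]
    exact mul_lt_one_of_nonneg_of_lt_one_left (norm_nonneg _) hx hy.le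
  have hdI1 := hlt (hdV hIV).2
  have c3 : ContinuousAt (fun e => betaRest p q a b c (d e) e) Complex.I := by
    unfold betaRest
    refine ((((cgp continuousAt_const ha ha1).mul (cgp continuousAt_const hb hb1)).mul
      (cgp continuousAt_const hc hc1)).mul (cgp hdc hdI0 hdI1)).mul ?_
    exact ((((continuousAt_const.mul continuousAt_const).mul
      (cg (continuousAt_const.mul hdc) (mul_ne_zero ha hdI0) (hm ha1 hdI1))).mul
      continuousAt_const).mul
      (cg (continuousAt_const.mul hdc) (mul_ne_zero hb hdI0) (hm hb1 hdI1))).mul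
      (cg (continuousAt_const.mul hdc) (mul_ne_zero hc hdI0) (hm hc1 hdI1))
  have c4 : ContinuousAt (fun e : ℂ => dblPoch p q (p * q / -e ^ 2)) Complex.I :=
    ContinuousAt.comp (f := fun e : ℂ => p * q / -e ^ 2) hP.continuousAt
      (continuousAt_const.div (continuousAt_id.pow 2).neg (by simp))
  have c5 : ContinuousAt (fun e : ℂ => dblPoch p q (-e ^ 2)) Complex.I :=
    ContinuousAt.comp (f := fun e : ℂ => -e ^ 2) hP.continuousAt (continuousAt_id.pow 2).neg
  have c6 : ContinuousAt (fun e : ℂ => Real.pi * Complex.I / e) Complex.I :=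
    continuousAt_const.div continuousAt_id Complex.I_ne_zero
  -- The relation `integral = J * betaValue`, with the integral split by the residue lemma and
  -- everything multiplied by `dblPoch p q (-e ^ 2)`. It vanishes along `e = ri`, hence also at `i`.
  have cF := ((c4.mul c3).const_mul J).sub ((c5.mul hC0).add (c6.mul (c4.mul (c1.sub c2))))
  have hlim : Tendsto (fun r : ℝ => (r : ℂ) * Complex.I) (𝓝[<] 1) (𝓝 Complex.I) := by
    have : ContinuousAt (fun r : ℝ => (r : ℂ) * Complex.I) 1 := by fun_prop
    have h := this.tendsto
    rw [Complex.ofReal_one, one_mul] at h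
    exact h.mono_left nhdsWithin_le_nhds
  have hF0 := tendsto_nhds_unique_of_eventuallyEq (cF.tendsto.comp hlim)
    (tendsto_const_nhds (x := (0 : ℂ)) (f := 𝓝[<] (1 : ℝ))) (by
      filter_upwards [hJ, hlim.eventually (hVo.mem_nhds hIV), self_mem_nhdsWithin,
        nhdsWithin_le_nhds (lt_mem_nhds zero_lt_one)] with r h1 h2 h3 h4
      have hr : ‖(r : ℂ) * Complex.I‖ < 1 := by
        rw [norm_mul, Complex.norm_I, mul_one, Complex.norm_real, Real.norm_of_nonneg h4.le]
        exact h3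
      simp only [Function.comp_apply]
      generalize (r : ℂ) * Complex.I = e at *
      have hres := circInt_eq_add_residue hp hq hρ0 h2.1 hr ha hb hc (hdV h2).1 hMp hMq hMa hMb hMc
        (hdV h2).2
      have h5 : circInt p q ![e, -e, a, b, c, d e] = J * betaValue p q ![e, -e, a, b, c, d e] := h1
      rw [hres, betaValue_eq_betaRest] at h5
      have hne : dblPoch p q (-e ^ 2) ≠ 0 := by
        refine dblPoch_ne_zero_of_norm_lt_one hp hq ?_
        rw [norm_neg, norm_pow]
        exact pow_lt_one₀ (norm_nonneg _) hr two_ne_zero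
      have hΓ : ellGamma p q (-e ^ 2) * dblPoch p q (-e ^ 2) = dblPoch p q (p * q / -e ^ 2) := by
        rw [ellGamma_eq, div_mul_cancel₀ _ hne]
      simp only [Pi.sub_apply, Pi.add_apply, Pi.mul_apply]
      rw [← hΓ]
      linear_combination (-dblPoch p q (-e ^ 2)) * h5)
  simp only [Pi.sub_apply, Pi.add_apply, Pi.mul_apply] at hF0
  -- This removes the integral over the circle of radius `ρ`.
  have hP1 : dblPoch p q 1 = 0 := by
    rw [dblPoch_eq_resFactor hp hq, sub_self, zero_mul]
  rw [Complex.I_sq, neg_neg, div_one, hP1, hdI, zero_mul, zero_add,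
    mul_div_cancel_right₀ _ Complex.I_ne_zero] at hF0
  have n1 : dblPoch p q (p * q) ≠ 0 := dblPoch_ne_zero_of_norm_lt_one hp hq (hm hp hq)
  have r1 := resValue_of_sq hp₀ hq₀ hp hq (a := a) (b := b) (c := c) (d := D) hI2
  have r2 := resValue_of_sq hp₀ hq₀ hp hq (a := a) (b := b) (c := c) (d := D) (e := -Complex.I)
    (by simp)
  simp only [mul_neg, neg_neg] at r2
  have na := norm_pos_iff.mpr ha
  have nb := norm_pos_iff.mpr hb
  have nc := norm_pos_iff.mpr hc
  have hpqn : ‖p * q‖ = ‖a‖ * ‖b‖ * ‖c‖ * ‖D‖ := by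
    rw [hD, norm_div, norm_mul (a * b), norm_mul a b]
    field_simp
  have hlt3 {w x y z : ℝ} (hw : 0 < w) (hx : 0 ≤ x) (hy : 0 ≤ y) (hz : 0 ≤ z) (hx1 : x < 1)
      (hy1 : y < 1) (hz1 : z < 1) : w * (x * y * z) < w :=
    mul_lt_of_lt_one_right hw (mul_lt_one_of_nonneg_of_lt_one_left (mul_nonneg hx hy)
      (mul_lt_one_of_nonneg_of_lt_one_left hx hx1 hy1.le) hz1.le)
  have ga : ‖p * q‖ < ‖a‖ := by
    rw [hpqn, show ‖a‖ * ‖b‖ * ‖c‖ * ‖D‖ = ‖a‖ * (‖b‖ * ‖c‖ * ‖D‖) by ring]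
    exact hlt3 na nb.le nc.le (norm_nonneg _) hb1 hc1 hD1
  have gb : ‖p * q‖ < ‖b‖ := by
    rw [hpqn, show ‖a‖ * ‖b‖ * ‖c‖ * ‖D‖ = ‖b‖ * (‖a‖ * ‖c‖ * ‖D‖) by ring]
    exact hlt3 nb na.le nc.le (norm_nonneg _) ha1 hc1 hD1
  have gc : ‖p * q‖ < ‖c‖ := by
    rw [hpqn, show ‖a‖ * ‖b‖ * ‖c‖ * ‖D‖ = ‖c‖ * (‖a‖ * ‖b‖ * ‖D‖) by ring]
    exact hlt3 nc na.le nb.le (norm_nonneg _) ha1 hb1 hD1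
  have gD : ‖p * q‖ < ‖D‖ := by
    rw [hpqn, show ‖a‖ * ‖b‖ * ‖c‖ * ‖D‖ = ‖D‖ * (‖a‖ * ‖b‖ * ‖c‖) by ring]
    exact hlt3 (norm_pos_iff.mpr hD0) na.le nb.le nc.le ha1 hb1 hc1
  have gp {x : ℂ} (h1 : ‖p * q‖ < ‖x‖) (h2 : ‖x‖ < 1) :
      ellGamma p q (x * Complex.I) * ellGamma p q (-(x * Complex.I)) ≠ 0 := by
    have h0 : x ≠ 0 := norm_pos_iff.mp ((norm_nonneg _).trans_lt h1)
    exact mul_ne_zero (ellGamma_ne_zero hp hq (mul_ne_zero h0 Complex.I_ne_zero) (by simpa using h2)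
      (by simpa using h1)) (ellGamma_ne_zero hp hq
      (neg_ne_zero.mpr (mul_ne_zero h0 Complex.I_ne_zero)) (by simpa using h2) (by simpa using h1))
  have hX := mul_ne_zero (mul_ne_zero (mul_ne_zero (gp ga ha1) (gp gb hb1)) (gp gc hc1)) (gp gD hD1)
  -- Since `abcD = pq`, the gamma factors of the pairs among `a, b, c, D` cancel by reflection.
  have gm {x y z : ℂ} (hx : x ≠ 0) (hy : y ≠ 0) (hx1 : ‖x‖ < 1) (hy1 : ‖y‖ < 1) (hz1 : ‖z‖ < 1)
      (hxyz : x * y * z = a * b * c) : ellGamma p q (x * y) * ellGamma p q (z * D) = 1 := by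
    have h0 := mul_ne_zero hx hy
    have hz0 : z ≠ 0 := by
      rintro rfl
      exact habc0 (by rw [← hxyz, mul_zero])
    have h1 : ellGamma p q (x * y) ≠ 0 := by
      refine ellGamma_ne_zero hp hq h0 (hm hx1 hy1) (habc.trans ?_)
      rw [← hxyz, norm_mul (x * y)]
      exact mul_lt_of_lt_one_right (norm_pos_iff.mpr h0) hz1
    have h2 : z * D = p * q / (x * y) := by
      rw [hD, ← hxyz]
      field_simp
    rw [h2, ← ellGamma_inv_eq hp₀ hq₀, mul_inv_cancel₀ h1]
  have k1 := gm ha hb ha1 hb1 hc1 rfl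
  have k2 := gm ha hc ha1 hc1 hb1 (by ring)
  have k3 := gm hb hc hb1 hc1 ha1 (by ring)
  have hrest : betaRest p q a b c D Complex.I =
      ellGamma p q (a * Complex.I) * ellGamma p q (-(a * Complex.I)) *
      (ellGamma p q (b * Complex.I) * ellGamma p q (-(b * Complex.I))) *
      (ellGamma p q (c * Complex.I) * ellGamma p q (-(c * Complex.I))) *
      (ellGamma p q (D * Complex.I) * ellGamma p q (-(D * Complex.I))) := by
    rw [betaRest]
    refine mul_eq_left₀ hX |>.mpr ?_
    calc _ = (ellGamma p q (a * b) * ellGamma p q (c * D)) *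
          (ellGamma p q (a * c) * ellGamma p q (b * D)) *
          (ellGamma p q (b * c) * ellGamma p q (a * D)) := by ring
      _ = 1 := by rw [k1, k2, k3]; ring
  rw [hrest] at hF0
  generalize ellGamma p q (a * Complex.I) = a1 at *
  generalize ellGamma p q (-(a * Complex.I)) = a2 at *
  generalize ellGamma p q (b * Complex.I) = b1 at *
  generalize ellGamma p q (-(b * Complex.I)) = b2 at *
  generalize ellGamma p q (c * Complex.I) = c1 at *
  generalize ellGamma p q (-(c * Complex.I)) = c2 at *
  generalize ellGamma p q (D * Complex.I) = d1 at *
  generalize ellGamma p q (-(D * Complex.I)) = d2 at *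
  refine mul_left_cancel₀ (mul_ne_zero n1 hX) ?_
  linear_combination (qPochInf p p * qPochInf q q) * hF0 + Real.pi * dblPoch p q (p * q) * (r1 - r2)

end

/-! ### Evaluation of the elliptic beta integral. -/

section

variable {p q : ℂ} (hp₀ : p ≠ 0) (hq₀ : q ≠ 0) (hp : ‖p‖ < 1) (hq : ‖q‖ < 1)

theorem circInt_div_swap (a b c d e f : ℂ) :
    circInt p q ![a, b, c, d, e, f] / betaValue p q ![a, b, c, d, e, f] =
      circInt p q ![b, a, c, d, e, f] / betaValue p q ![b, a, c, d, e, f] := by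
  have h : ![a, b, c, d, e, f] = ![b, a, c, d, e, f] ∘ Equiv.swap (0 : Fin 6) 1 := by
    funext j
    fin_cases j <;> rfl
  rw [h, circInt_comp, betaValue_comp]

include hp₀ hq₀ hp hq in
-- Two applications of `circInt_div_const` move `s 0` to `e = ri` and then `s 1` to `-e`, the last
-- parameter compensating. The assumption on `s 1 * s 2 * s 3 * s 4` is the condition `‖c‖ < ‖q‖` of
-- the first move; the conditions of the second hold for `r` near `1`. The quotient of integral and
-- value is thus the constant that `circInt_const_of_eventually` computes.
theorem circInt_eq_of_lt {s : Fin 6 → ℂ} (hs : ∀ j, s j ≠ 0) (hs1 : ∀ j, ‖s j‖ < 1)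
    (hprod : ∏ j, s j = p * q) (hlt : ‖p‖ < ‖s 1 * s 2 * s 3 * s 4‖) :
    circInt p q s * (qPochInf p p * qPochInf q q) =
      4 * Real.pi * Complex.I * betaValue p q s := by
  have hN := betaValue_ne_zero hp hq hs hs1 hprod
  rw [Fin.prod_univ_six] at hprod
  have h0 := hs 0
  have h1 := hs 1
  have h2 := hs 2
  have h3 := hs 3
  have h4 := hs 4
  have hQ : s 1 * s 2 * s 3 * s 4 ≠ 0 := mul_ne_zero (mul_ne_zero (mul_ne_zero h1 h2) h3) h4
  have hQ3 : s 2 * s 3 * s 4 ≠ 0 := mul_ne_zero (mul_ne_zero h2 h3) h4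
  have hpq : ‖p * q‖ < ‖p‖ := by
    rw [norm_mul]
    exact mul_lt_of_lt_one_right (norm_pos_iff.mpr hp₀) hq
  have hlt3 : ‖s 1 * s 2 * s 3 * s 4‖ < ‖s 2 * s 3 * s 4‖ := by
    rw [show s 1 * s 2 * s 3 * s 4 = s 1 * (s 2 * s 3 * s 4) by ring, norm_mul (s 1)]
    exact mul_lt_of_lt_one_left (norm_pos_iff.mpr hQ3) (hs1 1)
  set c := p * q / (s 1 * s 2 * s 3 * s 4) with hc
  have hcn : ‖c‖ < ‖q‖ := by
    rw [hc, norm_div, div_lt_iff₀ (norm_pos_iff.mpr hQ), norm_mul p, mul_comm]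
    exact mul_lt_mul_of_pos_left hlt (norm_pos_iff.mpr hq₀)
  have hs5 : s 5 = c / s 0 := by
    rw [hc, ← hprod]
    field_simp
  have hsv : s = ![s 0, s 1, s 2, s 3, s 4, c / s 0] := by
    funext j
    fin_cases j <;> first | rfl | exact hs5
  have hc0 : ‖c‖ < ‖s 0‖ := by
    have := hs1 5
    rwa [hs5, norm_div, div_lt_one (norm_pos_iff.mpr h0)] at this
  have key : circInt p q s / betaValue p q s * (qPochInf p p * qPochInf q q) =
      4 * Real.pi * Complex.I := by
    refine circInt_const_of_eventually hp₀ hq₀ hp hq h2 h3 h4 (hs1 2) (hs1 3) (hs1 4)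
      (hpq.trans (hlt.trans hlt3)) ?_
    have ev {x : ℝ} {y : ℝ} (hxy : x < y) (k : ℕ) : ∀ᶠ r : ℝ in 𝓝[<] 1, x < r ^ k * y := by
      have hcont : ContinuousAt (fun r : ℝ => r ^ k * y) 1 := by fun_prop
      exact nhdsWithin_le_nhds (hcont.eventually (lt_mem_nhds (by simpa using hxy)))
    filter_upwards [self_mem_nhdsWithin, nhdsWithin_le_nhds (lt_mem_nhds zero_lt_one),
      ev (hcn.trans hq) 1, ev (hlt.trans hlt3) 1, ev (hpq.trans hlt) 1,
      ev (hpq.trans (hlt.trans hlt3)) 2] with r hr1 hr0 e1 e2 e3 e4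
    rw [pow_one, mul_one] at e1
    rw [pow_one] at e2 e3
    have hrn : ‖(r : ℂ) * Complex.I‖ = r := by
      rw [norm_mul, Complex.norm_I, mul_one, Complex.norm_real, Real.norm_of_nonneg hr0.le]
    set e := (r : ℂ) * Complex.I with he
    have he0 : e ≠ 0 := norm_pos_iff.mp (by rwa [hrn])
    set c' := p * q / (e * (s 2 * s 3 * s 4)) with hc'
    have hcn' : ‖c'‖ = ‖p * q‖ / (r * ‖s 2 * s 3 * s 4‖) := by
      rw [hc', norm_div, norm_mul e, hrn]
    have hpos : 0 < r * ‖s 2 * s 3 * s 4‖ := mul_pos hr0 (norm_pos_iff.mpr hQ3)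
    have hstep := circInt_div_const hp₀ hq₀ hp hq h1 h2 h3 h4 (hs1 1) (hs1 2) (hs1 3) (hs1 4)
      (mul_div_cancel₀ _ hQ) hcn hc0 (hs1 0) (y := e) (by rwa [hrn]) (by rwa [hrn])
    have step2 := circInt_div_const hp₀ hq₀ hp hq he0 h2 h3 h4 (by rwa [hrn]) (hs1 2) (hs1 3)
      (hs1 4) (c := c') (by rw [hc']; field_simp)
      (by
        rw [hcn', div_lt_iff₀ hpos, norm_mul p, mul_comm ‖p‖]
        exact mul_lt_mul_of_pos_left e2 (norm_pos_iff.mpr hq₀))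
      (x := s 1) (y := -e)
      (by
        rw [hcn', div_lt_iff₀ hpos]
        refine e3.trans_eq ?_
        rw [show s 1 * s 2 * s 3 * s 4 = s 1 * (s 2 * s 3 * s 4) by ring, norm_mul (s 1)]
        ring) (hs1 1)
      (by
        rw [norm_neg, hrn, hcn', div_lt_iff₀ hpos]
        refine e4.trans_eq ?_
        ring)
      (by rwa [norm_neg, hrn])
    rw [← hsv, circInt_div_swap, show c / e = c' / s 1 by rw [hc, hc']; field_simp, step2,
      circInt_div_swap, show c' / -e = -(p * q / (s 2 * s 3 * s 4)) / e ^ 2 by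
        rw [hc']; field_simp] at hstep
    have hpn : ‖-(p * q / (s 2 * s 3 * s 4)) / e ^ 2‖ < 1 := by
      rw [norm_div, norm_neg, norm_div, norm_pow, hrn, div_div, div_lt_one
        (mul_pos (norm_pos_iff.mpr hQ3) (pow_pos hr0 2)), mul_comm ‖s 2 * s 3 * s 4‖]
      exact e4
    have hne : betaValue p q ![e, -e, s 2, s 3, s 4, -(p * q / (s 2 * s 3 * s 4)) / e ^ 2] ≠ 0 :=
      betaValue_ne_zero hp hq
        (forall_fin_six he0 (neg_ne_zero.mpr he0) h2 h3 h4 (div_ne_zero (neg_ne_zero.mpr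
          (div_ne_zero (mul_ne_zero hp₀ hq₀) hQ3)) (pow_ne_zero 2 he0)))
        (forall_fin_six (by change ‖e‖ < 1; rwa [hrn]) (by change ‖-e‖ < 1; rwa [norm_neg, hrn])
          (hs1 2) (hs1 3) (hs1 4) hpn)
        (by
          rw [Fin.prod_univ_six]
          simp only [Matrix.cons_val]
          field_simp)
    rw [hstep, div_mul_cancel₀ _ hne]
  rw [← key]
  field_simp

include hp₀ hq₀ hp hq in
/-- The **elliptic beta integral** over the unit circle. -/
theorem circInt_eq {s : Fin 6 → ℂ} (hs : ∀ j, s j ≠ 0) (hs1 : ∀ j, ‖s j‖ < 1)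
    (hprod : ∏ j, s j = p * q) :
    circInt p q s * (qPochInf p p * qPochInf q q) =
      4 * Real.pi * Complex.I * betaValue p q s := by
  set L : Fin 6 → ℂ := fun j => Complex.log (s j) with hL
  have hLs (j : Fin 6) : Complex.exp (L j) = s j := Complex.exp_log (hs j)
  have hLre (j : Fin 6) : (L j).re < 0 := by
    have := hs1 j
    rwa [← hLs j, Complex.norm_exp, Real.exp_lt_one_iff] at this
  -- A path of parameters with constant product: for real `τ` tending to `1` the four middle
  -- parameters tend to `1`, while the other two absorb the change. Near `τ = 1` their product
  -- exceeds `p` in modulus, and the identity theorem on the convex set `W` carries the formula back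
  -- to `τ = 0`.
  set m : ℂ := (L 1 + L 2 + L 3 + L 4) / 2 with hm
  have hmre : m.re = ((L 1).re + (L 2).re + (L 3).re + (L 4).re) / 2 := by
    simp [hm]
  set w : Fin 6 → ℂ := ![m, -L 1, -L 2, -L 3, -L 4, m] with hw
  set S : ℂ → Fin 6 → ℂ := fun τ j => Complex.exp (L j + τ * w j) with hS
  set W : Set ℂ := {τ | ∀ j, (L j + τ * w j).re < 0} with hW
  have hWo : IsOpen W := by
    have : W = ⋂ j, {τ | (L j + τ * w j).re < 0} := by
      ext τ
      simp [hW]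
    rw [this]
    exact isOpen_iInter_of_finite fun j =>
      isOpen_lt (Complex.continuous_re.comp (by fun_prop)) continuous_const
  have hWc : Convex ℝ W := by
    intro x hx y hy a b ha hb hab j
    have e : L j + (a • x + b • y) * w j = a • (L j + x * w j) + b • (L j + y * w j) := by
      have : (a : ℂ) + b = 1 := by exact_mod_cast hab
      simp only [Complex.real_smul]
      linear_combination (-L j) * this
    rw [e, Complex.add_re, Complex.smul_re, Complex.smul_re]
    rcases ha.eq_or_lt with h | h
    · have hb1 : b = 1 := by linarith
      simpa [← h, hb1] using hy j
    · have := mul_neg_of_pos_of_neg h (hx j)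
      have := mul_nonpos_of_nonneg_of_nonpos hb (hy j).le
      simp only [smul_eq_mul]
      linarith
  have hreal (x : ℝ) (hx : 0 ≤ x) (hx1 : x < 1) : (x : ℂ) ∈ W := by
    have h1 := hLre 1
    have h2 := hLre 2
    have h3 := hLre 3
    have h4 := hLre 4
    refine forall_fin_six ?_ ?_ ?_ ?_ ?_ ?_ <;>
      simp only [hw, Matrix.cons_val, Complex.add_re, Complex.re_ofReal_mul, Complex.neg_re, hmre]
    · nlinarith [hLre 0]
    · nlinarith
    · nlinarith
    · nlinarith
    · nlinarith
    · nlinarith [hLre 5]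
  have hSprod (τ : ℂ) : ∏ j, S τ j = p * q := by
    rw [hS]
    simp only
    rw [← Complex.exp_sum, ← hprod, ← prod_congr rfl fun j _ => hLs j, ← Complex.exp_sum]
    congr 1
    rw [Fin.sum_univ_six, Fin.sum_univ_six]
    simp only [hw, Matrix.cons_val, hm]
    ring
  have hS0 (τ : ℂ) (j : Fin 6) : S τ j ≠ 0 := Complex.exp_ne_zero _
  have hS1 (τ : ℂ) (hτ : τ ∈ W) (j : Fin 6) : ‖S τ j‖ < 1 := by
    rw [hS]
    simp only
    rw [Complex.norm_exp, Real.exp_lt_one_iff]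
    exact hτ j
  have hSd (j : Fin 6) : Differentiable ℂ (fun τ => S τ j) := by
    rw [hS]
    fun_prop
  set f : ℂ → ℂ := fun τ => circInt p q (S τ) * (qPochInf p p * qPochInf q q) -
    4 * Real.pi * Complex.I * betaValue p q (S τ) with hf
  have hfd : DifferentiableOn ℂ f W := fun τ hτ =>
    (DifferentiableAt.fun_sub ((differentiableAt_circInt hp hq hWo
      (fun j => (hSd j).differentiableOn) (fun τ _ => hS0 τ) hS1 hτ).fun_mul
        (differentiableAt_const _))
      ((differentiableAt_const _).fun_mul (differentiableAt_betaValue_of_norm_lt hp hq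
        (fun j => hSd j τ) (hS0 τ) (hS1 τ hτ)))).differentiableWithinAt
  have hcont : Continuous fun τ => ‖S τ 1 * S τ 2 * S τ 3 * S τ 4‖ :=
    ((((hSd 1).continuous.mul (hSd 2).continuous).mul (hSd 3).continuous).mul
      (hSd 4).continuous).norm
  have hone : ‖S 1 1 * S 1 2 * S 1 3 * S 1 4‖ = 1 := by
    simp [hS, hw]
  obtain ⟨x, hx0, hx1, hx⟩ : ∃ x : ℝ, 0 < x ∧ x < 1 ∧
      ‖p‖ < ‖S x 1 * S x 2 * S x 3 * S x 4‖ := by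
    have hc : ContinuousAt (fun x : ℝ => ‖S x 1 * S x 2 * S x 3 * S x 4‖) 1 :=
      (hcont.comp Complex.continuous_ofReal).continuousAt
    have h1 : ‖p‖ < (fun x : ℝ => ‖S x 1 * S x 2 * S x 3 * S x 4‖) 1 := by
      simp only [Complex.ofReal_one, hone]
      exact hp
    have h : ∀ᶠ x : ℝ in 𝓝[<] 1, 0 < x ∧ x < 1 ∧ ‖p‖ < ‖S x 1 * S x 2 * S x 3 * S x 4‖ := by
      filter_upwards [self_mem_nhdsWithin, nhdsWithin_le_nhds (lt_mem_nhds zero_lt_one),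
        nhdsWithin_le_nhds (hc.eventually (lt_mem_nhds h1))] with x h1 h2 h3 using ⟨h2, h1, h3⟩
    exact h.exists
  have hxW := hreal x hx0.le hx1
  have hev : f =ᶠ[𝓝 (x : ℂ)] 0 := by
    filter_upwards [hWo.mem_nhds hxW, hcont.continuousAt.eventually (lt_mem_nhds hx)] with τ h1 h2
    exact sub_eq_zero.mpr (circInt_eq_of_lt hp₀ hq₀ hp hq (hS0 τ) (hS1 τ h1) (hSprod τ) h2)
  have hz := (hfd.analyticOnNhd hWo).eqOn_zero_of_preconnected_of_eventuallyEq_zero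
    hWc.isPreconnected hxW hev (hreal 0 le_rfl zero_lt_one)
  have hS00 : S ((0 : ℝ) : ℂ) = s := by
    funext j
    simp [hS, hLs]
  simp only [hf, hS00, Pi.zero_apply] at hz
  exact sub_eq_zero.mp hz

include hp₀ hq₀ hp hq in
/-- The elliptic beta integral over any separating contour, for parameters of modulus less than
`1`. -/
theorem Separates.beta_integral {γ : ℝ → ℂ} {s : Fin 6 → ℂ}
    (h : Separates γ (paramPoints p q s)) (hs : ∀ j, s j ≠ 0) (hs1 : ∀ j, ‖s j‖ < 1)
    (hprod : ∏ j, s j = p * q) :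
    contourIntegral γ (betaKernel p q s) * (qPochInf p p * qPochInf q q) =
      4 * Real.pi * Complex.I * betaValue p q s := by
  rw [h.contourIntegral_betaKernel_eq hp hq (separates_unitCircle hp hq hs hp₀ hq₀ hs1) hs]
  exact circInt_eq hp₀ hq₀ hp hq hs hs1 hprod

end

/-! ### Shifts of the parameters by powers of `p` and `q` -/

/-- `x` is not of the form `p^a q^b` with integers `a, b`. -/
def Free (p q x : ℂ) : Prop := ∀ a b : ℤ, x ≠ p ^ a * q ^ b

section

variable {p q : ℂ}

theorem Free.swap {x : ℂ} (h : Free p q x) : Free q p x := fun a b hx => h b a (by rw [hx, mul_comm])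

theorem Free.mul_zpow (hp₀ : p ≠ 0) (hq₀ : q ≠ 0) {x : ℂ} (h : Free p q x) (a b : ℤ) :
    Free p q (x * p ^ a * q ^ b) := by
  intro c d hx
  refine h (c - a) (d - b) ?_
  rw [zpow_sub₀ hp₀, zpow_sub₀ hq₀]
  have := zpow_ne_zero a hp₀
  have := zpow_ne_zero b hq₀
  field_simp
  linear_combination hx

theorem Free.of_eq (hp₀ : p ≠ 0) (hq₀ : q ≠ 0) {x y : ℂ} (h : Free p q x) (a b : ℤ)
    (hy : y = x * p ^ a * q ^ b) : Free p q y := hy ▸ h.mul_zpow hp₀ hq₀ a b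

theorem Free.inv {x : ℂ} (h : Free p q x) : Free p q x⁻¹ := by
  intro a b hx
  refine h (-a) (-b) ?_
  rw [zpow_neg, zpow_neg, ← mul_inv, ← hx, inv_inv]

theorem Free.theta_ne_zero (hp₀ : p ≠ 0) (hp : ‖p‖ < 1) {x : ℂ} (hx : x ≠ 0) (h : Free p q x) :
    theta x p ≠ 0 := by
  intro h0
  obtain ⟨k, hk⟩ := (theta_eq_zero_iff hp₀ hp hx).mp h0
  exact h k 0 (by rw [hk, zpow_zero, mul_one])

theorem Free.generic (hp₀ : p ≠ 0) (hq₀ : q ≠ 0) (hp : ‖p‖ < 1) {x : ℂ} (hx : x ≠ 0)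
    (h : Free p q x) : Generic q p x := fun i =>
  (h.of_eq hp₀ hq₀ 0 i (by simp)).theta_ne_zero hp₀ hp (mul_ne_zero hx (zpow_ne_zero _ hq₀))

variable (hp₀ : p ≠ 0) (hq₀ : q ≠ 0) (hp : ‖p‖ < 1) (hq : ‖q‖ < 1)

include hp hq in
theorem Free.dblPoch_ne_zero {x : ℂ} (h : Free p q x) : dblPoch p q x ≠ 0 := by
  intro h0
  obtain ⟨a, b, hab⟩ := (dblPoch_eq_zero_iff hp hq x).mp h0
  refine h (-a) (-b) ?_
  rw [zpow_neg, zpow_neg, zpow_natCast, zpow_natCast, ← mul_inv]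
  refine eq_inv_of_mul_eq_one_left ?_
  rw [← mul_assoc]
  exact hab

include hp₀ hq₀ hp hq in
theorem Free.ellGamma_ne_zero {x : ℂ} (h : Free p q x) : ellGamma p q x ≠ 0 := by
  rw [ellGamma_eq]
  refine div_ne_zero ?_ (h.dblPoch_ne_zero hp hq)
  exact (h.inv.of_eq hp₀ hq₀ 1 1 (by rw [zpow_one, zpow_one]; ring)).dblPoch_ne_zero hp hq

theorem theta_pair_mul_p (hp₀ : p ≠ 0) (hp : ‖p‖ < 1) {x z : ℂ} (hx : x ≠ 0) (hz : z ≠ 0) :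
    theta (x * p * z) p * theta (x * p / z) p = (x ^ 2)⁻¹ * (theta (x * z) p * theta (x / z) p) := by
  rw [show x * p * z = x * z * p by ring, show x * p / z = x / z * p by ring,
    theta_mul_self hp₀ hp (mul_ne_zero hx hz), theta_mul_self hp₀ hp (div_ne_zero hx hz)]
  field_simp

/-- The product of the gamma factors of the kernel. -/
def gammaProd (p q : ℂ) (s : Fin 6 → ℂ) (z : ℂ) : ℂ :=
  ∏ j, ellGamma p q (s j * z) * ellGamma p q (s j / z)

/-- The change of the quotient `betaValue / gammaProd` if the parameter `u i` is multiplied by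
`q`. -/
def shiftFactor (p : ℂ) (u : Fin 6 → ℂ) (z : ℂ) (i : Fin 6) : ℂ :=
  (∏ m ∈ univ.erase i, theta (u i * u m) p) / (theta (u i * z) p * theta (u i / z) p)

/-- The quotient of the value of the beta integral and the gamma factors of its kernel. -/
def betaQuot (p q : ℂ) (s : Fin 6 → ℂ) (z : ℂ) : ℂ := betaValue p q s / gammaProd p q s z

/-- No product of two of the parameters, and no product of a parameter and `z` or `z⁻¹`, is of the
form `p^a q^b`. -/
structure FreeAt (p q : ℂ) (s : Fin 6 → ℂ) (z : ℂ) : Prop where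
  ne_zero : ∀ j, s j ≠ 0
  z_ne_zero : z ≠ 0
  pair : ∀ j k, Free p q (s j * s k)
  mul : ∀ j, Free p q (s j * z)
  div : ∀ j, Free p q (s j / z)

theorem gammaProd_swap (s : Fin 6 → ℂ) (z : ℂ) : gammaProd p q s z = gammaProd q p s z := by
  unfold gammaProd
  exact prod_congr rfl fun j _ => by rw [ellGamma_swap, ellGamma_swap p q (s j / z)]

theorem betaValue_swap (s : Fin 6 → ℂ) : betaValue p q s = betaValue q p s := by
  unfold betaValue
  exact prod_congr rfl fun j _ => prod_congr rfl fun k _ => ellGamma_swap _ _ _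

theorem betaQuot_swap (s : Fin 6 → ℂ) (z : ℂ) : betaQuot p q s z = betaQuot q p s z := by
  rw [betaQuot, betaQuot, betaValue_swap, gammaProd_swap]

theorem FreeAt.swap {s : Fin 6 → ℂ} {z : ℂ} (h : FreeAt p q s z) : FreeAt q p s z :=
  ⟨h.ne_zero, h.z_ne_zero, fun j k => (h.pair j k).swap, fun j => (h.mul j).swap,
    fun j => (h.div j).swap⟩

include hp₀ hq₀ hp hq in
theorem FreeAt.betaValue_ne_zero {s : Fin 6 → ℂ} {z : ℂ} (h : FreeAt p q s z) :
    betaValue p q s ≠ 0 :=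
  prod_ne_zero_iff.mpr fun j _ => prod_ne_zero_iff.mpr fun k _ =>
    (h.pair j k).ellGamma_ne_zero hp₀ hq₀ hp hq

include hp₀ hq₀ hp hq in
theorem FreeAt.gammaProd_ne_zero {s : Fin 6 → ℂ} {z : ℂ} (h : FreeAt p q s z) :
    gammaProd p q s z ≠ 0 :=
  prod_ne_zero_iff.mpr fun j _ => mul_ne_zero ((h.mul j).ellGamma_ne_zero hp₀ hq₀ hp hq)
    ((h.div j).ellGamma_ne_zero hp₀ hq₀ hp hq)

include hp₀ hq₀ hp hq in
theorem FreeAt.betaQuot_ne_zero {s : Fin 6 → ℂ} {z : ℂ} (h : FreeAt p q s z) :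
    betaQuot p q s z ≠ 0 :=
  div_ne_zero (h.betaValue_ne_zero hp₀ hq₀ hp hq) (h.gammaProd_ne_zero hp₀ hq₀ hp hq)

include hp hq hq₀ in
theorem FreeAt.betaQuot_update {u : Fin 6 → ℂ} {z : ℂ} (h : FreeAt p q u z) (i : Fin 6) :
    betaQuot p q (Function.update u i (u i * q)) z = betaQuot p q u z * shiftFactor p u z i := by
  have hz := h.z_ne_zero
  have e : gammaProd p q (Function.update u i (u i * q)) z =
      gammaProd p q u z * (theta (u i * z) p * theta (u i / z) p) := by
    unfold gammaProd
    rw [← mul_prod_erase univ _ (mem_univ i), ← mul_prod_erase univ _ (mem_univ i),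
      Function.update_self, show u i * q * z = u i * z * q by ring,
      show u i * q / z = u i / z * q by ring,
      ellGamma_mul_q hq₀ hp hq (mul_ne_zero (h.ne_zero i) hz) ((h.mul i).dblPoch_ne_zero hp hq),
      ellGamma_mul_q hq₀ hp hq (div_ne_zero (h.ne_zero i) hz) ((h.div i).dblPoch_ne_zero hp hq),
      prod_congr rfl fun m hm => by rw [Function.update_of_ne (ne_of_mem_erase hm)]]
    ring
  rw [betaQuot, betaQuot, shiftFactor, e,
    betaValue_update hq₀ hp hq h.ne_zero i fun m => (h.pair i m).dblPoch_ne_zero hp hq]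
  rw [mul_div_mul_comm]

include hp₀ hp in
-- All theta functions involved are quasi-periodic under `p`, and because the product of the
-- parameters is `1` the dependence on `z` drops out. The factor `-(u i * u l)⁻¹` separates into a
-- function of `i` and one of `l`, which makes the two kinds of shifts independent.
theorem shiftFactor_update {u : Fin 6 → ℂ} {z : ℂ} (hu : ∀ j, u j ≠ 0) (hz : z ≠ 0)
    (hprod : ∏ j, u j = 1) (i l : Fin 6) :
    shiftFactor p (Function.update u l (u l * p)) z i =
      -(u i * u l)⁻¹ * shiftFactor p u z i := by
  unfold shiftFactor
  by_cases hl : l = i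
  · subst hl
    rw [Function.update_self, theta_pair_mul_p hp₀ hp (hu l) hz]
    have e1 : ∏ m ∈ univ.erase l, theta (u l * p * Function.update u l (u l * p) m) p =
        (∏ m ∈ univ.erase l, -(u l)⁻¹) * (∏ m ∈ univ.erase l, u m)⁻¹ *
          ∏ m ∈ univ.erase l, theta (u l * u m) p := by
      rw [← prod_inv_distrib, ← prod_mul_distrib, ← prod_mul_distrib]
      refine prod_congr rfl fun m hm => ?_
      rw [Function.update_of_ne (ne_of_mem_erase hm), show u l * p * u m = u l * u m * p by ring,
        theta_mul_self hp₀ hp (mul_ne_zero (hu l) (hu m)), mul_inv]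
      ring
    have e2 : (∏ m ∈ univ.erase l, u m)⁻¹ = u l := by
      rw [← mul_prod_erase univ u (mem_univ l)] at hprod
      exact inv_eq_of_mul_eq_one_left hprod
    have hc : (univ.erase l : Finset (Fin 6)).card = 5 := by
      rw [card_erase_of_mem (mem_univ l)]
      rfl
    rw [e1, e2, prod_const, hc]
    have := hu l
    generalize ∏ m ∈ univ.erase l, theta (u l * u m) p = P
    generalize theta (u l * z) p = a
    generalize theta (u l / z) p = b
    rw [mul_div_mul_comm]
    field_simp
  · have hml : l ∈ univ.erase i := mem_erase.mpr ⟨hl, mem_univ l⟩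
    rw [Function.update_of_ne (Ne.symm hl), ← mul_prod_erase _ _ hml,
      ← mul_prod_erase (univ.erase i) (fun m => theta (u i * u m) p) hml, Function.update_self,
      show u i * (u l * p) = u i * u l * p by ring,
      theta_mul_self hp₀ hp (mul_ne_zero (hu i) (hu l)),
      prod_congr rfl fun m hm => by rw [Function.update_of_ne (ne_of_mem_erase hm)]]
    ring

/-- The parameters multiplied by powers of `q` and `p`. -/
def shifted (q p : ℂ) (t : Fin 6 → ℂ) (α β : Fin 6 → ℤ) (j : Fin 6) : ℂ :=
  t j * q ^ α j * p ^ β j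

theorem shifted_swap (t : Fin 6 → ℂ) (α β : Fin 6 → ℤ) :
    shifted q p t α β = shifted p q t β α := by
  funext j
  simp only [shifted]
  ring

theorem shifted_zero (t : Fin 6 → ℂ) : shifted q p t 0 0 = t := by
  funext j
  simp [shifted]

include hq₀ in
theorem shifted_add_single (t : Fin 6 → ℂ) (α β : Fin 6 → ℤ) (i : Fin 6) :
    shifted q p t (α + Pi.single i 1) β =
      Function.update (shifted q p t α β) i (shifted q p t α β i * q) := by
  funext j
  by_cases hj : j = i
  · subst hj
    simp only [shifted, Function.update_self, Pi.add_apply, Pi.single_eq_same]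
    rw [zpow_add_one₀ hq₀]
    ring
  · simp only [shifted, Function.update_of_ne hj, Pi.add_apply, Pi.single_eq_of_ne hj, add_zero]

include hp₀ in
theorem shifted_add_single' (t : Fin 6 → ℂ) (α β : Fin 6 → ℤ) (i : Fin 6) :
    shifted q p t α (β + Pi.single i 1) =
      Function.update (shifted q p t α β) i (shifted q p t α β i * p) := by
  rw [shifted_swap, shifted_add_single hp₀, shifted_swap]

include hp₀ hq₀ in
theorem FreeAt.shifted {t : Fin 6 → ℂ} {z : ℂ} (h : FreeAt p q t z) (α β : Fin 6 → ℤ) :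
    FreeAt p q (shifted q p t α β) z where
  ne_zero j := mul_ne_zero (mul_ne_zero (h.ne_zero j) (zpow_ne_zero _ hq₀)) (zpow_ne_zero _ hp₀)
  z_ne_zero := h.z_ne_zero
  pair j k := (h.pair j k).of_eq hp₀ hq₀ (β j + β k) (α j + α k) (by
    rw [EllHyp.shifted, EllHyp.shifted, zpow_add₀ hp₀, zpow_add₀ hq₀]
    ring)
  mul j := (h.mul j).of_eq hp₀ hq₀ (β j) (α j) (by rw [EllHyp.shifted]; ring)
  div j := (h.div j).of_eq hp₀ hq₀ (β j) (α j) (by rw [EllHyp.shifted]; ring)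

include hp₀ hq₀ in
theorem prod_shifted (t : Fin 6 → ℂ) (α β : Fin 6 → ℤ) :
    ∏ j, shifted q p t α β j = (∏ j, t j) * q ^ (∑ j, α j) * p ^ (∑ j, β j) := by
  simp only [Fin.prod_univ_six, Fin.sum_univ_six, shifted, zpow_add₀ hp₀, zpow_add₀ hq₀]
  ring

include hp₀ hq₀ hp hq in
/-- The changes of `betaQuot` under a shift by `q` and a shift by `p` are independent of each
other. -/
theorem FreeAt.betaQuot_square {t : Fin 6 → ℂ} {z : ℂ} (h : FreeAt p q t z)
    (hprod : ∏ j, t j = p * q) {α β : Fin 6 → ℤ} (hα : ∑ j, α j = -1) (hβ : ∑ j, β j = -1)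
    (i k j l : Fin 6) :
    betaQuot p q (EllHyp.shifted q p t (α + Pi.single i 1) (β + Pi.single j 1)) z *
        betaQuot p q (EllHyp.shifted q p t (α + Pi.single k 1) (β + Pi.single l 1)) z =
      betaQuot p q (EllHyp.shifted q p t (α + Pi.single i 1) (β + Pi.single l 1)) z *
        betaQuot p q (EllHyp.shifted q p t (α + Pi.single k 1) (β + Pi.single j 1)) z := by
  have hu := h.shifted hp₀ hq₀ α β
  have hprod' : ∏ j, EllHyp.shifted q p t α β j = 1 := by
    rw [prod_shifted hp₀ hq₀, hα, hβ, hprod, zpow_neg_one, zpow_neg_one]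
    field_simp
  -- In the cross ratio of four such expressions everything cancels, as each is a product of a
  -- factor depending on `i` and one depending on `j`.
  have key (i j : Fin 6) :
      betaQuot p q (EllHyp.shifted q p t (α + Pi.single i 1) (β + Pi.single j 1)) z =
        betaQuot p q (EllHyp.shifted q p t α (β + Pi.single j 1)) z *
        (-(EllHyp.shifted q p t α β i * EllHyp.shifted q p t α β j)⁻¹ *
          shiftFactor p (EllHyp.shifted q p t α β) z i) := by
    rw [shifted_add_single hq₀, (h.shifted hp₀ hq₀ α (β + Pi.single j 1)).betaQuot_update hq₀ hp hq,
      ← shiftFactor_update hp₀ hp hu.ne_zero h.z_ne_zero hprod', ← shifted_add_single' hp₀]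
  rw [key, key, key, key]
  simp only [mul_inv]
  ring

end

/-! ### Chains of shifts, and the moments they produce. -/

section

variable {p q : ℂ}

/-- The exponents that can be reached from `0` by moving units from one position to another, so
that all the exponents stay above `a`. -/
inductive Reachable (a : Fin 6 → ℤ) : (Fin 6 → ℤ) → Prop
  | zero : Reachable a 0
  | step {γ : Fin 6 → ℤ} {i k : Fin 6} (hik : i ≠ k) (ha : a ≤ γ) (hγ : ∑ j, γ j = -1)
      (h : Reachable a (γ + Pi.single k 1)) : Reachable a (γ + Pi.single i 1)

theorem Reachable.le {a α : Fin 6 → ℤ} (ha : a ≤ 0) (h : Reachable a α) : a ≤ α := by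
  induction h with
  | zero => exact ha
  | step _ h' _ _ _ => exact h'.trans (le_add_of_nonneg_right (by simp))

theorem Reachable.comp {a α : Fin 6 → ℤ} (h : Reachable a α) (σ : Equiv.Perm (Fin 6)) :
    Reachable (a ∘ σ) (α ∘ σ) := by
  have e (γ : Fin 6 → ℤ) (i : Fin 6) :
      (γ + Pi.single i 1) ∘ σ = γ ∘ σ + Pi.single (σ.symm i) 1 := by
    funext j
    simp [Pi.single_apply, Equiv.eq_symm_apply]
  induction h with
  | zero => exact Reachable.zero
  | @step γ i k hik h' hγ _ ih =>
    rw [e] at ih ⊢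
    refine Reachable.step (σ.symm.injective.ne hik) (fun j => h' (σ j)) ?_ ih
    rw [← hγ]
    exact Equiv.sum_comp σ γ

variable (hp₀ : p ≠ 0) (hq₀ : q ≠ 0) (hp : ‖p‖ < 1) (hq : ‖q‖ < 1)

include hp₀ hq₀ hp hq in
-- The square relation `FreeAt.betaQuot_square`, multiplied up along the chain that leads from `0`
-- to `α`.
theorem FreeAt.betaQuot_exchange {t : Fin 6 → ℂ} {z : ℂ} (h : FreeAt p q t z)
    (hprod : ∏ j, t j = p * q) {a α : Fin 6 → ℤ} (hα : Reachable a α) {β : Fin 6 → ℤ}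
    (hβ : ∑ j, β j = -1) (j l : Fin 6) :
    betaQuot p q (EllHyp.shifted q p t α (β + Pi.single j 1)) z *
        betaQuot p q (EllHyp.shifted q p t 0 (β + Pi.single l 1)) z =
      betaQuot p q (EllHyp.shifted q p t 0 (β + Pi.single j 1)) z *
        betaQuot p q (EllHyp.shifted q p t α (β + Pi.single l 1)) z := by
  induction hα with
  | zero => rfl
  | @step γ i k _ _ hγ _ ih =>
    have sq := h.betaQuot_square hp₀ hq₀ hp hq hprod hγ hβ i k j l
    have hne := (h.shifted hp₀ hq₀ (γ + Pi.single k 1) (β + Pi.single l 1)).betaQuot_ne_zero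
      hp₀ hq₀ hp hq
    refine mul_left_cancel₀ hne ?_
    linear_combination
      betaQuot p q (EllHyp.shifted q p t 0 (β + Pi.single l 1)) z * sq +
      betaQuot p q (EllHyp.shifted q p t (γ + Pi.single i 1) (β + Pi.single l 1)) z * ih

include hp₀ hq₀ hp hq in
-- The relation for one step of the `p`-chain is `FreeAt.betaQuot_exchange`; induction over that
-- chain gives the claim. This separation of the two bases is the reason why the biorthogonality is
-- a product of a statement for `q` and one for `p`.
theorem FreeAt.betaQuot_mul {t : Fin 6 → ℂ} {z : ℂ} (h : FreeAt p q t z)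
    (hprod : ∏ j, t j = p * q) {a b α β : Fin 6 → ℤ} (hα : Reachable a α) (hβ : Reachable b β) :
    betaQuot p q (EllHyp.shifted q p t α β) z * betaQuot p q t z =
      betaQuot p q (EllHyp.shifted q p t α 0) z * betaQuot p q (EllHyp.shifted q p t 0 β) z := by
  induction hβ with
  | zero => rw [shifted_zero]
  | @step γ j l _ _ hγ _ ih =>
    have ex := h.betaQuot_exchange hp₀ hq₀ hp hq hprod hα hγ j l
    have hne := (h.shifted hp₀ hq₀ 0 (γ + Pi.single l 1)).betaQuot_ne_zero hp₀ hq₀ hp hq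
    refine mul_left_cancel₀ hne ?_
    linear_combination betaQuot p q t z * ex +
      betaQuot p q (EllHyp.shifted q p t 0 (γ + Pi.single j 1)) z * ih

include hp₀ hq₀ hp hq in
/-- The change of `betaQuot` if the factor `q` is moved from the parameter with index `k` to the
parameter with index `i`. -/
theorem FreeAt.betaQuot_step {r : Fin 6 → ℂ} {z : ℂ} (h : FreeAt p q r z)
    (hprod : ∏ j, r j = q) {α : Fin 6 → ℤ} (hα : ∑ j, α j = -1) {i k : Fin 6} (hik : i ≠ k)
    (l : Fin 6) {w : Fin 6 → ℂ} (hw : ∀ j, w j = r j * q ^ α j) :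
    betaQuot p q (EllHyp.shifted q p r (α + Pi.single i 1) (Pi.single l 1)) z *
        (theta (w i * z) p * theta (w i / z) p) *
        ∏ m ∈ (univ.erase i).erase k, theta (w k * w m)⁻¹ p =
      betaQuot p q (EllHyp.shifted q p r (α + Pi.single k 1) (Pi.single l 1)) z *
        (theta (z / w k) p * theta (w k * z)⁻¹ p) *
        ∏ m ∈ (univ.erase i).erase k, theta (w i * w m) p := by
  have hw' : w = EllHyp.shifted q p r α 0 := by
    funext j
    simp [EllHyp.shifted, hw]
  have hf : FreeAt p q w z := hw' ▸ h.shifted hp₀ hq₀ α 0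
  have hwp : ∏ j, w j = 1 := by
    rw [hw', prod_shifted hp₀ hq₀, hα, hprod]
    simp [hq₀]
  have hz := hf.z_ne_zero
  have hwi := hf.ne_zero i
  have hwk := hf.ne_zero k
  have key (i : Fin 6) :
      betaQuot p q (EllHyp.shifted q p r (α + Pi.single i 1) (Pi.single l 1)) z =
        betaQuot p q (EllHyp.shifted q p r α (Pi.single l 1)) z *
        (-(w i * w l)⁻¹ * shiftFactor p w z i) := by
    rw [shifted_add_single hq₀, (h.shifted hp₀ hq₀ α (Pi.single l 1)).betaQuot_update hq₀ hp hq,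
      ← shiftFactor_update hp₀ hp hf.ne_zero hz hwp, hw', ← shifted_add_single' hp₀, zero_add]
  have hki : k ∈ univ.erase i := mem_erase.mpr ⟨hik.symm, mem_univ k⟩
  have hik' : i ∈ univ.erase k := mem_erase.mpr ⟨hik, mem_univ i⟩
  have e1 : shiftFactor p w z i = theta (w i * w k) p *
      (∏ m ∈ (univ.erase i).erase k, theta (w i * w m) p) /
        (theta (w i * z) p * theta (w i / z) p) := by
    rw [shiftFactor, ← mul_prod_erase _ _ hki]
  have e2 : shiftFactor p w z k = theta (w i * w k) p *
      (∏ m ∈ (univ.erase i).erase k, theta (w k * w m) p) /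
        (theta (w k * z) p * theta (w k / z) p) := by
    rw [shiftFactor, ← mul_prod_erase _ _ hik', erase_right_comm, mul_comm (w k) (w i)]
  -- Theta functions of inverse arguments appear because the denominators are Pochhammer symbols of
  -- `q / (r k * r m)`, whose arguments grow while `r k` is divided by powers of `q`.
  have e3 : ∏ m ∈ (univ.erase i).erase k, theta (w k * w m) p = w k ^ 3 * (w i)⁻¹ *
      ∏ m ∈ (univ.erase i).erase k, theta (w k * w m)⁻¹ p := by
    have hc : ((univ.erase i).erase k : Finset (Fin 6)).card = 4 := by
      rw [card_erase_of_mem hki, card_erase_of_mem (mem_univ i)]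
      rfl
    have hE : ∏ m ∈ (univ.erase i).erase k, w m = (w i)⁻¹ * (w k)⁻¹ := by
      rw [← mul_prod_erase univ w (mem_univ i), ← mul_prod_erase _ w hki] at hwp
      field_simp
      linear_combination hwp
    have : w k ^ 3 * (w i)⁻¹ = ∏ m ∈ (univ.erase i).erase k, -(w k * w m) := by
      rw [prod_neg, hc, prod_mul_distrib, prod_const, hc, hE]
      field_simp
    rw [this, ← prod_mul_distrib]
    refine prod_congr rfl fun m _ => ?_
    have hm := mul_ne_zero hwk (hf.ne_zero m)
    rw [theta_inv hp hm, ← mul_assoc, neg_mul_neg, mul_inv_cancel₀ hm, one_mul]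
  have e4 : theta (w k * z) p * theta (w k / z) p =
      w k ^ 2 * (theta (z / w k) p * theta (w k * z)⁻¹ p) := by
    rw [theta_inv hp (mul_ne_zero hwk hz), theta_div_comm hp hz hwk]
    field_simp
  have n1 : theta (z / w k) p ≠ 0 := by
    rw [← inv_div]
    exact (hf.div k).inv.theta_ne_zero hp₀ hp (inv_ne_zero (div_ne_zero hwk hz))
  have n2 : theta (w k * z)⁻¹ p ≠ 0 :=
    (hf.mul k).inv.theta_ne_zero hp₀ hp (inv_ne_zero (mul_ne_zero hwk hz))
  have n3 : theta (w i * z) p ≠ 0 := (hf.mul i).theta_ne_zero hp₀ hp (mul_ne_zero hwi hz)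
  have n4 : theta (w i / z) p ≠ 0 := (hf.div i).theta_ne_zero hp₀ hp (div_ne_zero hwi hz)
  have hwl := hf.ne_zero l
  rw [key i, key k, e1, e2, e3, e4]
  generalize (∏ m ∈ (univ.erase i).erase k, theta (w i * w m) p) = P
  generalize (∏ m ∈ (univ.erase i).erase k, theta (w k * w m)⁻¹ p) = Q
  generalize theta (w k * z)⁻¹ p = a1 at *
  generalize theta (z / w k) p = a2 at *
  generalize theta (w i * z) p = a3 at *
  generalize theta (w i / z) p = a4 at *
  generalize theta (w i * w k) p = a5 at *
  field_simp

/-- The product `(cz;q,p)_n (c/z;q,p)_n`. -/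
def pairPoch (q p c : ℂ) (n : ℕ) (z : ℂ) : ℂ := ellPoch q p (c * z) n * ellPoch q p (c / z) n

/-- The moments of the products `(r₀z^±)_j (r₃z^±)_i / ((qz^±/r₄)_j (qz^±/r₅)_i)`. -/
def moment (q p : ℂ) (r : Fin 6 → ℂ) (j i : ℕ) : ℂ :=
  (ellPoch q p (r 0 * r 1) j * ellPoch q p (r 0 * r 2) j * ellPoch q p (r 0 * r 3) j *
      ellPoch q p (r 0 * r 5) j) /
    (ellPoch q p (q / (r 4 * r 1)) j * ellPoch q p (q / (r 4 * r 2)) j *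
      ellPoch q p (q / (r 4 * r 3)) j * ellPoch q p (q / (r 4 * r 5)) j) *
  ((ellPoch q p (r 3 * r 0 * q ^ j) i * ellPoch q p (r 3 * r 1) i * ellPoch q p (r 3 * r 2) i *
      ellPoch q p (r 3 * r 4 / q ^ j) i) /
    (ellPoch q p (q / (r 5 * r 0 * q ^ j)) i * ellPoch q p (q / (r 5 * r 1)) i *
      ellPoch q p (q / (r 5 * r 2)) i * ellPoch q p (q * q ^ j / (r 5 * r 4)) i))

/-- The exponents of the shift that belongs to `moment q p r j i`. -/
def move (j i : ℕ) : Fin 6 → ℤ := ![j, 0, 0, i, -j, -i]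

theorem move_zero : move 0 0 = 0 := by
  funext m
  fin_cases m <;> simp [move]

theorem move_succ_left (j : ℕ) : move (j + 1) 0 = ![(j : ℤ), 0, 0, 0, -j - 1, 0] + Pi.single 0 1 := by
  funext m
  fin_cases m <;> simp [move] <;> ring

theorem move_eq_left (j : ℕ) : move j 0 = ![(j : ℤ), 0, 0, 0, -j - 1, 0] + Pi.single 4 1 := by
  funext m
  fin_cases m <;> simp +decide [move]

theorem move_succ_right (j i : ℕ) :
    move j (i + 1) = ![(j : ℤ), 0, 0, i, -j, -i - 1] + Pi.single 3 1 := by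
  funext m
  fin_cases m <;> simp +decide [move] <;> ring

theorem move_eq_right (j i : ℕ) :
    move j i = ![(j : ℤ), 0, 0, i, -j, -i - 1] + Pi.single 5 1 := by
  funext m
  fin_cases m <;> simp +decide [move]

/-- First `j` units go from position `4` to position `0`, then `i` units from `5` to `3`. The
exponents are negative only at `4` and `5`, so the bounds there suffice. -/
theorem reachable_move {a : Fin 6 → ℤ} (ha : a ≤ 0) {j i : ℕ} (h4 : a 4 ≤ -j) (h5 : a 5 ≤ -i) :
    Reachable a (move j i) := by
  have h1 {j : ℕ} (h4 : a 4 ≤ -j) : Reachable a (move j 0) := by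
    induction j with
    | zero => exact move_zero ▸ Reachable.zero
    | succ j ih =>
      rw [move_succ_left]
      push_cast at h4
      refine Reachable.step (k := 4) (by decide) ?_ (by simp [Fin.sum_univ_six]; ring) ?_
      · refine forall_fin_six (h0 := ?_) (ha 1) (ha 2) (ha 3) ?_ (ha 5)
        · exact (ha 0).trans (by simp)
        · simp only [Matrix.cons_val]
          linarith
      · rw [← move_eq_left]
        exact ih (by linarith)
  induction i with
  | zero => exact h1 h4
  | succ i ih =>
    rw [move_succ_right]
    push_cast at h5
    refine Reachable.step (k := 5) (by decide) ?_ (by simp [Fin.sum_univ_six]; ring) ?_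
    · refine forall_fin_six (h0 := ?_) (ha 1) (ha 2) ?_ h4 ?_
      · exact (ha 0).trans (by simp)
      · exact (ha 3).trans (by simp)
      · simp only [Matrix.cons_val]
        linarith
    · rw [← move_eq_right]
      exact ih (by linarith)

theorem Free.poch_ne_zero (hp₀ : p ≠ 0) (hq₀ : q ≠ 0) (hp : ‖p‖ < 1) {x : ℂ} (hx : x ≠ 0)
    (h : Free p q x) (n : ℕ) : ellPoch q p x n ≠ 0 :=
  (h.generic hp₀ hq₀ hp hx).poch_ne_zero hq₀ 0 n (by simp)

theorem mul_div_eq_of_step {B B' C D E M N u v U V : ℂ} (st : B' * u * V = B * v * U)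
    (ih : B * (N / D) = C * (M / E)) (hv : v ≠ 0) (hV : V ≠ 0) :
    B' * (N * u / (D * v)) = C * (M * U / (E * V)) := by
  calc B' * (N * u / (D * v)) = (B' * u * V) * (N / D) * (v⁻¹ * V⁻¹) := by
        field_simp
    _ = (B * (N / D)) * U * V⁻¹ := by
        rw [st]
        field_simp
    _ = C * (M * U / (E * V)) := by
        rw [ih]
        ring

include hp₀ hq₀ hp hq in
-- Each unit that is moved contributes, by `FreeAt.betaQuot_step`, one more theta factor to each
-- Pochhammer symbol. The inner induction makes the `j` moves from `4` to `0`; the outer one then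
-- makes the `i` moves from `5` to `3` with parameters already changed by `q ^ j`.
theorem FreeAt.betaQuot_move {r : Fin 6 → ℂ} {z : ℂ} (h : FreeAt p q r z)
    (hprod : ∏ j, r j = q) (l : Fin 6) (j i : ℕ) :
    betaQuot p q (EllHyp.shifted q p r (move j i) (Pi.single l 1)) z *
        (pairPoch q p (r 0) j z / pairPoch q p (q / r 4) j z *
          (pairPoch q p (r 3) i z / pairPoch q p (q / r 5) i z)) =
      betaQuot p q (EllHyp.shifted q p r 0 (Pi.single l 1)) z * moment q p r j i := by
  have hr := h.ne_zero
  have hz := h.z_ne_zero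
  have fq {x : ℂ} (hx : x ≠ 0) (hf : Free p q x) (n : ℕ) : ellPoch q p (q / x) n ≠ 0 :=
    (hf.inv.of_eq hp₀ hq₀ 0 1 (y := q / x) (by simp; ring)).poch_ne_zero hp₀ hq₀ hp
      (div_ne_zero hq₀ hx) n
  have fq' (k : Fin 6) (n : ℕ) : pairPoch q p (q / r k) n z ≠ 0 := by
    refine mul_ne_zero ?_ ?_
    · rw [show q / r k * z = q / (r k / z) by field_simp]
      exact fq (div_ne_zero (hr k) hz) (h.div k) n
    · rw [div_div]
      exact fq (mul_ne_zero (hr k) hz) (h.mul k) n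
  have hqj (n : ℕ) := pow_ne_zero n hq₀
  have m0 (a b : Fin 6) : r a * r b ≠ 0 := mul_ne_zero (hr a) (hr b)
  induction i with
  | zero =>
    induction j with
    | zero => simp [pairPoch, moment, move_zero]
    | succ j ih =>
      set w : Fin 6 → ℂ := fun m => r m * q ^ (![(j : ℤ), 0, 0, 0, -j - 1, 0] m) with hw
      have st := h.betaQuot_step hp₀ hq₀ hp hq hprod (α := ![(j : ℤ), 0, 0, 0, -j - 1, 0])
        (by simp [Fin.sum_univ_six]; ring) (i := 0) (k := 4) (by decide) l (w := w) (fun m => rfl)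
      rw [← move_succ_left, ← move_eq_left] at st
      have e : ((univ.erase 0).erase 4 : Finset (Fin 6)) = {1, 2, 3, 5} := by decide
      have w0 : w 0 = r 0 * q ^ j := by simp [hw]
      have w1 : w 1 = r 1 := by simp [hw]
      have w2 : w 2 = r 2 := by simp [hw]
      have w3 : w 3 = r 3 := by simp [hw]
      have w5 : w 5 = r 5 := by simp [hw]
      have w4 : w 4 = r 4 / q ^ (j + 1) := by
        simp only [hw, Matrix.cons_val]
        rw [show (-(j : ℤ) - 1) = -((j + 1 : ℕ) : ℤ) by push_cast; ring, zpow_neg, zpow_natCast,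
          div_eq_mul_inv]
      rw [e, prod_insert (by decide), prod_insert (by decide), prod_insert (by decide),
        prod_singleton, prod_insert (by decide), prod_insert (by decide), prod_insert (by decide),
        prod_singleton, w0, w1, w2, w3, w4, w5] at st
      simp only [moment, pairPoch, ellPoch_zero, mul_one, div_one] at ih ⊢
      have a1 (x : ℂ) : q / (r 4 * x) * q ^ j = (r 4 / q ^ (j + 1) * x)⁻¹ := by
        rw [mul_inv, inv_div, pow_succ, div_mul_eq_mul_div, mul_comm q, div_eq_mul_inv, mul_inv]
        ring
      have a2 : q / r 4 * z * q ^ j = z / (r 4 / q ^ (j + 1)) := by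
        rw [pow_succ]
        field_simp
      have a3 : q / r 4 / z * q ^ j = (r 4 / q ^ (j + 1) * z)⁻¹ := by
        rw [div_div, a1]
      have a4 (x : ℂ) : r 0 * x * q ^ j = r 0 * q ^ j * x := by ring
      have a5 : r 0 / z * q ^ j = r 0 * q ^ j / z := by ring
      have d1 := fq' 4 (j + 1)
      have d2 (m : Fin 6) := fq (m0 4 m) (h.pair 4 m) (j + 1)
      simp only [pairPoch, ellPoch_succ, a1, a2, a3, mul_ne_zero_iff] at d1 d2
      refine Eq.trans ?_ ((mul_div_eq_of_step st ih (mul_ne_zero d1.1.2 d1.2.2)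
        (mul_ne_zero (d2 1).2 (mul_ne_zero (d2 2).2 (mul_ne_zero (d2 3).2 (d2 5).2)))).trans ?_)
      · simp only [ellPoch_succ, a2, a3, a4, a5]
        ring
      · simp only [ellPoch_succ, a1, a4]
        ring
  | succ i ih =>
    set w : Fin 6 → ℂ := fun m => r m * q ^ (![(j : ℤ), 0, 0, i, -j, -i - 1] m) with hw
    have st := h.betaQuot_step hp₀ hq₀ hp hq hprod (α := ![(j : ℤ), 0, 0, i, -j, -i - 1])
      (by simp [Fin.sum_univ_six]; ring) (i := 3) (k := 5) (by decide) l (w := w) (fun m => rfl)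
    rw [← move_succ_right, ← move_eq_right] at st
    have e : ((univ.erase 3).erase 5 : Finset (Fin 6)) = {0, 1, 2, 4} := by decide
    have w0 : w 0 = r 0 * q ^ j := by simp [hw]
    have w1 : w 1 = r 1 := by simp [hw]
    have w2 : w 2 = r 2 := by simp [hw]
    have w3 : w 3 = r 3 * q ^ i := by simp [hw]
    have w4 : w 4 = r 4 / q ^ j := by simp [hw, div_eq_mul_inv]
    have w5 : w 5 = r 5 / q ^ (i + 1) := by
      simp only [hw, Matrix.cons_val]
      rw [show (-(i : ℤ) - 1) = -((i + 1 : ℕ) : ℤ) by push_cast; ring, zpow_neg, zpow_natCast,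
        div_eq_mul_inv]
    rw [e, prod_insert (by decide), prod_insert (by decide), prod_insert (by decide),
      prod_singleton, prod_insert (by decide), prod_insert (by decide), prod_insert (by decide),
      prod_singleton, w0, w1, w2, w3, w4, w5] at st
    have a1 (x : ℂ) : q / (r 5 * x) * q ^ i = (r 5 / q ^ (i + 1) * x)⁻¹ := by
      rw [mul_inv, inv_div, pow_succ, div_mul_eq_mul_div, mul_comm q, div_eq_mul_inv, mul_inv]
      ring
    have a2 : q / r 5 * z * q ^ i = z / (r 5 / q ^ (i + 1)) := by
      rw [pow_succ]
      field_simp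
    have a3 : q / r 5 / z * q ^ i = (r 5 / q ^ (i + 1) * z)⁻¹ := by
      rw [div_div, a1]
    have a4 (x : ℂ) : r 3 * x * q ^ i = r 3 * q ^ i * x := by ring
    have a5 : r 3 / z * q ^ i = r 3 * q ^ i / z := by ring
    have a6 : q / (r 5 * r 0 * q ^ j) * q ^ i = (r 5 / q ^ (i + 1) * (r 0 * q ^ j))⁻¹ := by
      rw [← a1, mul_assoc]
    have a7 : q * q ^ j / (r 5 * r 4) * q ^ i = (r 5 / q ^ (i + 1) * (r 4 / q ^ j))⁻¹ := by
      rw [← a1]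
      have := hqj j
      field_simp
    have a8 : r 3 * r 0 * q ^ j * q ^ i = r 3 * q ^ i * (r 0 * q ^ j) := by ring
    have a9 : r 3 * r 4 / q ^ j * q ^ i = r 3 * q ^ i * (r 4 / q ^ j) := by ring
    have d1 := fq' 5 (i + 1)
    have d2 (m : Fin 6) := fq (m0 5 m) (h.pair 5 m) (i + 1)
    have d3 : ellPoch q p (q / (r 5 * r 0 * q ^ j)) (i + 1) ≠ 0 :=
      fq (mul_ne_zero (m0 5 0) (hqj j)) ((h.pair 5 0).of_eq hp₀ hq₀ 0 j (by simp)) _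
    have d4 : ellPoch q p (q * q ^ j / (r 5 * r 4)) (i + 1) ≠ 0 := by
      rw [← div_div_eq_mul_div]
      exact fq (div_ne_zero (m0 5 4) (hqj j))
        ((h.pair 5 4).of_eq hp₀ hq₀ 0 (-j) (by simp [div_eq_mul_inv])) _
    rw [ellPoch_succ, a6] at d3
    rw [ellPoch_succ, a7] at d4
    simp only [pairPoch, ellPoch_succ, a1, a2, a3, mul_ne_zero_iff] at d1 d2
    rw [moment, div_mul_div_comm, div_mul_div_comm] at ih
    refine Eq.trans ?_ ((mul_div_eq_of_step st ih (mul_ne_zero d1.1.2 d1.2.2)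
      (mul_ne_zero (right_ne_zero_of_mul d3) (mul_ne_zero (d2 1).2 (mul_ne_zero (d2 2).2
        (right_ne_zero_of_mul d4))))).trans ?_)
    · simp only [pairPoch, ellPoch_succ, a2, a3, a4, a5]
      ring
    · simp only [moment, ellPoch_succ, a1, a4, a6, a7, a8, a9]
      ring

end

/-! ### Integrals of shifted kernels along a fixed contour. -/

section

variable {p q : ℂ}

/-- No product of two of the parameters is of the form `p^a q^b`. -/
structure FreeParams (p q : ℂ) (s : Fin 6 → ℂ) : Prop where
  ne_zero : ∀ j, s j ≠ 0
  pair : ∀ j k, Free p q (s j * s k)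

theorem FreeParams.swap {s : Fin 6 → ℂ} (h : FreeParams p q s) : FreeParams q p s :=
  ⟨h.ne_zero, fun j k => (h.pair j k).swap⟩

theorem countable_setOf_not_free (f : ℂ → ℂ) (hf : Function.Injective f) :
    {z | ¬ Free p q (f z)}.Countable := by
  have : {z | ¬ Free p q (f z)} ⊆ f ⁻¹' (Set.range fun x : ℤ × ℤ => p ^ x.1 * q ^ x.2) := by
    intro z hz
    simp only [Free, Set.mem_ofPred_eq, not_forall, not_not] at hz
    obtain ⟨a, b, h⟩ := hz
    exact ⟨(a, b), h.symm⟩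
  exact ((Set.countable_range _).preimage_of_injOn hf.injOn).mono this

/-- No product of a parameter and `z` or `z⁻¹` is of the form `p^a q^b`. -/
structure RegularAt (p q : ℂ) (t : Fin 6 → ℂ) (z : ℂ) : Prop where
  ne_zero : z ≠ 0
  mul : ∀ j, Free p q (t j * z)
  div : ∀ j, Free p q (t j / z)

theorem countable_not_regularAt {s : Fin 6 → ℂ} (hs : ∀ j, s j ≠ 0) :
    {z | ¬ RegularAt p q s z}.Countable := by
  have : {z | ¬ RegularAt p q s z} ⊆ ({0} : Set ℂ) ∪ ((⋃ j, {z | ¬ Free p q (s j * z)}) ∪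
      ⋃ j, {z | ¬ Free p q (s j / z)}) := by
    intro z hz
    by_contra hc
    simp only [Set.mem_union, Set.mem_singleton_iff, Set.mem_iUnion, Set.mem_ofPred_eq, not_or,
      not_exists, not_not] at hc
    exact hz ⟨hc.1, hc.2.1, hc.2.2⟩
  refine Set.Countable.mono this ((Set.countable_singleton 0).union
    ((Set.countable_iUnion fun j => ?_).union (Set.countable_iUnion fun j => ?_)))
  · exact countable_setOf_not_free _ (mul_right_injective₀ (hs j))
  · refine countable_setOf_not_free _ fun x y hxy => ?_
    simpa [div_eq_mul_inv, hs j] using hxy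

theorem FreeParams.countable_not_freeAt {s : Fin 6 → ℂ} (h : FreeParams p q s) :
    {z | ¬ FreeAt p q s z}.Countable := by
  refine (countable_not_regularAt (p := p) (q := q) h.ne_zero).mono ?_
  intro z hz (hz' : RegularAt p q s z)
  exact hz ⟨h.ne_zero, hz'.ne_zero, h.pair, hz'.mul, hz'.div⟩

theorem betaKernel_swap (hp : ‖p‖ < 1) (hq : ‖q‖ < 1) (s : Fin 6 → ℂ) {z : ℂ} (hz : z ≠ 0) :
    betaKernel p q s z = betaKernel q p s z := by
  have e := gammaProd_swap (p := p) (q := q) s z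
  unfold gammaProd at e
  rw [betaKernel, betaKernel, e, theta_inv hp (pow_ne_zero 2 hz), theta_inv hq (pow_ne_zero 2 hz)]
  ring

variable (hp₀ : p ≠ 0) (hq₀ : q ≠ 0) (hp : ‖p‖ < 1) (hq : ‖q‖ < 1)

include hp₀ hq₀ in
theorem paramPoints_shifted_subset (t : Fin 6 → ℂ) {a b α β : Fin 6 → ℤ} (ha : a ≤ α)
    (hb : b ≤ β) :
    paramPoints p q (shifted q p t α β) ⊆ paramPoints p q (shifted q p t a b) := by
  rintro w ⟨j, c, d, rfl⟩
  refine ⟨j, c + (β j - b j).toNat, d + (α j - a j).toNat, ?_⟩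
  have e1 := Int.toNat_of_nonneg (sub_nonneg.mpr (ha j))
  have e2 := Int.toNat_of_nonneg (sub_nonneg.mpr (hb j))
  have h1 : q ^ (α j) = q ^ (a j) * q ^ (α j - a j).toNat := by
    rw [← zpow_natCast, e1, ← zpow_add₀ hq₀]
    ring_nf
  have h2 : p ^ (β j) = p ^ (b j) * p ^ (β j - b j).toNat := by
    rw [← zpow_natCast, e2, ← zpow_add₀ hp₀]
    ring_nf
  simp only [shifted]
  rw [h1, h2, pow_add, pow_add]
  ring

theorem paramPoints_swap (s : Fin 6 → ℂ) : paramPoints p q s = paramPoints q p s := by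
  ext w
  constructor
  · rintro ⟨j, a, b, rfl⟩
    exact ⟨j, b, a, by ring⟩
  · rintro ⟨j, a, b, rfl⟩
    exact ⟨j, b, a, by ring⟩

include hp₀ hq₀ in
theorem FreeParams.shifted {t : Fin 6 → ℂ} (h : FreeParams p q t) (α β : Fin 6 → ℤ) :
    FreeParams p q (shifted q p t α β) where
  ne_zero j := mul_ne_zero (mul_ne_zero (h.ne_zero j) (zpow_ne_zero _ hq₀)) (zpow_ne_zero _ hp₀)
  pair j k := (h.pair j k).of_eq hp₀ hq₀ (β j + β k) (α j + α k) (by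
    rw [EllHyp.shifted, EllHyp.shifted, zpow_add₀ hp₀, zpow_add₀ hq₀]
    ring)

include hp₀ hq₀ hp hq in
theorem FreeParams.betaValue_ne_zero {s : Fin 6 → ℂ} (h : FreeParams p q s) :
    betaValue p q s ≠ 0 :=
  prod_ne_zero_iff.mpr fun j _ => prod_ne_zero_iff.mpr fun k _ =>
    (h.pair j k).ellGamma_ne_zero hp₀ hq₀ hp hq

include hp₀ hq₀ hp hq in
-- Induction along the chain, one application of `Separates.integral_shift` per step. The lower
-- bound in `Reachable` ensures that the points of each intermediate parameter set are among those
-- separated by the contour, so the contour never has to change.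
theorem Separates.integral_mul_of_reachable {γ : ℝ → ℂ} {t : Fin 6 → ℂ} {a b : Fin 6 → ℤ}
    (h : Separates γ (paramPoints p q (shifted q p t a b))) (ht : FreeParams p q t)
    (hprod : ∏ j, t j = p * q) {α β : Fin 6 → ℤ} (hα : Reachable a α) (hβ : b ≤ β)
    (hβs : ∑ j, β j = 0) :
    contourIntegral γ (betaKernel p q (shifted q p t α β)) *
        betaValue p q (shifted q p t 0 β) =
      contourIntegral γ (betaKernel p q (shifted q p t 0 β)) *
        betaValue p q (shifted q p t α β) := by
  induction hα with
  | zero => rfl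
  | @step δ i k hik hδ hs _ ih =>
    have hf := ht.shifted hp₀ hq₀ δ β
    have hS := h.mono (paramPoints_shifted_subset hp₀ hq₀ t hδ hβ)
    have key := hS.integral_shift hp₀ hq₀ hp hq hf.ne_zero (by
      rw [prod_shifted hp₀ hq₀, hs, hβs, hprod, zpow_neg_one, zpow_zero]
      field_simp) (fun j k _ => (hf.pair j k).theta_ne_zero hp₀ hp
        (mul_ne_zero (hf.ne_zero j) (hf.ne_zero k))) hik
    rw [← shifted_add_single hq₀, ← shifted_add_single hq₀] at key
    have hne := (ht.shifted hp₀ hq₀ (δ + Pi.single k 1) β).betaValue_ne_zero hp₀ hq₀ hp hq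
    refine mul_right_cancel₀ hne ?_
    linear_combination betaValue p q (EllHyp.shifted q p t 0 β) * key +
      betaValue p q (EllHyp.shifted q p t (δ + Pi.single i 1) β) * ih

theorem Reachable.sum_eq_zero {a α : Fin 6 → ℤ} (h : Reachable a α) : ∑ j, α j = 0 := by
  induction h with
  | zero => simp
  | step _ _ hγ _ _ => simp [sum_add_distrib, hγ]

include hp₀ hq₀ hp hq in
/-- The elliptic beta integral for the shifted parameters. -/
theorem Separates.beta_integral_shifted {γ : ℝ → ℂ} {t : Fin 6 → ℂ} {a b : Fin 6 → ℤ}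
    (h : Separates γ (paramPoints p q (shifted q p t a b))) (ht : FreeParams p q t)
    (ht1 : ∀ j, ‖t j‖ < 1) (hprod : ∏ j, t j = p * q) (ha : a ≤ 0) (hb : b ≤ 0)
    {α β : Fin 6 → ℤ} (hα : Reachable a α) (hβ : Reachable b β) :
    contourIntegral γ (betaKernel p q (shifted q p t α β)) * (qPochInf p p * qPochInf q q) =
      4 * Real.pi * Complex.I * betaValue p q (shifted q p t α β) := by
  have h0 := h.mono (paramPoints_shifted_subset hp₀ hq₀ t ha hb)
  rw [shifted_zero] at h0
  have e0 := h0.beta_integral hp₀ hq₀ hp hq ht.ne_zero ht1 hprod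
  have h' := h
  rw [paramPoints_swap, shifted_swap] at h'
  -- The path is: from `t` by the `p`-shift `β`, with the roles of `p` and `q` exchanged, and then
  -- by the `q`-shift `α`.
  have e1 := h'.integral_mul_of_reachable hq₀ hp₀ hq hp ht.swap (by rw [hprod, mul_comm]) hβ
    (β := 0) ha (by simp)
  have e2 := h.integral_mul_of_reachable hp₀ hq₀ hp hq ht hprod hα (hβ.le hb) hβ.sum_eq_zero
  have sw (s : Fin 6 → ℂ) : contourIntegral γ (betaKernel q p s) =
      contourIntegral γ (betaKernel p q s) :=
    contourIntegral_congr_of_countable Set.countable_empty fun s hs _ =>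
      betaKernel_swap hq hp _ (h.ne_zero s hs)
  rw [sw, sw, ← betaValue_swap (p := p), ← betaValue_swap (p := p), shifted_zero,
    ← shifted_swap] at e1
  have n1 := ht.betaValue_ne_zero hp₀ hq₀ hp hq
  have n2 := (ht.shifted hp₀ hq₀ 0 β).betaValue_ne_zero hp₀ hq₀ hp hq
  refine mul_right_cancel₀ n2 (mul_right_cancel₀ n1 ?_)
  linear_combination (qPochInf p p * qPochInf q q) * betaValue p q t * e2 +
    (qPochInf p p * qPochInf q q) * betaValue p q (EllHyp.shifted q p t α β) * e1 +
    betaValue p q (EllHyp.shifted q p t α β) * betaValue p q (EllHyp.shifted q p t 0 β) * e0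

/-- The function `F` is the quotient of the kernels with the parameters shifted by `q^α` and the
parameters `t`, up to the factor by which the values of the beta integrals differ from `μ`. -/
def HasMoment (p q : ℂ) (t : Fin 6 → ℂ) (α : Fin 6 → ℤ) (F : ℂ → ℂ) (μ : ℂ) : Prop :=
  ∀ z, FreeAt p q t z → betaQuot p q (shifted q p t α 0) z * F z = betaQuot p q t z * μ

theorem betaKernel_eq_gammaProd (s : Fin 6 → ℂ) (z : ℂ) :
    betaKernel p q s z = gammaProd p q s z * (theta (z ^ 2) p * theta ((z ^ 2)⁻¹) q / z) := by
  rw [betaKernel, gammaProd, mul_div_assoc]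

include hp₀ hq₀ hp hq in
-- By `FreeAt.betaQuot_mul` the product of a `q`-part and a `p`-part belongs to the simultaneous
-- shift, so the integrand is a constant multiple of one shifted kernel, whose integral is known.
theorem HasMoment.kernel_eq {t : Fin 6 → ℂ} {z : ℂ} (h : FreeAt p q t z)
    (hprod : ∏ j, t j = p * q) {a b α β : Fin 6 → ℤ} (hα : Reachable a α) (hβ : Reachable b β)
    {F G : ℂ → ℂ} {μ ν : ℂ} (hF : HasMoment p q t α F μ) (hG : HasMoment q p t β G ν) :
    F z * G z * betaKernel p q t z =
      betaKernel p q (shifted q p t α β) z *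
        (betaValue p q t * μ * ν / betaValue p q (shifted q p t α β)) := by
  have e1 := hF z h
  have e2 := hG z h.swap
  rw [betaQuot_swap, betaQuot_swap (p := q) t, ← shifted_swap] at e2
  have e3 := h.betaQuot_mul hp₀ hq₀ hp hq hprod hα hβ
  have n0 := h.betaQuot_ne_zero hp₀ hq₀ hp hq
  have key : betaQuot p q (shifted q p t α β) z * (F z * G z) = betaQuot p q t z * (μ * ν) := by
    refine mul_right_cancel₀ n0 ?_
    linear_combination F z * G z * e3 + betaQuot p q (shifted q p t 0 β) z * G z * e1 +
      betaQuot p q t z * μ * e2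
  rw [betaQuot, betaQuot] at key
  have hs := h.shifted hp₀ hq₀ α β
  have n1 := hs.betaValue_ne_zero hp₀ hq₀ hp hq
  have n2 := hs.gammaProd_ne_zero hp₀ hq₀ hp hq
  have n3 := h.gammaProd_ne_zero hp₀ hq₀ hp hq
  rw [betaKernel_eq_gammaProd, betaKernel_eq_gammaProd]
  generalize gammaProd p q (shifted q p t α β) z = g at *
  generalize betaValue p q (shifted q p t α β) = v at *
  generalize gammaProd p q t z = g₀ at *
  generalize betaValue p q t = v₀ at *
  generalize theta (z ^ 2) p * theta (z ^ 2)⁻¹ q / z = w at *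
  field_simp at key ⊢
  linear_combination w * key

include hp₀ hq₀ hp hq in
theorem Separates.contourIntegrable_moment {γ : ℝ → ℂ} {t : Fin 6 → ℂ} {a b : Fin 6 → ℤ}
    (h : Separates γ (paramPoints p q (shifted q p t a b))) (ht : FreeParams p q t)
    (hprod : ∏ j, t j = p * q) (ha : a ≤ 0) (hb : b ≤ 0)
    {α β : Fin 6 → ℤ} (hα : Reachable a α) (hβ : Reachable b β)
    {F G : ℂ → ℂ} {μ ν : ℂ} (hF : HasMoment p q t α F μ) (hG : HasMoment q p t β G ν) :
    ContourIntegrable γ fun z => F z * G z * betaKernel p q t z := by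
  refine contourIntegrable_congr_of_countable ht.countable_not_freeAt
    (g := fun z => betaKernel p q (shifted q p t α β) z *
        (betaValue p q t * μ * ν / betaValue p q (shifted q p t α β))) (fun s _ hsE => ?_) ?_
  · exact hF.kernel_eq hp₀ hq₀ hp hq (not_not.mp hsE) hprod hα hβ hG
  · have := (h.mono (paramPoints_shifted_subset hp₀ hq₀ t (hα.le ha)
      (hβ.le hb))).contourIntegrable_betaKernel hp hq (ht.shifted hp₀ hq₀ α β).ne_zero
    unfold ContourIntegrable at this ⊢
    convert this.mul_const (betaValue p q t * μ * ν / betaValue p q (shifted q p t α β)) using 2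
    ring

include hp₀ hq₀ hp hq in
theorem Separates.integral_moment {γ : ℝ → ℂ} {t : Fin 6 → ℂ} {a b : Fin 6 → ℤ}
    (h : Separates γ (paramPoints p q (shifted q p t a b))) (ht : FreeParams p q t)
    (ht1 : ∀ j, ‖t j‖ < 1) (hprod : ∏ j, t j = p * q) (ha : a ≤ 0) (hb : b ≤ 0)
    {α β : Fin 6 → ℤ} (hα : Reachable a α) (hβ : Reachable b β)
    {F G : ℂ → ℂ} {μ ν : ℂ} (hF : HasMoment p q t α F μ) (hG : HasMoment q p t β G ν) :
    contourIntegral γ (fun z => F z * G z * betaKernel p q t z) * (qPochInf p p * qPochInf q q) =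
      4 * Real.pi * Complex.I * betaValue p q t * μ * ν := by
  have e1 : contourIntegral γ (fun z => F z * G z * betaKernel p q t z) =
      contourIntegral γ (betaKernel p q (shifted q p t α β)) *
        (betaValue p q t * μ * ν / betaValue p q (shifted q p t α β)) := by
    rw [contourIntegral_congr_of_countable ht.countable_not_freeAt
      (g := fun z => betaKernel p q (shifted q p t α β) z *
        (betaValue p q t * μ * ν / betaValue p q (shifted q p t α β)))
      fun s _ hsE => hF.kernel_eq hp₀ hq₀ hp hq (not_not.mp hsE) hprod hα hβ hG]
    unfold contourIntegral
    rw [← intervalIntegral.integral_mul_const]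
    congr 1
    funext s
    ring
  have e2 := h.beta_integral_shifted hp₀ hq₀ hp hq ht ht1 hprod ha hb hα hβ
  have n1 := (ht.shifted hp₀ hq₀ α β).betaValue_ne_zero hp₀ hq₀ hp hq
  rw [e1]
  field_simp
  linear_combination (betaValue p q t * μ * ν) * e2

end

/-! ### The Frenkel–Turaev sum under weaker genericity assumptions. -/

theorem eq_of_eventually_of_countable {f g : ℂ → ℂ} {x : ℂ} (hf : ContinuousAt f x)
    (hg : ContinuousAt g x) {E : Set ℂ} (hE : E.Countable)
    (h : ∀ᶠ y in 𝓝 x, y ∉ E → f y = g y) : f x = g x := by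
  have hd : Dense Eᶜ := hE.dense_compl ℂ
  have hn : (𝓝[Eᶜ] x).NeBot := mem_closure_iff_nhdsWithin_neBot.mp (hd x)
  refine tendsto_nhds_unique (f := f) (l := 𝓝[Eᶜ] x) (hf.mono_left inf_le_left) ?_
  refine (hg.mono_left (inf_le_left : 𝓝[Eᶜ] x ≤ 𝓝 x)).congr' ?_
  refine eventually_nhdsWithin_iff.mpr ?_
  filter_upwards [h] with y hy hyE using (hy hyE).symm

section

variable {p q : ℂ} (hp₀ : p ≠ 0) (hq₀ : q ≠ 0) (hp : ‖p‖ < 1)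

include hp in
theorem continuousAt_theta_comp {X : Type*} [TopologicalSpace X] {f : X → ℂ} {x : X}
    (hf : ContinuousAt f x) (h : f x ≠ 0) :
    ContinuousAt (fun y => theta (f y) p) x :=
  ContinuousAt.comp (f := f) (g := fun y => theta y p)
    (differentiableAt_theta hp h).continuousAt hf

include hp hq₀ in
theorem continuousAt_ellPoch_comp {X : Type*} [TopologicalSpace X] {f : X → ℂ} {x : X}
    (hf : ContinuousAt f x) (h : f x ≠ 0) (n : ℕ) : ContinuousAt (fun y => ellPoch q p (f y) n) x := by
  unfold ellPoch
  refine tendsto_finsetProd _ fun j _ => ?_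
  exact continuousAt_theta_comp hp (hf.mul continuousAt_const) (mul_ne_zero h (pow_ne_zero j hq₀))

include hp hp₀ hq₀ in
theorem countable_setOf_not_generic_div {c : ℂ} (hc : c ≠ 0) :
    {d | d ≠ 0 ∧ ¬ Generic q p (c / d)}.Countable := by
  have : {d | d ≠ 0 ∧ ¬ Generic q p (c / d)} ⊆
      ⋃ i : ℤ, (fun d => c / d * q ^ i) ⁻¹' {x | x ≠ 0 ∧ theta x p = 0} := by
    intro d hd
    simp only [Generic, Set.mem_ofPred_eq, not_forall, not_not] at hd
    obtain ⟨hd0, i, h⟩ := hd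
    exact Set.mem_iUnion.mpr ⟨i, mul_ne_zero (div_ne_zero hc hd0) (zpow_ne_zero i hq₀), h⟩
  refine (Set.countable_iUnion fun i => Set.Countable.preimage_of_injOn ?_ ?_).mono this
  · exact countable_setOf_theta_eq_zero hp₀ hp
  · intro x _ y _ hxy
    simpa [div_eq_mul_inv, hc, zpow_ne_zero i hq₀] using hxy

include hp₀ hq₀ hp in
/-- The summation formula of Frenkel and Turaev, if only the parameters of the denominators are
generic. -/
theorem frenkel_turaev_of_generic_den
    {a b c d : ℂ} (ha : a ≠ 0) (hb : b ≠ 0) (hc : c ≠ 0) (hd : d ≠ 0)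
    (ga : Generic q p a) (gb : Generic q p (a / b)) (gc : Generic q p (a / c))
    (gd : Generic q p (a / d)) (gbc : Generic q p (a / (b * c)))
    (gbcd : Generic q p (a / (b * c * d))) (n : ℕ) (hn : ellPoch q p q n ≠ 0) :
    ∑ k ∈ range (n + 1), ftTerm q p a b c d (a ^ 2 * q ^ (n + 1) / (b * c * d)) n k =
      ftSum q p a b c d n := by
  have hid : ContinuousAt (fun x : ℂ => x) d := continuousAt_id
  have hdiv {x y : ℂ} (hy : y ≠ 0) : ContinuousAt (fun d => x / (y * d)) d :=
    continuousAt_const.div (continuousAt_const.mul hid) (mul_ne_zero hy hd)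
  have hdiv' {x : ℂ} : ContinuousAt (fun d => x / d) d := continuousAt_const.div hid hd
  have cP {f : ℂ → ℂ} (hf : ContinuousAt f d) (h : f d ≠ 0) (n : ℕ) :=
    continuousAt_ellPoch_comp hq₀ hp hf h n
  have cc {x : ℂ} : ContinuousAt (fun _ : ℂ => x) d := continuousAt_const
  have hqn := pow_ne_zero (n + 1) hq₀
  have hbc := mul_ne_zero hb hc
  have haq := mul_ne_zero ha hq₀
  have he0 : a ^ 2 * q ^ (n + 1) / (b * c * d) ≠ 0 := by positivity
  have n1 := gb.ellPoch_ne_zero hq₀ 1 n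
  have n2 := gc.ellPoch_ne_zero hq₀ 1 n
  have n3 := gd.ellPoch_ne_zero hq₀ 1 n
  have n4 := gbcd.ellPoch_ne_zero hq₀ 1 n
  have n5 : ellPoch q p (a * q / (a ^ 2 * q ^ (n + 1) / (b * c * d))) n ≠ 0 := by
    refine (gbcd.inv hq₀ hp (by positivity)).poch_ne_zero hq₀ (-n) n ?_
    rw [zpow_neg, zpow_natCast]
    field_simp
    ring
  have n6 : ellPoch q p (a * q ^ (n + 1)) n ≠ 0 := by
    exact ga.poch_ne_zero hq₀ (n + 1 : ℕ) n (by rw [zpow_natCast])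
  simp only [zpow_one, div_mul_eq_mul_div] at n1 n2 n3 n4
  -- Both sides are continuous in `d`, and the conditions on `d` that the generic formula needs
  -- exclude only countably many values.
  refine eq_of_eventually_of_countable
    (f := fun d => ∑ k ∈ range (n + 1), ftTerm q p a b c d (a ^ 2 * q ^ (n + 1) / (b * c * d)) n k)
    (g := fun d => ftSum q p a b c d n)
    (E := {d | d ≠ 0 ∧ ¬ Generic q p (a / d)} ∪ {d | d ≠ 0 ∧ ¬ Generic q p (a / b / d)} ∪
      {d | d ≠ 0 ∧ ¬ Generic q p (a / c / d)} ∪ {d | d ≠ 0 ∧ ¬ Generic q p (a / (b * c) / d)} ∪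
      {d | d ≠ 0 ∧ ¬ Generic q p (a ^ 2 / (b * c) / d)}) ?_ ?_ ?_ ?_
  · refine tendsto_finsetSum _ fun k hk => ?_
    have hk' : k ≤ n := Nat.lt_succ_iff.mp (mem_range.mp hk)
    have he : ContinuousAt (fun d => a ^ 2 * q ^ (n + 1) / (b * c * d)) d := hdiv hbc
    have hae : ContinuousAt (fun d => a * q / (a ^ 2 * q ^ (n + 1) / (b * c * d))) d :=
      cc.div he he0
    refine ContinuousAt.mul (ContinuousAt.mul cc (ContinuousAt.div ?_ ?_ ?_)) cc
    · exact ((((cc.mul cc).mul cc).mul (cP hid hd k)).mul (cP he he0 k)).mul cc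
    · exact ((((cc.mul cc).mul cc).mul (cP hdiv' (div_ne_zero haq hd) k)).mul
        (cP hae (div_ne_zero haq he0) k)).mul cc
    · exact mul_ne_zero (mul_ne_zero (mul_ne_zero (mul_ne_zero (mul_ne_zero
        (ellPoch_ne_zero_of_le hk' hn) (ellPoch_ne_zero_of_le hk' n1))
        (ellPoch_ne_zero_of_le hk' n2)) (ellPoch_ne_zero_of_le hk' n3))
        (ellPoch_ne_zero_of_le hk' n5)) (ellPoch_ne_zero_of_le hk' n6)
  · refine ContinuousAt.div ?_ ?_ ?_
    · exact ((cc.mul cc).mul (cP (hdiv hb) (div_ne_zero haq (mul_ne_zero hb hd)) n)).mul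
        (cP (hdiv hc) (div_ne_zero haq (mul_ne_zero hc hd)) n)
    · exact ((cc.mul cc).mul (cP hdiv' (div_ne_zero haq hd) n)).mul
        (cP (hdiv hbc) (div_ne_zero haq (mul_ne_zero hbc hd)) n)
    · exact mul_ne_zero (mul_ne_zero (mul_ne_zero n1 n2) n3) n4
  · have ct {c : ℂ} (hc : c ≠ 0) := countable_setOf_not_generic_div hp₀ hq₀ hp hc
    exact ((((ct ha).union (ct (div_ne_zero ha hb))).union (ct (div_ne_zero ha hc))).union
      (ct (div_ne_zero ha hbc))).union (ct (div_ne_zero (pow_ne_zero 2 ha) hbc))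
  · filter_upwards [eventually_ne_nhds hd] with y hy hyE
    simp only [Set.mem_union, Set.mem_ofPred_eq, not_or, not_and, not_not, div_div] at hyE
    exact frenkel_turaev hq₀ hp₀ hp ha hb hc hy ga gb gc (hyE.1.1.1.1 hy) gbc (hyE.1.1.1.2 hy)
      (hyE.1.1.2 hy) (hyE.1.2 hy) (hyE.2 hy) n hn

end

/-! ### Re-expansion of the well poised series in another basis. -/

section

variable {p q : ℂ} (hp₀ : p ≠ 0) (hq₀ : q ≠ 0) (hp : ‖p‖ < 1)

theorem pairPoch_zero (q p c z : ℂ) : pairPoch q p c 0 z = 1 := by simp [pairPoch]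

theorem pairPoch_succ (q p c : ℂ) (n : ℕ) (z : ℂ) :
    pairPoch q p c (n + 1) z =
      pairPoch q p c n z * (theta (c * q ^ n * z) p * theta (c * q ^ n / z) p) := by
  rw [pairPoch, pairPoch, ellPoch_succ, ellPoch_succ, show c * z * q ^ n = c * q ^ n * z by ring,
    show c / z * q ^ n = c * q ^ n / z by ring]
  ring

theorem pairPoch_add (q p c : ℂ) (m n : ℕ) (z : ℂ) :
    pairPoch q p c (m + n) z = pairPoch q p c m z * pairPoch q p (c * q ^ m) n z := by
  rw [pairPoch, pairPoch, pairPoch, ellPoch_add, ellPoch_add,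
    show c * z * q ^ m = c * q ^ m * z by ring, show c / z * q ^ m = c * q ^ m / z by ring]
  ring

theorem pairPoch_eq_prod (q p c : ℂ) (n : ℕ) (z : ℂ) :
    pairPoch q p c n z = ∏ k ∈ range n, (theta (c * q ^ k * z) p * theta (c * q ^ k / z) p) := by
  induction n with
  | zero => simp [pairPoch_zero]
  | succ n ih => rw [pairPoch_succ, prod_range_succ, ih]

include hp₀ hp in
-- By the addition formula, in the form `theta_pair` with `t = z`, `s = 1/z`, the functions
-- `θ(cz)θ(c/z)` lie in a space of dimension two, spanned by those for `b` and `x`.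
theorem exists_theta_pair {b x c : ℂ} (hb : b ≠ 0) (hx : x ≠ 0) (hc : c ≠ 0)
    (h₁ : theta (b * x) p ≠ 0) (h₂ : theta (b / x) p ≠ 0) :
    ∃ α β : ℂ, ∀ z, z ≠ 0 → theta (c * z) p * theta (c / z) p =
      α * (theta (b * z) p * theta (b / z) p) + β * (theta (x * z) p * theta (x / z) p) := by
  refine ⟨theta (c * x) p * theta (c / x) p / (theta (b * x) p * theta (b / x) p),
    -(b / x * (theta (c * b) p * theta (c / b) p)) / (theta (b * x) p * theta (b / x) p),
    fun z hz => ?_⟩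
  have key := theta_pair hp₀ hp hz (inv_ne_zero hz) hc hb hx
  simp only [mul_inv_cancel₀ hz, mul_one, ← div_eq_mul_inv] at key
  rw [div_mul_eq_mul_div, div_mul_eq_mul_div, ← add_div, eq_div_iff (mul_ne_zero h₁ h₂), key]
  ring

include hp₀ hq₀ hp in
/-- Every product of `m` pairs `θ(cz)θ(c/z)` is a linear combination of the functions
`(bz^±)_j (xq^jz^±)_(m-j)`. -/
theorem exists_prod_theta_pair_eq_sum {b x : ℂ} (hb : b ≠ 0) (hx : x ≠ 0)
    (g₁ : Generic q p (b * x)) (g₂ : Generic q p (b / x)) (m : ℕ) {c : ℕ → ℂ}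
    (hc : ∀ k, c k ≠ 0) :
    ∃ C : ℕ → ℂ, ∀ z, z ≠ 0 → ∏ k ∈ range m, (theta (c k * z) p * theta (c k / z) p) =
      ∑ j ∈ range (m + 1), C j * (pairPoch q p b j z * pairPoch q p (x * q ^ j) (m - j) z) := by
  induction m generalizing x with
  | zero => exact ⟨fun _ => 1, fun z _ => by simp [pairPoch_zero]⟩
  | succ m ih =>
    -- With `xq` instead of `x`, the next factor, written in the pairs for `b q^j` and `x q^j`,
    -- either appends to `(bz^±)_j` or prepends to `(xq^(j+1)z^±)_(m-j)`.
    obtain ⟨C, hC⟩ := ih (x := x * q) (mul_ne_zero hx hq₀)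
      (g₁.of_eq hq₀ 1 (by rw [zpow_one]; ring))
      (g₂.of_eq hq₀ (-1) (by rw [zpow_neg_one, div_mul_eq_div_div]; ring))
    have hab (j : ℕ) := exists_theta_pair hp₀ hp (mul_ne_zero hb (pow_ne_zero j hq₀))
      (mul_ne_zero hx (pow_ne_zero j hq₀)) (hc m)
      (g₁.theta_ne_zero (j + j) (by rw [zpow_add₀ hq₀, zpow_natCast]; ring))
      (g₂.theta_ne_zero 0 (by
        have := pow_ne_zero j hq₀
        rw [zpow_zero]
        field_simp))
    choose α β h using hab
    refine ⟨fun j => (if j = 0 then 0 else C (j - 1) * α (j - 1)) +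
      if j = m + 1 then 0 else C j * β j, fun z hz => ?_⟩
    have e (j : ℕ) (hj : j ≤ m) :
        C j * (pairPoch q p b j z * pairPoch q p (x * q * q ^ j) (m - j) z) *
          (theta (c m * z) p * theta (c m / z) p) =
        C j * α j * (pairPoch q p b (j + 1) z * pairPoch q p (x * q ^ (j + 1)) (m - j) z) +
        C j * β j * (pairPoch q p b j z * pairPoch q p (x * q ^ j) (m + 1 - j) z) := by
      rw [h j z hz, pairPoch_succ, show m + 1 - j = 1 + (m - j) by omega, pairPoch_add,
        show pairPoch q p (x * q ^ j) 1 z = theta (x * q ^ j * z) p * theta (x * q ^ j / z) p by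
          simp [pairPoch_eq_prod], show x * q * q ^ j = x * q ^ (j + 1) by ring,
        show x * q ^ j * q ^ 1 = x * q ^ (j + 1) by ring]
      ring
    rw [prod_range_succ, hC z hz, sum_mul,
      sum_congr rfl fun j hj => e j (Nat.lt_succ_iff.mp (mem_range.mp hj)), sum_add_distrib]
    simp only [add_mul]
    rw [sum_add_distrib]
    congr 1
    · rw [sum_range_succ' _ (m + 1)]
      simp
    · rw [sum_range_succ _ (m + 1)]
      simp only [if_true, zero_mul, add_zero]
      refine sum_congr rfl fun j hj => ?_
      rw [if_neg (mem_range.mp hj).ne]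

/-- The coefficients of the very well poised series `wpSeries`. -/
def wpCoeff (q p : ℂ) (r : Fin 6 → ℂ) (n i : ℕ) : ℂ :=
  theta (r 3 / r 4 * q ^ (2 * i)) p / theta (r 3 / r 4) p *
    ((ellPoch q p (r 3 / r 4) i * ellPoch q p (q / (r 0 * r 4)) i * ellPoch q p (q / (r 1 * r 4)) i *
        ellPoch q p (q / (r 2 * r 4)) i * ellPoch q p (q ^ (-(n : ℤ))) i *
        ellPoch q p (q ^ n / (r 4 * r 5)) i) /
      (ellPoch q p q i * ellPoch q p (r 0 * r 3) i * ellPoch q p (r 1 * r 3) i *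
        ellPoch q p (r 2 * r 3) i * ellPoch q p (r 3 / r 4 * q ^ (n + 1)) i *
        ellPoch q p (r 3 * r 5 * q ^ (1 - (n : ℤ))) i)) * q ^ i

/-- The terminating very well poised series with six parameters, whose product is `q`. -/
def wpSeries (q p : ℂ) (r : Fin 6 → ℂ) (n : ℕ) (z : ℂ) : ℂ :=
  ∑ i ∈ range (n + 1), wpCoeff q p r n i * (pairPoch q p (r 3) i z / pairPoch q p (q / r 4) i z)

include hp₀ hq₀ hp in
-- Over the common denominator `(qz^±/r₄)_m` all numerators are products of `m` theta pairs. The top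
-- coefficient is found at `z = r₄/q^m`, where only the terms of order `m` survive.
theorem exists_wpSeries_eq_sum {r : Fin 6 → ℂ} (hr : ∀ j, r j ≠ 0) (g₁ : Generic q p (r 0 * r 4))
    (g₂ : Generic q p (r 0 / r 4)) (m : ℕ) :
    ∃ C : ℕ → ℂ, (∀ z, z ≠ 0 → pairPoch q p (q / r 4) m z ≠ 0 → wpSeries q p r m z =
        ∑ j ∈ range (m + 1), C j * (pairPoch q p (r 0) j z / pairPoch q p (q / r 4) j z)) ∧
      C m * pairPoch q p (r 0) m (r 4 / q ^ m) =
        wpCoeff q p r m m * pairPoch q p (r 3) m (r 4 / q ^ m) := by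
  have hx : q / r 4 ≠ 0 := div_ne_zero hq₀ (hr 4)
  have hex (i : ℕ) : ∃ C : ℕ → ℂ, ∀ z, z ≠ 0 → i ≤ m →
      pairPoch q p (r 3) i z * pairPoch q p (q / r 4 * q ^ i) (m - i) z =
      ∑ j ∈ range (m + 1),
        C j * (pairPoch q p (r 0) j z * pairPoch q p (q / r 4 * q ^ j) (m - j) z) := by
    obtain ⟨C, hC⟩ := exists_prod_theta_pair_eq_sum hp₀ hq₀ hp (hr 0) hx
      (g₂.of_eq hq₀ 1 (by rw [zpow_one]; ring))
      (g₁.of_eq hq₀ (-1) (by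
        have := hr 4
        rw [zpow_neg_one]
        field_simp)) m
      (c := fun k => if k < i then r 3 * q ^ k else q / r 4 * q ^ i * q ^ (k - i)) (fun k => by
        split_ifs
        · exact mul_ne_zero (hr 3) (pow_ne_zero _ hq₀)
        · exact mul_ne_zero (mul_ne_zero hx (pow_ne_zero _ hq₀)) (pow_ne_zero _ hq₀))
    refine ⟨C, fun z hz him => ?_⟩
    rw [← hC z hz, pairPoch_eq_prod, pairPoch_eq_prod]
    conv_rhs => rw [← Nat.add_sub_cancel' him, prod_range_add]
    congr 1
    · refine prod_congr rfl fun k hk => ?_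
      rw [if_pos (mem_range.mp hk)]
    · refine prod_congr rfl fun k _ => ?_
      rw [if_neg (by omega), Nat.add_sub_cancel_left]
  choose D hD using hex
  have key (z : ℂ) (hz : z ≠ 0) : ∑ i ∈ range (m + 1), wpCoeff q p r m i *
      (pairPoch q p (r 3) i z * pairPoch q p (q / r 4 * q ^ i) (m - i) z) =
      ∑ j ∈ range (m + 1), (∑ i ∈ range (m + 1), wpCoeff q p r m i * D i j) *
        (pairPoch q p (r 0) j z * pairPoch q p (q / r 4 * q ^ j) (m - j) z) := by
    simp only [sum_mul]
    rw [sum_comm]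
    refine sum_congr rfl fun i hi => ?_
    rw [hD i z hz (Nat.lt_succ_iff.mp (mem_range.mp hi)), mul_sum]
    exact sum_congr rfl fun j _ => (mul_assoc _ _ _).symm
  refine ⟨fun j => ∑ i ∈ range (m + 1), wpCoeff q p r m i * D i j, fun z hz hz' => ?_, ?_⟩
  · have e (c : ℂ) (i : ℕ) (hi : i ∈ range (m + 1)) :
        pairPoch q p c i z / pairPoch q p (q / r 4) i z =
        pairPoch q p c i z * pairPoch q p (q / r 4 * q ^ i) (m - i) z /
          pairPoch q p (q / r 4) m z := by
      have := pairPoch_add q p (q / r 4) i (m - i) z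
      rw [Nat.add_sub_cancel' (Nat.lt_succ_iff.mp (mem_range.mp hi))] at this
      rw [this] at hz'
      rw [this, mul_div_mul_right _ _ (right_ne_zero_of_mul hz')]
    rw [wpSeries, sum_congr rfl fun i hi => by rw [e _ i hi, ← mul_div_assoc], ← sum_div, key z hz,
      sum_div]
    exact sum_congr rfl fun j hj => by rw [e _ j hj, mul_div_assoc]
  · have hz : r 4 / q ^ m ≠ 0 := div_ne_zero (hr 4) (pow_ne_zero _ hq₀)
    -- The last factor of the symbol is `θ(1)` at this point.
    have hv (j : ℕ) (hj : j < m) :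
        pairPoch q p (q / r 4 * q ^ j) (m - j) (r 4 / q ^ m) = 0 := by
      rw [pairPoch_eq_prod]
      refine prod_eq_zero (mem_range.mpr (show m - j - 1 < m - j by omega)) ?_
      have : q / r 4 * q ^ j * q ^ (m - j - 1) * (r 4 / q ^ m) = 1 := by
        have e : q ^ m = q * q ^ j * q ^ (m - j - 1) := by
          rw [← pow_succ', ← pow_add]
          congr 1
          omega
        rw [e]
        have := hr 4
        have := pow_ne_zero j hq₀
        have := pow_ne_zero (m - j - 1) hq₀
        field_simp
      rw [this, theta_one hp, zero_mul]
    have k := key _ hz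
    rw [sum_range_succ, sum_range_succ _ m, sum_eq_zero fun j hj => by
      rw [hv j (mem_range.mp hj), mul_zero, mul_zero], zero_add] at k
    rw [sum_eq_zero (s := range m) fun j hj => by
      rw [hv j (mem_range.mp hj), mul_zero, mul_zero], zero_add, Nat.sub_self, pairPoch_zero,
      mul_one, mul_one] at k
    exact k.symm

end

/-- No product of two parameters and no quotient of two distinct parameters is of the form
`p^a q^b`. -/
structure GenericParams (p q : ℂ) (r : Fin 6 → ℂ) : Prop extends FreeParams p q r where
  ratio : ∀ j k, j ≠ k → Free p q (r j / r k)

/-! ### Sums of coefficients times moments, and the norm. -/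

section

variable {p q : ℂ} (hp₀ : p ≠ 0) (hq₀ : q ≠ 0) (hp : ‖p‖ < 1)

/-- The exchange of the last two parameters. -/
def swapLast (r : Fin 6 → ℂ) : Fin 6 → ℂ := ![r 0, r 1, r 2, r 3, r 5, r 4]

include hp hq₀ in
-- Reversal of the order of the factors and inversion of each; it serves to remove the negative
-- powers of `q` from the symbols in the norm calculation.
theorem ellPoch_reverse {u : ℂ} (hu : u ≠ 0) (n : ℕ) {y : ℂ} (hy : y * q ^ n = u * q) :
    ellPoch q p y n = (-u) ^ n / (∏ j ∈ range n, q ^ j) * ellPoch q p u⁻¹ n := by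
  have hc : (-u) ^ n = ∏ _j ∈ range n, (-u) := by rw [prod_const, card_range]
  rw [ellPoch, ← prod_range_reflect, ellPoch, hc, ← prod_div_distrib, ← prod_mul_distrib]
  refine prod_congr rfl fun j hj => ?_
  have hj' := pow_ne_zero j hq₀
  have e : y * q ^ (n - 1 - j) = u / q ^ j := by
    have : q ^ n = q ^ (n - 1 - j) * q ^ j * q := by
      rw [← pow_add, ← pow_succ]
      congr 1
      have := mem_range.mp hj
      omega
    rw [this] at hy
    rw [eq_div_iff hj']
    refine mul_right_cancel₀ hq₀ ?_
    linear_combination hy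
  have h0 : u / q ^ j ≠ 0 := div_ne_zero hu hj'
  rw [e, show u⁻¹ * q ^ j = (u / q ^ j)⁻¹ by rw [inv_div]; ring, theta_inv hp h0,
    ← mul_assoc, neg_div, neg_mul_neg, mul_inv_cancel₀ h0, one_mul]

theorem theta_mul_ellPoch_mul_ellPoch (q p a : ℂ) (n : ℕ) :
    theta (a * q ^ (2 * n)) p * (ellPoch q p a n * ellPoch q p (a * q ^ n) n) =
      theta a p * (ellPoch q p (a * q) n * ellPoch q p (a * q ^ (n + 1)) n) := by
  have h2 := ellPoch_succ' q p a (n + n)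
  rw [ellPoch_add q p a (n + n) 1, ellPoch_one, ellPoch_add q p a n n,
    ellPoch_add q p (a * q) n n] at h2
  rw [show a * q * q ^ n = a * q ^ (n + 1) by ring] at h2
  rw [two_mul]
  linear_combination h2

theorem coeff_mul_moment_eq {θ a b c d e f g k l s u N M Q x₁ x₂ x₃ x₄ : ℂ} (h₁ : x₁ ≠ 0)
    (h₂ : x₂ ≠ 0) (h₃ : x₃ ≠ 0) (h₄ : x₄ ≠ 0) :
    θ * ((a * b * x₁ * x₂ * N * c) / (Q * f * x₃ * x₄ * g * e)) * s *
        (M * ((d * x₃ * x₄ * u) / (k * x₁ * x₂ * l))) =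
      M * (θ * ((a * b * c * d * u * N) / (Q * f * e * k * l * g)) * s) := by
  calc _ = M * (θ * ((a * b * c * d * u * N) / (Q * f * e * k * l * g)) * s) * (x₁ * x₁⁻¹) *
        (x₂ * x₂⁻¹) * (x₃ * x₃⁻¹) * (x₄ * x₄⁻¹) := by ring
    _ = _ := by
      rw [mul_inv_cancel₀ h₁, mul_inv_cancel₀ h₂, mul_inv_cancel₀ h₃, mul_inv_cancel₀ h₄]
      ring

include hp₀ hq₀ hp in
-- Four Pochhammer symbols of the moment cancel against the coefficient, and a balanced
-- Frenkel–Turaev series remains, in which `j` enters through `d = r₀r₃q^j`.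
theorem GenericParams.sum_wpCoeff_mul_moment {r : Fin 6 → ℂ} (h : GenericParams p q r)
    (hprod : ∏ j, r j = q) (n j : ℕ) (hn : ellPoch q p q n ≠ 0) :
    ∑ i ∈ range (n + 1), wpCoeff q p (swapLast r) n i * moment q p r j i =
      moment q p r j 0 * ftSum q p (r 3 / r 5) (q / (r 0 * r 5)) (q ^ n / (r 4 * r 5))
        (r 0 * r 3 * q ^ j) n := by
  have hr := h.ne_zero
  have h0 := hr 0
  have h1 := hr 1
  have h2 := hr 2
  have h3 := hr 3
  have h4 := hr 4
  have h5 := hr 5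
  have hqj := pow_ne_zero j hq₀
  have hqn := pow_ne_zero n hq₀
  have gp (j k : Fin 6) : Generic q p (r j * r k) :=
    (h.pair j k).generic hp₀ hq₀ hp (mul_ne_zero (hr j) (hr k))
  have gi (j k : Fin 6) : Generic q p (r j * r k)⁻¹ :=
    (gp j k).inv hq₀ hp (mul_ne_zero (hr j) (hr k))
  have hP : r 0 * r 1 * r 2 * r 3 * r 4 * r 5 = q := by rw [← hprod, Fin.prod_univ_six]
  -- The fully generic formula is not applicable: with these parameters `aq/(bd) = q^(-j)`, which is
  -- the source of the orthogonality.
  rw [← frenkel_turaev_of_generic_den hp₀ hq₀ hp (by positivity) (by positivity) (by positivity)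
    (by positivity) ((h.ratio 3 5 (by decide)).generic hp₀ hq₀ hp (by positivity))
    ((gp 0 3).of_eq hq₀ (-1) (by rw [zpow_neg_one]; field_simp))
    ((gp 3 4).of_eq hq₀ (-n) (by rw [zpow_neg, zpow_natCast]; field_simp))
    ((gi 0 5).of_eq hq₀ (-j) (by rw [zpow_neg, zpow_natCast]; field_simp))
    ((gi 1 2).of_eq hq₀ (-n) (by rw [zpow_neg, zpow_natCast]; field_simp; linear_combination hP))
    ((gp 4 5).of_eq hq₀ (-(n + j + 1 : ℕ)) (by
      rw [zpow_neg, zpow_natCast, pow_succ, pow_add]; field_simp)) n hn, mul_sum]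
  refine sum_congr rfl fun i hi => ?_
  have hi' : i ≤ n := Nat.lt_succ_iff.mp (mem_range.mp hi)
  have e1 : r 3 / r 5 * q / (q / (r 0 * r 5)) = r 0 * r 3 := by field_simp
  have e2 : r 3 / r 5 * q / (q ^ n / (r 4 * r 5)) = r 3 * r 4 * q ^ (1 - (n : ℤ)) := by
    rw [zpow_sub₀ hq₀, zpow_one, zpow_natCast]
    field_simp
  have e3 : r 3 / r 5 * q / (r 0 * r 3 * q ^ j) = q / (r 5 * r 0 * q ^ j) := by field_simp
  have e4 : (r 3 / r 5) ^ 2 * q ^ (n + 1) / (q / (r 0 * r 5) * (q ^ n / (r 4 * r 5)) *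
      (r 0 * r 3 * q ^ j)) = r 3 * r 4 / q ^ j := by
    field_simp
    ring
  have e5 : r 3 / r 5 * q / (r 3 * r 4 / q ^ j) = q * q ^ j / (r 5 * r 4) := by field_simp
  have n1 := (gi 1 5).poch_ne_zero hq₀ 1 i (y := q / (r 1 * r 5)) (by rw [zpow_one]; ring)
  have n2 := (gi 2 5).poch_ne_zero hq₀ 1 i (y := q / (r 2 * r 5)) (by rw [zpow_one]; ring)
  have n3 := (gp 1 3).poch_ne_zero hq₀ 0 i (y := r 1 * r 3) (by simp)
  have n4 := (gp 2 3).poch_ne_zero hq₀ 0 i (y := r 2 * r 3) (by simp)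
  simp only [wpCoeff, swapLast, moment, ftTerm, e4, e5, e1, e2, e3, Matrix.cons_val, ellPoch_zero,
    mul_comm (r 5) (r 1), mul_comm (r 5) (r 2), mul_comm (r 3) (r 1), mul_comm (r 3) (r 2),
    mul_comm (r 3) (r 0), mul_comm (r 5) (r 4)]
  simp only [mul_one, div_one]
  exact coeff_mul_moment_eq n1 n2 n3 n4

/-- The norm of the biorthogonal functions, in terms of six parameters. -/
def wpNorm (q p : ℂ) (r : Fin 6 → ℂ) (n : ℕ) : ℂ :=
  theta (r 4 * r 5)⁻¹ p *
    (ellPoch q p q n * ellPoch q p (r 3 / r 4 * q) n * ellPoch q p (r 0 * r 1) n *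
      ellPoch q p (r 0 * r 2) n * ellPoch q p (r 1 * r 2) n * ellPoch q p (r 3 / r 5 * q) n) /
    q ^ n /
  (theta ((r 4 * r 5)⁻¹ * q ^ (2 * n)) p *
    (ellPoch q p (r 3 * r 4)⁻¹ n * ellPoch q p (r 0 * r 3) n * ellPoch q p (r 1 * r 3) n *
      ellPoch q p (r 2 * r 3) n * ellPoch q p (r 3 * r 5)⁻¹ n * ellPoch q p (r 4 * r 5)⁻¹ n))

theorem pow_div_algebra {v₁ v₂ v₃ v₄ w₁ w₂ w₃ w₄ w₅ s Q : ℂ} (n : ℕ)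
    (h : v₁ * v₂ ^ 2 * v₃ * v₄ * (s * s) = w₁ * w₂ * w₃ * w₄ * w₅) :
    v₁ ^ n / Q * (v₂ ^ n / Q) ^ 2 * (v₃ ^ n / Q) * (v₄ ^ n / Q) * (s ^ n * s ^ n) =
      w₁ ^ n / Q * (w₂ ^ n / Q) * (w₃ ^ n / Q) * (w₄ ^ n / Q) * (w₅ ^ n / Q) := by
  calc _ = (v₁ * v₂ ^ 2 * v₃ * v₄ * (s * s)) ^ n / Q ^ 5 := by ring
    _ = _ := by
      rw [h]
      ring

/-- The `α` and `β` are the factors from reversing Pochhammer symbols; `ha` and `hb` are instances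
of `theta_mul_ellPoch_mul_ellPoch`, and `hα` says that the reversal factors balance, with `s = q ^
n`. -/
theorem norm_algebra {c θa θa' Pa Pa1 Pan Pan1 x₀ x₁ x₂ Q Bn f₀ f₁ f₂ g g' R0 α₁ α₂ α₃ α₄
    β₁ β₂ β₃ β₄ β₅ s M₁ M₂ y₃ B1 F v w θb θb' B0 Bn1 : ℂ}
    (hc : c * (β₁ * x₀ * R0) = θa' / θa * ((Pa * x₀ * x₁ * x₂ * (α₂ * Q) * Bn) /
      (Q * f₀ * f₁ * f₂ * Pan1 * (β₂ * g))) * s * (α₁ * y₃ * Pan))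
    (ha : θa' * (Pa * Pan) = θa * (Pa1 * Pan1)) (hb : θb' * (B0 * Bn) = θb * (B1 * Bn1))
    (hα : α₁ * α₂ ^ 2 * α₃ * α₄ * (s * s) = β₁ * β₂ * β₃ * β₄ * β₅)
    (hβ₁ : β₁ ≠ 0) (hβ₂ : β₂ ≠ 0) (hβ₃ : β₃ ≠ 0) (hβ₄ : β₄ ≠ 0) (hβ₅ : β₅ ≠ 0) (hs : s ≠ 0)
    (hx₀ : x₀ ≠ 0) (hx₁ : x₁ ≠ 0) (hx₂ : x₂ ≠ 0) (hR0 : R0 ≠ 0) (hθa : θa ≠ 0) (hPan1 : Pan1 ≠ 0)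
    (hy₃ : y₃ ≠ 0) (hv : v ≠ 0) (hf₀ : f₀ ≠ 0) (hQ : Q ≠ 0) (hB1 : B1 ≠ 0) (hBn1 : Bn1 ≠ 0)
    (hB0 : B0 ≠ 0) (hθb' : θb' ≠ 0) :
    c * ((M₁ * M₂ * f₀ * v) / (x₁ * x₂ * y₃ * B1) * ((F * (α₃ * w) * (α₂ * Q) * (α₄ * R0)) /
      (f₀ * (β₃ * g') * (β₄ * v) * (β₅ * Bn1)))) =
      θb * (Q * Pa1 * M₁ * M₂ * w * F) / s / (θb' * (g' * f₀ * f₁ * f₂ * g * B0)) := by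
  have ka : θa' * Pa * Pan / (θa * Pan1) = Pa1 := by
    rw [div_eq_iff (mul_ne_zero hθa hPan1)]
    linear_combination ha
  have kb : Bn / (B1 * Bn1) = θb / (θb' * B0) := by
    rw [div_eq_div_iff (mul_ne_zero hB1 hBn1) (mul_ne_zero hθb' hB0)]
    linear_combination hb
  have kα : α₁ * α₂ ^ 2 * α₃ * α₄ * s / (β₁ * β₂ * β₃ * β₄ * β₅) = 1 / s := by
    rw [div_eq_div_iff (by simp [*]) hs]
    linear_combination hα
  have hc' : c = θa' / θa * ((Pa * x₀ * x₁ * x₂ * (α₂ * Q) * Bn) /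
      (Q * f₀ * f₁ * f₂ * Pan1 * (β₂ * g))) * s * (α₁ * y₃ * Pan) / (β₁ * x₀ * R0) :=
    eq_div_of_mul_eq (by simp [*]) hc
  calc _ = (θa' * Pa * Pan / (θa * Pan1)) * (Bn / (B1 * Bn1)) *
        (α₁ * α₂ ^ 2 * α₃ * α₄ * s / (β₁ * β₂ * β₃ * β₄ * β₅)) *
        (Q * (M₁ * M₂ * w * F) / (g' * f₀ * f₁ * f₂ * g)) *
        ((x₀ * x₀⁻¹) * (x₁ * x₁⁻¹) * (x₂ * x₂⁻¹) * (Q * Q⁻¹) * (y₃ * y₃⁻¹) * (f₀ * f₀⁻¹) *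
          (v * v⁻¹) * (R0 * R0⁻¹)) := by
        rw [hc']
        ring
    _ = _ := by
      rw [ka, kb, kα, mul_inv_cancel₀ hx₀, mul_inv_cancel₀ hx₁, mul_inv_cancel₀ hx₂,
        mul_inv_cancel₀ hQ, mul_inv_cancel₀ hy₃, mul_inv_cancel₀ hf₀, mul_inv_cancel₀ hv,
        mul_inv_cancel₀ hR0]
      ring

include hp₀ hq₀ hp in
-- The coefficient `c` comes from `exists_wpSeries_eq_sum`, and the second factor is the only
-- nonzero sum when `m = n`. After the reversals `A1, …, B5` every symbol has an argument occurring
-- in the norm or cancels.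
theorem GenericParams.leadingCoeff_mul_moment {r : Fin 6 → ℂ} (h : GenericParams p q r)
    (hprod : ∏ j, r j = q) (n : ℕ) (hn : ellPoch q p q n ≠ 0) {c : ℂ}
    (hc : c * pairPoch q p (r 0) n (r 4 / q ^ n) =
        wpCoeff q p r n n * pairPoch q p (r 3) n (r 4 / q ^ n)) :
    c * (moment q p r n 0 * ftSum q p (r 3 / r 5) (q / (r 0 * r 5)) (q ^ n / (r 4 * r 5))
        (r 0 * r 3 * q ^ n) n) = wpNorm q p r n := by
  have hr := h.ne_zero
  have h0 := hr 0
  have h1 := hr 1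
  have h2 := hr 2
  have h3 := hr 3
  have h4 := hr 4
  have h5 := hr 5
  have hqn := pow_ne_zero n hq₀
  have gp (j k : Fin 6) : Generic q p (r j * r k) :=
    (h.pair j k).generic hp₀ hq₀ hp (mul_ne_zero (hr j) (hr k))
  have gi (j k : Fin 6) : Generic q p (r j * r k)⁻¹ :=
    (gp j k).inv hq₀ hp (mul_ne_zero (hr j) (hr k))
  have gr (j k : Fin 6) (hjk : j ≠ k) : Generic q p (r j / r k) :=
    (h.ratio j k hjk).generic hp₀ hq₀ hp (div_ne_zero (hr j) (hr k))
  have hP : r 0 * r 1 * r 2 * r 3 * r 4 * r 5 = q := by rw [← hprod, Fin.prod_univ_six]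
  have hQ0 : ∏ j ∈ range n, q ^ j ≠ 0 := prod_ne_zero_iff.mpr fun j _ => pow_ne_zero j hq₀
  have rev {u : ℂ} (hu : u ≠ 0) {y x : ℂ} (hy : y * q ^ n = u * q) (hx : x = u⁻¹) :
      ellPoch q p y n = (-u) ^ n / (∏ j ∈ range n, q ^ j) * ellPoch q p x n :=
    hx ▸ ellPoch_reverse hq₀ hp hu n hy
  have fac {u : ℂ} (hu : u ≠ 0) : (-u) ^ n / (∏ j ∈ range n, q ^ j) ≠ 0 :=
    div_ne_zero (pow_ne_zero n (neg_ne_zero.mpr hu)) hQ0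
  have A1 := rev (u := r 3 * r 4 / q) (by positivity) (y := r 3 * (r 4 / q ^ n))
    (x := q / (r 4 * r 3)) (by field_simp) (by field_simp)
  have A2 := rev (u := q⁻¹) (by positivity) (y := q ^ (-(n : ℤ)))
    (x := q) (by rw [zpow_neg, zpow_natCast]; field_simp) (by simp)
  have A2' := rev (u := q⁻¹) (by positivity)
    (y := r 3 / r 5 * q / (q / (r 0 * r 5) * (r 0 * r 3 * q ^ n)))
    (x := q) (by field_simp) (by simp)
  have A3 := rev (u := (r 1 * r 2)⁻¹) (by positivity)
    (y := r 3 / r 5 * q / (q / (r 0 * r 5) * (q ^ n / (r 4 * r 5))))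
    (x := r 1 * r 2) (by field_simp; linear_combination hP) (by simp)
  have A4 := rev (u := r 4 / (r 0 * q ^ n)) (by positivity)
    (y := r 3 / r 5 * q / (q ^ n / (r 4 * r 5) * (r 0 * r 3 * q ^ n)))
    (x := r 0 / (r 4 / q ^ n)) (by field_simp) (by field_simp)
  have B1 := rev (u := r 0 * r 4 / q) (by positivity) (y := r 0 * (r 4 / q ^ n))
    (x := q / (r 0 * r 4)) (by field_simp) (by field_simp)
  have B2 := rev (u := r 3 * r 5) (by positivity) (y := r 3 * r 5 * q ^ (1 - (n : ℤ)))
    (x := (r 3 * r 5)⁻¹) (by rw [zpow_sub₀ hq₀, zpow_one, zpow_natCast]; field_simp) rfl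
  have B3 := rev (u := r 3 * r 4) (by positivity) (y := r 3 / r 5 * q / (q ^ n / (r 4 * r 5)))
    (x := (r 3 * r 4)⁻¹) (by field_simp) rfl
  have B4 := rev (u := (r 0 * r 5)⁻¹) (by positivity) (y := r 3 / r 5 * q / (r 0 * r 3 * q ^ n))
    (x := r 0 * r 5) (by field_simp) (by simp)
  have B5 := rev (u := r 4 * r 5 / (q ^ n * q)) (by positivity)
    (y := r 3 / r 5 * q / (q / (r 0 * r 5) * (q ^ n / (r 4 * r 5)) * (r 0 * r 3 * q ^ n)))
    (x := (r 4 * r 5)⁻¹ * q ^ (n + 1)) (by field_simp) (by rw [pow_succ]; field_simp)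
  rw [wpCoeff, pairPoch, pairPoch, A1, A2, B1, B2, mul_comm (r 1) (r 4), mul_comm (r 2) (r 4),
    show r 3 / (r 4 / q ^ n) = r 3 / r 4 * q ^ n by field_simp,
    show q ^ n / (r 4 * r 5) = (r 4 * r 5)⁻¹ * q ^ n by ring] at hc
  have e1 : r 3 / r 5 * q / (q / (r 0 * r 5)) = r 0 * r 3 := by field_simp
  rw [moment, ftSum, wpNorm, A2', A3, A4, B3, B4, B5, e1,
    show q / (r 4 * r 5) = (r 4 * r 5)⁻¹ * q by ring]
  simp only [ellPoch_zero, mul_one, div_one]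
  refine norm_algebra hc (theta_mul_ellPoch_mul_ellPoch q p _ n)
    (theta_mul_ellPoch_mul_ellPoch q p _ n) ?_ (fac (by positivity)) (fac (by positivity))
    (fac (by positivity)) (fac (by positivity)) (fac (by positivity)) hqn ?_ ?_ ?_ ?_ ?_ ?_ ?_ ?_ ?_
    hn ?_ ?_ ?_ ?_
  · refine pow_div_algebra n ?_
    field_simp
    linear_combination hP
  · exact (gi 0 4).poch_ne_zero hq₀ 1 n (by rw [zpow_one]; ring)
  · exact (gi 4 1).poch_ne_zero hq₀ 1 n (by rw [zpow_one]; ring)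
  · exact (gi 4 2).poch_ne_zero hq₀ 1 n (by rw [zpow_one]; ring)
  · exact (gr 0 4 (by decide)).poch_ne_zero hq₀ n n (by rw [zpow_natCast]; field_simp)
  · exact (gr 3 4 (by decide)).theta_ne_zero 0 (by simp)
  · exact (gr 3 4 (by decide)).poch_ne_zero hq₀ (n + 1 : ℕ) n (by rw [zpow_natCast])
  · exact (gi 4 3).poch_ne_zero hq₀ 1 n (by rw [zpow_one]; ring)
  · exact (gp 0 5).poch_ne_zero hq₀ 0 n (by simp)
  · exact (gp 0 3).poch_ne_zero hq₀ 0 n (by simp)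
  · exact (gi 4 5).poch_ne_zero hq₀ 1 n (by rw [zpow_one])
  · exact (gi 4 5).poch_ne_zero hq₀ (n + 1 : ℕ) n (by rw [zpow_natCast])
  · exact (gi 4 5).poch_ne_zero hq₀ 0 n (by simp)
  · exact (gi 4 5).theta_ne_zero (2 * n : ℕ) (by rw [zpow_natCast])

include hp₀ hq₀ hp in
/-- The product of two of the series is a linear combination of the functions with the moments
`moment q p r j i`, and the corresponding combination of the moments is the norm. -/
theorem GenericParams.exists_expansion {r : Fin 6 → ℂ} (h : GenericParams p q r)
    (hprod : ∏ j, r j = q) {m n : ℕ} (hmn : m ≤ n) (hn : ellPoch q p q n ≠ 0) :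
    ∃ C : ℕ × ℕ → ℂ, (∀ z, FreeAt p q r z →
        wpSeries q p r m z * wpSeries q p (swapLast r) n z =
        ∑ x ∈ range (m + 1) ×ˢ range (n + 1), C x *
          (pairPoch q p (r 0) x.1 z / pairPoch q p (q / r 4) x.1 z *
            (pairPoch q p (r 3) x.2 z / pairPoch q p (q / r 5) x.2 z))) ∧
      ∑ x ∈ range (m + 1) ×ˢ range (n + 1), C x * moment q p r x.1 x.2 =
        if m = n then wpNorm q p r n else 0 := by
  have hr := h.ne_zero
  obtain ⟨c, hc, hcm⟩ := exists_wpSeries_eq_sum hp₀ hq₀ hp hr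
    ((h.pair 0 4).generic hp₀ hq₀ hp (mul_ne_zero (hr 0) (hr 4)))
    ((h.ratio 0 4 (by decide)).generic hp₀ hq₀ hp (div_ne_zero (hr 0) (hr 4))) m
  refine ⟨fun x => c x.1 * wpCoeff q p (swapLast r) n x.2, fun z hz => ?_, ?_⟩
  · have hne : pairPoch q p (q / r 4) m z ≠ 0 := by
      have hz0 := hz.z_ne_zero
      have h4 := hr 4
      refine mul_ne_zero (((hz.div 4).inv.of_eq hp₀ hq₀ 0 1 ?_).poch_ne_zero hp₀ hq₀ hp ?_ m)
        (((hz.mul 4).inv.of_eq hp₀ hq₀ 0 1 ?_).poch_ne_zero hp₀ hq₀ hp ?_ m)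
      · rw [zpow_zero, zpow_one]
        field_simp
      · positivity
      · rw [zpow_zero, zpow_one]
        field_simp
      · positivity
    rw [hc z hz.z_ne_zero hne, wpSeries, sum_mul_sum, ← sum_product']
    refine sum_congr rfl fun x _ => ?_
    simp only [swapLast, Matrix.cons_val]
    ring
  · rw [sum_product]
    have e (j : ℕ) : ∑ i ∈ range (n + 1), c j * wpCoeff q p (swapLast r) n i * moment q p r j i =
        c j * (moment q p r j 0 * ftSum q p (r 3 / r 5) (q / (r 0 * r 5)) (q ^ n / (r 4 * r 5))
        (r 0 * r 3 * q ^ j) n) := by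
      rw [← h.sum_wpCoeff_mul_moment hp₀ hq₀ hp hprod n j hn, mul_sum]
      exact sum_congr rfl fun i _ => by ring
    -- The product for the sum contains `(q^(-j))_n`, which is zero for `j < n`.
    have e0 (j : ℕ) (hj : j < n) : ftSum q p (r 3 / r 5) (q / (r 0 * r 5)) (q ^ n / (r 4 * r 5))
        (r 0 * r 3 * q ^ j) n = 0 := by
      have : r 3 / r 5 * q / (q / (r 0 * r 5) * (r 0 * r 3 * q ^ j)) = q ^ (-(j : ℤ)) := by
        have h0 := hr 0
        have h3 := hr 3
        have h5 := hr 5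
        rw [zpow_neg, zpow_natCast]
        field_simp
      rw [ftSum, this, ellPoch_neg_eq_zero hq₀ hp hj]
      simp
    rw [sum_congr rfl fun j _ => e j]
    split_ifs with hmn'
    · subst hmn'
      rw [sum_range_succ, sum_eq_zero fun j hj => by rw [e0 j (mem_range.mp hj), mul_zero, mul_zero],
        zero_add]
      exact h.leadingCoeff_mul_moment hp₀ hq₀ hp hprod m hn hcm
    · refine sum_eq_zero fun j hj => ?_
      have := mem_range.mp hj
      rw [e0 j (by omega), mul_zero, mul_zero]

end

/-! ### The biorthogonality for generic parameters. -/

theorem contourIntegral_sum_mul {ι : Type*} {s : Finset ι} {γ : ℝ → ℂ} {c : ι → ℂ}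
    {φ : ι → ℂ → ℂ} (h : ∀ x ∈ s, ContourIntegrable γ (φ x)) :
    contourIntegral γ (fun z => ∑ x ∈ s, c x * φ x z) = ∑ x ∈ s, c x * contourIntegral γ (φ x) := by
  unfold contourIntegral
  rw [← sum_congr rfl fun x _ => intervalIntegral.integral_const_mul (c x) _,
    ← intervalIntegral.integral_finsetSum fun x hx => (h x hx).const_mul (c x)]
  congr 1
  funext y
  rw [sum_mul]
  exact sum_congr rfl fun x _ => by ring

section

variable {p q : ℂ}

/-- `f` is a linear combination of functions `F` with `HasMoment`, and the corresponding
combination of the moments is `ν`. -/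
def HasExpansion (p q : ℂ) (t : Fin 6 → ℂ) (a : Fin 6 → ℤ) (f : ℂ → ℂ) (ν : ℂ) : Prop :=
  ∃ (s : Finset (ℕ × ℕ)) (c : ℕ × ℕ → ℂ) (α : ℕ × ℕ → Fin 6 → ℤ) (F : ℕ × ℕ → ℂ → ℂ)
    (μ : ℕ × ℕ → ℂ), (∀ x ∈ s, Reachable a (α x) ∧ HasMoment p q t (α x) (F x) (μ x)) ∧
    (∀ z, FreeAt p q t z → f z = ∑ x ∈ s, c x * F x z) ∧ ∑ x ∈ s, c x * μ x = ν

variable (hp₀ : p ≠ 0) (hq₀ : q ≠ 0) (hp : ‖p‖ < 1) (hq : ‖q‖ < 1)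

include hp₀ hq₀ hp hq in
theorem Separates.integral_expansion {γ : ℝ → ℂ} {t : Fin 6 → ℂ} {a b : Fin 6 → ℤ}
    (h : Separates γ (paramPoints p q (shifted q p t a b))) (ht : FreeParams p q t)
    (ht1 : ∀ j, ‖t j‖ < 1) (hprod : ∏ j, t j = p * q) (ha : a ≤ 0) (hb : b ≤ 0)
    {f g : ℂ → ℂ} {ν ν' : ℂ} (hf : HasExpansion p q t a f ν) (hg : HasExpansion q p t b g ν') :
    contourIntegral γ (fun z => f z * g z * betaKernel p q t z) * (qPochInf p p * qPochInf q q) =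
      4 * Real.pi * Complex.I * betaValue p q t * ν * ν' := by
  obtain ⟨s, c, α, F, μ, hF, hfF, rfl⟩ := hf
  obtain ⟨s', c', β, G, μ', hG, hgG, rfl⟩ := hg
  have e : ∀ y ∈ Set.Icc (0 : ℝ) 1, γ y ∉ {z | ¬ FreeAt p q t z} →
      f (γ y) * g (γ y) * betaKernel p q t (γ y) = ∑ x ∈ s ×ˢ s', c x.1 * c' x.2 *
        (F x.1 (γ y) * G x.2 (γ y) * betaKernel p q t (γ y)) := by
    intro y _ hy
    have hy' : FreeAt p q t (γ y) := not_not.mp hy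
    rw [hfF _ hy', hgG _ hy'.swap, sum_mul_sum, ← sum_product', sum_mul]
    exact sum_congr rfl fun x _ => by ring
  rw [contourIntegral_congr_of_countable ht.countable_not_freeAt
    (g := fun z => ∑ x ∈ s ×ˢ s', c x.1 * c' x.2 * (F x.1 z * G x.2 z * betaKernel p q t z)) e,
    contourIntegral_sum_mul, sum_mul]
  · rw [mul_assoc (4 * Real.pi * Complex.I * betaValue p q t), sum_mul_sum, ← sum_product',
      mul_sum]
    refine sum_congr rfl fun x hx => ?_
    obtain ⟨h1, h2⟩ := mem_product.mp hx
    have := h.integral_moment hp₀ hq₀ hp hq ht ht1 hprod ha hb (hF _ h1).1 (hG _ h2).1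
      (hF _ h1).2 (hG _ h2).2
    linear_combination c x.1 * c' x.2 * this
  · intro x hx
    obtain ⟨h1, h2⟩ := mem_product.mp hx
    exact h.contourIntegrable_moment hp₀ hq₀ hp hq ht hprod ha hb (hF _ h1).1 (hG _ h2).1
      (hF _ h1).2 (hG _ h2).2

/-- The parameters for the base `q`: their product is `q` if the product of `t` is `pq`. -/
def baseParams (p : ℂ) (t : Fin 6 → ℂ) : Fin 6 → ℂ := ![t 0, t 1, t 2, t 3, t 4, t 5 / p]

theorem FreeAt.comp {t : Fin 6 → ℂ} {z : ℂ} (h : FreeAt p q t z) (σ : Equiv.Perm (Fin 6)) :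
    FreeAt p q (t ∘ σ) z :=
  ⟨fun _ => h.ne_zero _, h.z_ne_zero, fun _ _ => h.pair _ _, fun _ => h.mul _, fun _ => h.div _⟩

theorem betaQuot_comp (s : Fin 6 → ℂ) (σ : Equiv.Perm (Fin 6)) (z : ℂ) :
    betaQuot p q (s ∘ σ) z = betaQuot p q s z := by
  rw [betaQuot, betaQuot, betaValue_comp, gammaProd, gammaProd,
    ← Equiv.prod_comp σ fun j => ellGamma p q (s j * z) * ellGamma p q (s j / z)]
  rfl

include hp₀ hq₀ hp hq in
-- The parameters `r`, with product `q`, arise from `t`, with product `pq`, by division of one entry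
-- by `p`. The index `l` in `FreeAt.betaQuot_move` puts this factor `p` back.
theorem hasMoment_move {t r : Fin 6 → ℂ} (σ : Equiv.Perm (Fin 6)) (l : Fin 6)
    (hr : r = shifted q p (t ∘ σ) 0 (-Pi.single l 1)) (hprod : ∏ j, r j = q) (j i : ℕ) :
    HasMoment p q t (move j i ∘ σ.symm)
      (fun z => pairPoch q p (r 0) j z / pairPoch q p (q / r 4) j z *
        (pairPoch q p (r 3) i z / pairPoch q p (q / r 5) i z)) (moment q p r j i) := by
  intro z hz
  have hrz : FreeAt p q r z := hr ▸ (hz.comp σ).shifted hp₀ hq₀ 0 (-Pi.single l 1)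
  have key := hrz.betaQuot_move hp₀ hq₀ hp hq hprod l j i
  have e (α : Fin 6 → ℤ) : shifted q p r α (Pi.single l 1) =
      shifted q p t (α ∘ σ.symm) 0 ∘ σ := by
    funext k
    have : p ^ (Pi.single l 1 : Fin 6 → ℤ) k ≠ 0 := zpow_ne_zero _ hp₀
    rw [hr]
    simp only [shifted, Function.comp_apply, Equiv.symm_apply_apply, Pi.zero_apply, zpow_zero,
      mul_one, Pi.neg_apply, zpow_neg]
    field_simp
  rw [e, e, betaQuot_comp, betaQuot_comp, show (0 : Fin 6 → ℤ) ∘ σ.symm = 0 from rfl,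
    shifted_zero] at key
  exact key

theorem baseParams_eq (t : Fin 6 → ℂ) : baseParams p t = shifted q p t 0 (-Pi.single 5 1) := by
  funext j
  fin_cases j <;> simp +decide [baseParams, shifted, div_eq_mul_inv]

theorem swapLast_baseParams_eq (t : Fin 6 → ℂ) :
    swapLast (baseParams p t) = shifted q p (t ∘ Equiv.swap 4 5) 0 (-Pi.single 4 1) := by
  funext j
  fin_cases j <;> simp +decide [swapLast, baseParams, shifted, div_eq_mul_inv] <;> rfl

theorem prod_swapLast (r : Fin 6 → ℂ) : ∏ j, swapLast r j = ∏ j, r j := by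
  rw [Fin.prod_univ_six, Fin.prod_univ_six]
  simp only [swapLast, Matrix.cons_val]
  ring

theorem swapLast_swapLast (r : Fin 6 → ℂ) : swapLast (swapLast r) = r := by
  funext j
  fin_cases j <;> rfl

include hp₀ hq₀ in
theorem GenericParams.shifted {t : Fin 6 → ℂ} (h : GenericParams p q t) (α β : Fin 6 → ℤ) :
    GenericParams p q (shifted q p t α β) where
  toFreeParams := h.toFreeParams.shifted hp₀ hq₀ α β
  ratio j k hjk := (h.ratio j k hjk).of_eq hp₀ hq₀ (β j - β k) (α j - α k) (by
    rw [EllHyp.shifted, EllHyp.shifted, zpow_sub₀ hp₀, zpow_sub₀ hq₀]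
    ring)

theorem GenericParams.comp {t : Fin 6 → ℂ} (h : GenericParams p q t) (σ : Equiv.Perm (Fin 6)) :
    GenericParams p q (t ∘ σ) :=
  ⟨⟨fun _ => h.ne_zero _, fun _ _ => h.pair _ _⟩, fun _ _ hjk => h.ratio _ _ (σ.injective.ne hjk)⟩

include hp₀ hq₀ hp hq in
-- The bounds on `a` at the positions `4` and `5` are exactly what the largest shifts in the
-- expansions of the two series need.
theorem GenericParams.hasExpansion {t : Fin 6 → ℂ} (h : GenericParams p q t)
    (hprod : ∏ j, t j = p * q) {a : Fin 6 → ℤ} (ha : a ≤ 0) {m n : ℕ} (h4 : a 4 ≤ -m)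
    (h5 : a 5 ≤ -n) (hm : ellPoch q p q m ≠ 0) (hn : ellPoch q p q n ≠ 0) :
    HasExpansion p q t a (fun z => wpSeries q p (swapLast (baseParams p t)) n z *
        wpSeries q p (baseParams p t) m z)
      (if m = n then wpNorm q p (baseParams p t) n else 0) := by
  have hP : ∏ j, baseParams p t j = q := by
    rw [Fin.prod_univ_six] at hprod ⊢
    simp only [baseParams, Matrix.cons_val]
    rw [← mul_div_assoc, hprod, mul_div_cancel_left₀ _ hp₀]
  rcases le_or_gt m n with hmn | hmn
  · have e := baseParams_eq (p := p) (q := q) t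
    have hg : GenericParams p q (baseParams p t) := e ▸ h.shifted hp₀ hq₀ 0 (-Pi.single 5 1)
    obtain ⟨C, hC, hs⟩ := hg.exists_expansion hp₀ hq₀ hp hP hmn hn
    refine ⟨_, C, fun x => move x.1 x.2,
      (fun x z => pairPoch q p (baseParams p t 0) x.1 z / pairPoch q p (q / baseParams p t 4) x.1 z *
        (pairPoch q p (baseParams p t 3) x.2 z / pairPoch q p (q / baseParams p t 5) x.2 z)), _, fun x hx => ?_, fun z hz => ?_, hs⟩
    · obtain ⟨h1, h2⟩ := mem_product.mp hx
      have hm := hasMoment_move hp₀ hq₀ hp hq (Equiv.refl (Fin 6)) 5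
        (by rw [Equiv.coe_refl, Function.comp_id]; exact e) hP x.1 x.2
      rw [Equiv.refl_symm, Equiv.coe_refl, Function.comp_id] at hm
      refine ⟨reachable_move ha ?_ ?_, hm⟩
      · have := mem_range.mp h1
        omega
      · have := mem_range.mp h2
        omega
    · refine (mul_comm _ _).trans ?_
      exact hC z (e ▸ hz.shifted hp₀ hq₀ 0 (-Pi.single 5 1))
  -- For `m > n` the exchange of the last two parameters exchanges the two series, and the expansion
  -- is applied to them in the other order; the divided entry is then at position `4`.
  · have e := swapLast_baseParams_eq (p := p) (q := q) t
    have hg : GenericParams p q (swapLast (baseParams p t)) :=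
      e.symm ▸ (h.comp (Equiv.swap 4 5)).shifted hp₀ hq₀ 0 (-Pi.single 4 1)
    have hP' : ∏ j, swapLast (baseParams p t) j = q := (prod_swapLast _).trans hP
    obtain ⟨C, hC, hs⟩ := hg.exists_expansion hp₀ hq₀ hp hP' hmn.le hm
    rw [swapLast_swapLast] at hC
    rw [if_neg hmn.ne] at hs
    rw [if_neg hmn.ne']
    refine ⟨_, C, fun x => move x.1 x.2 ∘ (Equiv.swap 4 5).symm,
      (fun x z => pairPoch q p (swapLast (baseParams p t) 0) x.1 z / pairPoch q p (q / swapLast (baseParams p t) 4) x.1 z *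
        (pairPoch q p (swapLast (baseParams p t) 3) x.2 z / pairPoch q p (q / swapLast (baseParams p t) 5) x.2 z)), _, fun x hx => ?_,
      fun z hz => ?_, hs⟩
    · obtain ⟨h1, h2⟩ := mem_product.mp hx
      refine ⟨?_, hasMoment_move hp₀ hq₀ hp hq (Equiv.swap 4 5) 4 e hP' x.1 x.2⟩
      have := (reachable_move (a := a ∘ Equiv.swap 4 5) (fun j => ha _) (j := x.1) (i := x.2)
        ?_ ?_).comp (Equiv.swap 4 5).symm
      · convert this using 1
        funext j
        simp
      · have := mem_range.mp h1
        simp only [Function.comp_apply, Equiv.swap_apply_left]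
        omega
      · have := mem_range.mp h2
        simp only [Function.comp_apply, Equiv.swap_apply_right]
        omega
    · exact hC z (e.symm ▸ (hz.comp (Equiv.swap 4 5)).shifted hp₀ hq₀ 0 (-Pi.single 4 1))

theorem GenericParams.swap {t : Fin 6 → ℂ} (h : GenericParams p q t) : GenericParams q p t :=
  ⟨h.toFreeParams.swap, fun j k hjk => (h.ratio j k hjk).swap⟩

include hp₀ hq₀ hp hq in
/-- The biorthogonality relation for generic parameters. -/
theorem Separates.biorthogonality {γ : ℝ → ℂ} {t : Fin 6 → ℂ} {m n k l : ℕ}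
    (h : Separates γ (paramPoints p q (shifted q p t ![0, 0, 0, 0, -m, -n] ![0, 0, 0, 0, -k, -l])))
    (ht : GenericParams p q t) (ht1 : ∀ j, ‖t j‖ < 1) (hprod : ∏ j, t j = p * q)
    (hm : ellPoch q p q m ≠ 0) (hn : ellPoch q p q n ≠ 0)
    (hk : ellPoch p q p k ≠ 0) (hl : ellPoch p q p l ≠ 0) :
    contourIntegral γ (fun z => wpSeries q p (swapLast (baseParams p t)) n z *
        wpSeries q p (baseParams p t) m z * (wpSeries p q (swapLast (baseParams q t)) l z *
        wpSeries p q (baseParams q t) k z) * betaKernel p q t z) *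
        (qPochInf p p * qPochInf q q) =
      4 * Real.pi * Complex.I * betaValue p q t *
        (if m = n then wpNorm q p (baseParams p t) n else 0) *
        (if k = l then wpNorm p q (baseParams q t) l else 0) := by
  have hle (m n : ℕ) : (![0, 0, 0, 0, -m, -n] : Fin 6 → ℤ) ≤ 0 := by
    refine forall_fin_six le_rfl le_rfl le_rfl le_rfl ?_ ?_ <;> simp
  exact h.integral_expansion hp₀ hq₀ hp hq ht.toFreeParams ht1 hprod (hle m n) (hle k l)
    (ht.hasExpansion hp₀ hq₀ hp hq hprod (hle m n) le_rfl le_rfl hm hn)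
    (ht.swap.hasExpansion hq₀ hp₀ hq hp (by rw [hprod, mul_comm]) (hle k l) le_rfl le_rfl hk hl)

end

/-! ### The integrand without its removable singularities -/

section

variable {p q : ℂ} (hp₀ : p ≠ 0) (hq₀ : q ≠ 0) (hp : ‖p‖ < 1) (hq : ‖q‖ < 1)

include hp in
theorem theta_pair_inv {x z : ℂ} (hx : x ≠ 0) (hz : z ≠ 0) :
    theta (x * z) p * theta (x / z) p = x ^ 2 * (theta (x⁻¹ * z) p * theta (x⁻¹ / z) p) := by
  have h1 := theta_inv hp (mul_ne_zero hx hz)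
  have h2 := theta_inv hp (div_ne_zero hx hz)
  rw [show x⁻¹ * z = (x / z)⁻¹ by rw [inv_div]; ring, show x⁻¹ / z = (x * z)⁻¹ by
    rw [mul_inv]; ring, h1, h2]
  generalize theta (x * z) p = a
  generalize theta (x / z) p = b
  field_simp

/-- The constant in `gamma_pair_eq`. -/
def shiftConst (q c : ℂ) (m : ℕ) : ℂ := ∏ j ∈ range m, (c / q ^ (j + 1)) ^ 2

/-- The constant in `pairPoch_mul_pow`. -/
def periodConst (p q c : ℂ) (k m : ℕ) : ℂ :=
  ∏ i ∈ range m, ∏ j ∈ range k, ((c * q ^ i * p ^ j) ^ 2)⁻¹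

include hp₀ hq₀ in
theorem periodConst_ne_zero {c : ℂ} (hc : c ≠ 0) (k m : ℕ) : periodConst p q c k m ≠ 0 :=
  prod_ne_zero_iff.mpr fun _ _ => prod_ne_zero_iff.mpr fun _ _ => inv_ne_zero
    (pow_ne_zero 2 (mul_ne_zero (mul_ne_zero hc (pow_ne_zero _ hq₀)) (pow_ne_zero _ hp₀)))

theorem continuous_shiftConst (q : ℂ) (m : ℕ) : Continuous fun c => shiftConst q c m :=
  continuous_finsetProd _ fun _ _ => (continuous_id.div_const _).pow 2

include hp₀ hq₀ in
theorem continuousAt_periodConst {c : ℂ} (hc : c ≠ 0) (k m : ℕ) :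
    ContinuousAt (fun c => periodConst p q c k m) c := by
  refine tendsto_finsetProd _ fun i _ => tendsto_finsetProd _ fun j _ => ?_
  refine ContinuousAt.inv₀ (((continuousAt_id.mul continuousAt_const).mul continuousAt_const).pow 2)
    ?_
  exact pow_ne_zero 2 (mul_ne_zero (mul_ne_zero hc (pow_ne_zero _ hq₀)) (pow_ne_zero _ hp₀))

include hp₀ hq₀ hq in
theorem pairPoch_mul_pow {c z : ℂ} (hc : c ≠ 0) (hz : z ≠ 0) (k m : ℕ) :
    pairPoch p q (c * q ^ m) k z = periodConst p q c k m * pairPoch p q c k z := by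
  induction m with
  | zero => simp [periodConst]
  | succ m ih =>
    rw [periodConst, prod_range_succ, ← periodConst, mul_right_comm, ← ih, pairPoch_eq_prod,
      pairPoch_eq_prod, ← prod_mul_distrib]
    refine prod_congr rfl fun j _ => ?_
    rw [show c * q ^ (m + 1) * p ^ j = c * q ^ m * p ^ j * q by ring,
      theta_pair_mul_p hq₀ hq (mul_ne_zero (mul_ne_zero hc (pow_ne_zero _ hq₀))
        (pow_ne_zero _ hp₀)) hz, mul_comm]

include hp₀ hq₀ hp hq in
-- The functional equation of the gamma function, used `m` times downwards. The Pochhammer symbols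
-- that split off are the denominators of the series, so the product of kernel and series has only
-- the poles of the kernel with `c` divided by `q^m`.
theorem gamma_pair_eq {c z : ℂ} (hc : c ≠ 0) (hz : z ≠ 0) (f₁ : Free p q (c * z))
    (f₂ : Free p q (c / z)) (m : ℕ) :
    ellGamma p q (c * z) * ellGamma p q (c / z) =
      shiftConst q c m * pairPoch q p (q / c) m z *
        (ellGamma p q (c / q ^ m * z) * ellGamma p q (c / q ^ m / z)) := by
  induction m with
  | zero => simp [shiftConst, pairPoch_zero]
  | succ m ih =>
    have hqm := pow_ne_zero (m + 1) hq₀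
    have hx : c / q ^ (m + 1) ≠ 0 := div_ne_zero hc hqm
    have e1 := ellGamma_mul_q hq₀ hp hq (mul_ne_zero hx hz)
      ((f₁.of_eq hp₀ hq₀ 0 (-(m + 1 : ℕ)) (by
        rw [zpow_neg, zpow_natCast]; field_simp)).dblPoch_ne_zero hp hq)
    have e2 := ellGamma_mul_q hq₀ hp hq (div_ne_zero hx hz)
      ((f₂.of_eq hp₀ hq₀ 0 (-(m + 1 : ℕ)) (by
        rw [zpow_neg, zpow_natCast]; field_simp)).dblPoch_ne_zero hp hq)
    have e3 := theta_pair_inv hp hx hz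
    have a1 : c / q ^ m * z = c / q ^ (m + 1) * z * q := by
      rw [pow_succ]
      field_simp
    have a2 : c / q ^ m / z = c / q ^ (m + 1) / z * q := by
      rw [pow_succ]
      field_simp
    have a3 : q / c * q ^ m = (c / q ^ (m + 1))⁻¹ := by
      rw [inv_div, pow_succ]
      ring
    rw [ih, a1, a2, e1, e2, shiftConst, shiftConst, prod_range_succ, pairPoch_succ, a3]
    linear_combination (∏ j ∈ range m, (c / q ^ (j + 1)) ^ 2) * pairPoch q p (q / c) m z *
      ellGamma p q (c / q ^ (m + 1) * z) * ellGamma p q (c / q ^ (m + 1) / z) * e3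

/-- The constant in `gamma_pair_eq_double`. -/
def doubleConst (p q c : ℂ) (m k : ℕ) : ℂ :=
  shiftConst q c m * shiftConst p (c / q ^ m) k * periodConst p q (p / c) k m

/-- The constant in `gamma_pair_eq_double'`. -/
def doubleConst' (p q c : ℂ) (m k : ℕ) : ℂ :=
  doubleConst p q c m k / (periodConst q p (q / c) m 1 * periodConst p q (p / c) k 1)

include hp₀ hq₀ hp hq in
theorem gamma_pair_eq_double {c z : ℂ} (hc : c ≠ 0) (hz : z ≠ 0) (f₁ : Free p q (c * z))
    (f₂ : Free p q (c / z)) (m k : ℕ) :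
    ellGamma p q (c * z) * ellGamma p q (c / z) =
      doubleConst p q c m k * (pairPoch q p (q / c) m z * pairPoch p q (p / c) k z) *
        (ellGamma p q (c * q ^ (-m : ℤ) * p ^ (-k : ℤ) * z) *
          ellGamma p q (c * q ^ (-m : ℤ) * p ^ (-k : ℤ) / z)) := by
  have hqm := pow_ne_zero m hq₀
  have hc' : c / q ^ m ≠ 0 := div_ne_zero hc hqm
  have e2 := gamma_pair_eq hq₀ hp₀ hq hp hc' hz
    (f₁.of_eq hp₀ hq₀ 0 (-m) (by rw [zpow_neg, zpow_natCast]; field_simp)).swap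
    (f₂.of_eq hp₀ hq₀ 0 (-m) (by rw [zpow_neg, zpow_natCast]; field_simp)).swap k
  rw [show p / (c / q ^ m) = p / c * q ^ m by field_simp,
    pairPoch_mul_pow hp₀ hq₀ hq (div_ne_zero hp₀ hc) hz k m, ellGamma_swap q p, ellGamma_swap q p,
    ellGamma_swap q p, ellGamma_swap q p] at e2
  rw [gamma_pair_eq hp₀ hq₀ hp hq hc hz f₁ f₂ m, e2, doubleConst, zpow_neg, zpow_neg, zpow_natCast,
    zpow_natCast, ← div_eq_mul_inv, ← div_eq_mul_inv]
  ring

include hp₀ hq₀ hp hq in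
-- This version is for the sixth parameter, which enters the series in base `q` as `t₅/p` and the
-- series in base `p` as `t₅/q`. Quasi-periodicity turns this discrepancy into a constant.
theorem gamma_pair_eq_double' {c z : ℂ} (hc : c ≠ 0) (hz : z ≠ 0) (f₁ : Free p q (c * z))
    (f₂ : Free p q (c / z)) (m k : ℕ) :
    ellGamma p q (c * z) * ellGamma p q (c / z) =
      doubleConst' p q c m k * (pairPoch q p (q / (c / p)) m z * pairPoch p q (p / (c / q)) k z) *
        (ellGamma p q (c * q ^ (-m : ℤ) * p ^ (-k : ℤ) * z) *
          ellGamma p q (c * q ^ (-m : ℤ) * p ^ (-k : ℤ) / z)) := by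
  rw [gamma_pair_eq_double hp₀ hq₀ hp hq hc hz f₁ f₂ m k, doubleConst']
  have e1 := pairPoch_mul_pow hq₀ hp₀ hp (div_ne_zero hq₀ hc) hz m 1
  have e2 := pairPoch_mul_pow hp₀ hq₀ hq (div_ne_zero hp₀ hc) hz k 1
  have n1 := periodConst_ne_zero hq₀ hp₀ (div_ne_zero hq₀ hc) m 1
  have n2 := periodConst_ne_zero hp₀ hq₀ (div_ne_zero hp₀ hc) k 1
  rw [show q / (c / p) = q / c * p ^ 1 by field_simp, show p / (c / q) = p / c * q ^ 1 by field_simp,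
    e1, e2]
  generalize periodConst q p (q / c) m 1 = x at *
  generalize periodConst p q (p / c) k 1 = y at *
  field_simp

include hp₀ hq₀ in
theorem continuousAt_doubleConst {c : ℂ} (hc : c ≠ 0) (m k : ℕ) :
    ContinuousAt (fun c => doubleConst p q c m k) c := by
  refine ((continuous_shiftConst q m).continuousAt.mul ?_).mul ?_
  · exact ((continuous_shiftConst p k).comp (continuous_id.div_const _)).continuousAt
  · exact ContinuousAt.comp (f := fun c => p / c) (continuousAt_periodConst hp₀ hq₀
      (div_ne_zero hp₀ hc) k m) (continuousAt_const.div continuousAt_id hc)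

include hp₀ hq₀ in
theorem continuousAt_doubleConst' {c : ℂ} (hc : c ≠ 0) (m k : ℕ) :
    ContinuousAt (fun c => doubleConst' p q c m k) c := by
  refine (continuousAt_doubleConst hp₀ hq₀ hc m k).div (ContinuousAt.mul ?_ ?_)
    (mul_ne_zero (periodConst_ne_zero hq₀ hp₀ (div_ne_zero hq₀ hc) m 1)
      (periodConst_ne_zero hp₀ hq₀ (div_ne_zero hp₀ hc) k 1))
  · exact ContinuousAt.comp (f := fun c => q / c) (continuousAt_periodConst hq₀ hp₀
      (div_ne_zero hq₀ hc) m 1) (continuousAt_const.div continuousAt_id hc)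
  · exact ContinuousAt.comp (f := fun c => p / c) (continuousAt_periodConst hp₀ hq₀
      (div_ne_zero hp₀ hc) k 1) (continuousAt_const.div continuousAt_id hc)

/-- The numerator of `wpSeries`. -/
def wpNumer (q p : ℂ) (r : Fin 6 → ℂ) (m : ℕ) (z : ℂ) : ℂ :=
  ∑ i ∈ range (m + 1), wpCoeff q p r m i *
    (pairPoch q p (r 3) i z * pairPoch q p (q / r 4 * q ^ i) (m - i) z)

theorem wpSeries_mul_pairPoch {r : Fin 6 → ℂ} {m : ℕ} {z : ℂ}
    (h : pairPoch q p (q / r 4) m z ≠ 0) :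
    wpSeries q p r m z * pairPoch q p (q / r 4) m z = wpNumer q p r m z := by
  rw [wpSeries, wpNumer, sum_mul]
  refine sum_congr rfl fun i hi => ?_
  have e := pairPoch_add q p (q / r 4) i (m - i) z
  rw [Nat.add_sub_cancel' (Nat.lt_succ_iff.mp (mem_range.mp hi))] at e
  rw [e] at h ⊢
  have h1 := left_ne_zero_of_mul h
  field_simp

/-- The integrand of the biorthogonality relation, in terms of six parameters. -/
def biorthIntegrand (p q : ℂ) (t : Fin 6 → ℂ) (m n k l : ℕ) (z : ℂ) : ℂ :=
  wpSeries q p (swapLast (baseParams p t)) n z * wpSeries q p (baseParams p t) m z *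
    (wpSeries p q (swapLast (baseParams q t)) l z * wpSeries p q (baseParams q t) k z) *
    betaKernel p q t z

/-- The parameters of the kernel without the poles of the integrand. -/
def poleParams (p q : ℂ) (t : Fin 6 → ℂ) (m n k l : ℕ) : Fin 6 → ℂ :=
  shifted q p t ![0, 0, 0, 0, -m, -n] ![0, 0, 0, 0, -k, -l]

/-- The integrand of the biorthogonality relation without its removable singularities. -/
def regularIntegrand (p q : ℂ) (t : Fin 6 → ℂ) (m n k l : ℕ) (z : ℂ) : ℂ :=
  doubleConst p q (t 4) m k * doubleConst' p q (t 5) n l *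
    (wpNumer q p (swapLast (baseParams p t)) n z * wpNumer q p (baseParams p t) m z *
    (wpNumer p q (swapLast (baseParams q t)) l z * wpNumer p q (baseParams q t) k z)) *
    betaKernel p q (poleParams p q t m n k l) z

include hp₀ hq₀ hp hq in
-- The denominators of the four series cancel against the factors split off from the gamma functions
-- of `t₄` and `t₅`. The right side is continuous on the contour and under deformation of the
-- parameters, which the left side, as written, need not be.
theorem RegularAt.biorthIntegrand_eq {t : Fin 6 → ℂ} {z : ℂ} (h : RegularAt p q t z)
    (ht : ∀ j, t j ≠ 0) (m n k l : ℕ) :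
    biorthIntegrand p q t m n k l z = regularIntegrand p q t m n k l z := by
  have hz := h.ne_zero
  have aux {p q : ℂ} (hp₀ : p ≠ 0) (hq₀ : q ≠ 0) (hp : ‖p‖ < 1) {c : ℂ} (hc : c ≠ 0)
      (f₁ : Free p q (c * z)) (f₂ : Free p q (c / z)) (n : ℕ) : pairPoch q p (q / c) n z ≠ 0 := by
    refine mul_ne_zero ((f₂.inv.of_eq hp₀ hq₀ 0 1 ?_).poch_ne_zero hp₀ hq₀ hp ?_ n)
      ((f₁.inv.of_eq hp₀ hq₀ 0 1 ?_).poch_ne_zero hp₀ hq₀ hp ?_ n)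
    · rw [zpow_zero, zpow_one]
      field_simp
    · positivity
    · rw [zpow_zero, zpow_one]
      field_simp
    · positivity
  have n1 := aux hp₀ hq₀ hp (ht 4) (h.mul 4) (h.div 4) m
  have n2 := aux hq₀ hp₀ hq (ht 4) (h.mul 4).swap (h.div 4).swap k
  have n3 := aux hp₀ hq₀ hp (div_ne_zero (ht 5) hp₀)
    ((h.mul 5).of_eq hp₀ hq₀ (-1) 0 (by rw [zpow_neg_one]; field_simp))
    ((h.div 5).of_eq hp₀ hq₀ (-1) 0 (by rw [zpow_neg_one]; field_simp)) n
  have n4 := aux hq₀ hp₀ hq (div_ne_zero (ht 5) hq₀)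
    ((h.mul 5).swap.of_eq hq₀ hp₀ (-1) 0 (by rw [zpow_neg_one]; field_simp))
    ((h.div 5).swap.of_eq hq₀ hp₀ (-1) 0 (by rw [zpow_neg_one]; field_simp)) l
  have w1 := wpSeries_mul_pairPoch (r := baseParams p t) n1
  have w2 := wpSeries_mul_pairPoch (r := baseParams q t) n2
  have w3 := wpSeries_mul_pairPoch (r := swapLast (baseParams p t)) n3
  have w4 := wpSeries_mul_pairPoch (r := swapLast (baseParams q t)) n4
  have g4 := gamma_pair_eq_double hp₀ hq₀ hp hq (ht 4) hz (h.mul 4) (h.div 4) m k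
  have g5 := gamma_pair_eq_double' hp₀ hq₀ hp hq (ht 5) hz (h.mul 5) (h.div 5) n l
  rw [biorthIntegrand, regularIntegrand, ← w1, ← w2, ← w3, ← w4, betaKernel, betaKernel,
    Fin.prod_univ_six, Fin.prod_univ_six, g4, g5]
  simp only [poleParams, shifted, Matrix.cons_val, zpow_zero, mul_one, swapLast, baseParams]
  ring

end

/-! ### Stability of separating contours -/

/-- By compactness of the contour, continuity near each of its points holds uniformly for `z` close
to `z₀`; this provides the bound for dominated convergence. -/
theorem IsClosedContour.continuousAt_contourIntegral {γ : ℝ → ℂ} (h : IsClosedContour γ)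
    {Φ : ℂ → ℂ → ℂ} {z₀ : ℂ}
    (hΦ : ∀ w ∈ γ '' Set.Icc 0 1, ∀ᶠ x : ℂ × ℂ in 𝓝 (z₀, w),
      ContinuousAt (fun x : ℂ × ℂ => Φ x.1 x.2) x) :
    ContinuousAt (fun z => contourIntegral γ (Φ z)) z₀ := by
  have hK : IsCompact (γ '' Set.Icc 0 1) := isCompact_Icc.image_of_continuousOn h.continuousOn
  have hev := hK.eventually_forall_of_forall_eventually
    (P := fun z w => ContinuousAt (fun x : ℂ × ℂ => Φ x.1 x.2) (z, w)) hΦ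
  obtain ⟨r, hr, hball⟩ := Metric.nhds_basis_closedBall.eventually_iff.mp hev
  have hc : ContinuousOn (fun x : ℂ × ℂ => Φ x.1 x.2)
      (Metric.closedBall z₀ r ×ˢ (γ '' Set.Icc 0 1)) := fun x hx =>
    (hball hx.1 x.2 hx.2).continuousWithinAt
  obtain ⟨M, hM⟩ := ((isCompact_closedBall z₀ r).prod hK).exists_bound_of_continuousOn hc
  have hcont (z : ℂ) (hz : z ∈ Metric.closedBall z₀ r) :
      ContinuousOn (fun s => Φ z (γ s)) (Set.Icc 0 1) := by
    have h1 : ContinuousOn (fun s => ((z, γ s) : ℂ × ℂ)) (Set.Icc 0 1) :=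
      continuousOn_const.prodMk h.continuousOn
    exact hc.comp h1 (fun s hs => ⟨hz, Set.mem_image_of_mem γ hs⟩)
  have hmem (s : ℝ) (hs : s ∈ Set.uIoc (0 : ℝ) 1) : γ s ∈ γ '' Set.Icc 0 1 := by
    rw [Set.uIoc_of_le zero_le_one] at hs
    exact Set.mem_image_of_mem γ (Set.Ioc_subset_Icc_self hs)
  have hnhds : ∀ᶠ z in 𝓝 z₀, z ∈ Metric.closedBall z₀ r := Metric.closedBall_mem_nhds z₀ hr
  unfold contourIntegral
  refine intervalIntegral.continuousAt_of_dominated_interval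
    (bound := fun s => M * ‖deriv γ s‖) ?_ ?_ ?_ ?_
  · filter_upwards [hnhds] with z hz
    exact (intervalIntegrable_iff.mp (h.contourIntegrable (hcont z hz))).aestronglyMeasurable
  · filter_upwards [hnhds] with z hz
    refine Eventually.of_forall fun s hs => ?_
    rw [norm_mul]
    exact mul_le_mul_of_nonneg_right (hM (z, γ s) ⟨hz, hmem s hs⟩) (norm_nonneg _)
  · exact h.intervalIntegrable_deriv.norm.const_mul _
  · refine Eventually.of_forall fun s hs => ContinuousAt.mul ?_ continuousAt_const
    exact ContinuousAt.comp (f := fun z : ℂ => (z, γ s)) (g := fun x : ℂ × ℂ => Φ x.1 x.2)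
      (hball (Metric.mem_closedBall_self hr.le) _ (hmem s hs))
      (continuousAt_id.prodMk continuousAt_const)

section

variable {p q : ℂ} (hp₀ : p ≠ 0) (hq₀ : q ≠ 0) (hp : ‖p‖ < 1) (hq : ‖q‖ < 1)

include hp hq in
theorem tendsto_pow_mul_pow_cofinite (c : ℂ) :
    Tendsto (fun x : ℕ × ℕ => ‖c * p ^ x.1 * q ^ x.2‖) cofinite (𝓝 0) := by
  have h1 := summable_geometric_of_lt_one (norm_nonneg p) hp
  have h2 := summable_geometric_of_lt_one (norm_nonneg q) hq
  have h3 := (h1.mul_of_nonneg h2 (fun _ => by positivity) (fun _ => by positivity)).mul_left ‖c‖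
  have := h3.tendsto_cofinite_zero
  refine this.congr fun x => ?_
  rw [norm_mul, norm_mul, norm_pow, norm_pow, mul_assoc]

include hp₀ hq₀ hp hq in
/-- The contour keeps a distance from the points it separates. -/
theorem Separates.eventually_lt_norm_sub {γ : ℝ → ℂ} {s : Fin 6 → ℂ}
    (h : Separates γ (paramPoints p q s)) (hs : ∀ j, s j ≠ 0) :
    ∀ᶠ ε : ℝ in 𝓝[>] 0, ∀ w ∈ paramPoints p q s, ∀ y ∈ Set.Icc (0 : ℝ) 1,
      ε * ‖w‖ < ‖γ y - w‖ ∧ ε * ‖w⁻¹‖ < ‖γ y - w⁻¹‖ := by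
  have hne : (Set.Icc (0 : ℝ) 1).Nonempty := Set.nonempty_Icc.mpr zero_le_one
  have hcont := h.isClosedContour.continuousOn
  have hlow (w : ℂ) (hw : ∀ y ∈ Set.Icc (0 : ℝ) 1, γ y ≠ w) :
      ∃ c > 0, ∀ y ∈ Set.Icc (0 : ℝ) 1, c ≤ ‖γ y - w‖ := by
    obtain ⟨y₀, hy₀, hmin⟩ := isCompact_Icc.exists_isMinOn hne
      (hcont.sub (continuousOn_const (c := w))).norm
    exact ⟨_, norm_pos_iff.mpr (sub_ne_zero.mpr (hw y₀ hy₀)), fun y hy => hmin hy⟩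
  have hone (w : ℂ) (hw : ∀ y ∈ Set.Icc (0 : ℝ) 1, γ y ≠ w) :
      ∀ᶠ ε : ℝ in 𝓝[>] 0, ∀ y ∈ Set.Icc (0 : ℝ) 1, ε * ‖w‖ < ‖γ y - w‖ := by
    obtain ⟨c, hc, hcw⟩ := hlow w hw
    have : Tendsto (fun ε : ℝ => ε * ‖w‖) (𝓝[>] 0) (𝓝 0) := by
      have hc : ContinuousAt (fun ε : ℝ => ε * ‖w‖) 0 := by fun_prop
      have := hc.tendsto
      rw [zero_mul] at this
      exact this.mono_left nhdsWithin_le_nhds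
    filter_upwards [this.eventually (gt_mem_nhds hc)] with ε hε y hy using hε.trans_le (hcw y hy)
  obtain ⟨m, hm, hmγ⟩ := hlow 0 fun y hy => h.ne_zero y hy
  obtain ⟨M, hM⟩ := isCompact_Icc.exists_bound_of_continuousOn hcont
  have hM0 : 0 < M := by
    have h1 := hM 0 ⟨le_rfl, zero_le_one⟩
    have h2 := norm_pos_iff.mpr (h.ne_zero 0 ⟨le_rfl, zero_le_one⟩)
    linarith
  -- A point close to `0` is far from the contour relative to its size, and so is its very large
  -- reciprocal. All but finitely many of the points are of this kind, and each of the others has a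
  -- positive distance.
  have hsmall {w : ℂ} (hw0 : w ≠ 0) (hw1 : ‖w‖ < m / 2) (hw2 : ‖w‖ < 1 / (2 * M)) {ε : ℝ}
      (hε : ε < 1 / 2) (y : ℝ) (hy : y ∈ Set.Icc (0 : ℝ) 1) :
      ε * ‖w‖ < ‖γ y - w‖ ∧ ε * ‖w⁻¹‖ < ‖γ y - w⁻¹‖ := by
    have h1 := norm_sub_norm_le (γ y) w
    have h2 := hmγ y hy
    have hwp := norm_pos_iff.mpr hw0
    rw [sub_zero] at h2
    constructor
    · nlinarith
    · rw [lt_div_iff₀ (by positivity)] at hw2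
      have h3 := norm_sub_norm_le w⁻¹ (γ y)
      rw [norm_sub_rev, norm_inv] at h3
      rw [norm_inv]
      have h4 : M < 1 / 2 * ‖w‖⁻¹ := by
        rw [← div_eq_mul_inv, lt_div_iff₀ hwp]
        linarith
      have h5 := hM y hy
      have h6 := inv_pos.mpr hwp
      nlinarith
  have hw0 (j : Fin 6) (x : ℕ × ℕ) : s j * p ^ x.1 * q ^ x.2 ≠ 0 :=
    mul_ne_zero (mul_ne_zero (hs j) (pow_ne_zero _ hp₀)) (pow_ne_zero _ hq₀)
  have hj (j : Fin 6) : ∀ᶠ ε : ℝ in 𝓝[>] 0, ∀ x : ℕ × ℕ, ∀ y ∈ Set.Icc (0 : ℝ) 1,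
      ε * ‖s j * p ^ x.1 * q ^ x.2‖ < ‖γ y - s j * p ^ x.1 * q ^ x.2‖ ∧
      ε * ‖(s j * p ^ x.1 * q ^ x.2)⁻¹‖ < ‖γ y - (s j * p ^ x.1 * q ^ x.2)⁻¹‖ := by
    have ht := tendsto_pow_mul_pow_cofinite hp hq (s j)
    have hfin : {x : ℕ × ℕ | ¬ (‖s j * p ^ x.1 * q ^ x.2‖ < m / 2 ∧
        ‖s j * p ^ x.1 * q ^ x.2‖ < 1 / (2 * M))}.Finite :=
      (ht.eventually (gt_mem_nhds (by positivity : (0 : ℝ) < m / 2))).and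
        (ht.eventually (gt_mem_nhds (by positivity : (0 : ℝ) < 1 / (2 * M))))
    have hev := (eventually_all_finite hfin).mpr fun x (_ : x ∈ _) =>
      (hone (s j * p ^ x.1 * q ^ x.2) fun y hy => (h.avoids _ ⟨j, x.1, x.2, rfl⟩ y hy).1).and
        (hone (s j * p ^ x.1 * q ^ x.2)⁻¹ fun y hy => (h.avoids _ ⟨j, x.1, x.2, rfl⟩ y hy).2)
    have hhalf : ∀ᶠ ε : ℝ in 𝓝[>] 0, ε < 1 / 2 :=
      nhdsWithin_le_nhds (gt_mem_nhds (by norm_num : (0 : ℝ) < 1 / 2))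
    filter_upwards [hev, hhalf] with ε hε hε' x y hy
    by_cases hx : ‖s j * p ^ x.1 * q ^ x.2‖ < m / 2 ∧ ‖s j * p ^ x.1 * q ^ x.2‖ < 1 / (2 * M)
    · exact hsmall (hw0 j x) hx.1 hx.2 hε' y hy
    · exact ⟨(hε x hx).1 y hy, (hε x hx).2 y hy⟩
  filter_upwards [eventually_all.mpr hj] with ε hε w hw
  obtain ⟨j, a, b, rfl⟩ := hw
  exact hε j (a, b)

include hp₀ hq₀ hp hq in
-- Multiplying a parameter by `u` displaces all its points, and their reciprocals, by a relative
-- error less than `ε`, which is less than the relative distance to the contour. Hence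
-- `IsClosedContour.contourIntegral_sub_inv_eq` preserves all the winding numbers at once.
theorem Separates.eventually_of_tendsto {γ : ℝ → ℂ} {s : Fin 6 → ℂ}
    (h : Separates γ (paramPoints p q s)) (hs : ∀ j, s j ≠ 0) {u : ℂ → Fin 6 → ℂ}
    {x : ℂ} (hu : ∀ j, ContinuousAt (fun τ => u τ j) x) (hu1 : ∀ j, u x j = 1) :
    ∀ᶠ τ in 𝓝 x, Separates γ (paramPoints p q fun j => s j * u τ j) := by
  obtain ⟨ε, hε, hε0⟩ := ((h.eventually_lt_norm_sub hp₀ hq₀ hp hq hs).and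
    self_mem_nhdsWithin).exists
  have hε0' : 0 < ε := hε0
  have e1 (j : Fin 6) : ∀ᶠ τ in 𝓝 x, ‖u τ j - 1‖ < ε ∧ ‖(u τ j)⁻¹ - 1‖ < ε := by
    have c1 : ContinuousAt (fun τ => ‖u τ j - 1‖) x := ((hu j).sub continuousAt_const).norm
    have c2 : ContinuousAt (fun τ => ‖(u τ j)⁻¹ - 1‖) x :=
      (((hu j).inv₀ (by rw [hu1]; exact one_ne_zero)).sub continuousAt_const).norm
    refine (c1.eventually (gt_mem_nhds ?_)).and (c2.eventually (gt_mem_nhds ?_))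
    · simpa [hu1] using hε0'
    · simpa [hu1] using hε0'
  filter_upwards [eventually_all.mpr e1] with τ hτ
  have k1 (j : Fin 6) (a b : ℕ) (y : ℝ) (hy : y ∈ Set.Icc (0 : ℝ) 1) :
      ‖s j * u τ j * p ^ a * q ^ b - s j * p ^ a * q ^ b‖ < ‖γ y - s j * p ^ a * q ^ b‖ := by
    refine lt_of_le_of_lt ?_ (hε _ ⟨j, a, b, rfl⟩ y hy).1
    rw [show s j * u τ j * p ^ a * q ^ b - s j * p ^ a * q ^ b =
      (u τ j - 1) * (s j * p ^ a * q ^ b) by ring, norm_mul]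
    exact mul_le_mul_of_nonneg_right (hτ j).1.le (norm_nonneg _)
  have k2 (j : Fin 6) (a b : ℕ) (y : ℝ) (hy : y ∈ Set.Icc (0 : ℝ) 1) :
      ‖(s j * u τ j * p ^ a * q ^ b)⁻¹ - (s j * p ^ a * q ^ b)⁻¹‖ <
        ‖γ y - (s j * p ^ a * q ^ b)⁻¹‖ := by
    refine lt_of_le_of_lt ?_ (hε _ ⟨j, a, b, rfl⟩ y hy).2
    rw [show (s j * u τ j * p ^ a * q ^ b)⁻¹ - (s j * p ^ a * q ^ b)⁻¹ =
      ((u τ j)⁻¹ - 1) * (s j * p ^ a * q ^ b)⁻¹ by simp only [mul_inv]; ring, norm_mul]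
    exact mul_le_mul_of_nonneg_right (hτ j).2.le (norm_nonneg _)
  refine ⟨h.isClosedContour, h.ne_zero, ?_, ?_, ?_⟩
  · rintro w ⟨j, a, b, rfl⟩ y hy
    constructor
    · intro h0
      have := k1 j a b y hy
      rw [← h0] at this
      exact lt_irrefl _ this
    · intro h0
      have := k2 j a b y hy
      rw [← h0] at this
      exact lt_irrefl _ this
  · rintro w ⟨j, a, b, rfl⟩
    rw [windingNumber, h.isClosedContour.contourIntegral_sub_inv_eq (k1 j a b)]
    exact h.inside _ ⟨j, a, b, rfl⟩
  · rintro w ⟨j, a, b, rfl⟩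
    rw [windingNumber, h.isClosedContour.contourIntegral_sub_inv_eq (k2 j a b)]
    exact h.outside _ ⟨j, a, b, rfl⟩

end

/-! ### The limit to parameters that are not generic -/

section

variable {p q : ℂ} (hp₀ : p ≠ 0) (hq₀ : q ≠ 0) (hp : ‖p‖ < 1) (hq : ‖q‖ < 1)

/-- The denominators of the coefficients of `wpSeries q p r m`. -/
def wpDen (q p : ℂ) (r : Fin 6 → ℂ) (m : ℕ) : ℂ :=
  theta (r 3 / r 4) p *
    (ellPoch q p q m * ellPoch q p (r 0 * r 3) m * ellPoch q p (r 1 * r 3) m *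
      ellPoch q p (r 2 * r 3) m * ellPoch q p (r 3 / r 4 * q ^ (m + 1)) m *
      ellPoch q p (r 3 * r 5 * q ^ (1 - (m : ℤ))) m)

/-- The denominator of `wpNorm q p r n`. -/
def wpNormDen (q p : ℂ) (r : Fin 6 → ℂ) (n : ℕ) : ℂ :=
  theta ((r 4 * r 5)⁻¹ * q ^ (2 * n)) p *
    (ellPoch q p (r 3 * r 4)⁻¹ n * ellPoch q p (r 0 * r 3) n * ellPoch q p (r 1 * r 3) n *
      ellPoch q p (r 2 * r 3) n * ellPoch q p (r 3 * r 5)⁻¹ n * ellPoch q p (r 4 * r 5)⁻¹ n)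

section

variable {X : Type*} [TopologicalSpace X] {x : X} {r : X → Fin 6 → ℂ}
  (hr : ∀ j, ContinuousAt (fun y => r y j) x) (hr0 : ∀ j, r x j ≠ 0)

include hq₀ hp hr hr0

theorem continuousAt_wpDen (m : ℕ) : ContinuousAt (fun y => wpDen q p (r y) m) x := by
  have c {f : X → ℂ} (hf : ContinuousAt f x) (h : f x ≠ 0) (n : ℕ) :=
    continuousAt_ellPoch_comp hq₀ hp hf h n
  have n34 := div_ne_zero (hr0 3) (hr0 4)
  have c34 := (hr 3).div (hr 4) (hr0 4)
  exact (continuousAt_theta_comp hp c34 n34).mul (((((continuousAt_const.mul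
    (c ((hr 0).mul (hr 3)) (mul_ne_zero (hr0 0) (hr0 3)) m)).mul
    (c ((hr 1).mul (hr 3)) (mul_ne_zero (hr0 1) (hr0 3)) m)).mul
    (c ((hr 2).mul (hr 3)) (mul_ne_zero (hr0 2) (hr0 3)) m)).mul
    (c (c34.mul continuousAt_const) (mul_ne_zero n34 (pow_ne_zero _ hq₀)) m)).mul
    (c (((hr 3).mul (hr 5)).mul continuousAt_const)
      (mul_ne_zero (mul_ne_zero (hr0 3) (hr0 5)) (zpow_ne_zero _ hq₀)) m))

theorem continuousAt_wpCoeff {m i : ℕ} (hi : i ≤ m) (hd : wpDen q p (r x) m ≠ 0) :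
    ContinuousAt (fun y => wpCoeff q p (r y) m i) x := by
  have c {f : X → ℂ} (hf : ContinuousAt f x) (h : f x ≠ 0) (n : ℕ) :=
    continuousAt_ellPoch_comp hq₀ hp hf h n
  have n34 := div_ne_zero (hr0 3) (hr0 4)
  have c34 := (hr 3).div (hr 4) (hr0 4)
  have cq {f : X → ℂ} (hf : ContinuousAt f x) (h : f x ≠ 0) {a : ℂ} (ha : a ≠ 0) (n : ℕ) :
      ContinuousAt (fun y => ellPoch q p (a / f y) n) x :=
    c (continuousAt_const.div hf h) (div_ne_zero ha h) n
  simp only [wpDen, mul_ne_zero_iff] at hd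
  obtain ⟨d0, ⟨⟨⟨⟨⟨d1, d2⟩, d3⟩, d4⟩, d5⟩, d6⟩⟩ := hd
  refine ContinuousAt.mul (ContinuousAt.mul (ContinuousAt.div ?_ ?_ d0) (ContinuousAt.div ?_ ?_ ?_))
    continuousAt_const
  · exact continuousAt_theta_comp hp (c34.mul continuousAt_const)
      (mul_ne_zero n34 (pow_ne_zero _ hq₀))
  · exact continuousAt_theta_comp hp c34 n34
  · exact (((((c c34 n34 i).mul (cq ((hr 0).mul (hr 4)) (mul_ne_zero (hr0 0) (hr0 4)) hq₀ i)).mul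
      (cq ((hr 1).mul (hr 4)) (mul_ne_zero (hr0 1) (hr0 4)) hq₀ i)).mul
      (cq ((hr 2).mul (hr 4)) (mul_ne_zero (hr0 2) (hr0 4)) hq₀ i)).mul continuousAt_const).mul
      (cq ((hr 4).mul (hr 5)) (mul_ne_zero (hr0 4) (hr0 5)) (pow_ne_zero m hq₀) i)
  · exact ((((continuousAt_const.mul
      (c ((hr 0).mul (hr 3)) (mul_ne_zero (hr0 0) (hr0 3)) i)).mul
      (c ((hr 1).mul (hr 3)) (mul_ne_zero (hr0 1) (hr0 3)) i)).mul
      (c ((hr 2).mul (hr 3)) (mul_ne_zero (hr0 2) (hr0 3)) i)).mul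
      (c (c34.mul continuousAt_const) (mul_ne_zero n34 (pow_ne_zero _ hq₀)) i)).mul
      (c (((hr 3).mul (hr 5)).mul continuousAt_const)
      (mul_ne_zero (mul_ne_zero (hr0 3) (hr0 5)) (zpow_ne_zero _ hq₀)) i)
  · exact mul_ne_zero (mul_ne_zero (mul_ne_zero (mul_ne_zero (mul_ne_zero
      (ellPoch_ne_zero_of_le hi d1) (ellPoch_ne_zero_of_le hi d2)) (ellPoch_ne_zero_of_le hi d3))
      (ellPoch_ne_zero_of_le hi d4)) (ellPoch_ne_zero_of_le hi d5)) (ellPoch_ne_zero_of_le hi d6)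

theorem continuousAt_wpNorm {n : ℕ} (hd : wpNormDen q p (r x) n ≠ 0) :
    ContinuousAt (fun y => wpNorm q p (r y) n) x := by
  have c {f : X → ℂ} (hf : ContinuousAt f x) (h : f x ≠ 0) (n : ℕ) :=
    continuousAt_ellPoch_comp hq₀ hp hf h n
  have cm (j k : Fin 6) := c ((hr j).mul (hr k)) (mul_ne_zero (hr0 j) (hr0 k)) n
  have ci (j k : Fin 6) := c (((hr j).mul (hr k)).inv₀ (mul_ne_zero (hr0 j) (hr0 k)))
    (inv_ne_zero (mul_ne_zero (hr0 j) (hr0 k))) n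
  have cd (j k : Fin 6) := c (((hr j).div (hr k) (hr0 k)).mul (continuousAt_const (y := q)))
    (mul_ne_zero (div_ne_zero (hr0 j) (hr0 k)) hq₀) n
  have n45 := inv_ne_zero (mul_ne_zero (hr0 4) (hr0 5))
  have c45 := ((hr 4).mul (hr 5)).inv₀ (mul_ne_zero (hr0 4) (hr0 5))
  refine ContinuousAt.div (ContinuousAt.div (ContinuousAt.mul ?_ ?_) continuousAt_const
    (pow_ne_zero n hq₀)) (ContinuousAt.mul ?_ ?_) hd
  · exact continuousAt_theta_comp hp c45 n45
  · exact ((((continuousAt_const.mul (cd 3 4)).mul (cm 0 1)).mul (cm 0 2)).mul (cm 1 2)).mul (cd 3 5)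
  · exact continuousAt_theta_comp hp (c45.mul continuousAt_const)
      (mul_ne_zero n45 (pow_ne_zero _ hq₀))
  · exact (((((ci 3 4).mul (cm 0 3)).mul (cm 1 3)).mul (cm 2 3)).mul (ci 3 5)).mul (ci 4 5)

theorem continuousAt_wpNumer {m : ℕ} (hd : wpDen q p (r x) m ≠ 0) {Z : X → ℂ}
    (hZ : ContinuousAt Z x) (hZ0 : Z x ≠ 0) :
    ContinuousAt (fun y => wpNumer q p (r y) m (Z y)) x := by
  have c {f : X → ℂ} (hf : ContinuousAt f x) (h : f x ≠ 0) (n : ℕ) :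
      ContinuousAt (fun y => pairPoch q p (f y) n (Z y)) x :=
    (continuousAt_ellPoch_comp hq₀ hp (hf.mul hZ) (mul_ne_zero h hZ0) n).mul
      (continuousAt_ellPoch_comp hq₀ hp (hf.div hZ hZ0) (div_ne_zero h hZ0) n)
  refine tendsto_finsetSum _ fun i hi => ?_
  refine ContinuousAt.mul (continuousAt_wpCoeff hq₀ hp hr hr0
    (Nat.lt_succ_iff.mp (mem_range.mp hi)) hd) (ContinuousAt.mul (c (hr 3) (hr0 3) i) (c ?_ ?_ _))
  · exact (continuousAt_const.div (hr 4) (hr0 4)).mul continuousAt_const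
  · exact mul_ne_zero (div_ne_zero hq₀ (hr0 4)) (pow_ne_zero _ hq₀)

end

theorem continuousAt_baseParams (hp₀ : p ≠ 0) {X : Type*} [TopologicalSpace X] {x : X}
    {t : X → Fin 6 → ℂ} (ht : ∀ j, ContinuousAt (fun y => t y j) x) (j : Fin 6) :
    ContinuousAt (fun y => baseParams p (t y) j) x := by
  revert j
  exact forall_fin_six (ht 0) (ht 1) (ht 2) (ht 3) (ht 4) ((ht 5).div continuousAt_const hp₀)

theorem continuousAt_swapLast {X : Type*} [TopologicalSpace X] {x : X}
    {t : X → Fin 6 → ℂ} (ht : ∀ j, ContinuousAt (fun y => t y j) x) (j : Fin 6) :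
    ContinuousAt (fun y => swapLast (t y) j) x := by
  revert j
  exact forall_fin_six (ht 0) (ht 1) (ht 2) (ht 3) (ht 5) (ht 4)

theorem baseParams_ne_zero (hp₀ : p ≠ 0) {t : Fin 6 → ℂ} (ht : ∀ j, t j ≠ 0) (j : Fin 6) :
    baseParams p t j ≠ 0 := by
  revert j
  exact forall_fin_six (ht 0) (ht 1) (ht 2) (ht 3) (ht 4) (div_ne_zero (ht 5) hp₀)

theorem swapLast_ne_zero {t : Fin 6 → ℂ} (ht : ∀ j, t j ≠ 0) (j : Fin 6) : swapLast t j ≠ 0 := by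
  revert j
  exact forall_fin_six (ht 0) (ht 1) (ht 2) (ht 3) (ht 5) (ht 4)

/-- The denominators not depending on `z` of the factors of the integrand. -/
def seriesDen (p q : ℂ) (t : Fin 6 → ℂ) (m n k l : ℕ) : ℂ :=
  wpDen q p (swapLast (baseParams p t)) n * wpDen q p (baseParams p t) m *
    (wpDen p q (swapLast (baseParams q t)) l * wpDen p q (baseParams q t) k)

include hp₀ hq₀ hp hq in
theorem continuousAt_seriesDen {X : Type*} [TopologicalSpace X] {x : X}
    {t : X → Fin 6 → ℂ} (ht : ∀ j, ContinuousAt (fun y => t y j) x) (ht0 : ∀ j, t x j ≠ 0)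
    (m n k l : ℕ) : ContinuousAt (fun y => seriesDen p q (t y) m n k l) x := by
  have c1 := continuousAt_baseParams hp₀ ht
  have c2 := continuousAt_baseParams hq₀ ht
  have n1 := baseParams_ne_zero hp₀ ht0
  have n2 := baseParams_ne_zero hq₀ ht0
  exact ((continuousAt_wpDen hq₀ hp (continuousAt_swapLast c1) (swapLast_ne_zero n1) n).mul
    (continuousAt_wpDen hq₀ hp c1 n1 m)).mul
    ((continuousAt_wpDen hp₀ hq (continuousAt_swapLast c2) (swapLast_ne_zero n2) l).mul
    (continuousAt_wpDen hp₀ hq c2 n2 k))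

include hp₀ hq₀ hp hq in
theorem continuousAt_regularIntegrand {E : Type*} [NormedAddCommGroup E] [NormedSpace ℂ E] {x : E}
    {t : E → Fin 6 → ℂ} (ht : ∀ j, DifferentiableAt ℂ (fun y => t y j) x) (ht0 : ∀ j, t x j ≠ 0)
    {Z : E → ℂ} (hZ : DifferentiableAt ℂ Z x) {m n k l : ℕ}
    (hd : seriesDen p q (t x) m n k l ≠ 0)
    (hreg : Z x ∈ regularSet p q (poleParams p q (t x) m n k l)) :
    ContinuousAt (fun y => regularIntegrand p q (t y) m n k l (Z y)) x := by
  have ht' (j : Fin 6) := (ht j).continuousAt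
  have c1 := continuousAt_baseParams hp₀ ht'
  have c2 := continuousAt_baseParams hq₀ ht'
  have n1 := baseParams_ne_zero hp₀ ht0
  have n2 := baseParams_ne_zero hq₀ ht0
  simp only [seriesDen, mul_ne_zero_iff] at hd
  refine ContinuousAt.mul (ContinuousAt.mul (ContinuousAt.mul ?_ ?_) (ContinuousAt.mul
    (ContinuousAt.mul ?_ ?_) (ContinuousAt.mul ?_ ?_))) ?_
  · exact ContinuousAt.comp (f := fun y => t y 4) (continuousAt_doubleConst hp₀ hq₀ (ht0 4) m k)
      (ht' 4)
  · exact ContinuousAt.comp (f := fun y => t y 5) (continuousAt_doubleConst' hp₀ hq₀ (ht0 5) n l)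
      (ht' 5)
  · exact continuousAt_wpNumer hq₀ hp (continuousAt_swapLast c1) (swapLast_ne_zero n1) hd.1.1
      hZ.continuousAt hreg.1
  · exact continuousAt_wpNumer hq₀ hp c1 n1 hd.1.2 hZ.continuousAt hreg.1
  · exact continuousAt_wpNumer hp₀ hq (continuousAt_swapLast c2) (swapLast_ne_zero n2) hd.2.1
      hZ.continuousAt hreg.1
  · exact continuousAt_wpNumer hp₀ hq c2 n2 hd.2.2 hZ.continuousAt hreg.1
  · refine DifferentiableAt.continuousAt (𝕜 := ℂ) (differentiableAt_betaKernel hp hq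
      (S := fun y => poleParams p q (t y) m n k l)
      (fun j => ?_) hZ (fun j => ?_) hreg.1 (fun j => (hreg.2 j).1) (fun j => (hreg.2 j).2))
    · exact ((ht j).mul_const _).mul_const _
    · exact mul_ne_zero (mul_ne_zero (ht0 j) (zpow_ne_zero _ hq₀)) (zpow_ne_zero _ hp₀)

/-- The exponents of the deformation of the parameters. -/
def deformWeight : Fin 6 → ℂ := ![1, 10, 100, 1000, 10000, -11111]

/-- A deformation of the parameters that does not change their product. -/
def deform (t : Fin 6 → ℂ) (τ : ℂ) (j : Fin 6) : ℂ := t j * Complex.exp (deformWeight j * τ)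

theorem deform_zero (t : Fin 6 → ℂ) : deform t 0 = t := by
  funext j
  simp [deform]

theorem prod_deform (t : Fin 6 → ℂ) (τ : ℂ) : ∏ j, deform t τ j = ∏ j, t j := by
  simp only [deform, prod_mul_distrib, ← Complex.exp_sum, ← sum_mul]
  rw [show ∑ j, deformWeight j = 0 by simp [deformWeight, Fin.sum_univ_six]; norm_num]
  simp

theorem deform_ne_zero {t : Fin 6 → ℂ} (ht : ∀ j, t j ≠ 0) (τ : ℂ) (j : Fin 6) :
    deform t τ j ≠ 0 := mul_ne_zero (ht j) (Complex.exp_ne_zero _)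

theorem differentiable_deform (t : Fin 6 → ℂ) (j : Fin 6) : Differentiable ℂ fun τ => deform t τ j :=
  ((differentiable_id.const_mul _).cexp).const_mul _

theorem countable_setOf_not_free_exp {x c : ℂ} (hx : x ≠ 0) (hc : c ≠ 0) :
    {τ | ¬ Free p q (x * Complex.exp (c * τ))}.Countable := by
  have h1 := countable_setOf_not_free (p := p) (q := q) (fun z => x * z) (mul_right_injective₀ hx)
  exact (h1.preimage_cexp).preimage (f := fun τ => c * τ) (mul_right_injective₀ hc)

theorem countable_setOf_not_generic_deform {t : Fin 6 → ℂ} (ht : ∀ j, t j ≠ 0) :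
    {τ | ¬ GenericParams p q (deform t τ)}.Countable := by
  -- The weights are powers of ten, balanced by the last one to have sum zero. No two of them add to
  -- zero, not even a weight with itself, and no two coincide; so each product or quotient of
  -- parameters really varies with `τ`.
  have hadd (j k : Fin 6) : deformWeight j + deformWeight k ≠ 0 := by
    fin_cases j <;> fin_cases k <;> norm_num [deformWeight]
  have hsub (j k : Fin 6) (hjk : j ≠ k) : deformWeight j - deformWeight k ≠ 0 := by
    fin_cases j <;> fin_cases k <;> first | exact absurd rfl hjk | norm_num [deformWeight]
  have hsubset : {τ | ¬ GenericParams p q (deform t τ)} ⊆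
      (⋃ j, ⋃ k, {τ | ¬ Free p q (t j * t k * Complex.exp ((deformWeight j + deformWeight k) * τ))}) ∪
      ⋃ j, ⋃ k, ⋃ (_ : j ≠ k),
        {τ | ¬ Free p q (t j / t k * Complex.exp ((deformWeight j - deformWeight k) * τ))} := by
    intro τ hτ
    by_contra hcon
    simp only [Set.mem_union, Set.mem_iUnion, Set.mem_ofPred_eq, not_or, not_exists,
      not_not] at hcon
    refine hτ ⟨⟨deform_ne_zero ht τ, fun j k => ?_⟩, fun j k hjk => ?_⟩
    · have := hcon.1 j k
      rwa [add_mul, Complex.exp_add, mul_mul_mul_comm] at this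
    · have := hcon.2 j k hjk
      rwa [sub_mul, Complex.exp_sub, div_mul_div_comm] at this
  refine Set.Countable.mono hsubset (Set.Countable.union ?_ ?_)
  · exact Set.countable_iUnion fun j => Set.countable_iUnion fun k =>
      countable_setOf_not_free_exp (mul_ne_zero (ht j) (ht k)) (hadd j k)
  · exact Set.countable_iUnion fun j => Set.countable_iUnion fun k => Set.countable_iUnion fun hjk =>
      countable_setOf_not_free_exp (div_ne_zero (ht j) (ht k)) (hsub j k hjk)

end

section

variable {p q : ℂ} (hp₀ : p ≠ 0) (hq₀ : q ≠ 0) (hp : ‖p‖ < 1) (hq : ‖q‖ < 1)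

theorem poleParams_deform (t : Fin 6 → ℂ) (τ : ℂ) (m n k l : ℕ) :
    poleParams p q (deform t τ) m n k l =
      fun j => poleParams p q t m n k l j * Complex.exp (deformWeight j * τ) := by
  funext j
  simp only [poleParams, shifted, deform]
  ring

include hp₀ hq₀ in
theorem poleParams_ne_zero {t : Fin 6 → ℂ} (ht : ∀ j, t j ≠ 0) (m n k l : ℕ) (j : Fin 6) :
    poleParams p q t m n k l j ≠ 0 :=
  mul_ne_zero (mul_ne_zero (ht j) (zpow_ne_zero _ hq₀)) (zpow_ne_zero _ hp₀)

theorem ellPoch_ne_zero_of_wpDen {r : Fin 6 → ℂ} {m : ℕ} (h : wpDen q p r m ≠ 0) :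
    ellPoch q p q m ≠ 0 := by
  simp only [wpDen, mul_ne_zero_iff] at h
  exact h.2.1.1.1.1.1

include hp₀ hq₀ hp hq in
theorem Separates.contourIntegrable_biorthIntegrand {γ : ℝ → ℂ} {t : Fin 6 → ℂ} {m n k l : ℕ}
    (h : Separates γ (paramPoints p q (poleParams p q t m n k l))) (ht : ∀ j, t j ≠ 0)
    (hd : seriesDen p q t m n k l ≠ 0) :
    ContourIntegrable γ (biorthIntegrand p q t m n k l) := by
  refine contourIntegrable_congr_of_countable (countable_not_regularAt ht)
    (fun s _ hs => (not_not.mp hs).biorthIntegrand_eq hp₀ hq₀ hp hq ht m n k l) ?_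
  refine h.isClosedContour.contourIntegrable fun s hs => ?_
  have := continuousAt_regularIntegrand hp₀ hq₀ hp hq (t := fun _ : ℂ => t) (Z := fun y => y)
    (x := γ s) (fun j => differentiableAt_const _) ht differentiableAt_id hd
    (h.mem_regularSet hp hq hs)
  exact this.comp_continuousWithinAt (h.isClosedContour.continuousOn s hs)

include hp₀ hq₀ hp hq in
theorem Separates.continuousAt_integral_deform {γ : ℝ → ℂ} {t : Fin 6 → ℂ} {m n k l : ℕ}
    (h : Separates γ (paramPoints p q (poleParams p q t m n k l))) (ht : ∀ j, t j ≠ 0)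
    (hd : seriesDen p q t m n k l ≠ 0) :
    ContinuousAt (fun τ => contourIntegral γ (regularIntegrand p q (deform t τ) m n k l)) 0 := by
  refine h.isClosedContour.continuousAt_contourIntegral ?_
  rintro w ⟨s, hs, rfl⟩
  obtain ⟨hz, hreg⟩ := h.mem_regularSet hp hq hs
  have hD (x : ℂ × ℂ) (j : Fin 6) : DifferentiableAt ℂ (fun y : ℂ × ℂ => deform t y.1 j) x :=
    (differentiable_deform t j).differentiableAt.comp x differentiableAt_fst
  have hP (x : ℂ × ℂ) (j : Fin 6) :
      ContinuousAt (fun y : ℂ × ℂ => poleParams p q (deform t y.1) m n k l j) x :=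
    (((hD x j).mul_const _).mul_const _).continuousAt
  have hc := (differentiable_dblPoch hp hq).continuous
  have e1 : ∀ᶠ x : ℂ × ℂ in 𝓝 (0, γ s), seriesDen p q (deform t x.1) m n k l ≠ 0 :=
    (continuousAt_seriesDen hp₀ hq₀ hp hq (fun j => (hD (0, γ s) j).continuousAt)
      (deform_ne_zero ht _) m n k l).eventually_ne (by simpa only [deform_zero] using hd)
  have e2 : ∀ᶠ x : ℂ × ℂ in 𝓝 (0, γ s), x.2 ≠ 0 := continuousAt_snd.eventually_ne hz
  have e3 (j : Fin 6) : ∀ᶠ x : ℂ × ℂ in 𝓝 (0, γ s),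
      dblPoch p q (poleParams p q (deform t x.1) m n k l j * x.2) ≠ 0 ∧
      dblPoch p q (poleParams p q (deform t x.1) m n k l j / x.2) ≠ 0 := by
    refine ((ContinuousAt.comp (g := dblPoch p q) hc.continuousAt
      ((hP (0, γ s) j).mul continuousAt_snd)).eventually_ne ?_).and
      ((ContinuousAt.comp (g := dblPoch p q) hc.continuousAt
      ((hP (0, γ s) j).div continuousAt_snd hz)).eventually_ne ?_)
    · simpa only [Function.comp_apply, Pi.mul_apply, deform_zero] using (hreg j).1
    · simpa only [Function.comp_apply, Pi.div_apply, deform_zero] using (hreg j).2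
  filter_upwards [e1, e2, eventually_all.mpr e3] with x h1 h2 h3
  exact continuousAt_regularIntegrand hp₀ hq₀ hp hq (t := fun y : ℂ × ℂ => deform t y.1)
    (Z := fun y => y.2) (hD x) (deform_ne_zero ht _) differentiableAt_snd h1 ⟨h2, h3⟩

theorem continuousAt_wpNorm_deform {p q : ℂ} (hp₀ : p ≠ 0) (hq₀ : q ≠ 0) (hp : ‖p‖ < 1)
    {t : Fin 6 → ℂ} (ht : ∀ j, t j ≠ 0) {n : ℕ} (hN : wpNormDen q p (baseParams p t) n ≠ 0) :
    ContinuousAt (fun τ => wpNorm q p (baseParams p (deform t τ)) n) 0 := by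
  have hD (j : Fin 6) : ContinuousAt (fun τ => deform t τ j) 0 :=
    (differentiable_deform t j).continuous.continuousAt
  rw [← deform_zero t] at hN
  exact continuousAt_wpNorm (r := fun τ => baseParams p (deform t τ)) hq₀ hp
    (continuousAt_baseParams hp₀ hD) (baseParams_ne_zero hp₀ (deform_ne_zero ht 0)) hN

include hp₀ hq₀ hp hq in
/-- The biorthogonality relation, in terms of six parameters. -/
theorem Separates.biorthogonality_of_den_ne_zero {γ : ℝ → ℂ} {t : Fin 6 → ℂ} {m n k l : ℕ}
    (h : Separates γ (paramPoints p q (poleParams p q t m n k l))) (ht : ∀ j, t j ≠ 0)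
    (ht1 : ∀ j, ‖t j‖ < 1) (hprod : ∏ j, t j = p * q) (hd : seriesDen p q t m n k l ≠ 0)
    (hN : wpNormDen q p (baseParams p t) n ≠ 0) (hN' : wpNormDen p q (baseParams q t) l ≠ 0) :
    contourIntegral γ (biorthIntegrand p q t m n k l) * (qPochInf p p * qPochInf q q) =
      4 * Real.pi * Complex.I * betaValue p q t *
        (if m = n then wpNorm q p (baseParams p t) n else 0) *
        (if k = l then wpNorm p q (baseParams q t) l else 0) := by
  have hD (j : Fin 6) : ContinuousAt (fun τ => deform t τ j) 0 :=
    (differentiable_deform t j).continuous.continuousAt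
  have heq {t : Fin 6 → ℂ} (ht : ∀ j, t j ≠ 0) :
      contourIntegral γ (biorthIntegrand p q t m n k l) =
        contourIntegral γ (regularIntegrand p q t m n k l) :=
    contourIntegral_congr_of_countable (countable_not_regularAt (p := p) (q := q) ht)
      fun s _ hs => (not_not.mp hs).biorthIntegrand_eq hp₀ hq₀ hp hq ht m n k l
  -- For `τ` near `0` and off a countable set, the deformed parameters are generic and have modulus
  -- less than `1`, and the contour still separates their points. Both sides are continuous at `0`.
  have key := eq_of_eventually_of_countable (x := 0)
    (f := fun τ => contourIntegral γ (regularIntegrand p q (deform t τ) m n k l) *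
      (qPochInf p p * qPochInf q q))
    (g := fun τ => 4 * Real.pi * Complex.I * betaValue p q (deform t τ) *
        (if m = n then wpNorm q p (baseParams p (deform t τ)) n else 0) *
        (if k = l then wpNorm p q (baseParams q (deform t τ)) l else 0))
    ((h.continuousAt_integral_deform hp₀ hq₀ hp hq ht hd).mul continuousAt_const) ?_
    (countable_setOf_not_generic_deform (p := p) (q := q) ht) ?_
  · simp only [deform_zero] at key
    rw [heq ht, key]
  · refine ContinuousAt.mul (ContinuousAt.mul (continuousAt_const.mul ?_) ?_) ?_
    · refine (differentiableAt_betaValue hp hq (fun j => (differentiable_deform t j).differentiableAt)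
        (deform_ne_zero ht 0) fun j k _ => ?_).continuousAt
      rw [deform_zero]
      refine dblPoch_ne_zero_of_norm_lt_one hp hq ?_
      rw [norm_mul]
      exact mul_lt_one_of_nonneg_of_lt_one_left (norm_nonneg _) (ht1 j) (ht1 k).le
    · split_ifs
      · exact continuousAt_wpNorm_deform hp₀ hq₀ hp ht hN
      · exact continuousAt_const
    · split_ifs
      · exact continuousAt_wpNorm_deform hq₀ hp₀ hq ht hN'
      · exact continuousAt_const
  · have e1 := h.eventually_of_tendsto hp₀ hq₀ hp hq (poleParams_ne_zero hp₀ hq₀ ht m n k l)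
      (u := fun τ j => Complex.exp (deformWeight j * τ)) (x := 0)
      (fun j => (Complex.continuous_exp.comp (continuous_const.mul continuous_id)).continuousAt)
      (fun j => by simp)
    have e2 (j : Fin 6) : ∀ᶠ τ in 𝓝 (0 : ℂ), ‖deform t τ j‖ < 1 :=
      (hD j).norm.eventually (gt_mem_nhds (by simpa [deform_zero] using ht1 j))
    simp only [seriesDen, mul_ne_zero_iff] at hd
    filter_upwards [e1, eventually_all.mpr e2] with τ h1 h2 h3
    rw [← poleParams_deform] at h1
    rw [← heq (deform_ne_zero ht τ)]
    exact h1.biorthogonality hp₀ hq₀ hp hq (not_not.mp h3) h2 ((prod_deform t τ).trans hprod)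
      (ellPoch_ne_zero_of_wpDen hd.1.2) (ellPoch_ne_zero_of_wpDen hd.1.1)
      (ellPoch_ne_zero_of_wpDen hd.2.2) (ellPoch_ne_zero_of_wpDen hd.2.1)

end

/-! ### Translation between the five and the six parameters. -/

section

variable {p q : ℂ}

/-- The infinite series stops at `n` because of the parameter `q^(-n)`. The parameters `r₃z` and
`r₃/z` contribute the denominators `q/(r₄z)` and `qz/r₄`, in exchanged order. -/
theorem wpSeries_eq_ellV (hq₀ : q ≠ 0) (hp : ‖p‖ < 1) {r : Fin 6 → ℂ} (hr : ∀ j, r j ≠ 0) (n : ℕ)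
    {z : ℂ} (hz : z ≠ 0) :
    wpSeries q p r n z = ellV q p (r 3 / r 4) ![q / (r 0 * r 4), q / (r 1 * r 4), q / (r 2 * r 4),
      r 3 * z, r 3 / z, q ^ (-(n : ℤ)), q ^ n / (r 4 * r 5)] := by
  have h0 := hr 0
  have h1 := hr 1
  have h2 := hr 2
  have h3 := hr 3
  have h4 := hr 4
  have h5 := hr 5
  rw [ellV, tsum_eq_sum (s := range (n + 1))]
  · refine sum_congr rfl fun i _ => ?_
    simp only [Fin.prod_univ_seven, Matrix.cons_val]
    rw [show q * (r 3 / r 4) / (q / (r 0 * r 4)) = r 0 * r 3 by field_simp,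
      show q * (r 3 / r 4) / (q / (r 1 * r 4)) = r 1 * r 3 by field_simp,
      show q * (r 3 / r 4) / (q / (r 2 * r 4)) = r 2 * r 3 by field_simp,
      show q * (r 3 / r 4) / (r 3 * z) = q / r 4 / z by field_simp,
      show q * (r 3 / r 4) / (r 3 / z) = q / r 4 * z by field_simp,
      show q * (r 3 / r 4) / q ^ (-(n : ℤ)) = r 3 / r 4 * q ^ (n + 1) by
        rw [zpow_neg, zpow_natCast]; field_simp; ring,
      show q * (r 3 / r 4) / (q ^ n / (r 4 * r 5)) = r 3 * r 5 * q ^ (1 - (n : ℤ)) by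
        rw [zpow_sub₀ hq₀, zpow_natCast, zpow_one]; field_simp]
    simp only [wpCoeff, pairPoch, div_eq_mul_inv, mul_inv]
    ring
  · intro i hi
    rw [mem_range, not_lt] at hi
    rw [prod_eq_zero (mem_univ (5 : Fin 7))]
    · ring
    · rw [show (![q / (r 0 * r 4), q / (r 1 * r 4), q / (r 2 * r 4), r 3 * z, r 3 / z,
        q ^ (-(n : ℤ)), q ^ n / (r 4 * r 5)] : Fin 7 → ℂ) 5 = q ^ (-(n : ℤ)) from rfl,
        ellPoch_neg_eq_zero hq₀ hp (by omega), zero_div]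

/-- The five parameters together with the sixth parameter `pq/A`. -/
def sixParams (p q : ℂ) (t : Fin 5 → ℂ) : Fin 6 → ℂ :=
  ![t 0, t 1, t 2, t 3, t 4, p * q / prodA t]

/-- The five parameters together with `q/A`. -/
def seriesParams (q : ℂ) (t : Fin 5 → ℂ) : Fin 6 → ℂ := ![t 0, t 1, t 2, t 3, t 4, q / prodA t]

theorem baseParams_sixParams (hp₀ : p ≠ 0) (t : Fin 5 → ℂ) :
    baseParams p (sixParams p q t) = seriesParams q t := by
  simp only [baseParams, sixParams, seriesParams, Matrix.cons_val]
  rw [show p * q / prodA t / p = q / prodA t by field_simp]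

theorem baseParams_sixParams' (hq₀ : q ≠ 0) (t : Fin 5 → ℂ) :
    baseParams q (sixParams p q t) = seriesParams p t := by
  rw [← baseParams_sixParams hq₀, sixParams, sixParams, mul_comm p]

section

variable {t : Fin 5 → ℂ}

theorem prodA_ne_zero (ht : ∀ j, t j ≠ 0) : prodA t ≠ 0 := prod_ne_zero_iff.mpr fun j _ => ht j

theorem seriesParams_ne_zero (hq₀ : q ≠ 0) (ht : ∀ j, t j ≠ 0) (j : Fin 6) :
    seriesParams q t j ≠ 0 := by
  revert j
  exact forall_fin_six (ht 0) (ht 1) (ht 2) (ht 3) (ht 4) (div_ne_zero hq₀ (prodA_ne_zero ht))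

variable (hq₀ : q ≠ 0) (ht : ∀ j, t j ≠ 0)

include hq₀ ht

theorem R_eq_wpSeries (hp : ‖p‖ < 1) (n : ℕ) {z : ℂ} (hz : z ≠ 0) :
    R t q p n z = wpSeries q p (seriesParams q t) n z := by
  have hA := prodA_ne_zero ht
  have h4 := ht 4
  rw [wpSeries_eq_ellV hq₀ hp (seriesParams_ne_zero hq₀ ht) n hz, R]
  simp only [seriesParams, Matrix.cons_val]
  rw [show prodA t * q ^ ((n : ℤ) - 1) / t 4 = q ^ n / (t 4 * (q / prodA t)) by
    rw [zpow_sub₀ hq₀, zpow_natCast, zpow_one]; field_simp]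

theorem T_eq_wpSeries (hp : ‖p‖ < 1) (n : ℕ) {z : ℂ} (hz : z ≠ 0) :
    T t q p n z = wpSeries q p (swapLast (seriesParams q t)) n z := by
  have hA := prodA_ne_zero ht
  have h0 := ht 0
  have h1 := ht 1
  have h2 := ht 2
  have h4 := ht 4
  rw [wpSeries_eq_ellV hq₀ hp (swapLast_ne_zero (seriesParams_ne_zero hq₀ ht)) n hz, T]
  simp only [swapLast, seriesParams, Matrix.cons_val]
  rw [show prodA t * q ^ ((n : ℤ) - 1) / t 4 = q ^ n / (q / prodA t * t 4) by
      rw [zpow_sub₀ hq₀, zpow_natCast, zpow_one]; field_simp,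
    show prodA t * t 3 / q = t 3 / (q / prodA t) by field_simp,
    show prodA t / t 0 = q / (t 0 * (q / prodA t)) by field_simp,
    show prodA t / t 1 = q / (t 1 * (q / prodA t)) by field_simp,
    show prodA t / t 2 = q / (t 2 * (q / prodA t)) by field_simp]

theorem RDen_eq_wpDen (n : ℕ) : RDen t q p n = wpDen q p (seriesParams q t) n := by
  have hA := prodA_ne_zero ht
  have h4 := ht 4
  simp only [RDen, wpDen, seriesParams, Matrix.cons_val]
  rw [show q ^ (n + 1) * t 3 / t 4 = t 3 / t 4 * q ^ (n + 1) by ring,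
    show q ^ (2 - (n : ℤ)) * t 3 / prodA t = t 3 * (q / prodA t) * q ^ (1 - (n : ℤ)) by
      rw [show (2 - (n : ℤ)) = 1 + (1 - n) by ring, zpow_add₀ hq₀, zpow_one]; ring]
  ring

theorem TDen_eq_wpDen (n : ℕ) : TDen t q p n = wpDen q p (swapLast (seriesParams q t)) n := by
  have hA := prodA_ne_zero ht
  simp only [TDen, wpDen, swapLast, seriesParams, Matrix.cons_val]
  rw [show prodA t * t 3 / q = t 3 / (q / prodA t) by field_simp,
    show prodA t * t 3 * q ^ n = t 3 / (q / prodA t) * q ^ (n + 1) by field_simp; ring]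
  ring

theorem hDen_eq_wpNormDen (n : ℕ) : hDen t q p n = wpNormDen q p (seriesParams q t) n := by
  have hA := prodA_ne_zero ht
  have h3 := ht 3
  have h4 := ht 4
  simp only [hDen, wpNormDen, seriesParams, Matrix.cons_val]
  rw [show prodA t * q ^ (2 * n) / (t 4 * q) = (t 4 * (q / prodA t))⁻¹ * q ^ (2 * n) by field_simp,
    show prodA t / (q * t 3) = (t 3 * (q / prodA t))⁻¹ by field_simp,
    show prodA t / (q * t 4) = (t 4 * (q / prodA t))⁻¹ by field_simp, one_div]

theorem h_eq_wpNorm (n : ℕ) : h t q p n = wpNorm q p (seriesParams q t) n := by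
  have hA := prodA_ne_zero ht
  have h4 := ht 4
  rw [h, hDen_eq_wpNormDen hq₀ ht]
  simp only [wpNorm, wpNormDen, seriesParams, Matrix.cons_val]
  rw [show prodA t / (q * t 4) = (t 4 * (q / prodA t))⁻¹ by field_simp,
    show q * t 3 / t 4 = t 3 / t 4 * q by ring,
    show prodA t * t 3 = t 3 / (q / prodA t) * q by field_simp, zpow_neg, zpow_natCast,
    ← div_eq_mul_inv]

end

theorem normN_eq_betaValue (hp₀ : p ≠ 0) (hq₀ : q ≠ 0) (t : Fin 5 → ℂ) :
    normN t q p = betaValue p q (sixParams p q t) := by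
  have e (m : Fin 5) : ellGamma p q (t m * (p * q / prodA t)) = (ellGamma p q (prodA t / t m))⁻¹ := by
    rw [ellGamma_inv_eq hp₀ hq₀]
    congr 1
    rw [div_div_eq_mul_div]
    ring
  have e0 : (Ioi (0 : Fin 5)) = {1, 2, 3, 4} := by decide
  have e1 : (Ioi (1 : Fin 5)) = {2, 3, 4} := by decide
  have e2 : (Ioi (2 : Fin 5)) = {3, 4} := by decide
  have e3 : (Ioi (3 : Fin 5)) = {4} := by decide
  have e4 : (Ioi (4 : Fin 5)) = ∅ := by decide
  rw [betaValue_eq, normN, Fin.prod_univ_five, Fin.prod_univ_five, e0, e1, e2, e3, e4]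
  simp only [sixParams, Matrix.cons_val, e]
  simp [prod_insert]
  ring

/-- Reflection moves `Γ(Az^±)` to the numerator as the gamma factors of the sixth parameter `pq/A`.
The last two hypotheses keep away from the points where `Γ(z^(±2))` has no proper value. -/
theorem weight_div_eq (hp₀ : p ≠ 0) (hq₀ : q ≠ 0) (hp : ‖p‖ < 1) (hq : ‖q‖ < 1) (t : Fin 5 → ℂ)
    {z : ℂ} (hz : z ≠ 0) (h : dblPoch p q (z ^ 2) ≠ 0) (h' : dblPoch p q (z ^ 2)⁻¹ ≠ 0) :
    weight t q p z / z = qPochInf q q * qPochInf p p / (4 * Real.pi * Complex.I) *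
      betaKernel p q (sixParams p q t) z := by
  have e1 := ellGamma_mul_inv hp₀ hq₀ hp hq (pow_ne_zero 2 hz) h h'
  have e2 : ellGamma p q (p * q / prodA t * z) = (ellGamma p q (prodA t * z⁻¹))⁻¹ := by
    rw [ellGamma_inv_eq hp₀ hq₀]
    congr 1
    rw [← div_eq_mul_inv, div_div_eq_mul_div]
    ring
  have e3 : ellGamma p q (p * q / prodA t / z) = (ellGamma p q (prodA t * z))⁻¹ := by
    rw [ellGamma_inv_eq hp₀ hq₀, div_div]
  rw [weight, betaKernel, ← e1, Fin.prod_univ_six, Fin.prod_univ_five, inv_pow]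
  simp only [sixParams, Matrix.cons_val, e2, e3, ← div_eq_mul_inv _ z]
  simp only [div_eq_mul_inv, mul_inv]
  ring

theorem paramPoints_poleParams_subset (hp₀ : p ≠ 0) (hq₀ : q ≠ 0) (t : Fin 5 → ℂ) (m n k l : ℕ) :
    paramPoints p q (poleParams p q (sixParams p q t) m n k l) ⊆ innerPoints t q p m n k l := by
  rintro w ⟨j, a, b, rfl⟩
  refine ⟨a, b, ?_⟩
  revert j
  refine forall_fin_six ?_ ?_ ?_ ?_ ?_ ?_ <;> simp only [poleParams, shifted, sixParams, Matrix.cons_val]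
  · exact Or.inl ⟨0, by simp⟩
  · exact Or.inl ⟨1, by simp⟩
  · exact Or.inl ⟨2, by simp⟩
  · exact Or.inl ⟨3, by simp⟩
  · refine Or.inr (Or.inl ?_)
    rw [zpow_sub₀ hp₀, zpow_sub₀ hq₀, zpow_neg, zpow_neg]
    simp only [zpow_natCast]
    ring
  · refine Or.inr (Or.inr ?_)
    rw [zpow_sub₀ hp₀, zpow_sub₀ hq₀, zpow_add₀ hp₀, zpow_add₀ hq₀, zpow_neg, zpow_neg]
    simp only [zpow_natCast, zpow_one]
    ring

theorem countable_setOf_not_free_sq : {z : ℂ | ¬ Free p q (z ^ 2)}.Countable := by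
  have : {z : ℂ | ¬ Free p q (z ^ 2)} ⊆ ⋃ x : ℤ × ℤ, {z | z ^ 2 = p ^ x.1 * q ^ x.2} := by
    intro z hz
    simp only [Free, Set.mem_ofPred_eq, not_forall, not_not] at hz
    obtain ⟨a, b, h⟩ := hz
    exact Set.mem_iUnion.mpr ⟨(a, b), h⟩
  refine (Set.countable_iUnion fun x => ?_).mono this
  obtain h | ⟨w, hw⟩ := Set.eq_empty_or_nonempty {z : ℂ | z ^ 2 = p ^ x.1 * q ^ x.2}
  · rw [h]
    exact Set.countable_empty
  · refine (Set.toFinite {w, -w}).countable.mono fun z hz => ?_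
    exact sq_eq_sq_iff_eq_or_eq_neg.mp ((show z ^ 2 = _ from hz).trans (show w ^ 2 = _ from hw).symm)

/-- The integrand in terms of five parameters. -/
theorem integrand_eq (hp₀ : p ≠ 0) (hq₀ : q ≠ 0) (hp : ‖p‖ < 1) (hq : ‖q‖ < 1) {t : Fin 5 → ℂ}
    (ht : ∀ j, t j ≠ 0) (m n k l : ℕ) {z : ℂ} (hz : z ≠ 0) (h : Free p q (z ^ 2)) :
    T₂ t q p n l z * R₂ t q p m k z * weight t q p z / z =
      qPochInf q q * qPochInf p p / (4 * Real.pi * Complex.I) *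
        biorthIntegrand p q (sixParams p q t) m n k l z := by
  rw [mul_div_assoc, weight_div_eq hp₀ hq₀ hp hq t hz (h.dblPoch_ne_zero hp hq)
    (h.inv.dblPoch_ne_zero hp hq), biorthIntegrand, baseParams_sixParams hp₀,
    baseParams_sixParams' hq₀, T₂, R₂, T_eq_wpSeries hq₀ ht hp n hz, T_eq_wpSeries hp₀ ht hq l hz,
    R_eq_wpSeries hq₀ ht hp m hz, R_eq_wpSeries hp₀ ht hq k hz]
  ring

end

end

end EllHyp

theorem mainTheorem6 (q p : ℂ) (hq₀ : q ≠ 0) (hp₀ : p ≠ 0) (hq : ‖q‖ < 1) (hp : ‖p‖ < 1)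
    (t : Fin 5 → ℂ) (ht : ∀ m, ‖t m‖ < 1) (hA : ‖p * q‖ < ‖EllHyp.prodA t‖)
    (n l m k : ℕ)
    -- all the functions and constants in the formula are well defined
    (hR : EllHyp.RDen t q p m ≠ 0) (hR' : EllHyp.RDen t p q k ≠ 0)
    (hT : EllHyp.TDen t q p n ≠ 0) (hT' : EllHyp.TDen t p q l ≠ 0)
    (hh : EllHyp.hDen t q p n ≠ 0) (hh' : EllHyp.hDen t p q l ≠ 0)
    (γ : ℝ → ℂ) (hγ : EllHyp.Separates γ (EllHyp.innerPoints t q p m n k l)) :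
    EllHyp.ContourIntegrable γ
        (fun z => EllHyp.T₂ t q p n l z * EllHyp.R₂ t q p m k z * EllHyp.weight t q p z / z) ∧
      EllHyp.contourIntegral γ
        (fun z => EllHyp.T₂ t q p n l z * EllHyp.R₂ t q p m k z * EllHyp.weight t q p z / z) =
        EllHyp.h₂ t q p n l * EllHyp.normN t q p *
          (if m = n then 1 else 0) * (if k = l then 1 else 0) := by
  -- The bound on `A` forces all parameters to be nonzero, and it says that the sixth one has
  -- modulus less than `1`.
  have hA0 : EllHyp.prodA t ≠ 0 := by
    rintro h
    rw [h, norm_zero] at hA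
    exact absurd hA (norm_nonneg _).not_gt
  have ht0 (j : Fin 5) : t j ≠ 0 := Finset.prod_ne_zero_iff.mp hA0 j (Finset.mem_univ j)
  have hs0 : ∀ j, EllHyp.sixParams p q t j ≠ 0 :=
    EllHyp.forall_fin_six (ht0 0) (ht0 1) (ht0 2) (ht0 3) (ht0 4)
      (div_ne_zero (mul_ne_zero hp₀ hq₀) hA0)
  have hs1 : ∀ j, ‖EllHyp.sixParams p q t j‖ < 1 := by
    refine EllHyp.forall_fin_six (ht 0) (ht 1) (ht 2) (ht 3) (ht 4) ?_
    change ‖p * q / EllHyp.prodA t‖ < 1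
    rwa [norm_div, div_lt_one (norm_pos_iff.mpr hA0)]
  have hprod : ∏ j, EllHyp.sixParams p q t j = p * q := by
    have e : EllHyp.prodA t = t 0 * t 1 * t 2 * t 3 * t 4 := Fin.prod_univ_five t
    simp only [Fin.prod_univ_six, EllHyp.sixParams, Matrix.cons_val]
    rw [← e, mul_div_cancel₀ _ hA0]
  have hsep := hγ.mono (EllHyp.paramPoints_poleParams_subset hp₀ hq₀ t m n k l)
  have hd : EllHyp.seriesDen p q (EllHyp.sixParams p q t) m n k l ≠ 0 := by
    rw [EllHyp.seriesDen, EllHyp.baseParams_sixParams hp₀, EllHyp.baseParams_sixParams' hq₀,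
      ← EllHyp.RDen_eq_wpDen hq₀ ht0, ← EllHyp.RDen_eq_wpDen hp₀ ht0,
      ← EllHyp.TDen_eq_wpDen hq₀ ht0, ← EllHyp.TDen_eq_wpDen hp₀ ht0]
    exact mul_ne_zero (mul_ne_zero hT hR) (mul_ne_zero hT' hR')
  -- The contour may meet points where `z²` is of the form `p^a q^b`; these form a countable set and
  -- do not influence the integral.
  have hcongr (s : ℝ) (hs : s ∈ Set.Icc (0 : ℝ) 1)
      (hE : γ s ∉ {z : ℂ | ¬ EllHyp.Free p q (z ^ 2)}) :=
    EllHyp.integrand_eq hp₀ hq₀ hp hq ht0 m n k l (hsep.ne_zero s hs) (not_not.mp hE)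
  have hE := EllHyp.countable_setOf_not_free_sq (p := p) (q := q)
  let g (z : ℂ) := EllHyp.qPochInf q q * EllHyp.qPochInf p p / (4 * Real.pi * Complex.I) *
    EllHyp.biorthIntegrand p q (EllHyp.sixParams p q t) m n k l z
  refine ⟨EllHyp.contourIntegrable_congr_of_countable (g := g) hE hcongr ?_,
    (EllHyp.contourIntegral_congr_of_countable (g := g) hE hcongr).trans ?_⟩
  · have := hsep.contourIntegrable_biorthIntegrand hp₀ hq₀ hp hq hs0 hd
    unfold EllHyp.ContourIntegrable at this ⊢
    simpa only [g, mul_assoc] using this.const_mul _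
  · rw [EllHyp.hDen_eq_wpNormDen hq₀ ht0, ← EllHyp.baseParams_sixParams hp₀] at hh
    rw [EllHyp.hDen_eq_wpNormDen hp₀ ht0, ← EllHyp.baseParams_sixParams' hq₀] at hh'
    have key := hsep.biorthogonality_of_den_ne_zero hp₀ hq₀ hp hq hs0 hs1 hprod hd hh hh'
    have hc : (4 * Real.pi * Complex.I : ℂ) ≠ 0 := by simp [Real.pi_ne_zero]
    rw [EllHyp.baseParams_sixParams hp₀, EllHyp.baseParams_sixParams' hq₀,
      ← EllHyp.normN_eq_betaValue hp₀ hq₀, ← EllHyp.h_eq_wpNorm hq₀ ht0,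
      ← EllHyp.h_eq_wpNorm hp₀ ht0] at key
    rw [EllHyp.contourIntegral]
    simp only [g, mul_assoc (_ / _)]
    rw [intervalIntegral.integral_const_mul, ← EllHyp.contourIntegral, EllHyp.h₂, div_mul_eq_mul_div,
      div_eq_iff hc, mul_comm (_ * _), mul_comm (EllHyp.qPochInf q q), key]
    split_ifs <;> ring
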